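/- **Proposition 3.1.** Let $\mathbb R^2_+=\{(X,Y): Y>0\}$ and, for $m\in\mathbb N$, let $L^2(m)$ be the space of real measurable functions on $\mathbb R^2_+$ with $\int_{\mathbb R^2_+}|u|^2(1+X^2+Y^2)^m\,dX\,dY<\infty$. Let $$\mathcal L=\partial_Y^2+\tfrac32X\partial_X+\tfrac12Y\partial_Y+\tfrac52-Y\partial_X .$$ Consider the problem $$\mathcal L u=0\ \text{ in } \mathbb R^2_+,\qquad u(X,0)=0,\qquad \int_{\mathbb R^2_+}Y\,u(X,Y)\,dX\,dY=1, \qquad (\ast)$$ where the equation is understood in the sense of distributions on $\mathbb R^2_+$, and the boundary condition in the sense of traces: $\frac1\varepsilon\int_0^\varepsilon\int_{\mathbb R}u(X,Y)\varphi(X)\,dX\,dY\to0$ as $\varepsilon\to0^+$ for every $\varphi\in C_c^\infty(\mathbb R)$. There is a function $\bar\Omega$ which belongs to $L^2(m)$ for every integer $m>5$ and solves $(\ast)$; it is continuous on $\{Y\ge0\}$ with $\bar\Omega(X,0)=0$ for all $X\in\mathbb R$. It is unique: if $m>5$ is an integer and $u\in L^2(m)$ solves $(\ast)$, then $u=\bar\Omega$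 almost everywhere in $\mathbb R^2_+$. Moreover, let $\tilde\Omega$ be the extension of $\bar\Omega$ to $\mathbb R^2$ with $\tilde\Omega(X,Y)=-\bar\Omega(-X,-Y)$ for $Y<0$ and $\tilde\Omega(X,0)=0$. Then there is a continuous function $h:[0,\infty)\to\mathbb C$ with $$\int_0^\tau(\tau-s)^{-1/2}e^{-\frac1{12}(\tau-s)^3}h(s)\,ds=i\,\tau^{1/2}e^{-\frac1{12}\tau^3}\qquad\text{for all }\tau>0$$ such that, with $g(k)=k\,h(|k|^{2/3})$, for all $k,\eta\in\mathbb R$, $$\begin{aligned}\int_{\mathbb R^2}\tilde\Omega(X,Y)e^{-ikX-i\eta Y}\,dX\,dY={}&-2i(k+\eta)e^{-(k+\eta)^2+k(k+\eta)-\frac13k^2}\\&+\frac23\int_0^{|k|}\Bigl(\frac{|k|}{\ell}\Bigr)^{1/3}\exp\Bigl(-(k+\eta)^2\bigl(1-(\tfrac{\ell}{|k|})^{2/3}\bigr)+k(k+\eta)\bigl(1-(\tfrac{\ell}{|k|})^{4/3}\bigr)-\tfrac13(k^2-\ell^2)\Bigr)\frac{g(\mathrm{sgn}(k)\ell)}{\ell}\,d\ell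 .\end{aligned}$$ -/

import Mathlib

open MeasureTheory Set Filter Topology
open scoped ContDiff

namespace HalfPlaneKernel

/-- The open upper half-plane; a point is `p = (X, Y)`. -/
def halfPlane : Set (ℝ × ℝ) := {p | 0 < p.2}

/-- Membership in the weighted space `L²(m)` on the half-plane:
`∫ |u|² (1 + X² + Y²)^m dX dY < ∞`. -/
def MemL2Weighted (m : ℕ) (u : ℝ × ℝ → ℝ) : Prop :=
  AEStronglyMeasurable u (volume.restrict halfPlane) ∧
    IntegrableOn (fun p : ℝ × ℝ => |u p| ^ 2 * (1 + p.1 ^ 2 + p.2 ^ 2) ^ m) halfPlane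

/-- The partial derivative in the first variable `X`. -/
noncomputable def partialX (φ : ℝ × ℝ → ℝ) (p : ℝ × ℝ) : ℝ := fderiv ℝ φ p (1, 0)

/-- The partial derivative in the second variable `Y`. -/
noncomputable def partialY (φ : ℝ × ℝ → ℝ) (p : ℝ × ℝ) : ℝ := fderiv ℝ φ p (0, 1)

/-- The formal adjoint, term by term, of the operator
`𝓛 = ∂_Y² + (3/2) X ∂_X + (1/2) Y ∂_Y + 5/2 - Y ∂_X`. -/
noncomputable def adjointL (φ : ℝ × ℝ → ℝ) (p : ℝ × ℝ) : ℝ :=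
  partialY (partialY φ) p
    - (3 / 2) * partialX (fun q => q.1 * φ q) p
    - (1 / 2) * partialY (fun q => q.2 * φ q) p
    + (5 / 2) * φ p
    + partialX (fun q => q.2 * φ q) p

/-- `𝓛 u = 0` in the sense of distributions on the open half-plane. -/
def SolvesL (u : ℝ × ℝ → ℝ) : Prop :=
  ∀ φ : ℝ × ℝ → ℝ, ContDiff ℝ ∞ φ → HasCompactSupport φ → tsupport φ ⊆ halfPlane →
    ∫ p in halfPlane, u p * adjointL φ p = 0

/-- `u(X, 0) = 0` in the trace sense: the averages of `u` over the strips `0 < Y < ε` tend to zero,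
as distributions in `X`, as `ε → 0+`. It does not depend on the representative of `u`, and it holds
for every `u` that is continuous up to `Y = 0` and vanishes there. -/
def HasZeroTrace (u : ℝ × ℝ → ℝ) : Prop :=
  ∀ φ : ℝ → ℝ, ContDiff ℝ ∞ φ → HasCompactSupport φ →
    Tendsto (fun ε : ℝ => ε⁻¹ * ∫ p in (univ : Set ℝ) ×ˢ Ioo 0 ε, u p * φ p.1) (𝓝[>] 0) (𝓝 0)

/-- `u` belongs to `L²(m)` and solves `𝓛 u = 0`, `u(X, 0) = 0`, `∫ Y u(X, Y) dX dY = 1`. -/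
structure IsNormalizedKernel (m : ℕ) (u : ℝ × ℝ → ℝ) : Prop where
  memL2 : MemL2Weighted m u
  solves : SolvesL u
  zeroTrace : HasZeroTrace u
  momentum : ∫ p in halfPlane, p.2 * u p = 1

/-- The centrally antisymmetric extension of a function on the half-plane to the plane. -/
noncomputable def centralExtension (u : ℝ × ℝ → ℝ) (p : ℝ × ℝ) : ℝ :=
  if 0 < p.2 then u p else if p.2 < 0 then -u (-p) else 0

/-- The Fourier transform `∫ v(X, Y) exp(-i k X - i η Y) dX dY`. -/
noncomputable def fourierPlane (v : ℝ × ℝ → ℝ) (k η : ℝ) : ℂ :=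
  ∫ p : ℝ × ℝ, (v p : ℂ) * Complex.exp (-(Complex.I * (k * p.1)) - Complex.I * (η * p.2))

/-- The convolution equation
`∫_0^τ (τ - s)^(-1/2) exp(-(τ - s)³/12) h(s) ds = i τ^(1/2) exp(-τ³/12)` for all `τ > 0`. -/
def SolvesVolterra (h : ℝ → ℂ) : Prop :=
  ∀ τ : ℝ, 0 < τ →
    ∫ s in (0 : ℝ)..τ,
        (((τ - s) ^ (-(1 / 2) : ℝ) * Real.exp (-(τ - s) ^ 3 / 12) : ℝ) : ℂ) * h s
      = Complex.I * ((τ ^ (1 / 2 : ℝ) * Real.exp (-τ ^ 3 / 12) : ℝ) : ℂ)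

/-- The odd boundary datum `g(k) = k h(|k|^(2/3))`. -/
noncomputable def boundaryDatum (h : ℝ → ℂ) (k : ℝ) : ℂ := (k : ℂ) * h (|k| ^ (2 / 3 : ℝ))

/-- The profile in the Fourier variables, obtained from a boundary datum `g`. -/
noncomputable def characteristicFormula (g : ℝ → ℂ) (k η : ℝ) : ℂ :=
  -2 * Complex.I *
      (((k + η) * Real.exp (-(k + η) ^ 2 + k * (k + η) - (1 / 3) * k ^ 2) : ℝ) : ℂ)
    + (2 / 3) * ∫ l in (0 : ℝ)..|k|,
        (((|k| / l) ^ (1 / 3 : ℝ) *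
          Real.exp (-(k + η) ^ 2 * (1 - (l / |k|) ^ (2 / 3 : ℝ))
            + k * (k + η) * (1 - (l / |k|) ^ (4 / 3 : ℝ))
            - (1 / 3) * (k ^ 2 - l ^ 2)) : ℝ) : ℂ)
          * (g (SignType.sign k * l) / (l : ℂ))

end HalfPlaneKernel

/-!
*The kernel.* In the frequency variables `(k, η)` the equation is a transport equation with a source
proportional to the boundary flux. Rescaled along its characteristics, the Fourier transform becomes
a function `f(t, x)` with `t = |k|^(2/3)` that solves the damped transport equation
`∂_t f = ∂_x f - x² f + h(t)`, and the boundary condition becomes `∫ f(t, x) dx = 0`, which turns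
into the Volterra equation for `h`. Comparing Taylor coefficients, this equation has the solution
`h(t) = i F(t³)` with an entire function `F` (`volterraSeries`, `volterraSeries_convolution`).
Everything else about `h` follows from its rapid decay, which the power series does not show. It
comes from an energy method (`IsDampedSlice`, `energy_decay`): all time derivatives of `f` solve the
same constrained problem, the constraint force does no work, and a coercivity estimate bounds the
energy of `f` by its dissipation and the energy of `∂_t f`. Hence the energies decay faster than any
power, and the force `h` with them (`iteratedDeriv_rapid_decay`).

Consequently `k ↦ F(k²)` is a Schwartz function, and the kernel is written in physical variables as
the explicit initial contribution (a derivative of the Kolmogorov kernel) plus a superposition of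
layers emitted by the boundary at the fractions `1 - r` of the time (`kernel`). The formula is odd
under `p ↦ -p`, so it already is the central extension. Uniform Schwartz bounds on the frequency
densities of the layers give continuity and decay; the boundary value is the Volterra equation
(`integral_density`); the Fourier formula is Fubini's theorem and the substitution
`ℓ = |k| (1 - r)^(3/2)`; and the equation holds since on each frequency of a layer the operator acts
as a divergence in `(k, r)` (`operatorL_layerWave`).

*Uniqueness.* Let `d` be the difference of two solutions (`IsNullSolution`). The vanishing trace
admits the test functions `cos(kX) sin(ξY)` and `sin(kX) sin(ξY)`, so the Fourier–sine transform
`s(k, ξ)` of `d` solves a first-order equation whose only non-local term comes from `Y ∂_X`. The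
energy `E(k) = ∫ |s(k, ξ)|² exp(-ε ξ²) dξ` satisfies `k E' ≤ E + (4/3) k J`
(`IsNullSolution.hasDerivAt_sineEnergy`), where the production `J` is a double integral over the
half-plane in which symmetrization brings out a factor `Y' - Y` that compensates the concentration
of the Gaussian on the diagonal; hence `J = O(ε^(1/4))` uniformly in `k`
(`IsNullSolution.exists_abs_sineProduction_le`). Zero momentum gives `s(0, ξ) = 0`, so
`E(k) = O(k² ε^(-1/2))`. Integrating from `k₁ = ε` and letting `ε → 0` shows `s = 0`, and `d = 0` by
injectivity of the Fourier transform on finite measures.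
-/

namespace HalfPlaneKernel

/-! ### The entire solution of the convolution equation -/

/-- The moments `(-1)^n / (12^n n!) · Γ(3n + 1/2) / Γ(1/2)`: up to `Γ(1/2)`, the coefficients of the
formal Laplace transform of the kernel `t^(-1/2) exp(-t³/12)`. -/
noncomputable def kernelMoment (n : ℕ) : ℝ :=
  (-1) ^ n / (12 ^ n * n.factorial) * (Real.Gamma (3 * n + 1 / 2) / Real.Gamma (1 / 2))

/-- The numbers `(3N)! c_N`, where `∑ c_N t^(3N)` is the solution of the convolution equation. They
are obtained by comparing coefficients. -/
noncomputable def scaledCoeff : ℕ → ℝ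
  | N => (3 * N + 1 / 2) * kernelMoment N - ∑ m : Fin N, kernelMoment (N - m) * scaledCoeff m

/-- The Taylor coefficients of `volterraSeries`. -/
noncomputable def volterraCoeff (N : ℕ) : ℝ := scaledCoeff N / (3 * N).factorial

/-- The entire function `F` such that `t ↦ F (t³)` solves the convolution equation (up to the
factor `i`). -/
noncomputable def volterraSeries (x : ℝ) : ℝ := ∑' n, volterraCoeff n * x ^ n

lemma scaledCoeff_eq (N : ℕ) : scaledCoeff N =
    (3 * N + 1 / 2) * kernelMoment N
      - ∑ m ∈ Finset.range N, kernelMoment (N - m) * scaledCoeff m := by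
  rw [scaledCoeff, Finset.sum_range (fun m => kernelMoment (N - m) * scaledCoeff m)]

lemma Gamma_add_half_le (n : ℕ) :
    Real.Gamma (n + 1 / 2) / Real.Gamma (1 / 2) ≤ n.factorial := by
  have h0 : 0 < Real.Gamma (1 / 2) := Real.Gamma_pos_of_pos (by norm_num)
  induction n with
  | zero => norm_num; exact div_self_le_one _
  | succ n ih =>
    have h1 : ((n + 1 : ℕ) : ℝ) + 1 / 2 = ((n : ℝ) + 1 / 2) + 1 := by push_cast; ring
    rw [h1, Real.Gamma_add_one (by positivity), Nat.factorial_succ, mul_div_assoc]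
    push_cast
    apply mul_le_mul _ ih _ (by positivity)
    · linarith
    · exact div_nonneg (Real.Gamma_pos_of_pos (by positivity)).le h0.le

lemma factorial_three_mul_le (n : ℕ) :
    ((3 * n).factorial : ℝ) ≤ 27 ^ n * (n.factorial : ℝ) ^ 3 := by
  induction n with
  | zero => simp
  | succ n ih =>
    have h1 : 3 * (n + 1) = 3 * n + 2 + 1 := by ring
    rw [h1, Nat.factorial_succ, Nat.factorial_succ, Nat.factorial_succ, Nat.factorial_succ]
    push_cast
    have h2 : ((3 : ℝ) * n + 2 + 1) * ((3 * n + 1 + 1) * ((3 * n + 1))) ≤ 27 * (n + 1) ^ 3 := by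
      have : (0 : ℝ) ≤ n := by positivity
      nlinarith [mul_nonneg this this]
    calc _ = ((3 : ℝ) * n + 2 + 1) * ((3 * n + 1 + 1) * ((3 * n + 1))) * (3 * n).factorial := by
            ring
      _ ≤ (27 * (n + 1) ^ 3) * (27 ^ n * (n.factorial : ℝ) ^ 3) := by gcongr
      _ = _ := by ring

lemma factorial_pow_three_le (n : ℕ) : (n.factorial : ℝ) ^ 3 ≤ (3 * n).factorial := by
  have h1 := Nat.factorial_mul_factorial_dvd_factorial_add n n
  have h2 := Nat.factorial_mul_factorial_dvd_factorial_add (n + n) n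
  have h3 : n.factorial ^ 3 ≤ (3 * n).factorial := by
    apply Nat.le_of_dvd (Nat.factorial_pos _)
    have : 3 * n = n + n + n := by ring
    rw [this, pow_succ, pow_two]
    exact (mul_dvd_mul_right h1 _).trans h2
  exact_mod_cast h3

lemma abs_kernelMoment_le (n : ℕ) : |kernelMoment n| ≤ 3 ^ n * (n.factorial : ℝ) ^ 2 := by
  have h0 : 0 < Real.Gamma (1 / 2) := Real.Gamma_pos_of_pos (by norm_num)
  have h1 : 0 < Real.Gamma (3 * n + 1 / 2) := Real.Gamma_pos_of_pos (by positivity)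
  have h2 := Gamma_add_half_le (3 * n)
  have h3 := factorial_three_mul_le n
  push_cast at h2
  rw [kernelMoment, abs_mul, abs_div, abs_pow, abs_neg, abs_one, one_pow,
    abs_of_pos (div_pos h1 h0), abs_of_pos (by positivity)]
  calc _ ≤ 1 / (12 ^ n * (n.factorial : ℝ)) * (27 ^ n * (n.factorial : ℝ) ^ 3) := by
        gcongr; exact h2.trans h3
    _ = (27 / 12) ^ n * (n.factorial : ℝ) ^ 2 := by rw [div_pow]; field_simp
    _ ≤ _ := by gcongr; norm_num

/-- The recursion costs at most a geometric factor, so `volterraCoeff N` decays like `1 / N!`. -/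
lemma abs_scaledCoeff_le (N : ℕ) : |scaledCoeff N| ≤ 2 * 12 ^ N * (N.factorial : ℝ) ^ 2 := by
  induction N using Nat.strong_induction_on with
  | _ N ih =>
  have hgeom : ∀ N : ℕ, ∑ m ∈ Finset.range N, (3 : ℝ) ^ (N - m) * 12 ^ m ≤ 12 ^ N / 3 := by
    intro N
    induction N with
    | zero => simp
    | succ N ih =>
      rw [Finset.sum_range_succ]
      have : ∑ m ∈ Finset.range N, (3 : ℝ) ^ (N + 1 - m) * 12 ^ m
          = 3 * ∑ m ∈ Finset.range N, (3 : ℝ) ^ (N - m) * 12 ^ m := by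
        rw [Finset.mul_sum]
        apply Finset.sum_congr rfl
        intro m hm
        rw [Nat.sub_add_comm (Finset.mem_range.mp hm).le, pow_succ]; ring
      rw [this, show N + 1 - N = 1 by omega, pow_succ (12 : ℝ)]
      linarith [pow_pos (show (0 : ℝ) < 12 by norm_num) N]
  have h4 : ∀ N : ℕ, (3 * N + 1 / 2 : ℝ) ≤ 4 ^ N := by
    intro N
    have := one_add_mul_le_pow (a := (3 : ℝ)) (by norm_num) N
    norm_num at this
    linarith
  have h1 : |(3 * N + 1 / 2) * kernelMoment N| ≤ 12 ^ N * (N.factorial : ℝ) ^ 2 := by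
    rw [abs_mul, abs_of_pos (by positivity)]
    calc _ ≤ (4 : ℝ) ^ N * (3 ^ N * (N.factorial : ℝ) ^ 2) := by
          gcongr
          · exact h4 N
          · exact abs_kernelMoment_le N
      _ = _ := by rw [← mul_assoc, ← mul_pow]; norm_num
  have h2 : |∑ m ∈ Finset.range N, kernelMoment (N - m) * scaledCoeff m|
      ≤ (2 * (N.factorial : ℝ) ^ 2) * (12 ^ N / 3) := by
    refine (Finset.abs_sum_le_sum_abs _ _).trans ?_
    refine le_trans ?_ (mul_le_mul_of_nonneg_left (hgeom N) (by positivity))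
    rw [Finset.mul_sum]
    apply Finset.sum_le_sum
    intro m hm
    have hm' := Finset.mem_range.mp hm
    rw [abs_mul]
    have hf : (((N - m).factorial : ℝ) * m.factorial) ≤ N.factorial := by
      have := Nat.factorial_mul_factorial_dvd_factorial_add (N - m) m
      rw [Nat.sub_add_cancel hm'.le] at this
      exact_mod_cast Nat.le_of_dvd (Nat.factorial_pos _) this
    calc _ ≤ (3 ^ (N - m) * ((N - m).factorial : ℝ) ^ 2) * (2 * 12 ^ m * (m.factorial : ℝ) ^ 2) := by
          gcongr
          · exact abs_kernelMoment_le _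
          · exact ih m hm'
      _ = 2 * (((N - m).factorial : ℝ) * m.factorial) ^ 2 * (3 ^ (N - m) * 12 ^ m) := by ring
      _ ≤ _ := by gcongr
  rw [scaledCoeff_eq]
  refine (abs_sub _ _).trans ?_
  nlinarith [show (0 : ℝ) ≤ 12 ^ N * (N.factorial : ℝ) ^ 2 by positivity]

lemma abs_volterraCoeff_le (N : ℕ) : |volterraCoeff N| ≤ 2 * (12 ^ N / N.factorial) := by
  rw [volterraCoeff, abs_div, abs_of_pos (by positivity : (0 : ℝ) < (3 * N).factorial)]
  calc _ ≤ (2 * 12 ^ N * (N.factorial : ℝ) ^ 2) / (N.factorial : ℝ) ^ 3 := by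
        gcongr
        · exact abs_scaledCoeff_le N
        · exact factorial_pow_three_le N
    _ = _ := by field_simp

lemma summable_volterraCoeff (x : ℝ) : Summable (fun n => |volterraCoeff n * x ^ n|) := by
  have := (Real.summable_pow_div_factorial (12 * |x|)).mul_left 2
  refine Summable.of_nonneg_of_le (fun _ => abs_nonneg _) (fun n => ?_) this
  rw [abs_mul, abs_pow]
  calc _ ≤ (2 * (12 ^ n / n.factorial)) * |x| ^ n := by gcongr; exact abs_volterraCoeff_le n
    _ = _ := by rw [mul_pow]; ring

lemma contDiff_volterraSeries : ContDiff ℝ ∞ volterraSeries := by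
  have hr : (FormalMultilinearSeries.ofScalars ℝ volterraCoeff).radius = ⊤ := by
    apply FormalMultilinearSeries.radius_eq_top_of_summable_norm
    intro r
    refine (summable_volterraCoeff r).congr fun n => ?_
    rw [FormalMultilinearSeries.ofScalars_norm, abs_mul, abs_pow, NNReal.abs_eq]
    rfl
  have h := (FormalMultilinearSeries.ofScalars ℝ volterraCoeff).hasFPowerSeriesOnBall
    (by rw [hr]; simp)
  rw [hr] at h
  have h2 : AnalyticOnNhd ℝ (FormalMultilinearSeries.ofScalars ℝ volterraCoeff).sum univ := by
    have := h.analyticOnNhd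
    simpa using this
  have h3 : (FormalMultilinearSeries.ofScalars ℝ volterraCoeff).sum = volterraSeries := by
    ext x
    rw [volterraSeries]
    change FormalMultilinearSeries.ofScalarsSum volterraCoeff x = _
    rw [FormalMultilinearSeries.ofScalarsSum_eq_tsum]
    simp
  rw [h3] at h2
  exact h2.contDiff

lemma integral_rpow_mul_rpow {t a b : ℝ} (ht : 0 < t) (ha : 0 < a) (hb : 0 < b) :
    ∫ s in (0 : ℝ)..t, s ^ (a - 1) * (t - s) ^ (b - 1)
      = t ^ (a + b - 1) * (Real.Gamma a * Real.Gamma b / Real.Gamma (a + b)) := by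
  have h := Complex.betaIntegral_scaled a b ht
  have hB : Complex.betaIntegral a b =
      ((Real.Gamma a * Real.Gamma b / Real.Gamma (a + b) : ℝ) : ℂ) := by
    rw [Complex.betaIntegral_eq_Gamma_mul_div _ _ (by simpa) (by simpa)]
    push_cast
    rw [← Complex.ofReal_add, Complex.Gamma_ofReal, Complex.Gamma_ofReal, Complex.Gamma_ofReal]
  rw [hB] at h
  have h2 : ∫ s in (0 : ℝ)..t, ((s ^ (a - 1) * (t - s) ^ (b - 1) : ℝ) : ℂ)
      = ∫ s in (0 : ℝ)..t, (s : ℂ) ^ ((a : ℂ) - 1) * ((t : ℂ) - s) ^ ((b : ℂ) - 1) := by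
    apply intervalIntegral.integral_congr
    intro s hs
    rw [uIcc_of_le ht.le] at hs
    simp only
    rw [Complex.ofReal_mul, Complex.ofReal_cpow hs.1, Complex.ofReal_cpow (by linarith [hs.2])]
    push_cast
    rfl
  have h3 : (t : ℂ) ^ ((a : ℂ) + b - 1) = ((t ^ (a + b - 1) : ℝ) : ℂ) := by
    rw [Complex.ofReal_cpow ht.le]; push_cast; rfl
  rw [← h2, intervalIntegral.integral_ofReal, h3] at h
  exact_mod_cast h

lemma sub_rpow_intervalIntegrable (t : ℝ) :
    IntervalIntegrable (fun s : ℝ => (t - s) ^ (-(1 / 2) : ℝ)) volume 0 t := by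
  have := (intervalIntegral.intervalIntegrable_rpow' (a := 0) (b := t)
    (r := (-(1 / 2) : ℝ)) (by norm_num)).comp_sub_left t
  simpa using this.symm

/-- The coefficient identity behind the convolution equation. -/
lemma sum_antidiagonal_coeff (N : ℕ) :
    ∑ p ∈ Finset.HasAntidiagonal.antidiagonal N, (-1 : ℝ) ^ p.1 / (12 ^ p.1 * p.1.factorial) * volterraCoeff p.2 *
      (Real.Gamma (3 * p.2 + 1) * Real.Gamma (3 * p.1 + 1 / 2) / Real.Gamma (3 * N + 3 / 2))
      = (-1) ^ N / (12 ^ N * N.factorial) := by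
  have h0 : 0 < Real.Gamma (1 / 2) := Real.Gamma_pos_of_pos (by norm_num)
  have hN : 0 < Real.Gamma (3 * N + 1 / 2) := Real.Gamma_pos_of_pos (by positivity)
  have hk0 : kernelMoment 0 = 1 := by
    simp only [kernelMoment]
    norm_num
    simpa using h0.ne'
  have h1 : ∑ p ∈ Finset.HasAntidiagonal.antidiagonal N, kernelMoment p.1 * scaledCoeff p.2
      = (3 * N + 1 / 2) * kernelMoment N := by
    rw [← Finset.Nat.sum_antidiagonal_swap, Finset.Nat.sum_antidiagonal_eq_sum_range_succ_mk]
    simp only [Prod.fst_swap, Prod.snd_swap]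
    rw [Finset.sum_range_succ, Nat.sub_self, hk0, one_mul]
    linarith [scaledCoeff_eq N]
  have h2 : Real.Gamma (3 * N + 3 / 2) = (3 * N + 1 / 2) * Real.Gamma (3 * N + 1 / 2) := by
    rw [← Real.Gamma_add_one (by positivity)]; congr 1; ring
  have h3 : ∀ p ∈ Finset.HasAntidiagonal.antidiagonal N,
      (-1 : ℝ) ^ p.1 / (12 ^ p.1 * p.1.factorial) * volterraCoeff p.2 *
      (Real.Gamma (3 * p.2 + 1) * Real.Gamma (3 * p.1 + 1 / 2) / Real.Gamma (3 * N + 3 / 2))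
      = (Real.Gamma (1 / 2) / Real.Gamma (3 * N + 3 / 2)) * (kernelMoment p.1 * scaledCoeff p.2) := by
    intro p _
    have : Real.Gamma (3 * p.2 + 1) = (3 * p.2).factorial := by
      have := Real.Gamma_nat_eq_factorial (3 * p.2)
      push_cast at this
      exact this
    rw [this, volterraCoeff, kernelMoment]
    have : ((3 * p.2).factorial : ℝ) ≠ 0 := by positivity
    field_simp
  rw [Finset.sum_congr rfl h3, ← Finset.mul_sum, h1, h2, kernelMoment]
  have : (3 * N + 1 / 2 : ℝ) ≠ 0 := by positivity
  field_simp

/-- Both factors of the convolution are expanded in power series; the terms are Beta integrals. -/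
lemma volterraSeries_convolution {t : ℝ} (ht : 0 < t) :
    ∫ s in (0 : ℝ)..t, (t - s) ^ (-(1 / 2) : ℝ) * Real.exp (-(t - s) ^ 3 / 12)
        * volterraSeries (s ^ 3)
      = t ^ (1 / 2 : ℝ) * Real.exp (-t ^ 3 / 12) := by
  set kap : ℕ → ℝ := fun n => (-1 : ℝ) ^ n / (12 ^ n * n.factorial) with hkap
  have hexp : ∀ x : ℝ, HasSum (fun n => kap n * x ^ n) (Real.exp (-x / 12)) := by
    intro x
    have := NormedSpace.expSeries_div_hasSum_exp (𝔸 := ℝ) (-x / 12)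
    rw [← Real.exp_eq_exp_ℝ] at this
    refine this.congr_fun ?_ |> fun h => h
    intro n
    simp only [hkap]
    rw [div_pow, neg_pow x n]; field_simp
  have hkapabs : ∀ x : ℝ, Summable (fun n => |kap n * x ^ n|) := fun x => (hexp x).summable.abs
  have hF : ∀ x, HasSum (fun n => volterraCoeff n * x ^ n) (volterraSeries x) := fun x =>
    (summable_volterraCoeff x).of_abs.hasSum
  let T : ℕ × ℕ → ℝ → ℝ := fun p s =>
    (t - s) ^ (-(1 / 2) : ℝ) * ((kap p.1 * ((t - s) ^ 3) ^ p.1) * (volterraCoeff p.2 * (s ^ 3) ^ p.2))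
  have hprod : ∀ s, HasSum (fun p => T p s)
      ((t - s) ^ (-(1 / 2) : ℝ) * Real.exp (-(t - s) ^ 3 / 12) * volterraSeries (s ^ 3)) := by
    intro s
    have hs := summable_mul_of_summable_norm (f := fun n => kap n * ((t - s) ^ 3) ^ n)
      (g := fun n => volterraCoeff n * (s ^ 3) ^ n) (hkapabs ((t - s) ^ 3))
      (summable_volterraCoeff (s ^ 3))
    have := ((hexp ((t - s) ^ 3)).mul (hF (s ^ 3)) hs).mul_left ((t - s) ^ (-(1 / 2) : ℝ))
    simpa only [T, mul_assoc] using this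
  have hTint : ∀ p, IntervalIntegrable (T p) volume 0 t := by
    intro p
    apply (sub_rpow_intervalIntegrable t).mul_continuousOn
    fun_prop
  have hTint' : ∀ p, Integrable (T p) (volume.restrict (Ioc 0 t)) := fun p => by
    have := hTint p
    rwa [intervalIntegrable_iff_integrableOn_Ioc_of_le ht.le] at this
  set J : ℝ := ∫ s in Ioc 0 t, (t - s) ^ (-(1 / 2) : ℝ) with hJ
  have hbd : ∀ p, ∫ s in Ioc 0 t, ‖T p s‖
      ≤ J * (|kap p.1 * (t ^ 3) ^ p.1| * |volterraCoeff p.2 * (t ^ 3) ^ p.2|) := by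
    intro p
    rw [hJ, ← integral_mul_const]
    apply setIntegral_mono_on (hTint' p).norm _ measurableSet_Ioc
    · intro s hs
      have h1 : 0 ≤ t - s := by linarith [hs.2]
      have h2 : t - s ≤ t := by linarith [hs.1]
      have h3 : 0 ≤ s := hs.1.le
      simp only [T, Real.norm_eq_abs, abs_mul]
      rw [abs_of_nonneg (Real.rpow_nonneg h1 _)]
      gcongr
      exact hs.2
    · apply Integrable.mul_const
      have := sub_rpow_intervalIntegrable t
      rwa [intervalIntegrable_iff_integrableOn_Ioc_of_le ht.le] at this
  have hsum : Summable fun p => ∫ s in Ioc 0 t, ‖T p s‖ := by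
    refine Summable.of_nonneg_of_le (fun p => integral_nonneg fun _ => norm_nonneg _) hbd ?_
    apply Summable.mul_left
    exact ((hkapabs (t ^ 3)).mul_of_nonneg (summable_volterraCoeff (t ^ 3))
      (fun _ => abs_nonneg _) (fun _ => abs_nonneg _))
  have hmain := hasSum_integral_of_summable_integral_norm hTint' hsum
  have hTval : ∀ p, ∫ s in Ioc 0 t, T p s = t ^ (1 / 2 : ℝ) * ((t ^ 3) ^ (p.1 + p.2) *
      (kap p.1 * volterraCoeff p.2 * (Real.Gamma (3 * p.2 + 1) * Real.Gamma (3 * p.1 + 1 / 2)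
        / Real.Gamma (3 * ((p.1 + p.2 : ℕ) : ℝ) + 3 / 2)))) := by
    intro p
    have hb := integral_rpow_mul_rpow (a := 3 * p.2 + 1) (b := 3 * p.1 + 1 / 2) ht
      (by positivity) (by positivity)
    rw [intervalIntegral.integral_of_le ht.le] at hb
    have : ∫ s in Ioc 0 t, T p s = ∫ s in Ioc 0 t, (kap p.1 * volterraCoeff p.2) *
        (s ^ ((3 * p.2 + 1 : ℝ) - 1) * (t - s) ^ ((3 * p.1 + 1 / 2 : ℝ) - 1)) := by
      rw [integral_Ioc_eq_integral_Ioo, integral_Ioc_eq_integral_Ioo]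
      apply setIntegral_congr_fun measurableSet_Ioo
      intro s hs
      have h1 : 0 < t - s := by linarith [hs.2]
      have e1 : s ^ ((3 * p.2 + 1 : ℝ) - 1) = (s ^ 3) ^ p.2 := by
        rw [← pow_mul, ← Real.rpow_natCast]; congr 1; push_cast; ring
      have e2 : (t - s) ^ ((3 * p.1 + 1 / 2 : ℝ) - 1)
          = (t - s) ^ (-(1 / 2) : ℝ) * ((t - s) ^ 3) ^ p.1 := by
        rw [← pow_mul, ← Real.rpow_natCast (t - s), ← Real.rpow_add h1]
        congr 1; push_cast; ring
      simp only [T]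
      rw [e1, e2]; ring
    rw [this, integral_const_mul, hb]
    have e3 : t ^ ((3 * p.2 + 1 : ℝ) + (3 * p.1 + 1 / 2) - 1)
        = t ^ (1 / 2 : ℝ) * (t ^ 3) ^ (p.1 + p.2) := by
      rw [← pow_mul, ← Real.rpow_natCast t, ← Real.rpow_add ht]
      congr 1; push_cast; ring
    have e4 : ((3 * p.2 + 1 : ℝ) + (3 * p.1 + 1 / 2)) = 3 * ((p.1 + p.2 : ℕ) : ℝ) + 3 / 2 := by
      push_cast; ring
    rw [e3, e4]; ring
  rw [intervalIntegral.integral_of_le ht.le,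
    ← integral_congr_ae (Eventually.of_forall fun s => (hprod s).tsum_eq)]
  rw [← hmain.tsum_eq]
  have hs2 := hmain.summable
  simp_rw [hTval] at hs2 ⊢
  rw [tsum_mul_left]
  congr 1
  have hs3 : Summable fun p : ℕ × ℕ => ((t ^ 3) ^ (p.1 + p.2) *
      (kap p.1 * volterraCoeff p.2 * (Real.Gamma (3 * p.2 + 1) * Real.Gamma (3 * p.1 + 1 / 2)
        / Real.Gamma (3 * ((p.1 + p.2 : ℕ) : ℝ) + 3 / 2)))) := by
    have := hs2.mul_left ((t ^ (1 / 2 : ℝ))⁻¹)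
    refine this.congr fun p => ?_
    rw [inv_mul_cancel_left₀ (by positivity)]
  have hsig := Summable.tsum_sigma' (fun n => (hasSum_fintype _).summable)
    ((Finset.HasAntidiagonal.sigmaAntidiagonalEquivProd (A := ℕ)).summable_iff.mpr hs3)
  simp only [Function.comp_def] at hsig
  rw [← (hexp (t ^ 3)).tsum_eq,
    ← (Finset.HasAntidiagonal.sigmaAntidiagonalEquivProd (A := ℕ)).tsum_eq, hsig]
  congr 1
  ext N
  rw [tsum_fintype, show kap N = _ from (sum_antidiagonal_coeff N).symm, Finset.sum_mul]
  rw [← Finset.sum_coe_sort (Finset.HasAntidiagonal.antidiagonal N)]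
  apply Finset.sum_congr rfl
  intro p _
  have hp : p.1.1 + p.1.2 = N := Finset.HasAntidiagonal.mem_antidiagonal.mp p.2
  simp only [Finset.HasAntidiagonal.sigmaAntidiagonalEquivProd_apply, hp]
  ring

/-! ### Parametric integrals -/

/-- Leibniz rule for a Volterra convolution. -/
lemma hasDerivAt_volterra {h g : ℝ → ℝ} (hh : ContDiff ℝ 1 h) (hg : Continuous g) (t : ℝ) :
    HasDerivAt (fun t => ∫ s in (0 : ℝ)..t, h (t - s) * g s)
      (h 0 * g t + ∫ s in (0 : ℝ)..t, deriv h (t - s) * g s) t := by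
  have hd : Continuous (deriv h) := hh.continuous_deriv le_rfl
  have hc : Continuous h := hh.continuous
  have h1 : ∀ u t : ℝ, HasDerivAt (fun u => ∫ s in (0 : ℝ)..u, h (t - s) * g s)
      (h (t - u) * g u) u := fun u t =>
    (show Continuous fun s => h (t - s) * g s by fun_prop).integral_hasStrictDerivAt 0 u
      |>.hasDerivAt
  have h2 : ∀ u t : ℝ, HasDerivAt (fun t => ∫ s in (0 : ℝ)..u, h (t - s) * g s)
      (∫ s in (0 : ℝ)..u, deriv h (t - s) * g s) t := by
    intro u t
    obtain ⟨M, hM⟩ := ((isCompact_closedBall t 1).prod (isCompact_uIcc (a := 0) (b := u))).exists_bound_of_continuousOn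
      (f := fun p : ℝ × ℝ => deriv h (p.1 - p.2) * g p.2) (by fun_prop)
    refine (intervalIntegral.hasDerivAt_integral_of_dominated_loc_of_deriv_le
      (F := fun t s => h (t - s) * g s) (F' := fun t s => deriv h (t - s) * g s)
      (bound := fun _ => M) (Metric.ball_mem_nhds t one_pos) ?_ ?_ ?_ ?_ ?_ ?_).2
    · exact Eventually.of_forall fun x => Continuous.aestronglyMeasurable (by fun_prop)
    · exact Continuous.intervalIntegrable (by fun_prop) _ _
    · exact Continuous.aestronglyMeasurable (by fun_prop)
    · exact Eventually.of_forall fun s hs x hx =>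
        hM (x, s) ⟨Metric.ball_subset_closedBall hx, uIoc_subset_uIcc hs⟩
    · exact intervalIntegrable_const
    · refine Eventually.of_forall fun s _ x _ => ?_
      have := ((hh.differentiable one_ne_zero (x - s)).hasDerivAt.comp_sub_const x s).mul_const (g s)
      exact this
  have hc1 : Continuous fun v : ℝ × ℝ => h (v.2 - v.1) * g v.1 := by fun_prop
  have hc2 : Continuous fun v : ℝ × ℝ => ∫ s in (0 : ℝ)..v.1, deriv h (v.2 - s) * g s := by
    apply intervalIntegral.continuous_parametric_intervalIntegral_of_continuous
    · fun_prop
    · fun_prop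
  have key := hasStrictFDerivAt_uncurry_coprod (𝕜 := ℝ) (u := (t, t))
    (f := fun u t => ∫ s in (0 : ℝ)..u, h (t - s) * g s)
    (f₁ := fun u t => ContinuousLinearMap.toSpanSingleton ℝ (h (t - u) * g u))
    (f₂ := fun u t => ContinuousLinearMap.toSpanSingleton ℝ
      (∫ s in (0 : ℝ)..u, deriv h (t - s) * g s))
    (Eventually.of_forall fun v => (h1 v.1 v.2).hasFDerivAt)
    (Eventually.of_forall fun v => (h2 v.1 v.2).hasFDerivAt)
    (Continuous.continuousAt (by
      exact (ContinuousLinearMap.toSpanSingletonCLE (𝕜 := ℝ) (E := ℝ)).continuous.comp hc1))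
    (Continuous.continuousAt (by
      exact (ContinuousLinearMap.toSpanSingletonCLE (𝕜 := ℝ) (E := ℝ)).continuous.comp hc2))
  have hdiag : HasDerivAt (fun t : ℝ => (t, t)) ((1 : ℝ), (1 : ℝ)) t :=
    (hasDerivAt_id t).prodMk (hasDerivAt_id t)
  have := HasFDerivAt.comp_hasDerivAt (f := fun t : ℝ => (t, t)) t key.hasFDerivAt hdiag
  refine this.congr_deriv ?_
  simp [Function.HasUncurry.uncurry]

lemma hasDerivAt_intervalIntegral_of_continuous {F F' : ℝ → ℝ → ℝ} {a b : ℝ}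
    (hF : Continuous (Function.uncurry F)) (hF' : Continuous (Function.uncurry F'))
    (hd : ∀ x s, HasDerivAt (fun x => F x s) (F' x s) x) (x : ℝ) :
    HasDerivAt (fun x => ∫ s in a..b, F x s) (∫ s in a..b, F' x s) x := by
  obtain ⟨M, hM⟩ := ((isCompact_closedBall x 1).prod (isCompact_uIcc (a := a) (b := b))).exists_bound_of_continuousOn
      (f := Function.uncurry F') hF'.continuousOn
  refine (intervalIntegral.hasDerivAt_integral_of_dominated_loc_of_deriv_le
      (bound := fun _ => M) (Metric.ball_mem_nhds x one_pos) ?_ ?_ ?_ ?_ ?_ ?_).2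
  · exact Eventually.of_forall fun y =>
      Continuous.aestronglyMeasurable (hF.comp (by fun_prop : Continuous fun s => (y, s)))
  · exact Continuous.intervalIntegrable (hF.comp (by fun_prop : Continuous fun s => (x, s))) _ _
  · exact Continuous.aestronglyMeasurable (hF'.comp (by fun_prop : Continuous fun s => (x, s)))
  · exact Eventually.of_forall fun s hs y hy =>
        hM (y, s) ⟨Metric.ball_subset_closedBall hy, uIoc_subset_uIcc hs⟩
  · exact intervalIntegrable_const
  · exact Eventually.of_forall fun s _ y _ => hd y s

lemma sq_integral_mul_le {f g : ℝ → ℝ} (hf : Integrable fun x => f x ^ 2)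
    (hg : Integrable fun x => g x ^ 2) (hfg : Integrable fun x => f x * g x) :
    (∫ x, f x * g x) ^ 2 ≤ (∫ x, f x ^ 2) * ∫ x, g x ^ 2 := by
  have h : ∀ c : ℝ, 0 ≤ (∫ x, g x ^ 2) * (c * c) + (2 * ∫ x, f x * g x) * c + ∫ x, f x ^ 2 := by
    intro c
    have h0 : 0 ≤ ∫ x, (f x + c * g x) ^ 2 := integral_nonneg fun x => sq_nonneg _
    have h1 : ∫ x, (f x + c * g x) ^ 2
        = ∫ x, (f x ^ 2 + (2 * c) * (f x * g x) + c ^ 2 * g x ^ 2) := by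
      congr 1; ext x; ring
    have hs : Integrable fun x => f x ^ 2 + (2 * c) * (f x * g x) := hf.add (hfg.const_mul _)
    rw [h1, integral_add hs (hg.const_mul _),
      integral_add hf (hfg.const_mul _), integral_const_mul, integral_const_mul] at h0
    linarith
  have := discrim_le_zero h
  rw [discrim] at this
  linarith

/-! ### Energy inequalities for the damped transport equation -/

lemma integrable_of_le_inv {f : ℝ → ℝ} {C : ℝ} (hf : Continuous f)
    (hb : ∀ x, |f x| ≤ C / (1 + x ^ 2)) : Integrable f := by
  refine (integrable_inv_one_add_sq.const_mul C).mono' hf.aestronglyMeasurable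
    (Eventually.of_forall fun x => ?_)
  rw [Real.norm_eq_abs, ← div_eq_mul_inv]
  exact hb x

lemma integrable_quadratic_mul {f g p : ℝ → ℝ} {C : ℝ} (hf : Continuous f) (hg : Continuous g)
    (hp : Continuous p) (hfb : ∀ x, |f x| ≤ C / (1 + x ^ 2)) (hgb : ∀ x, |g x| ≤ C / (1 + x ^ 2))
    (hpb : ∀ x, |p x| ≤ 1 + x ^ 2) : Integrable fun x => p x * (f x * g x) := by
  apply integrable_of_le_inv (C := C ^ 2) (by fun_prop)
  intro x
  have hx : 0 < 1 + x ^ 2 := by positivity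
  rw [abs_mul, abs_mul]
  calc |p x| * (|f x| * |g x|) ≤ (1 + x ^ 2) * (C / (1 + x ^ 2) * (C / (1 + x ^ 2))) := by
        have := (abs_nonneg _).trans (hfb x)
        gcongr
        exacts [hpb x, hfb x, hgb x]
    _ = _ := by field_simp

/-- One time slice of the damped transport equation `∂_t f = ∂_x f - x² f + H(t)` with the
constraint `∫ f = 0`: here `g = ∂_x f` and `r = ∂_t f`. All three decay like `1 / (1 + x²)`. -/
structure IsDampedSlice (C : ℝ) (f g r : ℝ → ℝ) (H : ℝ) : Prop where
  deriv : ∀ x, HasDerivAt f (g x) x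
  cont : Continuous g
  eq : ∀ x, r x = g x - x ^ 2 * f x + H
  bound_f : ∀ x, |f x| ≤ C / (1 + x ^ 2)
  bound_g : ∀ x, |g x| ≤ C / (1 + x ^ 2)
  bound_r : ∀ x, |r x| ≤ C / (1 + x ^ 2)
  mean : ∫ x, f x = 0

namespace IsDampedSlice

variable {C H : ℝ} {f g r : ℝ → ℝ}

lemma cont_f (h : IsDampedSlice C f g r H) : Continuous f :=
  continuous_iff_continuousAt.mpr fun x => (h.deriv x).continuousAt

lemma cont_r (h : IsDampedSlice C f g r H) : Continuous r := by
  have := h.cont_f; have := h.cont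
  rw [funext h.eq]; fun_prop

lemma integrable_f (h : IsDampedSlice C f g r H) : Integrable f :=
  integrable_of_le_inv h.cont_f h.bound_f

lemma integrable_g (h : IsDampedSlice C f g r H) : Integrable g :=
  integrable_of_le_inv h.cont h.bound_g

lemma integral_g (h : IsDampedSlice C f g r H) : ∫ x, g x = 0 :=
  integral_eq_zero_of_hasDerivAt_of_integrable h.deriv h.integrable_g h.integrable_f

lemma integrable_ff (h : IsDampedSlice C f g r H) {p : ℝ → ℝ} (hp : Continuous p)
    (hpb : ∀ x, |p x| ≤ 1 + x ^ 2) : Integrable fun x => p x * (f x * f x) :=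
  integrable_quadratic_mul h.cont_f h.cont_f hp h.bound_f h.bound_f hpb

lemma integrable_fg (h : IsDampedSlice C f g r H) {p : ℝ → ℝ} (hp : Continuous p)
    (hpb : ∀ x, |p x| ≤ 1 + x ^ 2) : Integrable fun x => p x * (f x * g x) :=
  integrable_quadratic_mul h.cont_f h.cont hp h.bound_f h.bound_g hpb

lemma integrable_sq (h : IsDampedSlice C f g r H) : Integrable fun x => f x ^ 2 := by
  simpa [sq] using h.integrable_ff (p := fun _ => 1) (by fun_prop) (fun x => by simp; positivity)

lemma integrable_weighted_sq (h : IsDampedSlice C f g r H) :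
    Integrable fun x => (x * f x) ^ 2 := by
  have := h.integrable_ff (p := fun x => x ^ 2) (by fun_prop) (fun x => by simp)
  refine this.congr (Eventually.of_forall fun x => ?_)
  simp only; ring

lemma integrable_g_sq (h : IsDampedSlice C f g r H) : Integrable fun x => g x ^ 2 := by
  have := integrable_quadratic_mul h.cont h.cont (p := fun _ => 1) continuous_const
    h.bound_g h.bound_g (fun x => by simp; positivity)
  simpa [sq] using this

lemma integrable_r_sq (h : IsDampedSlice C f g r H) : Integrable fun x => r x ^ 2 := by
  have := integrable_quadratic_mul h.cont_r h.cont_r (p := fun _ => 1) continuous_const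
    h.bound_r h.bound_r (fun x => by simp; positivity)
  simpa [sq] using this

lemma abs_le_one_add_sq (x : ℝ) : |x| ≤ 1 + x ^ 2 := by
  nlinarith [abs_nonneg x, sq_abs x, sq_nonneg (|x| - 1)]

/-- The energy dissipation identity: transport and the constraint force do no work. -/
lemma integral_mul_r (h : IsDampedSlice C f g r H) :
    ∫ x, f x * r x = -∫ x, (x * f x) ^ 2 := by
  have hfg := h.integrable_fg (p := fun _ => 1) continuous_const (fun x => by simp; positivity)
  simp only [one_mul] at hfg
  have h1 : ∫ x, f x * g x = 0 := by
    apply integral_eq_zero_of_hasDerivAt_of_integrable (f := fun x => f x ^ 2 / 2) _ hfg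
      (h.integrable_sq.div_const 2)
    intro x
    refine (((h.deriv x).pow 2).div_const 2).congr_deriv ?_
    push_cast; ring
  have h2 : ∫ x, f x * r x = ∫ x, (f x * g x - (x * f x) ^ 2 + H * f x) := by
    congr 1; ext x; rw [h.eq]; ring
  have h3 : Integrable fun x => f x * g x - (x * f x) ^ 2 := hfg.sub h.integrable_weighted_sq
  rw [h2, integral_add h3 (h.integrable_f.const_mul H), integral_sub hfg h.integrable_weighted_sq,
    integral_const_mul, h.mean, h1]
  ring

/-- The Heisenberg inequality: `∫ f² = -2 ∫ x f g`. -/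
lemma sq_integral_sq_le (h : IsDampedSlice C f g r H) :
    (∫ x, f x ^ 2) ^ 2 ≤ 4 * (∫ x, (x * f x) ^ 2) * ∫ x, g x ^ 2 := by
  have hi := h.integrable_fg (p := fun x => x) continuous_id abs_le_one_add_sq
  have hj := h.integrable_ff (p := fun x => x) continuous_id abs_le_one_add_sq
  have h1 : ∫ x, (f x ^ 2 + 2 * (x * (f x * g x))) = 0 := by
    apply integral_eq_zero_of_hasDerivAt_of_integrable (f := fun x => x * (f x * f x)) _
      (h.integrable_sq.add (hi.const_mul 2)) hj
    intro x
    refine ((hasDerivAt_id x).mul ((h.deriv x).mul (h.deriv x))).congr_deriv ?_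
    simp; ring
  rw [integral_add h.integrable_sq (hi.const_mul 2), integral_const_mul] at h1
  have e : ∀ x, x * (f x * g x) = (x * f x) * g x := fun x => by ring
  simp_rw [e] at h1 hi
  have h2 := sq_integral_mul_le h.integrable_weighted_sq h.integrable_g_sq hi
  rw [show ∫ x, f x ^ 2 = -(2 * ∫ x, x * f x * g x) by linarith]
  nlinarith

/-- The equation tested against `g`; the force drops out because `∫ g = 0`. -/
lemma integral_g_sq (h : IsDampedSlice C f g r H) :
    ∫ x, g x ^ 2 = (∫ x, r x * g x) - ∫ x, x * f x * f x := by
  have hi := h.integrable_fg (p := fun x => x ^ 2) (by fun_prop) (fun x => by simp)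
  have hj := h.integrable_ff (p := fun x => x ^ 2) (by fun_prop) (fun x => by simp)
  have hk := h.integrable_ff (p := fun x => x) continuous_id abs_le_one_add_sq
  have h1 : ∫ x, (2 * (x * (f x * f x)) + 2 * (x ^ 2 * (f x * g x))) = 0 := by
    apply integral_eq_zero_of_hasDerivAt_of_integrable (f := fun x => x ^ 2 * (f x * f x)) _
      ((hk.const_mul 2).add (hi.const_mul 2)) hj
    intro x
    refine (((hasDerivAt_id x).pow 2).mul ((h.deriv x).mul (h.deriv x))).congr_deriv ?_
    simp; ring
  rw [integral_add (hk.const_mul 2) (hi.const_mul 2), integral_const_mul, integral_const_mul] at h1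
  have h2 : ∫ x, r x * g x = ∫ x, (g x ^ 2 - x ^ 2 * (f x * g x) + H * g x) := by
    congr 1; ext x; rw [h.eq]; ring
  have h3 : Integrable fun x => g x ^ 2 - x ^ 2 * (f x * g x) := h.integrable_g_sq.sub hi
  rw [h2, integral_add h3 (h.integrable_g.const_mul H), integral_sub h.integrable_g_sq hi,
    integral_const_mul, h.integral_g]
  simp_rw [mul_assoc]
  linarith

/-- The coercivity estimate: the energy is controlled by its dissipation and by the energy of the
time derivative. -/
lemma coercivity (h : IsDampedSlice C f g r H) :
    (∫ x, f x ^ 2) ^ 2 ≤ 4 * (∫ x, (x * f x) ^ 2) * ((∫ x, r x ^ 2) +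
      2 * √((∫ x, (x * f x) ^ 2) * ∫ x, f x ^ 2)) := by
  have hrg : Integrable fun x => r x * g x := by
    simpa using integrable_quadratic_mul h.cont_r h.cont (p := fun _ => 1) continuous_const
      h.bound_r h.bound_g (fun x => by simp; positivity)
  have hff : Integrable fun x => x * f x * f x := by
    simpa only [mul_assoc] using h.integrable_ff (p := fun x => x) continuous_id abs_le_one_add_sq
  have h1 : |∫ x, x * f x * f x| ≤ √((∫ x, (x * f x) ^ 2) * ∫ x, f x ^ 2) :=
    Real.abs_le_sqrt (sq_integral_mul_le h.integrable_weighted_sq h.integrable_sq hff)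
  have h2 : ∫ x, r x * g x ≤ ∫ x, (r x ^ 2 / 2 + g x ^ 2 / 2) := by
    apply integral_mono hrg ((h.integrable_r_sq.div_const 2).add (h.integrable_g_sq.div_const 2))
    intro x
    simp only [Pi.add_apply]
    nlinarith [sq_nonneg (r x - g x)]
  rw [integral_add (h.integrable_r_sq.div_const 2) (h.integrable_g_sq.div_const 2),
    integral_div, integral_div] at h2
  have h3 := h.integral_g_sq
  refine h.sq_integral_sq_le.trans ?_
  apply mul_le_mul_of_nonneg_left
  · linarith [neg_abs_le (∫ x, x * f x * f x)]
  · exact mul_nonneg (by norm_num) (integral_nonneg fun x => sq_nonneg _)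

/-- The constraint force is controlled by the energies of the solution and of its time
derivative: test the equation with a fixed Gaussian. -/
lemma exists_abs_force_le : ∃ K : ℝ, 0 ≤ K ∧ ∀ {C H : ℝ} {f g r : ℝ → ℝ},
    IsDampedSlice C f g r H → |H| ≤ K * (√(∫ x, r x ^ 2) + √(∫ x, f x ^ 2)) := by
  let z : ℝ → ℝ := fun x => Real.exp (-x ^ 2)
  -- `w = (x² + ∂_x) z` is what the adjoint of `-∂_x + x²` makes of the Gaussian `z`
  let w : ℝ → ℝ := fun x => (x ^ 2 - 2 * x) * z x
  have hzc : Continuous z := by fun_prop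
  have hwc : Continuous w := by fun_prop
  have hz1 : ∀ x, |z x| ≤ 1 / (1 + x ^ 2) := by
    intro x
    rw [abs_of_pos (Real.exp_pos _), Real.exp_neg, ← one_div]
    gcongr
    linarith [Real.add_one_le_exp (x ^ 2)]
  have hw1 : ∀ x, |w x| ≤ 12 / (1 + x ^ 2) := by
    intro x
    have hx : 0 < 1 + x ^ 2 := by positivity
    have e1 : |x ^ 2 - 2 * x| ≤ 2 * (1 + x ^ 2) := by
      rw [abs_le]; constructor <;> nlinarith [sq_nonneg (x - 1), sq_nonneg (x + 1)]
    have e2 : (1 + x ^ 2) ^ 2 ≤ 6 * Real.exp (x ^ 2) := by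
      nlinarith [Real.quadratic_le_exp_of_nonneg (sq_nonneg x), sq_nonneg x]
    rw [abs_mul, abs_of_pos (Real.exp_pos _), Real.exp_neg, ← div_eq_mul_inv,
      div_le_div_iff₀ (Real.exp_pos _) hx]
    nlinarith
  have hsq : ∀ {C C' : ℝ} {u v : ℝ → ℝ}, Continuous u → Continuous v →
      (∀ x, |u x| ≤ C / (1 + x ^ 2)) → (∀ x, |v x| ≤ C' / (1 + x ^ 2)) →
      Integrable fun x => u x * v x := by
    intro C C' u v hu hv hub hvb
    have hle : ∀ x : ℝ, 0 < 1 + x ^ 2 := fun x => by positivity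
    have := integrable_quadratic_mul hu hv (p := fun _ => 1) (C := max C C') continuous_const
      (fun x => (hub x).trans (by have := hle x; gcongr; exact le_max_left _ _))
      (fun x => (hvb x).trans (by have := hle x; gcongr; exact le_max_right _ _))
      (fun x => by simp; positivity)
    simpa using this
  have hzz : Integrable fun x => z x ^ 2 := by simpa only [sq] using hsq hzc hzc hz1 hz1
  have hww : Integrable fun x => w x ^ 2 := by simpa only [sq] using hsq hwc hwc hw1 hw1
  have hzi : ∫ x, z x = √Real.pi := by
    have := integral_gaussian 1
    simpa [z] using this
  refine ⟨(√(∫ x, z x ^ 2) + √(∫ x, w x ^ 2)) / √Real.pi, by positivity, ?_⟩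
  intro C H f g r h
  have hzr := hsq hzc h.cont_r hz1 h.bound_r
  have hzg := hsq hzc h.cont hz1 h.bound_g
  have hwf := hsq hwc h.cont_f hw1 h.bound_f
  have hzf := hsq hzc h.cont_f hz1 h.bound_f
  have hxzf : Integrable fun x => x * (z x * f x) :=
    integrable_quadratic_mul (C := max 1 C) hzc h.cont_f continuous_id
      (fun x => (hz1 x).trans (by gcongr; exact le_max_left _ _))
      (fun x => (h.bound_f x).trans (by gcongr; exact le_max_right _ _)) abs_le_one_add_sq
  have h1 : ∫ x, (z x * g x - 2 * (x * (z x * f x))) = 0 := by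
    apply integral_eq_zero_of_hasDerivAt_of_integrable (f := fun x => z x * f x) _
      (hzg.sub (hxzf.const_mul 2)) hzf
    intro x
    have hz' : HasDerivAt z (z x * (-(2 * x))) x := by
      have := ((hasDerivAt_id x).pow 2).neg.exp
      refine this.congr_deriv ?_
      simp [z]
    refine (hz'.mul (h.deriv x)).congr_deriv ?_
    simp only [Pi.sub_apply]
    ring
  have h2 : ∫ x, H * z x = ∫ x, (z x * r x + w x * f x - (z x * g x - 2 * (x * (z x * f x)))) := by
    congr 1; ext x; rw [h.eq]; simp only [w]; ring
  have h3 : Integrable fun x => z x * r x + w x * f x := hzr.add hwf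
  have h4 : Integrable fun x => z x * g x - 2 * (x * (z x * f x)) := hzg.sub (hxzf.const_mul 2)
  rw [integral_sub h3 h4, h1, integral_add hzr hwf, integral_const_mul,
    hzi] at h2
  have h4 := Real.abs_le_sqrt (sq_integral_mul_le hzz h.integrable_r_sq hzr)
  have h5 := Real.abs_le_sqrt (sq_integral_mul_le hww h.integrable_sq hwf)
  rw [Real.sqrt_mul (integral_nonneg fun x => sq_nonneg _)] at h4 h5
  have hpi : 0 < √Real.pi := Real.sqrt_pos.mpr Real.pi_pos
  rw [div_mul_eq_mul_div, le_div_iff₀ hpi, ← abs_of_pos hpi, ← abs_mul, h2, sub_zero]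
  refine (abs_add_le _ _).trans ?_
  have a1 := Real.sqrt_nonneg (∫ x, z x ^ 2)
  have a2 := Real.sqrt_nonneg (∫ x, w x ^ 2)
  have a3 := Real.sqrt_nonneg (∫ x, r x ^ 2)
  have a4 := Real.sqrt_nonneg (∫ x, f x ^ 2)
  nlinarith [mul_nonneg a1 a4, mul_nonneg a2 a3]

end IsDampedSlice

/-- Rapid decay of energies `E j` of a family in which `E (j + 1)` is the energy of the time
derivative: the coercivity estimate gains a factor `t⁻¹` at each step. -/
lemma energy_decay {E D : ℕ → ℝ → ℝ} (hE : ∀ j t, 0 ≤ E j t) (hD : ∀ j t, 0 ≤ D j t)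
    (hderiv : ∀ j t, 0 < t → HasDerivAt (E j) (-2 * D j t) t)
    (hco : ∀ j t, 0 < t → E j t ^ 2 ≤ 4 * D j t * (E (j + 1) t + 2 * √(D j t * E j t)))
    (n j : ℕ) : ∃ C, ∀ t, 1 ≤ t → E j t ^ 2 * t ^ n ≤ C := by
  have hanti : ∀ j, ∀ s t, 0 < s → s ≤ t → E j t ≤ E j s := by
    intro j s t hs hst
    have := antitoneOn_of_deriv_nonpos (convex_Ioi (0 : ℝ)) (f := E j)
      (fun x hx => (hderiv j x hx).continuousAt.continuousWithinAt)
      (fun x hx => by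
        rw [interior_Ioi] at hx
        exact (hderiv j x hx).differentiableAt.differentiableWithinAt)
      (fun x hx => by
        rw [interior_Ioi] at hx
        rw [(hderiv j x hx).deriv]
        linarith [hD j x])
    exact this hs (hs.trans_le hst) hst
  induction n generalizing j with
  | zero =>
    refine ⟨E j 1 ^ 2, fun t ht => ?_⟩
    rw [pow_zero, mul_one]
    exact pow_le_pow_left₀ (hE j t) (hanti j 1 t one_pos ht) 2
  | succ n ih =>
    obtain ⟨C, hC⟩ := ih j
    obtain ⟨C', hC'⟩ := ih (j + 1)
    have hC0 : 0 ≤ C := le_trans (by have := hE j 1; positivity) (hC 1 le_rfl)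
    have hC0' : 0 ≤ C' := le_trans (by have := hE (j+1) 1; positivity) (hC' 1 le_rfl)
    refine ⟨max (E j 1 ^ 2 * 2 ^ (n + 1)) (4 * (C + C' + 2 * C) * 2 ^ n), fun t ht => ?_⟩
    rcases le_total t 2 with h2 | h2
    · refine le_max_of_le_left ?_
      gcongr
      · exact hE j t
      · exact hanti j 1 t one_pos ht
    · refine le_max_of_le_right ?_
      have ht0 : 0 < t := by linarith
      -- on `[t / 2, t]` some time `s` has dissipation at most `E j (t / 2) / t`
      obtain ⟨s, ⟨hs1, hs2⟩, hs⟩ := exists_hasDerivAt_eq_slope (E j) (fun t => -2 * D j t)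
        (show t / 2 < t by linarith)
        (fun x hx => (hderiv j x (by linarith [hx.1])).continuousAt.continuousWithinAt)
        (fun x hx => hderiv j x (by linarith [hx.1]))
      have hs0 : 0 < s := by linarith
      set A := E j (t / 2) with hA
      set A' := E (j + 1) (t / 2) with hA'
      have hA0 : 0 ≤ A := hE _ _
      have hA0' : 0 ≤ A' := hE _ _
      have hDs : D j s ≤ A / t := by
        rw [eq_div_iff (by linarith)] at hs
        rw [le_div_iff₀ ht0]
        linarith [hE j t]
      have hEs : E j s ≤ A := hanti j _ _ (by linarith) hs1.le
      have hEs' : E (j + 1) s ≤ A' := hanti (j + 1) _ _ (by linarith) hs1.le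
      have hEt : E j t ≤ E j s := hanti j _ _ hs0 hs2.le
      have hsq : √(D j s * E j s) ≤ A := by
        rw [Real.sqrt_le_left hA0]
        calc D j s * E j s ≤ A / t * A := by gcongr; exact hE _ _
          _ ≤ A / 1 * A := by gcongr
          _ = A ^ 2 := by ring
      have h1 : E j t ^ 2 ≤ 4 * (A / t) * (A' + 2 * A) := by
        calc E j t ^ 2 ≤ E j s ^ 2 := by gcongr; exact hE _ _
          _ ≤ _ := hco j s hs0
          _ ≤ _ := by
            have := hE (j + 1) s
            gcongr
      have hAn : A ^ 2 * (t / 2) ^ n ≤ C := hC _ (by linarith)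
      have hAn' : A' ^ 2 * (t / 2) ^ n ≤ C' := hC' _ (by linarith)
      have h3 : A * (A' + 2 * A) * (t / 2) ^ n ≤ C + C' + 2 * C := by
        have hp : 0 ≤ (t / 2) ^ n := by positivity
        have : A * A' ≤ A ^ 2 + A' ^ 2 := by nlinarith [sq_nonneg (A - A'), sq_nonneg A, sq_nonneg A']
        nlinarith [mul_le_mul_of_nonneg_right this hp]
      calc E j t ^ 2 * t ^ (n + 1) ≤ (4 * (A / t) * (A' + 2 * A)) * t ^ (n + 1) := by gcongr
        _ = 4 * (A * (A' + 2 * A) * (t / 2) ^ n) * 2 ^ n := by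
          rw [div_pow, pow_succ]; field_simp
        _ ≤ _ := by gcongr

/-! ### The transport equation with source `h` in frequency variables -/

/-- The damping factor `exp (-∫_0^s (x + a)² da)` along a characteristic of length `s`. -/
noncomputable def damping (s x : ℝ) : ℝ := Real.exp (-(x ^ 2 * s + x * s ^ 2 + s ^ 3 / 3))

lemma damping_pos (s x : ℝ) : 0 < damping s x := Real.exp_pos _

@[simp] lemma damping_zero (x : ℝ) : damping 0 x = 1 := by simp [damping]

@[fun_prop]
lemma continuous_damping {α : Type*} [TopologicalSpace α] {f g : α → ℝ} (hf : Continuous f)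
    (hg : Continuous g) : Continuous fun a => damping (f a) (g a) := by
  unfold damping; fun_prop

lemma damping_le {s : ℝ} (hs : 0 ≤ s) (x : ℝ) : damping s x ≤ Real.exp (-(s * x ^ 2 / 4)) := by
  rw [damping]
  gcongr
  have : x ^ 2 * s + x * s ^ 2 + s ^ 3 / 3 - s * x ^ 2 / 4 = s * (3 * (x / 2 + s / 3) ^ 2) := by ring
  have : 0 ≤ s * (3 * (x / 2 + s / 3) ^ 2) := by positivity
  linarith

lemma hasDerivAt_damping_left (s x : ℝ) :
    HasDerivAt (fun s => damping s x) (-(x + s) ^ 2 * damping s x) s := by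
  have h : HasDerivAt (fun s : ℝ => -(x ^ 2 * s + x * s ^ 2 + s ^ 3 / 3)) (-(x + s) ^ 2) s := by
    refine ((((hasDerivAt_id s).const_mul (x ^ 2)).add (((hasDerivAt_id s).pow 2).const_mul x)).add
      (((hasDerivAt_id s).pow 3).div_const 3)).neg.congr_deriv ?_
    simp; ring
  refine h.exp.congr_deriv ?_
  rw [damping]; ring

lemma hasDerivAt_damping_right (s x : ℝ) :
    HasDerivAt (fun x => damping s x) (-(2 * x * s + s ^ 2) * damping s x) x := by
  have h : HasDerivAt (fun x : ℝ => -(x ^ 2 * s + x * s ^ 2 + s ^ 3 / 3)) (-(2 * x * s + s ^ 2)) x := by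
    refine (((((hasDerivAt_id x).pow 2).mul_const s).add ((hasDerivAt_id x).mul_const (s ^ 2))).add_const
      (s ^ 3 / 3)).neg.congr_deriv ?_
    simp
  refine h.exp.congr_deriv ?_
  rw [damping]; ring

/-- The contribution of the source `h` to the solution of the damped transport equation. -/
noncomputable def duhamel (h : ℝ → ℝ) (t x : ℝ) : ℝ := ∫ s in (0 : ℝ)..t, h (t - s) * damping s x

/-- The derivative of `duhamel h t` in `x`. -/
noncomputable def duhamelDeriv (h : ℝ → ℝ) (t x : ℝ) : ℝ :=
  ∫ s in (0 : ℝ)..t, h (t - s) * (-(2 * x * s + s ^ 2) * damping s x)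

/-- The polynomials `p j` such that `p j (x + t) * damping t x` is the contribution of the initial
datum to the `j`-th time derivative of the solution. -/
noncomputable def initialPoly (h : ℝ → ℝ) : ℕ → Polynomial ℝ
  | 0 => Polynomial.C (-2) * Polynomial.X
  | j + 1 => (initialPoly h j).derivative - Polynomial.X ^ 2 * initialPoly h j
      + Polynomial.C (iteratedDeriv j h 0)

/-- The `j`-th time derivative of the solution of `∂_t f = ∂_x f - x² f + h(t)` with initial datum
`-2x`. -/
noncomputable def slice (h : ℝ → ℝ) (j : ℕ) (t x : ℝ) : ℝ :=
  (initialPoly h j).eval (x + t) * damping t x + duhamel (iteratedDeriv j h) t x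

/-- The derivative of `slice h j t` in `x`. -/
noncomputable def sliceDeriv (h : ℝ → ℝ) (j : ℕ) (t x : ℝ) : ℝ :=
  ((initialPoly h j).derivative.eval (x + t)
    - (2 * x * t + t ^ 2) * (initialPoly h j).eval (x + t)) * damping t x
    + duhamelDeriv (iteratedDeriv j h) t x

lemma hasDerivAt_duhamel_left {h : ℝ → ℝ} (hh : ContDiff ℝ 1 h) (t x : ℝ) :
    HasDerivAt (fun t => duhamel h t x) (h 0 * damping t x + duhamel (deriv h) t x) t :=
  hasDerivAt_volterra hh (by fun_prop) t

lemma hasDerivAt_duhamel_right {h : ℝ → ℝ} (hh : Continuous h) (t x : ℝ) :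
    HasDerivAt (fun x => duhamel h t x) (duhamelDeriv h t x) x := by
  apply hasDerivAt_intervalIntegral_of_continuous (F := fun x s => h (t - s) * damping s x)
    (F' := fun x s => h (t - s) * (-(2 * x * s + s ^ 2) * damping s x))
  · unfold Function.uncurry; fun_prop
  · unfold Function.uncurry; fun_prop
  · intro x s
    exact (hasDerivAt_damping_right s x).const_mul _

lemma continuous_duhamelDeriv {h : ℝ → ℝ} (hh : Continuous h) (t : ℝ) :
    Continuous (duhamelDeriv h t) := by
  apply intervalIntegral.continuous_parametric_intervalIntegral_of_continuous'
  unfold Function.uncurry; fun_prop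

lemma duhamel_transport {h : ℝ → ℝ} (hh : ContDiff ℝ 1 h) (t x : ℝ) :
    h 0 * damping t x + duhamel (deriv h) t x
      = duhamelDeriv h t x - x ^ 2 * duhamel h t x + h t := by
  have hc := hh.continuous
  have hd : Continuous (deriv h) := hh.continuous_deriv le_rfl
  have h1 : ∫ s in (0 : ℝ)..t, (-(deriv h (t - s) * damping s x)
      + h (t - s) * (-(x + s) ^ 2 * damping s x)) = h 0 * damping t x - h t := by
    rw [intervalIntegral.integral_eq_sub_of_hasDerivAt
      (f := fun s => h (t - s) * damping s x)]
    · simp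
    · intro s _
      have := ((hh.differentiable one_ne_zero (t - s)).hasDerivAt.comp_const_sub t s).mul
        (hasDerivAt_damping_left s x)
      refine this.congr_deriv ?_
      ring
    · exact Continuous.intervalIntegrable (by fun_prop) _ _
  have h2 : duhamelDeriv h t x - x ^ 2 * duhamel h t x
      = ∫ s in (0 : ℝ)..t, h (t - s) * (-(x + s) ^ 2 * damping s x) := by
    rw [duhamelDeriv, duhamel, ← intervalIntegral.integral_const_mul,
      ← intervalIntegral.integral_sub]
    · congr 1; ext s; ring
    · exact Continuous.intervalIntegrable (by fun_prop) _ _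
    · exact Continuous.intervalIntegrable (by fun_prop) _ _
  rw [intervalIntegral.integral_add] at h1
  · rw [intervalIntegral.integral_neg] at h1
    rw [h2, duhamel]
    linarith
  · exact Continuous.intervalIntegrable (by fun_prop) _ _
  · exact Continuous.intervalIntegrable (by fun_prop) _ _

section

variable {h : ℝ → ℝ}

lemma contDiff_iteratedDeriv (hh : ContDiff ℝ ∞ h) (j : ℕ) : ContDiff ℝ ∞ (iteratedDeriv j h) := by
  rw [iteratedDeriv_eq_iterate]
  exact hh.iterate_deriv j

lemma hasDerivAt_slice_time (hh : ContDiff ℝ ∞ h) (j : ℕ) (t x : ℝ) :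
    HasDerivAt (fun t => slice h j t x) (slice h (j + 1) t x) t := by
  have h1 := contDiff_iteratedDeriv hh j
  have hp : HasDerivAt (fun t => (initialPoly h j).eval (x + t))
      ((initialPoly h j).derivative.eval (x + t)) t :=
    ((initialPoly h j).hasDerivAt (x + t)).comp_const_add x t
  refine ((hp.mul (hasDerivAt_damping_left t x)).add
    (hasDerivAt_duhamel_left (h1.of_le (by exact_mod_cast le_top)) t x)).congr_deriv ?_
  rw [slice, iteratedDeriv_succ, initialPoly]
  simp only [Polynomial.eval_add, Polynomial.eval_sub, Polynomial.eval_mul, Polynomial.eval_pow,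
    Polynomial.eval_X, Polynomial.eval_C]
  ring

lemma hasDerivAt_slice_space (hh : ContDiff ℝ ∞ h) (j : ℕ) (t x : ℝ) :
    HasDerivAt (fun x => slice h j t x) (sliceDeriv h j t x) x := by
  have h1 := contDiff_iteratedDeriv hh j
  have hp : HasDerivAt (fun x => (initialPoly h j).eval (x + t))
      ((initialPoly h j).derivative.eval (x + t)) x :=
    ((initialPoly h j).hasDerivAt (x + t)).comp_add_const x t
  refine ((hp.mul (hasDerivAt_damping_right t x)).add
    (hasDerivAt_duhamel_right h1.continuous t x)).congr_deriv ?_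
  rw [sliceDeriv]
  ring

lemma slice_transport (hh : ContDiff ℝ ∞ h) (j : ℕ) (t x : ℝ) :
    slice h (j + 1) t x = sliceDeriv h j t x - x ^ 2 * slice h j t x + iteratedDeriv j h t := by
  have h1 := duhamel_transport ((contDiff_iteratedDeriv hh j).of_le (by exact_mod_cast le_top)) t x
  rw [← iteratedDeriv_succ] at h1
  rw [slice, sliceDeriv, slice, initialPoly]
  simp only [Polynomial.eval_add, Polynomial.eval_sub, Polynomial.eval_mul, Polynomial.eval_pow,
    Polynomial.eval_X, Polynomial.eval_C]
  linear_combination h1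

lemma continuous_sliceDeriv (hh : ContDiff ℝ ∞ h) (j : ℕ) (t : ℝ) :
    Continuous (sliceDeriv h j t) := by
  have h1 := continuous_duhamelDeriv (contDiff_iteratedDeriv hh j).continuous t
  have h3 : ∀ p : Polynomial ℝ, Continuous fun x : ℝ => p.eval (x + t) := fun p =>
    p.continuous.comp (by fun_prop)
  have h4 := h3 (initialPoly h j)
  have h5 := h3 (initialPoly h j).derivative
  unfold sliceDeriv
  fun_prop

end

/-! ### Bounds on the slices -/

lemma one_add_sq_mul_integral_exp_le {t c : ℝ} (ht : 0 ≤ t) (hc : 0 < c) (x : ℝ) :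
    (1 + x ^ 2) * ∫ s in (0 : ℝ)..t, Real.exp (-(s * (c * x ^ 2))) ≤ t + 1 / c := by
  have h1 : ∫ s in (0 : ℝ)..t, Real.exp (-(s * (c * x ^ 2))) ≤ t := by
    have : ∫ s in (0 : ℝ)..t, Real.exp (-(s * (c * x ^ 2))) ≤ ∫ s in (0 : ℝ)..t, (1 : ℝ) := by
      apply intervalIntegral.integral_mono_on ht
      · exact Continuous.intervalIntegrable (by fun_prop) _ _
      · exact intervalIntegrable_const
      · intro s hs
        rw [Real.exp_le_one_iff]
        have := hs.1
        have : 0 ≤ s * (c * x ^ 2) := by positivity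
        linarith
    simpa using this
  have h2 : ∫ s in (0 : ℝ)..t, (c * x ^ 2) * Real.exp (-(s * (c * x ^ 2)))
      = 1 - Real.exp (-(t * (c * x ^ 2))) := by
    rw [intervalIntegral.integral_eq_sub_of_hasDerivAt
      (f := fun s => -Real.exp (-(s * (c * x ^ 2))))]
    · simp; ring
    · intro s _
      refine ((hasDerivAt_id s).mul_const (c * x ^ 2)).neg.exp.neg.congr_deriv ?_
      simp; ring
    · exact Continuous.intervalIntegrable (by fun_prop) _ _
  rw [intervalIntegral.integral_const_mul] at h2
  have h3 := Real.exp_pos (-(t * (c * x ^ 2)))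
  have h4 : x ^ 2 * ∫ s in (0 : ℝ)..t, Real.exp (-(s * (c * x ^ 2))) ≤ 1 / c := by
    rw [le_div_iff₀ hc]; linarith
  linarith

lemma exists_pow_mul_exp_le (n : ℕ) {c : ℝ} (hc : 0 < c) :
    ∃ C, ∀ x : ℝ, (1 + |x|) ^ n * Real.exp (-(c * x ^ 2)) ≤ C := by
  refine ⟨2 ^ n * ((n.factorial : ℝ) / c ^ n * Real.exp c), fun x => ?_⟩
  have h1 : (1 + |x|) ^ n ≤ 2 ^ n * (1 + x ^ 2) ^ n := by
    rw [← mul_pow]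
    gcongr
    nlinarith [abs_nonneg x, sq_abs x, sq_nonneg (|x| - 1)]
  have h2 := Real.pow_div_factorial_le_exp (x := c * (1 + x ^ 2)) (by positivity) n
  rw [div_le_iff₀ (by positivity), mul_pow] at h2
  have h3 : (1 + x ^ 2) ^ n ≤ (n.factorial : ℝ) / c ^ n * Real.exp (c * (1 + x ^ 2)) := by
    rw [div_mul_eq_mul_div, le_div_iff₀ (by positivity)]
    linarith
  calc (1 + |x|) ^ n * Real.exp (-(c * x ^ 2))
      ≤ (2 ^ n * ((n.factorial : ℝ) / c ^ n * Real.exp (c * (1 + x ^ 2))))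
        * Real.exp (-(c * x ^ 2)) := by
        gcongr
        exact h1.trans (by gcongr)
    _ = 2 ^ n * ((n.factorial : ℝ) / c ^ n * Real.exp c) := by
        rw [show c * (1 + x ^ 2) = c + c * x ^ 2 by ring, Real.exp_add, Real.exp_neg]
        field_simp

lemma exists_abs_eval_le (p : Polynomial ℝ) :
    ∃ C, 0 ≤ C ∧ ∀ x : ℝ, |p.eval x| ≤ C * (1 + |x|) ^ p.natDegree := by
  refine ⟨∑ i ∈ Finset.range (p.natDegree + 1), |p.coeff i|, Finset.sum_nonneg fun _ _ => abs_nonneg _,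
    fun x => ?_⟩
  rw [Polynomial.eval_eq_sum_range, Finset.sum_mul]
  refine (Finset.abs_sum_le_sum_abs _ _).trans (Finset.sum_le_sum fun i hi => ?_)
  rw [abs_mul, abs_pow]
  have hx := abs_nonneg x
  gcongr
  calc |x| ^ i ≤ (1 + |x|) ^ i := by gcongr; linarith
    _ ≤ _ := by
      apply pow_le_pow_right₀ (by linarith)
      have := Finset.mem_range.mp hi
      omega

lemma exists_poly_damping_le (p : Polynomial ℝ) (k : ℕ) {a b : ℝ} (ha : 0 < a) (hab : a ≤ b) :
    ∃ C, ∀ t ∈ Icc a b, ∀ x : ℝ, (1 + |x|) ^ k * |p.eval (x + t)| * damping t x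
      ≤ C / (1 + x ^ 2) := by
  obtain ⟨C1, hC1, hp⟩ := exists_abs_eval_le p
  obtain ⟨C2, hC2⟩ := exists_pow_mul_exp_le (k + p.natDegree + 2) (c := a / 4) (by positivity)
  refine ⟨C1 * (1 + b) ^ p.natDegree * C2, fun t ht x => ?_⟩
  have hx := abs_nonneg x
  have ht0 : 0 < t := ha.trans_le ht.1
  have h1 : 1 + |x + t| ≤ (1 + b) * (1 + |x|) := by
    have := abs_add_le x t
    rw [abs_of_pos ht0] at this
    nlinarith [ht.2]
  have h2 : damping t x ≤ Real.exp (-(a / 4 * x ^ 2)) := by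
    refine (damping_le ht0.le x).trans ?_
    gcongr
    have := mul_le_mul_of_nonneg_right ht.1 (sq_nonneg x)
    linarith
  have h3 : 1 + x ^ 2 ≤ (1 + |x|) ^ 2 := by rw [← sq_abs x]; nlinarith
  have hb : 0 < 1 + b := by linarith
  rw [le_div_iff₀ (by positivity)]
  calc (1 + |x|) ^ k * |p.eval (x + t)| * damping t x * (1 + x ^ 2)
      ≤ (1 + |x|) ^ k * (C1 * ((1 + b) * (1 + |x|)) ^ p.natDegree) * Real.exp (-(a / 4 * x ^ 2))
        * (1 + |x|) ^ 2 := by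
        have := (damping_pos t x).le
        gcongr
        refine (hp _).trans ?_
        gcongr
    _ = C1 * (1 + b) ^ p.natDegree *
        ((1 + |x|) ^ (k + p.natDegree + 2) * Real.exp (-(a / 4 * x ^ 2))) := by
        rw [mul_pow]; ring
    _ ≤ _ := by gcongr; exact hC2 x

lemma exists_duhamel_le {h : ℝ → ℝ} (hh : Continuous h) (b : ℝ) :
    ∃ C, ∀ t ∈ Icc 0 b, ∀ x : ℝ, |duhamel h t x| ≤ C / (1 + x ^ 2) ∧
      |duhamelDeriv h t x| ≤ C / (1 + x ^ 2) := by
  obtain ⟨M, hM⟩ := (isCompact_Icc (a := 0) (b := b)).exists_bound_of_continuousOn hh.continuousOn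
  have hMs : ∀ t ∈ Icc 0 b, ∀ s ∈ Ioc 0 t, |h (t - s)| ≤ M := fun t ht s hs =>
    hM _ ⟨by linarith [hs.2], by linarith [hs.1, ht.2]⟩
  have key : ∀ t ∈ Icc 0 b, ∀ (x K c : ℝ) (q : ℝ → ℝ), 0 < c → 0 ≤ K → Continuous q →
      (∀ s ∈ Ioc 0 t, |q s| ≤ K * Real.exp (-(s * (c * x ^ 2)))) →
      |∫ s in (0 : ℝ)..t, h (t - s) * q s| ≤ M * K * (b + 1 / c) / (1 + x ^ 2) := by
    intro t ht x K c q hc hK hq hqb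
    have hM0 : 0 ≤ M := (norm_nonneg _).trans (hM t ht)
    have h1 := one_add_sq_mul_integral_exp_le ht.1 hc x
    have hx : 0 < 1 + x ^ 2 := by positivity
    calc _ ≤ ∫ s in (0 : ℝ)..t, M * K * Real.exp (-(s * (c * x ^ 2))) := by
          rw [← Real.norm_eq_abs]
          apply intervalIntegral.norm_integral_le_of_norm_le ht.1
          · refine Eventually.of_forall fun s hs => ?_
            rw [Real.norm_eq_abs, abs_mul, mul_assoc]
            gcongr
            exacts [hMs t ht s hs, hqb s hs]
          · exact Continuous.intervalIntegrable (by fun_prop) _ _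
      _ = M * K * ∫ s in (0 : ℝ)..t, Real.exp (-(s * (c * x ^ 2))) :=
          intervalIntegral.integral_const_mul _ _
      _ ≤ M * K * ((t + 1 / c) / (1 + x ^ 2)) := by
          gcongr
          rw [le_div_iff₀ hx]; linarith
      _ ≤ M * K * ((b + 1 / c) / (1 + x ^ 2)) := by
          gcongr; exact ht.2
      _ = _ := by ring
  refine ⟨max (M * 1 * (b + 1 / (1 / 4))) (M * (8 + b + b ^ 2) * (b + 1 / (1 / 8))),
    fun t ht x => ⟨?_, ?_⟩⟩
  · refine (key t ht x 1 (1 / 4) (fun s => damping s x) (by norm_num) zero_le_one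
      (by fun_prop) fun s hs => ?_).trans
      (by gcongr; exact le_max_left _ _)
    rw [abs_of_pos (damping_pos _ _), one_mul]
    refine (damping_le hs.1.le x).trans (le_of_eq ?_)
    congr 1; ring
  · have hb : 0 ≤ b := ht.1.trans ht.2
    refine (key t ht x (8 + b + b ^ 2) (1 / 8) (fun s => -(2 * x * s + s ^ 2) * damping s x)
      (by norm_num) (by positivity) ?_ fun s hs => ?_).trans
      (by gcongr; exact le_max_right _ _)
    · fun_prop
    · have hs0 := hs.1
      have hsb : s ≤ b := hs.2.trans ht.2
      have e1 : |-(2 * x * s + s ^ 2)| ≤ s * x ^ 2 + b + b ^ 2 := by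
        rw [abs_neg, abs_le]
        constructor <;> nlinarith [mul_nonneg hs0.le (sq_nonneg (x - 1)),
          mul_nonneg hs0.le (sq_nonneg (x + 1))]
      have e2 : s * x ^ 2 ≤ 8 * Real.exp (s * (1 / 8 * x ^ 2)) := by
        linarith [Real.add_one_le_exp (s * (1 / 8 * x ^ 2))]
      have e3 : 1 ≤ Real.exp (s * (1 / 8 * x ^ 2)) := Real.one_le_exp (by positivity)
      rw [abs_mul, abs_of_pos (damping_pos _ _)]
      calc _ ≤ (s * x ^ 2 + b + b ^ 2) * Real.exp (-(s * x ^ 2 / 4)) := by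
            gcongr
            · exact (damping_pos _ _).le
            · exact damping_le hs0.le x
        _ ≤ ((8 + b + b ^ 2) * Real.exp (s * (1 / 8 * x ^ 2))) * Real.exp (-(s * x ^ 2 / 4)) := by
            gcongr
            nlinarith [sq_nonneg b]
        _ = _ := by
            rw [mul_assoc, ← Real.exp_add]
            congr 2; ring

/-! ### The constraint and the convolution equation -/

lemma damping_eq_gaussian (s x : ℝ) :
    damping s x = Real.exp (-s * (x + s / 2) ^ 2) * Real.exp (-s ^ 3 / 12) := by
  rw [damping, ← Real.exp_add]; congr 1; ring

lemma integrable_damping {s : ℝ} (hs : 0 < s) : Integrable (damping s) := by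
  have := ((integrable_exp_neg_mul_sq hs).comp_add_right (s / 2)).mul_const (Real.exp (-s ^ 3 / 12))
  exact this.congr (Eventually.of_forall fun x => (damping_eq_gaussian s x).symm)

lemma integral_damping (s : ℝ) :
    ∫ x, damping s x = √(Real.pi / s) * Real.exp (-s ^ 3 / 12) := by
  simp_rw [damping_eq_gaussian]
  rw [integral_mul_const, integral_add_right_eq_self (fun x => Real.exp (-s * x ^ 2)),
    integral_gaussian]

lemma integral_initial {t : ℝ} (ht : 0 < t) :
    ∫ x, (-2 * (x + t)) * damping t x = -t * (√(Real.pi / t) * Real.exp (-t ^ 3 / 12)) := by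
  obtain ⟨C, hC⟩ := exists_poly_damping_le (Polynomial.C (-2) * Polynomial.X) 0 ht le_rfl
  have hi : Integrable fun x => (-2 * (x + t)) * damping t x := by
    apply integrable_of_le_inv (C := C) (by fun_prop)
    intro x
    have := hC t ⟨le_rfl, le_rfl⟩ x
    rw [abs_mul, abs_of_pos (damping_pos t x)]
    simpa using this
  have h1 : ∫ x, (-(2 * x * t + t ^ 2) * damping t x) = 0 := by
    apply integral_eq_zero_of_hasDerivAt_of_integrable (f := damping t)
      (hasDerivAt_damping_right t) _ (integrable_damping ht)
    have := (hi.const_mul t).add ((integrable_damping ht).const_mul (t ^ 2))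
    refine this.congr (Eventually.of_forall fun x => ?_)
    simp only [Pi.add_apply]; ring
  have h2 : ∀ x, (-2 * (x + t)) * damping t x
      = t⁻¹ * (-(2 * x * t + t ^ 2) * damping t x) + (-t) * damping t x := by
    intro x; field_simp; ring
  have hi' : Integrable fun x => t⁻¹ * (-(2 * x * t + t ^ 2) * damping t x) := by
    have := hi.sub ((integrable_damping ht).const_mul (-t))
    refine this.congr (Eventually.of_forall fun x => ?_)
    simp only [Pi.sub_apply, h2]; ring
  simp_rw [h2]
  rw [integral_add hi' ((integrable_damping ht).const_mul _), integral_const_mul,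
    integral_const_mul, h1, integral_damping]
  ring

lemma integral_duhamel {h : ℝ → ℝ} (hh : Continuous h) {t : ℝ} (ht : 0 < t) :
    ∫ x, duhamel h t x
      = √Real.pi * ∫ s in (0 : ℝ)..t, (t - s) ^ (-(1 / 2) : ℝ) * Real.exp (-(t - s) ^ 3 / 12) * h s := by
  obtain ⟨M, hM⟩ := (isCompact_Icc (a := 0) (b := t)).exists_bound_of_continuousOn hh.continuousOn
  have hprod : Integrable (Function.uncurry fun x s => h (t - s) * damping s x)
      (volume.prod (volume.restrict (Ioc 0 t))) := by
    rw [integrable_prod_iff' (by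
      apply Continuous.aestronglyMeasurable; unfold Function.uncurry; fun_prop)]
    constructor
    · rw [ae_restrict_iff' measurableSet_Ioc]
      exact Eventually.of_forall fun s hs => (integrable_damping hs.1).const_mul (h (t - s))
    · have hint : IntegrableOn (fun s : ℝ => M * (√Real.pi * s ^ (-(1 / 2) : ℝ))) (Ioc 0 t) := by
        have := (intervalIntegral.intervalIntegrable_rpow' (a := 0) (b := t)
          (r := (-(1 / 2) : ℝ)) (by norm_num))
        rw [intervalIntegrable_iff_integrableOn_Ioc_of_le ht.le] at this
        exact (this.const_mul _).const_mul _
      refine hint.mono' ?_ ?_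
      · refine (StronglyMeasurable.integral_prod_left (f := fun x s => ‖h (t - s) * damping s x‖)
          (Continuous.stronglyMeasurable ?_)).aestronglyMeasurable
        unfold Function.uncurry; fun_prop
      · rw [ae_restrict_iff' measurableSet_Ioc]
        refine Eventually.of_forall fun s hs => ?_
        have e : ∀ x, ‖Function.uncurry (fun x s => h (t - s) * damping s x) (x, s)‖
            = |h (t - s)| * damping s x := fun x => by
          simp [Function.uncurry, abs_of_pos (damping_pos s x)]
        simp_rw [e]
        rw [integral_const_mul, integral_damping, Real.norm_eq_abs,
          abs_of_nonneg (by positivity), Real.sqrt_div Real.pi_pos.le, div_eq_mul_inv]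
        have e2 : s ^ (-(1 / 2) : ℝ) = (√s)⁻¹ := by
          rw [Real.rpow_neg hs.1.le, Real.sqrt_eq_rpow]
        rw [e2]
        have e3 : Real.exp (-s ^ 3 / 12) ≤ 1 := by
          rw [Real.exp_le_one_iff]
          have : 0 < s ^ 3 := pow_pos hs.1 3
          linarith
        have e4 := hM (t - s) ⟨by linarith [hs.2], by linarith [hs.1]⟩
        rw [Real.norm_eq_abs] at e4
        calc _ ≤ M * (√Real.pi * (√s)⁻¹ * 1) := by
              have := (abs_nonneg _).trans e4
              gcongr
          _ = _ := by ring
  have h1 : ∫ x, duhamel h t x = ∫ s in Ioc 0 t, ∫ x, h (t - s) * damping s x := by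
    simp_rw [duhamel, intervalIntegral.integral_of_le ht.le]
    exact integral_integral_swap hprod
  rw [h1, ← intervalIntegral.integral_of_le ht.le]
  have h2 := intervalIntegral.integral_comp_sub_left (a := 0) (b := t)
    (fun s => ∫ x, h s * damping (t - s) x) t
  simp only [sub_sub_cancel, sub_self, sub_zero] at h2
  rw [h2, ← intervalIntegral.integral_const_mul]
  apply intervalIntegral.integral_congr
  intro s hs
  rw [uIcc_of_le ht.le] at hs
  simp only
  rw [integral_const_mul, integral_damping, Real.sqrt_div Real.pi_pos.le, div_eq_mul_inv,
    Real.rpow_neg (by linarith [hs.2]), Real.sqrt_eq_rpow (t - s)]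
  ring

/-! ### Rapid decay of the boundary datum -/

section

variable {h : ℝ → ℝ}

lemma exists_slice_le (hh : ContDiff ℝ ∞ h) (j : ℕ) {a b : ℝ} (ha : 0 < a) (hab : a ≤ b) :
    ∃ C, ∀ t ∈ Icc a b, ∀ x : ℝ, |slice h j t x| ≤ C / (1 + x ^ 2) ∧
      |sliceDeriv h j t x| ≤ C / (1 + x ^ 2) := by
  obtain ⟨C1, h1⟩ := exists_poly_damping_le (initialPoly h j) 2 ha hab
  obtain ⟨C2, h2⟩ := exists_poly_damping_le (initialPoly h j).derivative 0 ha hab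
  obtain ⟨C3, h3⟩ := exists_duhamel_le (contDiff_iteratedDeriv hh j).continuous b
  have hb : 0 < b := ha.trans_le hab
  refine ⟨max (C1 + C3) (C2 + (2 * b + b ^ 2) * C1 + C3), fun t ht x => ?_⟩
  have ht0 : 0 < t := ha.trans_le ht.1
  have hx := abs_nonneg x
  obtain ⟨h3a, h3b⟩ := h3 t ⟨ht0.le, ht.2⟩ x
  have h1' := h1 t ht x
  have h2' := h2 t ht x
  have hd := (damping_pos t x).le
  have hxx : 0 < 1 + x ^ 2 := by positivity
  rw [pow_zero, one_mul] at h2'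
  set P := (initialPoly h j).eval (x + t)
  set P' := (initialPoly h j).derivative.eval (x + t)
  constructor
  · have e1 : |P * damping t x| ≤ C1 / (1 + x ^ 2) := by
      rw [abs_mul, abs_of_nonneg hd]
      refine le_trans ?_ h1'
      gcongr
      nlinarith [abs_nonneg P, mul_nonneg hx (abs_nonneg P)]
    calc _ ≤ C1 / (1 + x ^ 2) + C3 / (1 + x ^ 2) := (abs_add_le _ _).trans (add_le_add e1 h3a)
      _ = (C1 + C3) / (1 + x ^ 2) := by ring
      _ ≤ _ := by gcongr; exact le_max_left _ _
  · have e1 : |(2 * x * t + t ^ 2) * P * damping t x| ≤ (2 * b + b ^ 2) * (C1 / (1 + x ^ 2)) := by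
      rw [abs_mul, abs_mul, abs_of_nonneg hd]
      have e2 : |2 * x * t + t ^ 2| ≤ (2 * b + b ^ 2) * (1 + |x|) ^ 2 := by
        refine (abs_add_le _ _).trans ?_
        rw [abs_mul, abs_mul, abs_of_pos ht0, abs_of_pos (by positivity : 0 < t ^ 2), abs_two]
        have := ht.2
        have e3 : |x| * t ≤ |x| * b := by gcongr
        have e4 : t ^ 2 ≤ b ^ 2 := by gcongr
        nlinarith [mul_nonneg hb.le hx, mul_nonneg (sq_nonneg b) hx, mul_nonneg hb.le (sq_nonneg |x|),
          mul_nonneg (sq_nonneg b) (sq_nonneg |x|)]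
      calc _ ≤ ((2 * b + b ^ 2) * (1 + |x|) ^ 2) * |P| * damping t x := by gcongr
        _ = (2 * b + b ^ 2) * ((1 + |x|) ^ 2 * |P| * damping t x) := by ring
        _ ≤ _ := by gcongr
    have e2 : |P' * damping t x| ≤ C2 / (1 + x ^ 2) := by
      rw [abs_mul, abs_of_nonneg hd]; exact h2'
    calc |(P' - (2 * x * t + t ^ 2) * P) * damping t x + duhamelDeriv (iteratedDeriv j h) t x|
        ≤ C2 / (1 + x ^ 2) + (2 * b + b ^ 2) * (C1 / (1 + x ^ 2)) + C3 / (1 + x ^ 2) := by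
          refine (abs_add_le _ _).trans (add_le_add ?_ h3b)
          rw [sub_mul]
          exact (abs_sub _ _).trans (add_le_add e2 e1)
      _ = (C2 + (2 * b + b ^ 2) * C1 + C3) / (1 + x ^ 2) := by ring
      _ ≤ _ := by gcongr; exact le_max_right _ _

lemma continuous_slice (hh : ContDiff ℝ ∞ h) (j : ℕ) (t : ℝ) : Continuous (slice h j t) :=
  continuous_iff_continuousAt.mpr fun x => (hasDerivAt_slice_space hh j t x).continuousAt

lemma integrable_slice (hh : ContDiff ℝ ∞ h) (j : ℕ) {t : ℝ} (ht : 0 < t) :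
    Integrable (slice h j t) := by
  obtain ⟨C, hC⟩ := exists_slice_le hh j ht le_rfl
  exact integrable_of_le_inv (continuous_slice hh j t) fun x => (hC t ⟨le_rfl, le_rfl⟩ x).1

/-- The convolution equation, real form. -/
def SolvesRealVolterra (h : ℝ → ℝ) : Prop :=
  ∀ t : ℝ, 0 < t → ∫ s in (0 : ℝ)..t, (t - s) ^ (-(1 / 2) : ℝ) * Real.exp (-(t - s) ^ 3 / 12) * h s
    = t ^ (1 / 2 : ℝ) * Real.exp (-t ^ 3 / 12)

/-- The convolution equation says that all time slices have vanishing integral. -/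
lemma integral_slice (hh : ContDiff ℝ ∞ h) (hV : SolvesRealVolterra h) (j : ℕ) {t : ℝ}
    (ht : 0 < t) : ∫ x, slice h j t x = 0 := by
  induction j generalizing t with
  | zero =>
    have e : ∀ x, slice h 0 t x = -2 * (x + t) * damping t x + duhamel h t x := fun x => by
      simp [slice, initialPoly]
    obtain ⟨C, hC⟩ := exists_duhamel_le hh.continuous t
    have hi : Integrable (duhamel h t) := integrable_of_le_inv
      (continuous_iff_continuousAt.mpr fun x =>
        (hasDerivAt_duhamel_right hh.continuous t x).continuousAt)
      fun x => (hC t ⟨ht.le, le_rfl⟩ x).1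
    have hi2 : Integrable fun x => -2 * (x + t) * damping t x := by
      refine ((integrable_slice hh 0 ht).sub hi).congr (Eventually.of_forall fun x => ?_)
      simp [e]
    simp_rw [e]
    rw [integral_add hi2 hi, integral_initial ht, integral_duhamel hh.continuous ht, hV t ht,
      Real.sqrt_div Real.pi_pos.le, ← Real.sqrt_eq_rpow]
    have : √t ≠ 0 := (Real.sqrt_pos.mpr ht).ne'
    field_simp
    rw [Real.sq_sqrt ht.le]
    ring
  | succ j ih =>
    obtain ⟨C, hC⟩ := exists_slice_le hh (j + 1) (half_pos ht) (show t / 2 ≤ 2 * t by linarith)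
    have h1 := (hasDerivAt_integral_of_dominated_loc_of_deriv_le (μ := volume)
      (F := fun t x => slice h j t x) (F' := fun t x => slice h (j + 1) t x) (x₀ := t)
      (bound := fun x => C / (1 + x ^ 2)) (Icc_mem_nhds (show t / 2 < t by linarith)
        (show t < 2 * t by linarith))
      (Eventually.of_forall fun s => (continuous_slice hh j s).aestronglyMeasurable)
      (integrable_slice hh j ht) (continuous_slice hh (j + 1) t).aestronglyMeasurable
      (Eventually.of_forall fun x s hs => (hC s hs x).1)
      (by simpa [div_eq_mul_inv] using integrable_inv_one_add_sq.const_mul C)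
      (Eventually.of_forall fun x s _ => hasDerivAt_slice_time hh j s x)).2
    have h2 : (fun s => ∫ x, slice h j s x) =ᶠ[𝓝 t] fun _ => 0 := by
      filter_upwards [lt_mem_nhds ht] with s hs using ih hs
    exact h1.unique ((hasDerivAt_const t (0 : ℝ)).congr_of_eventuallyEq h2)

lemma isDampedSlice_slice (hh : ContDiff ℝ ∞ h) (hV : SolvesRealVolterra h) (j : ℕ) {t : ℝ}
    (ht : 0 < t) : ∃ C, IsDampedSlice C (slice h j t) (sliceDeriv h j t) (slice h (j + 1) t)
      (iteratedDeriv j h t) := by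
  obtain ⟨C, hC⟩ := exists_slice_le hh j ht le_rfl
  obtain ⟨C', hC'⟩ := exists_slice_le hh (j + 1) ht le_rfl
  have ht' : t ∈ Icc t t := ⟨le_rfl, le_rfl⟩
  exact ⟨max C C', hasDerivAt_slice_space hh j t, continuous_sliceDeriv hh j t,
    slice_transport hh j t,
    fun x => ((hC t ht' x).1).trans (by gcongr; exact le_max_left _ _),
    fun x => ((hC t ht' x).2).trans (by gcongr; exact le_max_left _ _),
    fun x => ((hC' t ht' x).1).trans (by gcongr; exact le_max_right _ _),
    integral_slice hh hV j ht⟩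

/-- The time derivative of a slice is the next slice, so the dissipation identity gives the
derivative of the energy. -/
lemma hasDerivAt_energy (hh : ContDiff ℝ ∞ h) (hV : SolvesRealVolterra h) (j : ℕ) {t : ℝ}
    (ht : 0 < t) : HasDerivAt (fun t => ∫ x, slice h j t x ^ 2)
      (-2 * ∫ x, (x * slice h j t x) ^ 2) t := by
  obtain ⟨C, hC⟩ := exists_slice_le hh j (half_pos ht) (show t / 2 ≤ 2 * t by linarith)
  obtain ⟨C', hC'⟩ := exists_slice_le hh (j + 1) (half_pos ht) (show t / 2 ≤ 2 * t by linarith)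
  obtain ⟨K, hK⟩ := isDampedSlice_slice hh hV j ht
  have hcs := fun j s => continuous_slice hh j s
  have hC0 : 0 ≤ C := by
    have := (abs_nonneg _).trans (hC t ⟨by linarith, by linarith⟩ 0).1; simpa using this
  have hC0' : 0 ≤ C' := by
    have := (abs_nonneg _).trans (hC' t ⟨by linarith, by linarith⟩ 0).1; simpa using this
  have h1 := (hasDerivAt_integral_of_dominated_loc_of_deriv_le (μ := volume)
      (F := fun t x => slice h j t x ^ 2) (x₀ := t)
      (F' := fun t x => 2 * (slice h j t x * slice h (j + 1) t x))
      (bound := fun x => (2 * C * C') * (1 + x ^ 2)⁻¹) (Icc_mem_nhds (show t / 2 < t by linarith)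
        (show t < 2 * t by linarith))
      (Eventually.of_forall fun s => ((hcs j s).pow 2).aestronglyMeasurable)
      hK.integrable_sq (by have := hcs j t; have := hcs (j + 1) t
                           exact Continuous.aestronglyMeasurable (by fun_prop))
      (Eventually.of_forall fun x s hs => ?_)
      (integrable_inv_one_add_sq.const_mul _)
      (Eventually.of_forall fun x s _ => ?_)).2
  · refine h1.congr_deriv ?_
    rw [integral_const_mul, hK.integral_mul_r]
    ring
  · rw [Real.norm_eq_abs, abs_mul, abs_mul, abs_two]
    have a1 := (hC s hs x).1
    have a2 := (hC' s hs x).1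
    have hx : 1 ≤ 1 + x ^ 2 := by nlinarith [sq_nonneg x]
    calc _ ≤ 2 * (C / (1 + x ^ 2) * (C' / (1 + x ^ 2))) := by gcongr
      _ ≤ 2 * (C / (1 + x ^ 2) * (C' / 1)) := by gcongr
      _ = _ := by rw [div_one]; ring
  · refine ((hasDerivAt_slice_time hh j s x).pow 2).congr_deriv ?_
    push_cast; ring

/-- A smooth solution of the convolution equation decays rapidly, with all its derivatives. -/
lemma iteratedDeriv_rapid_decay (hh : ContDiff ℝ ∞ h) (hV : SolvesRealVolterra h) (n j : ℕ) :
    ∃ C, ∀ t, 1 ≤ t → t ^ n * |iteratedDeriv j h t| ≤ C := by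
  obtain ⟨K, hK0, hK⟩ := IsDampedSlice.exists_abs_force_le
  have hE := energy_decay (E := fun j t => ∫ x, slice h j t x ^ 2)
    (D := fun j t => ∫ x, (x * slice h j t x) ^ 2)
    (fun j t => integral_nonneg fun x => sq_nonneg _)
    (fun j t => integral_nonneg fun x => sq_nonneg _)
    (fun j t ht => hasDerivAt_energy hh hV j ht)
    (fun j t ht => (isDampedSlice_slice hh hV j ht).choose_spec.coercivity)
  have hs : ∀ j, ∃ C, ∀ t, 1 ≤ t → t ^ n * √(∫ x, slice h j t x ^ 2) ≤ C := by
    intro j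
    obtain ⟨C, hC⟩ := hE (4 * n) j
    refine ⟨√(√C), fun t ht => ?_⟩
    have ht0 : 0 ≤ t := by linarith
    have hI : 0 ≤ ∫ x, slice h j t x ^ 2 := integral_nonneg fun x => sq_nonneg _
    apply Real.le_sqrt_of_sq_le
    apply Real.le_sqrt_of_sq_le
    refine le_trans (le_of_eq ?_) (hC t ht)
    rw [mul_pow, mul_pow, Real.sq_sqrt hI]
    ring
  obtain ⟨C1, hC1⟩ := hs j
  obtain ⟨C2, hC2⟩ := hs (j + 1)
  refine ⟨K * (C2 + C1), fun t ht => ?_⟩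
  have ht0 : 0 < t := by linarith
  have := hK (isDampedSlice_slice hh hV j ht0).choose_spec
  calc _ ≤ t ^ n * (K * (√(∫ x, slice h (j + 1) t x ^ 2) + √(∫ x, slice h j t x ^ 2))) := by gcongr
    _ = K * (t ^ n * √(∫ x, slice h (j + 1) t x ^ 2) + t ^ n * √(∫ x, slice h j t x ^ 2)) := by ring
    _ ≤ _ := by
      gcongr
      exacts [hC2 t ht, hC1 t ht]

end

/-! ### Schwartz bounds -/

/-- Smooth functions that decay rapidly with all their derivatives. -/
def IsRapid (f : ℝ → ℝ) : Prop :=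
  ContDiff ℝ ∞ f ∧ ∀ n N : ℕ, ∃ C, ∀ x, (1 + |x|) ^ N * |iteratedDeriv n f x| ≤ C

lemma exists_iteratedDeriv_gaussian (n : ℕ) : ∃ p : Polynomial ℝ, ∀ x : ℝ,
    iteratedDeriv n (fun x : ℝ => Real.exp (-x ^ 2 / 12)) x = p.eval x * Real.exp (-x ^ 2 / 12) := by
  induction n with
  | zero => exact ⟨1, fun x => by simp⟩
  | succ n ih =>
    obtain ⟨p, hp⟩ := ih
    refine ⟨p.derivative - Polynomial.C (1 / 6) * Polynomial.X * p, fun x => ?_⟩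
    rw [iteratedDeriv_succ, funext hp]
    have hg : HasDerivAt (fun x : ℝ => Real.exp (-x ^ 2 / 12))
        (Real.exp (-x ^ 2 / 12) * (-(1 / 6) * x)) x := by
      refine (((hasDerivAt_id x).pow 2).neg.div_const 12).exp.congr_deriv ?_
      simp; ring
    refine (((p.hasDerivAt x).mul hg).congr_deriv ?_).deriv
    simp
    ring

lemma isRapid_gaussian : IsRapid fun x => Real.exp (-x ^ 2 / 12) := by
  refine ⟨by fun_prop, fun n N => ?_⟩
  obtain ⟨p, hp⟩ := exists_iteratedDeriv_gaussian n
  obtain ⟨C1, hC1, h1⟩ := exists_abs_eval_le p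
  obtain ⟨C2, h2⟩ := exists_pow_mul_exp_le (N + p.natDegree) (c := 1 / 12) (by norm_num)
  refine ⟨C1 * C2, fun x => ?_⟩
  rw [hp, abs_mul, abs_of_pos (Real.exp_pos _)]
  calc _ ≤ (1 + |x|) ^ N * ((C1 * (1 + |x|) ^ p.natDegree) * Real.exp (-x ^ 2 / 12)) := by
        gcongr; exact h1 x
    _ = C1 * ((1 + |x|) ^ (N + p.natDegree) * Real.exp (-(1 / 12 * x ^ 2))) := by
        rw [pow_add, show -(1 / 12 * x ^ 2) = -x ^ 2 / 12 by ring]; ring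
    _ ≤ _ := by gcongr; exact h2 x

/-- Rapid decay at `+∞` of all derivatives is preserved by the change of variables
`x ↦ x ^ (2/3)` and by multiplication with powers. -/
lemma rapid_decay_comp_rpow (n : ℕ) : ∀ (a : ℝ) (φ : ℝ → ℝ), ContDiff ℝ ∞ φ →
    (∀ N j : ℕ, ∃ C, ∀ t, 1 ≤ t → t ^ N * |iteratedDeriv j φ t| ≤ C) →
    ∀ N : ℕ, ∃ C, ∀ x, 1 ≤ x →
      x ^ N * |iteratedDeriv n (fun x : ℝ => x ^ a * φ (x ^ (2 / 3 : ℝ))) x| ≤ C := by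
  induction n with
  | zero =>
    intro a φ hφ hd N
    obtain ⟨M, hM⟩ := exists_nat_ge (|a|)
    obtain ⟨C, hC⟩ := hd (2 * (N + M)) 0
    refine ⟨C, fun x hx => ?_⟩
    have hx0 : 0 < x := by linarith
    have ht : 1 ≤ x ^ (2 / 3 : ℝ) := Real.one_le_rpow hx (by norm_num)
    refine le_trans ?_ (hC _ ht)
    simp only [iteratedDeriv_zero]
    rw [abs_mul, abs_of_pos (Real.rpow_pos_of_pos hx0 a), ← mul_assoc]
    gcongr
    rw [← Real.rpow_natCast x, ← Real.rpow_add hx0, ← Real.rpow_natCast (x ^ (2 / 3 : ℝ)),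
      ← Real.rpow_mul hx0.le]
    apply Real.rpow_le_rpow_of_exponent_le hx
    push_cast
    have := le_abs_self a
    have : (0 : ℝ) ≤ N := by positivity
    have : (0 : ℝ) ≤ M := by positivity
    linarith
  | succ n ih =>
    intro a φ hφ hd N
    have hφ' : ContDiff ℝ ∞ (deriv φ) := by
      have := contDiff_iteratedDeriv hφ 1
      rwa [iteratedDeriv_one] at this
    obtain ⟨C1, h1⟩ := ih (a - 1) φ hφ hd N
    obtain ⟨C2, h2⟩ := ih (a - 1 / 3) (deriv φ) hφ' (fun N j => by
      have := hd N (j + 1)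
      rwa [iteratedDeriv_succ'] at this) N
    refine ⟨|a| * C1 + 2 / 3 * C2, fun x hx => ?_⟩
    have hx0 : 0 < x := by linarith
    have hder : deriv (fun x : ℝ => x ^ a * φ (x ^ (2 / 3 : ℝ))) =ᶠ[𝓝 x]
        fun x => a * (x ^ (a - 1) * φ (x ^ (2 / 3 : ℝ)))
          + 2 / 3 * (x ^ (a - 1 / 3) * deriv φ (x ^ (2 / 3 : ℝ))) := by
      filter_upwards [lt_mem_nhds hx0] with y hy
      have e1 : HasDerivAt (fun x : ℝ => x ^ a) (a * y ^ (a - 1)) y :=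
        Real.hasDerivAt_rpow_const (Or.inl hy.ne')
      have e2 : HasDerivAt (fun x : ℝ => x ^ (2 / 3 : ℝ)) (2 / 3 * y ^ ((2 / 3 : ℝ) - 1)) y :=
        Real.hasDerivAt_rpow_const (Or.inl hy.ne')
      have e3 := ((hφ.differentiable (by simp) (y ^ (2 / 3 : ℝ))).hasDerivAt).comp y e2
      refine ((e1.mul e3).congr_deriv ?_).deriv
      have e4 : y ^ (a - 1 / 3) = y ^ a * y ^ ((2 / 3 : ℝ) - 1) := by
        rw [← Real.rpow_add hy]; congr 1; ring
      rw [e4]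
      simp only [Function.comp]
      ring
    have hsm : ∀ (b : ℝ) (ψ : ℝ → ℝ), ContDiff ℝ ∞ ψ →
        ContDiffAt ℝ n (fun x : ℝ => x ^ b * ψ (x ^ (2 / 3 : ℝ))) x := by
      intro b ψ hψ
      have e : ∀ c : ℝ, ContDiffAt ℝ n (fun x : ℝ => x ^ c) x := fun c =>
        Real.contDiffAt_rpow_const_of_ne hx0.ne'
      exact (e b).mul (((hψ.of_le (by exact_mod_cast le_top)).contDiffAt).comp x (e _))
    rw [iteratedDeriv_succ', hder.iteratedDeriv_eq,
      iteratedDeriv_fun_add (contDiffAt_const.mul (hsm _ _ hφ)) (contDiffAt_const.mul (hsm _ _ hφ')),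
      iteratedDeriv_const_mul_field, iteratedDeriv_const_mul_field]
    calc _ ≤ x ^ N * (|a| * |iteratedDeriv n (fun x : ℝ => x ^ (a - 1) * φ (x ^ (2 / 3 : ℝ))) x|
          + 2 / 3 * |iteratedDeriv n (fun x : ℝ => x ^ (a - 1 / 3) * deriv φ (x ^ (2 / 3 : ℝ))) x|) := by
          gcongr
          refine (abs_add_le _ _).trans ?_
          rw [abs_mul, abs_mul, abs_of_pos (by norm_num : (0 : ℝ) < 2 / 3)]
      _ = |a| * (x ^ N * |iteratedDeriv n (fun x : ℝ => x ^ (a - 1) * φ (x ^ (2 / 3 : ℝ))) x|)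
          + 2 / 3 * (x ^ N * |iteratedDeriv n
            (fun x : ℝ => x ^ (a - 1 / 3) * deriv φ (x ^ (2 / 3 : ℝ))) x|) := by ring
      _ ≤ _ := by
          gcongr
          exacts [h1 x hx, h2 x hx]

lemma contDiff_volterraSeries_cube : ContDiff ℝ ∞ fun t : ℝ => volterraSeries (t ^ 3) :=
  contDiff_volterraSeries.comp (by fun_prop)

lemma solvesRealVolterra_volterraSeries : SolvesRealVolterra fun t => volterraSeries (t ^ 3) :=
  fun _ ht => volterraSeries_convolution ht

/-- The boundary datum, divided by `i k`, is a Schwartz function of the frequency `k`. -/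
lemma isRapid_volterraSeries_sq : IsRapid fun k => volterraSeries (k ^ 2) := by
  have hsm : ContDiff ℝ ∞ fun k : ℝ => volterraSeries (k ^ 2) :=
    contDiff_volterraSeries.comp (by fun_prop)
  refine ⟨hsm, fun n N => ?_⟩
  obtain ⟨C1, h1⟩ := rapid_decay_comp_rpow n 0 _ contDiff_volterraSeries_cube
    (fun N j => iteratedDeriv_rapid_decay contDiff_volterraSeries_cube
      solvesRealVolterra_volterraSeries N j) N
  have hpos : ∀ x, 1 ≤ x → x ^ N * |iteratedDeriv n (fun k => volterraSeries (k ^ 2)) x| ≤ C1 := by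
    intro x hx
    refine le_trans (le_of_eq ?_) (h1 x hx)
    congr 2
    apply Filter.EventuallyEq.iteratedDeriv_eq
    filter_upwards [lt_mem_nhds (show (0 : ℝ) < x by linarith)] with y hy
    rw [Real.rpow_zero, one_mul, ← Real.rpow_natCast, ← Real.rpow_natCast, ← Real.rpow_mul hy.le]
    norm_num
  have hev : ∀ x, |iteratedDeriv n (fun k => volterraSeries (k ^ 2)) (-x)|
      = |iteratedDeriv n (fun k => volterraSeries (k ^ 2)) x| := by
    intro x
    have := iteratedDeriv_comp_neg n (fun k => volterraSeries (k ^ 2)) x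
    simp only [neg_sq] at this
    rw [this, smul_eq_mul, abs_mul, abs_pow, abs_neg, abs_one, one_pow, one_mul]
  obtain ⟨C2, h2⟩ := (isCompact_Icc (a := (-1 : ℝ)) (b := 1)).exists_bound_of_continuousOn
    (contDiff_iteratedDeriv hsm n).continuous.continuousOn
  refine ⟨max (2 ^ N * C1) (2 ^ N * C2), fun x => ?_⟩
  rcases le_total |x| 1 with hx | hx
  · refine le_max_of_le_right ?_
    have := h2 x (abs_le.mp hx)
    rw [Real.norm_eq_abs] at this
    gcongr
    linarith
  · refine le_max_of_le_left ?_
    have e : |iteratedDeriv n (fun k => volterraSeries (k ^ 2)) x|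
        = |iteratedDeriv n (fun k => volterraSeries (k ^ 2)) (|x|)| := by
      rcases abs_choice x with h | h <;> rw [h]
      rw [hev]
    rw [e]
    calc _ ≤ (2 * |x|) ^ N * |iteratedDeriv n (fun k => volterraSeries (k ^ 2)) (|x|)| := by
          gcongr; linarith
      _ = 2 ^ N * (|x| ^ N * |iteratedDeriv n (fun k => volterraSeries (k ^ 2)) (|x|)|) := by
          rw [mul_pow]; ring
      _ ≤ _ := by gcongr; exact hpos _ hx

/-- Products `f (a x) g (b x)` of two rapidly decreasing functions are rapidly decreasing uniformly
in `a, b ∈ [0, 1]`, as long as one of the two scales stays away from zero. -/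
lemma IsRapid.mul_scaled {f g : ℝ → ℝ} (hf : IsRapid f) (hg : IsRapid g) (n N : ℕ) :
    ∃ C, ∀ a ∈ Icc (0 : ℝ) 1, ∀ b ∈ Icc (0 : ℝ) 1, (1 / 3 ≤ a ∨ 1 / 3 ≤ b) → ∀ x,
      (1 + |x|) ^ N * |iteratedDeriv n (fun x => f (a * x) * g (b * x)) x| ≤ C := by
  choose A hA using fun i => hf.2 i N
  choose B hB using fun i => hg.2 i N
  refine ⟨3 ^ N * ∑ i ∈ Finset.range (n + 1), (n.choose i : ℝ) * A i * B (n - i),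
    fun a ha b hb hab x => ?_⟩
  have hsc : ∀ (φ : ℝ → ℝ) (hφ : IsRapid φ) (c : ℝ) (i : ℕ),
      iteratedDeriv i (fun x => φ (c * x)) x = c ^ i * iteratedDeriv i φ (c * x) := by
    intro φ hφ c i
    rw [iteratedDeriv_comp_const_mul (hφ.1.of_le (by exact_mod_cast le_top))]
  have hsm : ∀ (φ : ℝ → ℝ) (hφ : IsRapid φ) (c : ℝ), ContDiffAt ℝ n (fun x => φ (c * x)) x :=
    fun φ hφ c => ((hφ.1.of_le (by exact_mod_cast le_top)).comp
      (by fun_prop : ContDiff ℝ n fun x : ℝ => c * x)).contDiffAt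
  have hm := iteratedDeriv_mul (hsm f hf a) (hsm g hg b)
  have hm' : iteratedDeriv n (fun x => f (a * x) * g (b * x)) x = _ := hm
  rw [hm']
  have hone : (1 + |x|) ^ N ≤ 3 ^ N * ((1 + |a * x|) ^ N * (1 + |b * x|) ^ N) := by
    rw [← mul_pow, ← mul_pow]
    gcongr
    rw [abs_mul, abs_mul, abs_of_nonneg ha.1, abs_of_nonneg hb.1]
    have h1 := mul_nonneg ha.1 (abs_nonneg x)
    have h2 := mul_nonneg hb.1 (abs_nonneg x)
    rcases hab with h | h
    · nlinarith [mul_le_mul_of_nonneg_right h (abs_nonneg x), mul_nonneg h1 h2]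
    · nlinarith [mul_le_mul_of_nonneg_right h (abs_nonneg x), mul_nonneg h1 h2]
  calc _ ≤ (3 ^ N * ((1 + |a * x|) ^ N * (1 + |b * x|) ^ N)) * ∑ i ∈ Finset.range (n + 1),
        (n.choose i : ℝ) * |iteratedDeriv i f (a * x)| * |iteratedDeriv (n - i) g (b * x)| := by
        gcongr
        refine (Finset.abs_sum_le_sum_abs _ _).trans (Finset.sum_le_sum fun i _ => ?_)
        rw [hsc f hf, hsc g hg, abs_mul, abs_mul, abs_mul, abs_mul, abs_pow, abs_pow,
          abs_of_nonneg ha.1, abs_of_nonneg hb.1, Nat.abs_cast]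
        have := hb.1
        gcongr
        · exact mul_le_of_le_one_left (abs_nonneg _) (pow_le_one₀ ha.1 ha.2)
        · exact mul_le_of_le_one_left (abs_nonneg _) (pow_le_one₀ hb.1 hb.2)
    _ = 3 ^ N * ∑ i ∈ Finset.range (n + 1), (n.choose i : ℝ) *
        ((1 + |a * x|) ^ N * |iteratedDeriv i f (a * x)|) *
        ((1 + |b * x|) ^ N * |iteratedDeriv (n - i) g (b * x)|) := by
        rw [mul_assoc, Finset.mul_sum]
        congr 1
        apply Finset.sum_congr rfl
        intro i _
        ring
    _ ≤ _ := by
        gcongr with i _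
        · exact mul_nonneg (Nat.cast_nonneg _) (le_trans (by positivity) (hA i 0))
        · exact hA i _
        · exact hB _ _

lemma iteratedDeriv_id_mul {f : ℝ → ℝ} (hf : ContDiff ℝ ∞ f) (n : ℕ) (x : ℝ) :
    iteratedDeriv n (fun x => x * f x) x
      = x * iteratedDeriv n f x + n * iteratedDeriv (n - 1) f x := by
  induction n generalizing x with
  | zero => simp
  | succ n ih =>
    rw [iteratedDeriv_succ, funext ih]
    have hd : ∀ j, HasDerivAt (iteratedDeriv j f) (iteratedDeriv (j + 1) f x) x := fun j => by
      rw [iteratedDeriv_succ]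
      exact ((contDiff_iteratedDeriv hf j).differentiable (by simp) x).hasDerivAt
    refine ((((hasDerivAt_id x).mul (hd n)).add ((hd (n - 1)).const_mul (n : ℝ))).congr_deriv ?_).deriv
    rcases n with _ | n
    · simp; ring
    · simp; ring

/-! ### Frequency densities of the layers -/

/-- The density, in the frequency `k`, of the part of the solution emitted by the boundary at the
fraction `1 - r` of the time. -/
noncomputable def density (r k : ℝ) : ℝ :=
  k * (Real.exp (-(r ^ 3 * k ^ 2) / 12) * volterraSeries ((1 - r) ^ 3 * k ^ 2))

lemma contDiff_density (r : ℝ) : ContDiff ℝ ∞ (density r) := by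
  have h := contDiff_volterraSeries.comp
    (by fun_prop : ContDiff ℝ ∞ fun k : ℝ => (1 - r) ^ 3 * k ^ 2)
  unfold density
  exact contDiff_id.mul ((by fun_prop : ContDiff ℝ ∞ fun k : ℝ =>
    Real.exp (-(r ^ 3 * k ^ 2) / 12)).mul h)

lemma continuous_volterraSeries : Continuous volterraSeries := contDiff_volterraSeries.continuous

lemma exists_density_le (n N : ℕ) : ∃ C, ∀ r ∈ Icc (0 : ℝ) 1, ∀ k,
    (1 + |k|) ^ N * |iteratedDeriv n (density r) k| ≤ C := by
  obtain ⟨C1, h1⟩ := isRapid_gaussian.mul_scaled isRapid_volterraSeries_sq n (N + 1)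
  obtain ⟨C2, h2⟩ := isRapid_gaussian.mul_scaled isRapid_volterraSeries_sq (n - 1) N
  refine ⟨C1 + n * C2, fun r hr k => ?_⟩
  set a := √(r ^ 3) with ha
  set b := √((1 - r) ^ 3) with hb
  have hr0 : 0 ≤ r := hr.1
  have hr1 : 0 ≤ 1 - r := by linarith [hr.2]
  have ha' : a ∈ Icc (0 : ℝ) 1 := ⟨Real.sqrt_nonneg _, Real.sqrt_le_one.mpr (pow_le_one₀ hr0 hr.2)⟩
  have hb' : b ∈ Icc (0 : ℝ) 1 :=
    ⟨Real.sqrt_nonneg _, Real.sqrt_le_one.mpr (pow_le_one₀ hr1 (by linarith))⟩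
  have hthird : ∀ c : ℝ, 1 / 2 ≤ c → 1 / 3 ≤ √(c ^ 3) := by
    intro c hc
    apply Real.le_sqrt_of_sq_le
    calc ((1 : ℝ) / 3) ^ 2 ≤ (1 / 2) ^ 3 := by norm_num
      _ ≤ c ^ 3 := by gcongr
  have hab : 1 / 3 ≤ a ∨ 1 / 3 ≤ b := by
    rcases le_total (1 / 2) r with h | h
    · exact Or.inl (hthird r h)
    · exact Or.inr (hthird (1 - r) (by linarith))
  let p : ℝ → ℝ := fun x => Real.exp (-(a * x) ^ 2 / 12) * volterraSeries ((b * x) ^ 2)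
  have hp : density r = fun x => x * p x := by
    ext x
    simp only [density, p, mul_pow, ha, hb]
    rw [Real.sq_sqrt (by positivity), Real.sq_sqrt (by positivity)]
  have hpc : ContDiff ℝ ∞ p := (by fun_prop : ContDiff ℝ ∞ fun x =>
    Real.exp (-(a * x) ^ 2 / 12)).mul (contDiff_volterraSeries.comp
      (by fun_prop : ContDiff ℝ ∞ fun x => (b * x) ^ 2))
  rw [hp, iteratedDeriv_id_mul hpc]
  calc _ ≤ (1 + |k|) ^ N * ((1 + |k|) * |iteratedDeriv n p k| + n * |iteratedDeriv (n - 1) p k|) := by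
        gcongr
        refine (abs_add_le _ _).trans ?_
        rw [abs_mul, abs_mul, Nat.abs_cast]
        gcongr
        linarith
    _ = (1 + |k|) ^ (N + 1) * |iteratedDeriv n p k|
        + n * ((1 + |k|) ^ N * |iteratedDeriv (n - 1) p k|) := by ring
    _ ≤ _ := by
        gcongr
        · exact h1 a ha' b hb' hab k
        · exact h2 a ha' b hb' hab k

/-- The identity expressing that the solution vanishes on the boundary. -/
lemma integral_density (k : ℝ) :
    ∫ r in (0 : ℝ)..1, r ^ (-(1 / 2) : ℝ) * density r k = k * Real.exp (-k ^ 2 / 12) := by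
  rcases eq_or_ne k 0 with rfl | hk
  · simp [density]
  set t := |k| ^ (2 / 3 : ℝ) with ht
  have hk0 : 0 < |k| := abs_pos.mpr hk
  have ht0 : 0 < t := Real.rpow_pos_of_pos hk0 _
  have ht3 : t ^ 3 = k ^ 2 := by
    rw [ht, ← Real.rpow_natCast, ← Real.rpow_mul hk0.le, ← sq_abs k, ← Real.rpow_natCast |k|]
    norm_num
  have h1 := volterraSeries_convolution ht0
  -- with `t³ = k²`, this is the convolution equation at time `t`, rescaled by `s = t (1 - r)`
  have h2 := intervalIntegral.mul_integral_comp_sub_mul (a := 0) (b := 1)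
    (f := fun s => (t - s) ^ (-(1 / 2) : ℝ) * Real.exp (-(t - s) ^ 3 / 12)
      * volterraSeries (s ^ 3)) t t
  simp only [mul_one, mul_zero, sub_self, sub_zero] at h2
  rw [h1, ht3] at h2
  have h3 : ∫ r in (0 : ℝ)..1, r ^ (-(1 / 2) : ℝ) * density r k
      = k * t ^ (1 / 2 : ℝ) * ∫ x in (0 : ℝ)..1, (t - (t - t * x)) ^ (-(1 / 2) : ℝ) *
        Real.exp (-(t - (t - t * x)) ^ 3 / 12) * volterraSeries ((t - t * x) ^ 3) := by
    rw [← intervalIntegral.integral_const_mul]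
    apply intervalIntegral.integral_congr
    intro r hr
    rw [uIcc_of_le zero_le_one] at hr
    have e1 : t - (t - t * r) = t * r := by ring
    have e2 : (t - t * r) ^ 3 = (1 - r) ^ 3 * k ^ 2 := by rw [← ht3]; ring
    have e3 : -(t * r) ^ 3 / 12 = -(r ^ 3 * k ^ 2) / 12 := by rw [← ht3]; ring
    simp only
    rw [e1, e2, e3, density, Real.mul_rpow ht0.le hr.1, Real.rpow_neg ht0.le]
    have : t ^ (1 / 2 : ℝ) ≠ 0 := (Real.rpow_pos_of_pos ht0 _).ne'
    field_simp
  have h4 : t = t ^ (1 / 2 : ℝ) * t ^ (1 / 2 : ℝ) := by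
    rw [← Real.rpow_add ht0]; norm_num
  rw [h3]
  generalize ∫ x in (0 : ℝ)..1, (t - (t - t * x)) ^ (-(1 / 2) : ℝ) *
        Real.exp (-(t - (t - t * x)) ^ 3 / 12) * volterraSeries ((t - t * x) ^ 3) = I at h2 ⊢
  have h5 : t ^ (1 / 2 : ℝ) ≠ 0 := (Real.rpow_pos_of_pos ht0 _).ne'
  have h6 : t ^ (1 / 2 : ℝ) * I = Real.exp (-k ^ 2 / 12) := by
    apply mul_left_cancel₀ h5
    rw [← mul_assoc, ← h4, h2]
  rw [mul_assoc, h6]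

/-! ### The profile in physical variables -/

/-- The unnormalized inverse Fourier transform `∫ exp (i k x) f(k) dk`. -/
noncomputable def waveIntegral (f : ℝ → ℝ) (x : ℝ) : ℂ :=
  ∫ k : ℝ, Complex.exp (Complex.I * (k * x)) * (f k : ℂ)

lemma norm_exp_I_mul (k x : ℝ) : ‖Complex.exp (Complex.I * (k * x))‖ = 1 := by
  rw [← Complex.ofReal_mul, mul_comm, Complex.norm_exp_ofReal_mul_I]

lemma integrable_wave {f : ℝ → ℝ} (hf : Integrable f) (x : ℝ) :
    Integrable fun k : ℝ => Complex.exp (Complex.I * (k * x)) * (f k : ℂ) := by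
  apply hf.ofReal.bdd_mul (c := 1)
  · exact Continuous.aestronglyMeasurable (by fun_prop)
  · exact Eventually.of_forall fun k => (norm_exp_I_mul k x).le

lemma norm_waveIntegral_le {f : ℝ → ℝ} (x : ℝ) : ‖waveIntegral f x‖ ≤ ∫ k, |f k| := by
  refine (norm_integral_le_integral_norm _).trans (le_of_eq ?_)
  congr 1; ext k
  rw [norm_mul, norm_exp_I_mul, one_mul, Complex.norm_real, Real.norm_eq_abs]

lemma waveIntegral_deriv {f f' : ℝ → ℝ} (hd : ∀ k, HasDerivAt f (f' k) k) (hf : Integrable f)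
    (hf' : Integrable f') (x : ℝ) :
    waveIntegral f' x = -(Complex.I * x) * waveIntegral f x := by
  have h1 := integrable_wave hf x
  have h2 := integrable_wave hf' x
  have h : ∫ k : ℝ, ((Complex.I * x) * (Complex.exp (Complex.I * (k * x)) * (f k : ℂ))
      + Complex.exp (Complex.I * (k * x)) * (f' k : ℂ)) = 0 := by
    apply integral_eq_zero_of_hasDerivAt_of_integrable
      (f := fun k : ℝ => Complex.exp (Complex.I * (k * x)) * (f k : ℂ)) _
      ((h1.const_mul _).add h2) h1
    intro k
    have e1 : HasDerivAt (fun k : ℝ => Complex.exp (Complex.I * (k * x)))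
        (Complex.exp (Complex.I * (k * x)) * (Complex.I * x)) k := by
      have := (((Complex.ofRealCLM.hasDerivAt (x := k)).mul_const (x : ℂ)).const_mul Complex.I).cexp
      refine this.congr_deriv ?_
      simp
    refine (e1.mul (hd k).ofReal_comp).congr_deriv ?_
    simp only [Pi.add_apply]
    ring
  rw [integral_add (h1.const_mul _) h2, integral_const_mul] at h
  rw [waveIntegral, waveIntegral]
  linear_combination h

lemma integrable_of_forall_le {f : ℝ → ℝ} {C : ℝ} (hf : Continuous f)
    (hC : ∀ k, (1 + |k|) ^ 2 * |f k| ≤ C) : Integrable f := by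
  apply integrable_of_le_inv (C := C) hf
  intro x
  rw [le_div_iff₀ (by positivity), mul_comm]
  refine le_trans ?_ (hC x)
  gcongr
  nlinarith [abs_nonneg x, sq_abs x]

lemma integral_abs_le {f : ℝ → ℝ} {C : ℝ} (hf : Continuous f)
    (hC : ∀ k, (1 + |k|) ^ 2 * |f k| ≤ C) : ∫ k, |f k| ≤ C * Real.pi := by
  have : ∫ k, |f k| ≤ ∫ k : ℝ, C * (1 + k ^ 2)⁻¹ := by
    apply integral_mono (integrable_of_forall_le hf hC).abs
      (integrable_inv_one_add_sq.const_mul C)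
    intro x
    simp only
    rw [← div_eq_mul_inv, le_div_iff₀ (by positivity), mul_comm]
    refine le_trans ?_ (hC x)
    gcongr
    nlinarith [abs_nonneg x, sq_abs x]
  rwa [integral_const_mul, integral_univ_inv_one_add_sq] at this

/-- The physical-space profile emitted by the boundary at the fraction `1 - r` of the time. -/
noncomputable def layer (r x : ℝ) : ℝ := -∫ k : ℝ, Real.sin (k * x) * density r k

lemma continuous_density : Continuous (Function.uncurry density) := by
  have := continuous_volterraSeries
  unfold density Function.uncurry; fun_prop

lemma continuous_density_right (r : ℝ) : Continuous (density r) := (contDiff_density r).continuous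

lemma integrable_iteratedDeriv_density {r : ℝ} (hr : r ∈ Icc (0 : ℝ) 1) (n : ℕ) :
    Integrable (iteratedDeriv n (density r)) := by
  obtain ⟨C, hC⟩ := exists_density_le n 2
  exact integrable_of_forall_le (contDiff_iteratedDeriv (contDiff_density r) n).continuous (hC r hr)

lemma integrable_density {r : ℝ} (hr : r ∈ Icc (0 : ℝ) 1) : Integrable (density r) := by
  simpa using integrable_iteratedDeriv_density hr 0

lemma exists_density_le_inv : ∃ C, 0 ≤ C ∧ ∀ r ∈ Icc (0 : ℝ) 1, ∀ k,
    |density r k| ≤ C * (1 + k ^ 2)⁻¹ := by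
  obtain ⟨C, hC⟩ := exists_density_le 0 2
  refine ⟨C, le_trans (by positivity) (hC 0 ⟨le_rfl, zero_le_one⟩ 0), fun r hr k => ?_⟩
  have := hC r hr k
  rw [iteratedDeriv_zero] at this
  rw [← div_eq_mul_inv, le_div_iff₀ (by positivity), mul_comm]
  refine le_trans ?_ this
  gcongr
  nlinarith [abs_nonneg k, sq_abs k]

lemma density_neg (r k : ℝ) : density r (-k) = -density r k := by simp [density]

lemma layer_neg (r x : ℝ) : layer r (-x) = -layer r x := by
  simp [layer, integral_neg]

lemma layer_eq {r : ℝ} (hr : r ∈ Icc (0 : ℝ) 1) (x : ℝ) :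
    (layer r x : ℂ) = Complex.I * waveIntegral (density r) x := by
  have hi := integrable_density hr
  have hc : Integrable fun k => Real.cos (k * x) * density r k :=
    hi.bdd_mul (c := 1) (Continuous.aestronglyMeasurable (by fun_prop))
      (Eventually.of_forall fun k => Real.abs_cos_le_one _)
  have hs : Integrable fun k => Real.sin (k * x) * density r k :=
    hi.bdd_mul (c := 1) (Continuous.aestronglyMeasurable (by fun_prop))
      (Eventually.of_forall fun k => Real.abs_sin_le_one _)
  have h0 : ∫ k, Real.cos (k * x) * density r k = 0 := by
    have := integral_neg_eq_self (fun k => Real.cos (k * x) * density r k) volume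
    simp only [density_neg, neg_mul, Real.cos_neg, mul_neg, integral_neg] at this
    linarith
  have h1 : waveIntegral (density r) x = ((∫ k, Real.cos (k * x) * density r k : ℝ) : ℂ)
      + ((∫ k, Real.sin (k * x) * density r k : ℝ) : ℂ) * Complex.I := by
    have e1 : ((∫ k, Real.cos (k * x) * density r k : ℝ) : ℂ)
        = ∫ k, ((Real.cos (k * x) * density r k : ℝ) : ℂ) := integral_ofReal.symm
    have e2 : ((∫ k, Real.sin (k * x) * density r k : ℝ) : ℂ)
        = ∫ k, ((Real.sin (k * x) * density r k : ℝ) : ℂ) := integral_ofReal.symm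
    rw [waveIntegral, e1, e2, ← integral_mul_const,
      ← integral_add hc.ofReal (hs.ofReal.mul_const _)]
    congr 1; ext k
    rw [← Complex.ofReal_mul, mul_comm Complex.I, Complex.exp_mul_I]
    push_cast; ring
  rw [h1, h0, layer]
  push_cast
  linear_combination -((∫ k, Real.sin (k * x) * density r k : ℝ) : ℂ) * Complex.I_mul_I

lemma exists_layer_le (N : ℕ) : ∃ C, 0 ≤ C ∧ ∀ r ∈ Icc (0 : ℝ) 1, ∀ x,
    (1 + |x|) ^ N * |layer r x| ≤ C := by
  have key : ∀ n, ∃ C, 0 ≤ C ∧ ∀ r ∈ Icc (0 : ℝ) 1, ∀ x, |x| ^ n * |layer r x| ≤ C := by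
    intro n
    obtain ⟨C, hC⟩ := exists_density_le n 2
    have hC0 : 0 ≤ C := le_trans (by positivity) (hC 0 ⟨le_rfl, zero_le_one⟩ 0)
    refine ⟨C * Real.pi, by positivity, fun r hr x => ?_⟩
    have hw : ∀ n, ‖waveIntegral (iteratedDeriv n (density r)) x‖
        = |x| ^ n * ‖waveIntegral (density r) x‖ := by
      intro n
      induction n with
      | zero => simp
      | succ n ih =>
        rw [waveIntegral_deriv (f := iteratedDeriv n (density r)) _
          (integrable_iteratedDeriv_density hr n) (integrable_iteratedDeriv_density hr (n + 1)),
          norm_mul, ih, norm_neg, norm_mul, Complex.norm_I, Complex.norm_real, Real.norm_eq_abs]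
        · ring
        · intro k
          rw [iteratedDeriv_succ]
          exact ((contDiff_iteratedDeriv (contDiff_density r) n).differentiable (by simp) k).hasDerivAt
    have h1 : |layer r x| = ‖waveIntegral (density r) x‖ := by
      rw [← Real.norm_eq_abs, ← Complex.norm_real, layer_eq hr, norm_mul, Complex.norm_I, one_mul]
    rw [h1, ← hw]
    exact (norm_waveIntegral_le x).trans
      (integral_abs_le (contDiff_iteratedDeriv (contDiff_density r) n).continuous (hC r hr))
  obtain ⟨C0, h0, hC0⟩ := key 0
  obtain ⟨C1, h1, hC1⟩ := key N
  refine ⟨2 ^ N * (C0 + C1), by positivity, fun r hr x => ?_⟩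
  have hx := abs_nonneg x
  have e : (1 + |x|) ^ N ≤ 2 ^ N * (1 + |x| ^ N) := by
    rcases le_total |x| 1 with h | h
    · calc (1 + |x|) ^ N ≤ 2 ^ N := by gcongr; linarith
        _ ≤ _ := by
          have : 0 ≤ |x| ^ N := by positivity
          nlinarith [pow_pos (two_pos (α := ℝ)) N]
    · calc (1 + |x|) ^ N ≤ (2 * |x|) ^ N := by gcongr; linarith
        _ = 2 ^ N * |x| ^ N := mul_pow _ _ _
        _ ≤ _ := by gcongr; linarith
  have a0 := hC0 r hr x
  have a1 := hC1 r hr x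
  rw [pow_zero, one_mul] at a0
  calc _ ≤ (2 ^ N * (1 + |x| ^ N)) * |layer r x| := by gcongr
    _ = 2 ^ N * (|layer r x| + |x| ^ N * |layer r x|) := by ring
    _ ≤ _ := by gcongr

lemma continuousOn_layer : ContinuousOn (Function.uncurry layer) (Icc 0 1 ×ˢ univ) := by
  obtain ⟨C, _, hC⟩ := exists_density_le_inv
  unfold layer Function.uncurry
  apply ContinuousOn.neg
  apply continuousOn_of_dominated (bound := fun k => C * (1 + k ^ 2)⁻¹)
  · intro p _
    have := continuous_density_right p.1
    exact Continuous.aestronglyMeasurable (by fun_prop)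
  · intro p hp
    refine Eventually.of_forall fun k => ?_
    rw [norm_mul, Real.norm_eq_abs, Real.norm_eq_abs]
    calc _ ≤ 1 * |density p.1 k| := by gcongr; exact Real.abs_sin_le_one _
      _ ≤ _ := by rw [one_mul]; exact hC _ hp.1 k
  · exact integrable_inv_one_add_sq.const_mul C
  · refine Eventually.of_forall fun k => Continuous.continuousOn ?_
    have : Continuous fun p : ℝ × ℝ => density p.1 k :=
      continuous_density.comp (by fun_prop : Continuous fun p : ℝ × ℝ => (p.1, k))
    fun_prop

lemma continuous_layer {r : ℝ} (hr : r ∈ Icc (0 : ℝ) 1) : Continuous (layer r) := by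
  rw [← continuousOn_univ]
  exact continuousOn_layer.comp (f := fun x => (r, x)) (by fun_prop) fun x _ => ⟨hr, mem_univ _⟩

/-- The contribution of the initial datum: a derivative of the Kolmogorov kernel. -/
noncomputable def initialProfile (p : ℝ × ℝ) : ℝ :=
  √3 / (2 * Real.pi) * ((6 * p.1 - 2 * p.2) * Real.exp (-p.2 ^ 2 / 4 - 3 * (p.1 - p.2 / 2) ^ 2))

/-- The contribution of the boundary layer emitted at the fraction `1 - r` of the time. -/
noncomputable def layerProfile (r : ℝ) (p : ℝ × ℝ) : ℝ :=
  r ^ (-(1 / 2) : ℝ) * Real.exp (-p.2 ^ 2 / (4 * r)) * layer r (p.1 - r * p.2 / 2)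

/-- The normalized kernel, on the whole plane. -/
noncomputable def kernel (p : ℝ × ℝ) : ℝ :=
  initialProfile p + 1 / (4 * Real.pi * √Real.pi) * ∫ r in (0 : ℝ)..1, layerProfile r p

lemma kernel_neg (p : ℝ × ℝ) : kernel (-p) = -kernel p := by
  have h1 : initialProfile (-p) = -initialProfile p := by
    simp only [initialProfile, Prod.fst_neg, Prod.snd_neg]
    rw [show -(-p.2) ^ 2 / 4 - 3 * (-p.1 - -p.2 / 2) ^ 2 = -p.2 ^ 2 / 4 - 3 * (p.1 - p.2 / 2) ^ 2 by ring]
    ring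
  have h2 : ∀ r, layerProfile r (-p) = -layerProfile r p := by
    intro r
    simp only [layerProfile, Prod.fst_neg, Prod.snd_neg]
    rw [show -p.1 - r * -p.2 / 2 = -(p.1 - r * p.2 / 2) by ring, layer_neg, neg_sq]
    ring
  simp only [kernel, h1, h2, intervalIntegral.integral_neg]
  ring

lemma integrableOn_rpow_neg_half : IntegrableOn (fun r : ℝ => r ^ (-(1 / 2) : ℝ)) (Ioc 0 1) := by
  have := (intervalIntegral.intervalIntegrable_rpow' (a := 0) (b := 1)
          (r := (-(1 / 2) : ℝ)) (by norm_num))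
  rwa [intervalIntegrable_iff_integrableOn_Ioc_of_le zero_le_one] at this

lemma continuousOn_layerProfile :
    ContinuousOn (fun q : ℝ × (ℝ × ℝ) => layerProfile q.1 q.2) (Ioc 0 1 ×ˢ univ) := by
  unfold layerProfile
  apply ContinuousOn.mul
  · apply ContinuousOn.mul
    · exact continuousOn_fst.rpow_const fun q hq => Or.inl hq.1.1.ne'
    · apply ContinuousOn.rexp
      apply ContinuousOn.div (by fun_prop) (by fun_prop)
      intro q hq
      have := hq.1.1.ne'
      positivity
  · exact continuousOn_layer.comp (f := fun q : ℝ × (ℝ × ℝ) => (q.1, q.2.1 - q.1 * q.2.2 / 2))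
      (by fun_prop) fun q hq => ⟨Ioc_subset_Icc_self hq.1, mem_univ _⟩

/-- Rapid decay of the layers, with the integrable singularity in `r`. -/
lemma exists_layerProfile_le (N : ℕ) : ∃ C, 0 ≤ C ∧ ∀ r ∈ Ioc (0 : ℝ) 1, ∀ p : ℝ × ℝ,
    (1 + |p.1|) ^ N * (1 + |p.2|) ^ N * |layerProfile r p| ≤ C * r ^ (-(1 / 2) : ℝ) := by
  obtain ⟨C1, hC1, h1⟩ := exists_layer_le N
  obtain ⟨C2, h2⟩ := exists_pow_mul_exp_le (N + N) (c := 1 / 4) (by norm_num)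
  have hC2 : 0 ≤ C2 := le_trans (by positivity) (h2 0)
  refine ⟨C1 * C2, by positivity, fun r hr p => ?_⟩
  set x := p.1 - r * p.2 / 2 with hx
  have hY := abs_nonneg p.2
  have hX : 1 + |p.1| ≤ (1 + |x|) * (1 + |p.2|) := by
    have e1 : |p.1| ≤ |x| + |r * p.2 / 2| := by
      have : p.1 = x + r * p.2 / 2 := by rw [hx]; ring
      calc |p.1| = |x + r * p.2 / 2| := by rw [← this]
        _ ≤ _ := abs_add_le _ _
    have e2 : |r * p.2 / 2| ≤ |p.2| := by
      rw [abs_div, abs_mul, abs_of_pos hr.1, abs_two]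
      nlinarith [mul_le_mul_of_nonneg_right hr.2 hY]
    nlinarith [abs_nonneg x, mul_nonneg (abs_nonneg x) hY]
  have hexp : Real.exp (-p.2 ^ 2 / (4 * r)) ≤ Real.exp (-(1 / 4 * p.2 ^ 2)) := by
    gcongr
    have h4 : 0 < 4 * r := by linarith [hr.1]
    rw [neg_div, neg_le_neg_iff, le_div_iff₀ h4]
    nlinarith [mul_le_mul_of_nonneg_right hr.2 (sq_nonneg p.2)]
  have hrp : 0 ≤ r ^ (-(1 / 2) : ℝ) := Real.rpow_nonneg hr.1.le _
  rw [layerProfile, abs_mul, abs_mul, abs_of_nonneg hrp, abs_of_pos (Real.exp_pos _)]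
  calc _ ≤ ((1 + |x|) * (1 + |p.2|)) ^ N * (1 + |p.2|) ^ N *
        (r ^ (-(1 / 2) : ℝ) * Real.exp (-(1 / 4 * p.2 ^ 2)) * |layer r x|) := by gcongr
    _ = ((1 + |x|) ^ N * |layer r x|) * ((1 + |p.2|) ^ (N + N) * Real.exp (-(1 / 4 * p.2 ^ 2)))
        * r ^ (-(1 / 2) : ℝ) := by rw [mul_pow, pow_add]; ring
    _ ≤ _ := by
        gcongr
        exacts [h1 r (Ioc_subset_Icc_self hr) x, h2 _]

lemma exists_abs_layerProfile_le : ∃ C, 0 ≤ C ∧ ∀ r ∈ Ioc (0 : ℝ) 1, ∀ p : ℝ × ℝ,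
    |layerProfile r p| ≤ C * r ^ (-(1 / 2) : ℝ) := by
  simpa using exists_layerProfile_le 0

lemma aestronglyMeasurable_layerProfile (p : ℝ × ℝ) :
    AEStronglyMeasurable (fun r => layerProfile r p) (volume.restrict (Ioc 0 1)) := by
  apply ContinuousOn.aestronglyMeasurable _ measurableSet_Ioc
  exact continuousOn_layerProfile.comp (f := fun r => (r, p)) (by fun_prop)
    fun r hr => ⟨hr, mem_univ _⟩

lemma continuous_kernel : Continuous kernel := by
  obtain ⟨C, _, hC⟩ := exists_abs_layerProfile_le
  have h1 : Continuous initialProfile := by unfold initialProfile; fun_prop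
  have h2 : Continuous fun p => ∫ r in (0 : ℝ)..1, layerProfile r p := by
    simp_rw [intervalIntegral.integral_of_le zero_le_one]
    apply continuous_of_dominated (bound := fun r => C * r ^ (-(1 / 2) : ℝ))
      aestronglyMeasurable_layerProfile
    · intro p
      rw [ae_restrict_iff' measurableSet_Ioc]
      exact Eventually.of_forall fun r hr => hC r hr p
    · exact integrableOn_rpow_neg_half.const_mul C
    · rw [ae_restrict_iff' measurableSet_Ioc]
      refine Eventually.of_forall fun r hr => ?_
      rw [← continuousOn_univ]
      exact continuousOn_layerProfile.comp (f := fun p => (r, p)) (by fun_prop)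
        fun p _ => ⟨hr, mem_univ _⟩
  unfold kernel
  fun_prop

/-- Rapid decay of the contribution of the initial datum. -/
lemma exists_initialProfile_le (N : ℕ) : ∃ C, 0 ≤ C ∧ ∀ p : ℝ × ℝ,
    (1 + |p.1|) ^ N * (1 + |p.2|) ^ N * |initialProfile p| ≤ C := by
  obtain ⟨A, hA⟩ := exists_pow_mul_exp_le (N + 1) (c := 3) (by norm_num)
  obtain ⟨B, hB⟩ := exists_pow_mul_exp_le (N + N + 1) (c := 1 / 4) (by norm_num)
  have hA0 : 0 ≤ A := le_trans (by positivity) (hA 0)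
  have hB0 : 0 ≤ B := le_trans (by positivity) (hB 0)
  refine ⟨√3 / (2 * Real.pi) * (6 * (A * B)), by positivity, fun p => ?_⟩
  set x := p.1 - p.2 / 2 with hx
  have hX' := abs_nonneg x
  have hY := abs_nonneg p.2
  have hxp : p.1 = x + p.2 / 2 := by rw [hx]; ring
  have hX : 1 + |p.1| ≤ (1 + |x|) * (1 + |p.2|) := by
    have e1 : |p.1| ≤ |x| + |p.2| / 2 := by
      rw [hxp]
      refine (abs_add_le _ _).trans ?_
      rw [abs_div, abs_two]
    nlinarith [mul_nonneg hX' hY]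
  have h6 : |6 * p.1 - 2 * p.2| ≤ 6 * ((1 + |x|) * (1 + |p.2|)) := by
    have : 6 * p.1 - 2 * p.2 = 6 * x + p.2 := by rw [hxp]; ring
    rw [this]
    refine (abs_add_le _ _).trans ?_
    rw [abs_mul, abs_of_pos (by norm_num : (0 : ℝ) < 6)]
    nlinarith [mul_nonneg hX' hY]
  rw [initialProfile, abs_mul, abs_mul, abs_of_pos (Real.exp_pos _),
    abs_of_pos (by positivity : 0 < √3 / (2 * Real.pi)), ← hx]
  calc _ ≤ ((1 + |x|) * (1 + |p.2|)) ^ N * (1 + |p.2|) ^ N * (√3 / (2 * Real.pi) *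
        ((6 * ((1 + |x|) * (1 + |p.2|))) * Real.exp (-p.2 ^ 2 / 4 - 3 * x ^ 2))) := by gcongr
    _ = √3 / (2 * Real.pi) * (6 * (((1 + |x|) ^ (N + 1) * Real.exp (-(3 * x ^ 2))) *
        ((1 + |p.2|) ^ (N + N + 1) * Real.exp (-(1 / 4 * p.2 ^ 2))))) := by
        rw [show -p.2 ^ 2 / 4 - 3 * x ^ 2 = -(3 * x ^ 2) + -(1 / 4 * p.2 ^ 2) by ring,
          Real.exp_add, mul_pow]
        ring
    _ ≤ _ := by
        gcongr
        exacts [hA x, hB _]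

/-- The kernel decays faster than any power. -/
lemma exists_kernel_le (N : ℕ) : ∃ C, 0 ≤ C ∧ ∀ p : ℝ × ℝ,
    (1 + |p.1|) ^ N * (1 + |p.2|) ^ N * |kernel p| ≤ C := by
  obtain ⟨C, hC0, hC⟩ := exists_layerProfile_le N
  obtain ⟨D, hD0, h1⟩ := exists_initialProfile_le N
  set J : ℝ := ∫ r in (0 : ℝ)..1, r ^ (-(1 / 2) : ℝ) with hJ
  have hJ0 : 0 ≤ J := intervalIntegral.integral_nonneg zero_le_one fun r hr =>
    Real.rpow_nonneg hr.1 _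
  refine ⟨D + 1 / (4 * Real.pi * √Real.pi) * (C * J),
    by positivity, fun p => ?_⟩
  set w := (1 + |p.1|) ^ N * (1 + |p.2|) ^ N with hw
  have hw0 : 0 < w := by positivity
  have h2 : w * |∫ r in (0 : ℝ)..1, layerProfile r p| ≤ C * J := by
    rw [← abs_of_pos hw0, ← abs_mul, ← intervalIntegral.integral_const_mul, hJ,
      ← intervalIntegral.integral_const_mul, ← Real.norm_eq_abs]
    apply intervalIntegral.norm_integral_le_of_norm_le zero_le_one
    · refine Eventually.of_forall fun r hr => ?_
      rw [Real.norm_eq_abs, abs_mul, abs_of_pos hw0]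
      exact hC r hr p
    · rw [intervalIntegrable_iff_integrableOn_Ioc_of_le zero_le_one]
      exact integrableOn_rpow_neg_half.const_mul C
  have hc : 0 < 1 / (4 * Real.pi * √Real.pi) := by positivity
  calc w * |kernel p| ≤ w * (|initialProfile p| +
        1 / (4 * Real.pi * √Real.pi) * |∫ r in (0 : ℝ)..1, layerProfile r p|) := by
        gcongr
        rw [kernel]
        refine (abs_add_le _ _).trans ?_
        rw [abs_mul, abs_of_pos hc]
    _ = w * |initialProfile p| + 1 / (4 * Real.pi * √Real.pi) *
        (w * |∫ r in (0 : ℝ)..1, layerProfile r p|) := by ring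
    _ ≤ _ := add_le_add (h1 p) (mul_le_mul_of_nonneg_left h2 hc.le)

/-- The Gaussian integral with a linear complex exponent. -/
lemma integral_cexp_neg_sq {b : ℝ} (hb : 0 < b) (c : ℂ) :
    ∫ x : ℝ, Complex.exp (-b * x ^ 2 + c * x)
      = (√(Real.pi / b) : ℝ) * Complex.exp (c ^ 2 / (4 * b)) := by
  have := integral_cexp_quadratic (b := -(b : ℂ)) (by simpa using hb) c 0
  simp only [add_zero] at this
  rw [this, neg_neg, Real.sqrt_eq_rpow, Complex.ofReal_cpow (by positivity)]
  push_cast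
  congr 2
  rw [zero_sub, mul_neg, div_neg, neg_neg]

lemma waveIntegral_gaussian (x : ℝ) : waveIntegral (fun k => Real.exp (-k ^ 2 / 12)) x
    = ((√(12 * Real.pi) * Real.exp (-3 * x ^ 2) : ℝ) : ℂ) := by
  have := integral_cexp_neg_sq (b := 1 / 12) (by norm_num) (Complex.I * x)
  rw [waveIntegral]
  calc _ = ∫ k : ℝ, Complex.exp (-(1 / 12 : ℝ) * k ^ 2 + Complex.I * x * k) := by
        congr 1; ext k
        rw [Complex.ofReal_exp, ← Complex.exp_add]
        congr 1; push_cast; ring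
    _ = _ := by
        rw [this, mul_pow, Complex.I_sq]
        push_cast
        congr 2
        · congr 2; ring
        · ring

lemma integral_sin_mul_gaussian (x : ℝ) : ∫ k : ℝ, Real.sin (k * x) * (k * Real.exp (-k ^ 2 / 12))
    = 6 * x * (√(12 * Real.pi) * Real.exp (-3 * x ^ 2)) := by
  have hd : ∀ k : ℝ, HasDerivAt (fun k : ℝ => Real.exp (-k ^ 2 / 12))
      (Real.exp (-k ^ 2 / 12) * (-(2 * k) / 12)) k := by
    intro k
    have := (((hasDerivAt_pow 2 k).neg).div_const 12).exp
    simpa using this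
  have hi : Integrable fun k : ℝ => Real.exp (-k ^ 2 / 12) := by
    have := integrable_exp_neg_mul_sq (b := 1 / 12) (by norm_num)
    refine this.congr (Eventually.of_forall fun k => ?_)
    simp only; congr 1; ring
  have hi' : Integrable fun k : ℝ => Real.exp (-k ^ 2 / 12) * (-(2 * k) / 12) := by
    have := (integrable_mul_exp_neg_mul_sq (b := 1 / 12) (by norm_num)).const_mul (-(1 / 6))
    refine this.congr (Eventually.of_forall fun k => ?_)
    simp only
    rw [show -(1 / 12 : ℝ) * k ^ 2 = -k ^ 2 / 12 by ring]; ring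
  have h := waveIntegral_deriv hd hi hi' x
  rw [waveIntegral_gaussian, waveIntegral] at h
  have h2 := congrArg Complex.im h
  rw [← Complex.imCLM_apply, ← Complex.imCLM.integral_comp_comm (integrable_wave hi' x)] at h2
  have e : ∀ k : ℝ, Complex.imCLM (Complex.exp (Complex.I * (k * x)) *
      ((Real.exp (-k ^ 2 / 12) * (-(2 * k) / 12) : ℝ) : ℂ))
      = (-(1 / 6)) * (Real.sin (k * x) * (k * Real.exp (-k ^ 2 / 12))) := by
    intro k
    rw [Complex.imCLM_apply, Complex.im_mul_ofReal, ← Complex.ofReal_mul, mul_comm Complex.I,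
      Complex.exp_ofReal_mul_I_im]
    ring
  simp only [e, integral_const_mul] at h2
  have hx : (-(Complex.I * (x : ℂ))).im = -x := by simp
  rw [Complex.im_mul_ofReal, hx] at h2
  linarith

lemma integrable_rpow_mul_density :
    Integrable (fun q : ℝ × ℝ => q.1 ^ (-(1 / 2) : ℝ) * density q.1 q.2)
      ((volume.restrict (Ioc 0 1)).prod volume) := by
  obtain ⟨C, hC0, hC⟩ := exists_density_le_inv
  have h : Integrable (fun q : ℝ × ℝ => q.1 ^ (-(1 / 2) : ℝ) * (C * (1 + q.2 ^ 2)⁻¹))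
      ((volume.restrict (Ioc 0 1)).prod volume) :=
    Integrable.mul_prod integrableOn_rpow_neg_half (integrable_inv_one_add_sq.const_mul C)
  refine h.mono' ?_ ?_
  · refine Measurable.aestronglyMeasurable ?_
    exact (measurable_fst.pow_const _).mul continuous_density.measurable
  · have : ∀ᵐ q : ℝ × ℝ ∂((volume.restrict (Ioc 0 1)).prod volume), q.1 ∈ Ioc (0 : ℝ) 1 :=
      Measure.quasiMeasurePreserving_fst.ae (ae_restrict_mem measurableSet_Ioc)
    filter_upwards [this] with q hq
    rw [norm_mul, Real.norm_eq_abs, Real.norm_eq_abs, abs_of_nonneg (Real.rpow_nonneg hq.1.le _)]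
    exact mul_le_mul_of_nonneg_left (hC _ (Ioc_subset_Icc_self hq) _)
      (Real.rpow_nonneg hq.1.le _)

lemma kernel_boundary (X : ℝ) : kernel (X, 0) = 0 := by
  have h1 : ∫ r in (0 : ℝ)..1, layerProfile r (X, 0)
      = -∫ k : ℝ, Real.sin (k * X) * (k * Real.exp (-k ^ 2 / 12)) := by
    have hint : Integrable (Function.uncurry fun r k : ℝ =>
        Real.sin (k * X) * (r ^ (-(1 / 2) : ℝ) * density r k))
        ((volume.restrict (Ioc 0 1)).prod volume) :=
      integrable_rpow_mul_density.bdd_mul (c := 1) (Continuous.aestronglyMeasurable (by fun_prop))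
        (Eventually.of_forall fun q => Real.abs_sin_le_one _)
    have e : ∀ r, layerProfile r (X, 0)
        = -∫ k, Real.sin (k * X) * (r ^ (-(1 / 2) : ℝ) * density r k) := by
      intro r
      simp only [layerProfile, layer, ne_eq, OfNat.ofNat_ne_zero, not_false_eq_true, zero_pow,
        neg_zero, zero_div, Real.exp_zero, mul_one, mul_zero, sub_zero, mul_neg]
      rw [← integral_const_mul]
      congr 2; ext k; ring
    simp only [e, intervalIntegral.integral_neg]
    rw [intervalIntegral.integral_of_le zero_le_one, integral_integral_swap hint]
    congr 2; ext k
    rw [integral_const_mul, ← intervalIntegral.integral_of_le zero_le_one, integral_density]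
  rw [kernel, h1, integral_sin_mul_gaussian, initialProfile]
  have e1 : √(12 * Real.pi) = 2 * √3 * √Real.pi := by
    rw [show (12 : ℝ) * Real.pi = 2 ^ 2 * 3 * Real.pi by ring, Real.sqrt_mul (by norm_num),
      Real.sqrt_mul (by norm_num), Real.sqrt_sq (by norm_num)]
  have e2 : √Real.pi ≠ 0 := by positivity
  rw [e1]
  simp only
  rw [show -(0 : ℝ) ^ 2 / 4 - 3 * (X - 0 / 2) ^ 2 = -3 * X ^ 2 by ring]
  field_simp
  ring

/-! ### Testing the kernel against functions of moderate growth -/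

lemma mul_one_add_abs_le {f X Y C : ℝ} (h : (1 + |X|) ^ 3 * (1 + |Y|) ^ 3 * |f| ≤ C) :
    |f| * (1 + |Y|) ≤ C * ((1 + X ^ 2)⁻¹ * (1 + Y ^ 2)⁻¹) := by
  have hX := abs_nonneg X
  have hY := abs_nonneg Y
  rw [← mul_inv, ← div_eq_mul_inv, le_div_iff₀ (by positivity)]
  refine le_trans ?_ h
  have e1 : 1 + X ^ 2 ≤ (1 + |X|) ^ 3 := by
    rw [← sq_abs X]; nlinarith [pow_nonneg hX 3]
  have e2 : 1 + Y ^ 2 ≤ (1 + |Y|) ^ 2 := by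
    rw [← sq_abs Y]; nlinarith
  calc _ = (1 + X ^ 2) * ((1 + Y ^ 2) * (1 + |Y|)) * |f| := by ring
    _ ≤ (1 + |X|) ^ 3 * ((1 + |Y|) ^ 2 * (1 + |Y|)) * |f| := by gcongr
    _ = _ := by ring

lemma integrable_inv_prod :
    Integrable fun p : ℝ × ℝ => (1 + p.1 ^ 2)⁻¹ * (1 + p.2 ^ 2)⁻¹ :=
  Integrable.mul_prod integrable_inv_one_add_sq integrable_inv_one_add_sq

/-- A rapidly decaying function is integrable against a weight of linear growth in `Y`. -/
lemma integrable_mul_weight {f : ℝ × ℝ → ℝ} {C D : ℝ} (hf : AEStronglyMeasurable f)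
    (hC : ∀ p : ℝ × ℝ, (1 + |p.1|) ^ 3 * (1 + |p.2|) ^ 3 * |f p| ≤ C)
    {w : ℝ × ℝ → ℂ} (hw : AEStronglyMeasurable w) (hD : ∀ p, ‖w p‖ ≤ D * (1 + |p.2|)) :
    Integrable fun p => (f p : ℂ) * w p := by
  refine (integrable_inv_prod.const_mul (D * C)).mono'
    ((Complex.continuous_ofReal.comp_aestronglyMeasurable hf).mul hw)
    (Eventually.of_forall fun p => ?_)
  have hD0 : 0 ≤ D := by simpa using (norm_nonneg _).trans (hD (0, 0))
  rw [norm_mul, Complex.norm_real, Real.norm_eq_abs]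
  calc _ ≤ |f p| * (D * (1 + |p.2|)) := by gcongr; exact hD p
    _ = D * (|f p| * (1 + |p.2|)) := by ring
    _ ≤ D * (C * ((1 + p.1 ^ 2)⁻¹ * (1 + p.2 ^ 2)⁻¹)) := by
        exact mul_le_mul_of_nonneg_left (mul_one_add_abs_le (hC p)) hD0
    _ = _ := by ring

lemma continuous_initialProfile : Continuous initialProfile := by
  unfold initialProfile; fun_prop

lemma continuous_layerProfile {r : ℝ} (hr : r ∈ Ioc (0 : ℝ) 1) : Continuous (layerProfile r) := by
  rw [← continuousOn_univ]
  exact continuousOn_layerProfile.comp (f := fun p => (r, p)) (by fun_prop)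
    fun p _ => ⟨hr, mem_univ _⟩

lemma integrable_initialProfile_mul {w : ℝ × ℝ → ℂ} {D : ℝ} (hw : AEStronglyMeasurable w)
    (hD : ∀ p, ‖w p‖ ≤ D * (1 + |p.2|)) : Integrable fun p => (initialProfile p : ℂ) * w p := by
  obtain ⟨C, _, hC⟩ := exists_initialProfile_le 3
  exact integrable_mul_weight continuous_initialProfile.aestronglyMeasurable hC hw hD

lemma integrable_layerProfile_mul {r : ℝ} (hr : r ∈ Ioc (0 : ℝ) 1) {w : ℝ × ℝ → ℂ} {D : ℝ}
    (hw : AEStronglyMeasurable w) (hD : ∀ p, ‖w p‖ ≤ D * (1 + |p.2|)) :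
    Integrable fun p => (layerProfile r p : ℂ) * w p := by
  obtain ⟨C, _, hC⟩ := exists_layerProfile_le 3
  exact integrable_mul_weight (continuous_layerProfile hr).aestronglyMeasurable (hC r hr) hw hD

lemma integrable_layerProfile_mul_prod {w : ℝ × ℝ → ℂ} {D : ℝ}
    (hw : AEStronglyMeasurable w) (hD : ∀ p, ‖w p‖ ≤ D * (1 + |p.2|)) :
    Integrable (Function.uncurry fun (r : ℝ) (p : ℝ × ℝ) => (layerProfile r p : ℂ) * w p)
      ((volume.restrict (Ioc 0 1)).prod volume) := by
  obtain ⟨C, _, hC⟩ := exists_layerProfile_le 3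
  have hD0 : 0 ≤ D := by simpa using (norm_nonneg _).trans (hD (0, 0))
  have h := Integrable.mul_prod (μ := volume.restrict (Ioc 0 1)) (ν := volume)
    (integrableOn_rpow_neg_half) (integrable_inv_prod.const_mul (D * C))
  refine h.mono' ?_ ?_
  · refine AEStronglyMeasurable.mul (Complex.continuous_ofReal.comp_aestronglyMeasurable ?_)
      hw.comp_snd
    rw [← Measure.restrict_univ (μ := (volume : Measure (ℝ × ℝ))), Measure.prod_restrict]
    exact continuousOn_layerProfile.aestronglyMeasurable (measurableSet_Ioc.prod .univ)
  · have : ∀ᵐ q : ℝ × (ℝ × ℝ) ∂((volume.restrict (Ioc 0 1)).prod volume), q.1 ∈ Ioc (0 : ℝ) 1 :=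
      Measure.quasiMeasurePreserving_fst.ae (ae_restrict_mem measurableSet_Ioc)
    filter_upwards [this] with q hq
    simp only [Function.uncurry]
    rw [norm_mul, Complex.norm_real, Real.norm_eq_abs]
    calc _ ≤ |layerProfile q.1 q.2| * (D * (1 + |q.2.2|)) := by gcongr; exact hD q.2
      _ = D * (|layerProfile q.1 q.2| * (1 + |q.2.2|)) := by ring
      _ ≤ D * (C * q.1 ^ (-(1 / 2) : ℝ) * ((1 + q.2.1 ^ 2)⁻¹ * (1 + q.2.2 ^ 2)⁻¹)) := by
          exact mul_le_mul_of_nonneg_left (mul_one_add_abs_le (hC q.1 hq q.2)) hD0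
      _ = _ := by ring

/-- Fubini's theorem for the superposition defining the kernel. -/
lemma integral_kernel_mul {w : ℝ × ℝ → ℂ} {D : ℝ} (hw : AEStronglyMeasurable w)
    (hD : ∀ p, ‖w p‖ ≤ D * (1 + |p.2|)) :
    ∫ p, (kernel p : ℂ) * w p = (∫ p, (initialProfile p : ℂ) * w p)
      + ((1 / (4 * Real.pi * √Real.pi) : ℝ) : ℂ) *
        ∫ r in (0 : ℝ)..1, ∫ p, (layerProfile r p : ℂ) * w p := by
  have hp := integrable_layerProfile_mul_prod hw hD
  have hp' : Integrable fun p => ∫ r in Ioc (0 : ℝ) 1, (layerProfile r p : ℂ) * w p :=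
    hp.integral_prod_right
  rw [intervalIntegral.integral_of_le zero_le_one, integral_integral_swap hp,
    ← integral_const_mul, ← integral_add (integrable_initialProfile_mul hw hD)
      (hp'.const_mul _)]
  congr 1; ext p
  have : ((∫ r in (0 : ℝ)..1, layerProfile r p : ℝ) : ℂ)
      = ∫ r in Ioc (0 : ℝ) 1, (layerProfile r p : ℂ) := by
    rw [intervalIntegral.integral_of_le zero_le_one]; exact integral_ofReal.symm
  rw [integral_mul_const, kernel, Complex.ofReal_add, Complex.ofReal_mul, this]
  ring

/-! ### Weighted integrability and the boundary trace -/

lemma memL2Weighted_kernel (m : ℕ) : MemL2Weighted m kernel := by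
  refine ⟨continuous_kernel.aestronglyMeasurable, ?_⟩
  obtain ⟨C, hC0, hC⟩ := exists_kernel_le (m + 1)
  refine Integrable.integrableOn ?_
  refine (integrable_inv_prod.const_mul (C ^ 2)).mono'
    (Continuous.aestronglyMeasurable (by have := continuous_kernel; fun_prop))
    (Eventually.of_forall fun p => ?_)
  have hX := abs_nonneg p.1
  have hY := abs_nonneg p.2
  have h0 : 0 ≤ |kernel p| ^ 2 * (1 + p.1 ^ 2 + p.2 ^ 2) ^ m := by positivity
  rw [Real.norm_eq_abs, abs_of_nonneg h0, ← mul_inv, ← div_eq_mul_inv,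
    le_div_iff₀ (by positivity)]
  have e0 : 1 + p.1 ^ 2 + p.2 ^ 2 ≤ ((1 + |p.1|) * (1 + |p.2|)) ^ 2 := by
    rw [← sq_abs p.1, ← sq_abs p.2]
    nlinarith [mul_nonneg hX hY, mul_nonneg (mul_nonneg hX hY) hX,
      mul_nonneg (mul_nonneg hX hY) hY, sq_nonneg (|p.1| * |p.2|)]
  have e1 : (1 + p.1 ^ 2) * (1 + p.2 ^ 2) ≤ ((1 + |p.1|) * (1 + |p.2|)) ^ 2 := by
    rw [mul_pow]
    gcongr <;> rw [← sq_abs] <;> nlinarith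
  calc _ ≤ |kernel p| ^ 2 * (((1 + |p.1|) * (1 + |p.2|)) ^ 2) ^ m *
        ((1 + |p.1|) * (1 + |p.2|)) ^ 2 := by gcongr
    _ = ((1 + |p.1|) ^ (m + 1) * (1 + |p.2|) ^ (m + 1) * |kernel p|) ^ 2 := by
        rw [← mul_pow]
        generalize (1 + |p.1|) * (1 + |p.2|) = w
        ring
    _ ≤ C ^ 2 := by gcongr; exact hC p

/-- A bounded continuous function that vanishes on the boundary has zero trace. -/
lemma hasZeroTrace_of_continuous {u : ℝ × ℝ → ℝ} (hu : Continuous u) {C : ℝ}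
    (hC : ∀ p, |u p| ≤ C) (h0 : ∀ X, u (X, 0) = 0) : HasZeroTrace u := by
  intro φ hφ hφc
  have hφi : Integrable φ := hφ.continuous.integrable_of_hasCompactSupport hφc
  have hφ' := hφ.continuous
  have hg : Continuous fun Y => ∫ X, u (X, Y) * φ X := by
    apply continuous_of_dominated (bound := fun X => C * |φ X|)
    · intro Y
      exact Continuous.aestronglyMeasurable (by fun_prop)
    · intro Y
      refine Eventually.of_forall fun X => ?_
      rw [norm_mul, Real.norm_eq_abs, Real.norm_eq_abs]
      gcongr; exact hC _
    · exact hφi.abs.const_mul C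
    · exact Eventually.of_forall fun X => by fun_prop
  have hd := intervalIntegral.integral_hasDerivAt_right (hg.intervalIntegrable 0 0)
    (hg.stronglyMeasurableAtFilter _ _) hg.continuousAt
  rw [hasDerivAt_iff_tendsto_slope_zero] at hd
  have hd := hd.mono_left (nhdsGT_le_nhdsNE 0)
  simp only [h0, zero_mul, integral_zero, zero_add, intervalIntegral.integral_same, sub_zero,
    smul_eq_mul] at hd
  refine hd.congr' ?_
  filter_upwards [self_mem_nhdsWithin] with ε hε
  have hε : (0 : ℝ) < ε := hε
  congr 1
  have hint : Integrable (fun p : ℝ × ℝ => u p * φ p.1)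
      ((volume.restrict univ).prod (volume.restrict (Ioo 0 ε))) := by
    rw [Measure.restrict_univ]
    have h := Integrable.mul_prod (ν := volume.restrict (Ioo 0 ε)) (hφi.abs.const_mul C)
      (integrable_const (1 : ℝ))
    refine h.mono' (Continuous.aestronglyMeasurable (by fun_prop))
      (Eventually.of_forall fun p => ?_)
    rw [norm_mul, Real.norm_eq_abs, Real.norm_eq_abs, mul_one]
    gcongr; exact hC _
  rw [Measure.volume_eq_prod, ← Measure.prod_restrict, integral_prod_symm _ hint,
    intervalIntegral.integral_of_le hε.le, integral_Ioc_eq_integral_Ioo, Measure.restrict_univ]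

lemma hasZeroTrace_kernel : HasZeroTrace kernel := by
  obtain ⟨C, _, hC⟩ := exists_kernel_le 0
  simp only [pow_zero, one_mul] at hC
  exact hasZeroTrace_of_continuous continuous_kernel hC kernel_boundary

/-! ### Fourier transform of the kernel -/

lemma integrable_layer {r : ℝ} (hr : r ∈ Icc (0 : ℝ) 1) : Integrable (layer r) := by
  obtain ⟨C, _, hC⟩ := exists_layer_le 2
  exact integrable_of_forall_le (continuous_layer hr) (hC r hr)

/-- Fourier inversion for the layers. -/
lemma integral_layer_mul_cexp {r : ℝ} (hr : r ∈ Icc (0 : ℝ) 1) (k : ℝ) :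
    ∫ x, (layer r x : ℂ) * Complex.exp (-(Complex.I * (k * x)))
      = 2 * Real.pi * Complex.I * density r k := by
  have hpi := Real.pi_pos
  set f : ℝ → ℂ := fun k => (density r k : ℂ) with hf
  have hw : ∀ x, waveIntegral (density r) x = -Complex.I * layer r x := by
    intro x; rw [layer_eq hr]; linear_combination waveIntegral (density r) x * Complex.I_mul_I
  have hinv : ∀ v, FourierTransformInv.fourierInv f v = -Complex.I * layer r (2 * Real.pi * v) := by
    intro v
    rw [Real.fourierInv_eq', ← hw, waveIntegral]
    congr 1; ext k
    rw [smul_eq_mul]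
    congr 2
    simp
    ring
  have hfor : ∀ v, FourierTransform.fourier f v
      = -Complex.I * layer r (-(2 * Real.pi) * v) := by
    intro v
    rw [Real.fourier_eq', ← hw, waveIntegral]
    congr 1; ext k
    rw [smul_eq_mul]
    congr 2
    simp
    ring
  have hint : Integrable (FourierTransform.fourier f) := by
    rw [show FourierTransform.fourier f = _ from funext hfor]
    exact (((integrable_layer hr).comp_mul_left' (by
      rw [neg_ne_zero]; positivity)).ofReal).const_mul _
  have h := congrFun ((Complex.continuous_ofReal.comp
    (continuous_density_right r)).fourier_fourierInv_eq (integrable_density hr).ofReal hint) k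
  rw [Real.fourier_eq'] at h
  have e := Measure.integral_comp_mul_left
    (fun x : ℝ => (layer r x : ℂ) * Complex.exp (-(Complex.I * (k * x)))) (2 * Real.pi)
  have e2 : ∀ v : ℝ, Complex.exp (((-2 * Real.pi * inner ℝ v k : ℝ) : ℂ) * Complex.I) •
      FourierTransformInv.fourierInv f v = -Complex.I * ((layer r (2 * Real.pi * v) : ℂ) *
        Complex.exp (-(Complex.I * (k * ((2 * Real.pi * v : ℝ) : ℂ))))) := by
    intro v
    rw [hinv, smul_eq_mul]
    have : ((-2 * Real.pi * inner ℝ v k : ℝ) : ℂ) * Complex.I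
        = -(Complex.I * (k * ((2 * Real.pi * v : ℝ) : ℂ))) := by
      simp; ring
    rw [this]; ring
  have h' : ∫ v : ℝ, -Complex.I * ((layer r (2 * Real.pi * v) : ℂ) *
        Complex.exp (-(Complex.I * (k * ((2 * Real.pi * v : ℝ) : ℂ))))) = density r k := by
    rw [← show Complex.ofReal (density r k) = _ from rfl]
    refine Eq.trans ?_ h
    exact integral_congr_ae (Eventually.of_forall fun v => (e2 v).symm)
  rw [integral_const_mul, e, abs_of_pos (by positivity), Complex.real_smul] at h'
  have hpi' : (Real.pi : ℂ) ≠ 0 := by exact_mod_cast hpi.ne'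
  rw [← h']
  generalize ∫ y : ℝ, (layer r y : ℂ) * Complex.exp (-(Complex.I * (k * y))) = Z
  push_cast
  field_simp
  linear_combination Z * Complex.I_sq

/-! ### Fourier transform and momentum of the kernel -/

/-- The first moment of an oscillating Gaussian. -/
lemma integral_mul_cexp_neg_sq {b : ℝ} (hb : 0 < b) (a : ℝ) :
    Integrable (fun x : ℝ => Complex.exp (-b * x ^ 2 + Complex.I * a * x)) ∧
    Integrable (fun x : ℝ => (x : ℂ) * Complex.exp (-b * x ^ 2 + Complex.I * a * x)) ∧
    ∫ x : ℝ, (x : ℂ) * Complex.exp (-b * x ^ 2 + Complex.I * a * x)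
      = Complex.I * a / (2 * b) * ∫ x : ℝ, Complex.exp (-b * x ^ 2 + Complex.I * a * x) := by
  have hn : ∀ x : ℝ, ‖Complex.exp (-b * x ^ 2 + Complex.I * a * x)‖ = Real.exp (-b * x ^ 2) := by
    intro x
    rw [Complex.norm_exp]
    congr 1
    have : (-b * x ^ 2 + Complex.I * a * x : ℂ)
        = ((-b * x ^ 2 : ℝ) : ℂ) + ((a * x : ℝ) : ℂ) * Complex.I := by push_cast; ring
    rw [this, Complex.add_re, Complex.ofReal_re, Complex.re_ofReal_mul, Complex.I_re]
    ring
  have h1 : Integrable (fun x : ℝ => Complex.exp (-b * x ^ 2 + Complex.I * a * x)) := by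
    refine (integrable_exp_neg_mul_sq hb).mono' (Continuous.aestronglyMeasurable (by fun_prop))
      (Eventually.of_forall fun x => (hn x).le)
  have h2 : Integrable (fun x : ℝ => (x : ℂ) * Complex.exp (-b * x ^ 2 + Complex.I * a * x)) := by
    refine (integrable_mul_exp_neg_mul_sq hb).norm.mono'
      (Continuous.aestronglyMeasurable (by fun_prop)) (Eventually.of_forall fun x => ?_)
    rw [norm_mul, hn, norm_mul, Complex.norm_real, Real.norm_of_nonneg (Real.exp_pos _).le]
  refine ⟨h1, h2, ?_⟩
  have h : ∫ x : ℝ, (Complex.I * a * Complex.exp (-b * x ^ 2 + Complex.I * a * x)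
      - 2 * b * ((x : ℂ) * Complex.exp (-b * x ^ 2 + Complex.I * a * x))) = 0 := by
    apply integral_eq_zero_of_hasDerivAt_of_integrable
      (f := fun x : ℝ => Complex.exp (-b * x ^ 2 + Complex.I * a * x)) _
      ((h1.const_mul _).sub (h2.const_mul _)) h1
    intro x
    have hx := Complex.ofRealCLM.hasDerivAt (x := x)
    have := (((hx.pow 2).const_mul (-b : ℂ)).add (hx.const_mul (Complex.I * a))).cexp
    refine this.congr_deriv ?_
    simp
    ring
  rw [integral_sub (h1.const_mul _) (h2.const_mul _), integral_const_mul, integral_const_mul] at h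
  have hb' : (b : ℂ) ≠ 0 := by exact_mod_cast hb.ne'
  rw [div_mul_eq_mul_div, eq_div_iff (by simpa using hb')]
  linear_combination -h

lemma integral_prod_test {f : ℝ × ℝ → ℝ} {k : ℝ} {g : ℝ → ℂ} {M : ℝ → ℂ}
    (hi : Integrable fun p : ℝ × ℝ =>
      (f p : ℂ) * (Complex.exp (-(Complex.I * (k * p.1))) * g p.2))
    (h : ∀ Y, ∫ X : ℝ, (f (X, Y) : ℂ) * Complex.exp (-(Complex.I * (k * X))) = M Y) :
    ∫ p : ℝ × ℝ, (f p : ℂ) * (Complex.exp (-(Complex.I * (k * p.1))) * g p.2)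
      = ∫ Y, M Y * g Y := by
  rw [Measure.volume_eq_prod, integral_prod_symm _ hi]
  congr 1; ext Y
  rw [← h, ← integral_mul_const]
  congr 1; ext X
  ring

/-- The Fourier transform in `X` of the initial contribution. -/
lemma integral_initialProfile_mul_cexp (k Y : ℝ) :
    ∫ X : ℝ, (initialProfile (X, Y) : ℂ) * Complex.exp (-(Complex.I * (k * X)))
      = ((1 / (2 * √Real.pi) : ℝ) : ℂ) * (Y - Complex.I * k) *
        Complex.exp (-(Y : ℂ) ^ 2 / 4 - Complex.I * k * Y / 2 - (k : ℂ) ^ 2 / 12) := by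
  obtain ⟨h1, h2, h3⟩ := integral_mul_cexp_neg_sq (b := 3) (by norm_num) (-k)
  rw [← integral_add_right_eq_self (μ := (volume : Measure ℝ)) _ (Y / 2)]
  have e : ∀ x : ℝ, (initialProfile (x + Y / 2, Y) : ℂ)
      * Complex.exp (-(Complex.I * (k * ((x + Y / 2 : ℝ) : ℂ))))
      = (√3 / (2 * Real.pi) : ℝ) * Complex.exp (-(Y : ℂ) ^ 2 / 4 - Complex.I * k * Y / 2) *
        (6 * ((x : ℂ) * Complex.exp (-(3 : ℝ) * x ^ 2 + Complex.I * (-k : ℝ) * x))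
          + Y * Complex.exp (-(3 : ℝ) * x ^ 2 + Complex.I * (-k : ℝ) * x)) := by
    intro x
    simp only [initialProfile]
    rw [Complex.ofReal_mul, Complex.ofReal_mul, Complex.ofReal_exp]
    have : Complex.exp ((-Y ^ 2 / 4 - 3 * (x + Y / 2 - Y / 2) ^ 2 : ℝ) : ℂ)
        * Complex.exp (-(Complex.I * (k * ((x + Y / 2 : ℝ) : ℂ))))
        = Complex.exp (-(Y : ℂ) ^ 2 / 4 - Complex.I * k * Y / 2)
          * Complex.exp (-(3 : ℝ) * x ^ 2 + Complex.I * (-k : ℝ) * x) := by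
      rw [← Complex.exp_add, ← Complex.exp_add]
      congr 1; push_cast; ring
    rw [mul_assoc, mul_assoc (((6 * (x + Y / 2) - 2 * Y : ℝ)) : ℂ), this]
    push_cast
    ring
  simp_rw [e]
  rw [integral_const_mul, integral_add (h2.const_mul _) (h1.const_mul _), integral_const_mul,
    integral_const_mul, h3, integral_cexp_neg_sq (by norm_num)]
  have e3 : Complex.exp (-(Y : ℂ) ^ 2 / 4 - Complex.I * k * Y / 2 - (k : ℂ) ^ 2 / 12)
      = Complex.exp (-(Y : ℂ) ^ 2 / 4 - Complex.I * k * Y / 2)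
        * Complex.exp ((Complex.I * (-k : ℝ)) ^ 2 / (4 * (3 : ℝ))) := by
    rw [← Complex.exp_add, mul_pow, Complex.I_sq]
    congr 1; push_cast; ring
  rw [e3]
  have e4 : √3 / (2 * Real.pi) * √(Real.pi / 3) = 1 / (2 * √Real.pi) := by
    have : √Real.pi * √Real.pi = Real.pi := Real.mul_self_sqrt Real.pi_pos.le
    rw [Real.sqrt_div Real.pi_pos.le]
    have h5 : √Real.pi ≠ 0 := by positivity
    field_simp
    rw [sq, this]
  rw [← e4]
  push_cast
  ring

/-- The Fourier transform in `X` of a layer. -/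
lemma integral_layerProfile_mul_cexp {r : ℝ} (hr : r ∈ Ioc (0 : ℝ) 1) (k Y : ℝ) :
    ∫ X : ℝ, (layerProfile r (X, Y) : ℂ) * Complex.exp (-(Complex.I * (k * X)))
      = ((r ^ (-(1 / 2) : ℝ) * density r k : ℝ) : ℂ) * (2 * Real.pi * Complex.I) *
        Complex.exp (-((1 / (4 * r) : ℝ) : ℂ) * Y ^ 2 + Complex.I * (-(k * r / 2) : ℝ) * Y) := by
  rw [← integral_add_right_eq_self (μ := (volume : Measure ℝ)) _ (r * Y / 2)]
  have e : ∀ x : ℝ, (layerProfile r (x + r * Y / 2, Y) : ℂ)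
      * Complex.exp (-(Complex.I * (k * ((x + r * Y / 2 : ℝ) : ℂ))))
      = (r ^ (-(1 / 2) : ℝ) : ℝ) * Complex.exp (-((1 / (4 * r) : ℝ) : ℂ) * Y ^ 2
          + Complex.I * (-(k * r / 2) : ℝ) * Y) *
        ((layer r x : ℂ) * Complex.exp (-(Complex.I * (k * x)))) := by
    intro x
    simp only [layerProfile]
    rw [Complex.ofReal_mul, Complex.ofReal_mul, Complex.ofReal_exp, add_sub_cancel_right]
    have : Complex.exp ((-Y ^ 2 / (4 * r) : ℝ) : ℂ)
        * Complex.exp (-(Complex.I * (k * ((x + r * Y / 2 : ℝ) : ℂ))))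
        = Complex.exp (-((1 / (4 * r) : ℝ) : ℂ) * Y ^ 2 + Complex.I * (-(k * r / 2) : ℝ) * Y)
          * Complex.exp (-(Complex.I * (k * x))) := by
      rw [← Complex.exp_add, ← Complex.exp_add]
      congr 1; push_cast; ring
    linear_combination ((r ^ (-(1 / 2) : ℝ) : ℝ) : ℂ) * layer r x * this
  simp_rw [e]
  rw [integral_const_mul, integral_layer_mul_cexp (Ioc_subset_Icc_self hr)]
  push_cast
  ring

/-- Testing the kernel against a product of a character in `X` and a function of `Y`. -/
lemma integral_kernel_mul_prod (k : ℝ) {g : ℝ → ℂ} {D : ℝ} (hg : AEStronglyMeasurable g)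
    (hD : ∀ Y, ‖g Y‖ ≤ D * (1 + |Y|)) :
    ∫ p : ℝ × ℝ, (kernel p : ℂ) * (Complex.exp (-(Complex.I * (k * p.1))) * g p.2)
      = (∫ Y : ℝ, ((1 / (2 * √Real.pi) : ℝ) : ℂ) * (Y - Complex.I * k) *
          Complex.exp (-(Y : ℂ) ^ 2 / 4 - Complex.I * k * Y / 2 - (k : ℂ) ^ 2 / 12) * g Y)
        + ((1 / (4 * Real.pi * √Real.pi) : ℝ) : ℂ) * ∫ r in (0 : ℝ)..1, ∫ Y : ℝ,
          ((r ^ (-(1 / 2) : ℝ) * density r k : ℝ) : ℂ) * (2 * Real.pi * Complex.I) *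
          Complex.exp (-((1 / (4 * r) : ℝ) : ℂ) * Y ^ 2 + Complex.I * (-(k * r / 2) : ℝ) * Y)
          * g Y := by
  have hw : AEStronglyMeasurable
      (fun p : ℝ × ℝ => Complex.exp (-(Complex.I * (k * p.1))) * g p.2) :=
    (Continuous.aestronglyMeasurable (by fun_prop)).mul hg.comp_snd
  have hwD : ∀ p : ℝ × ℝ, ‖Complex.exp (-(Complex.I * (k * p.1))) * g p.2‖ ≤ D * (1 + |p.2|) := by
    intro p
    have : -(Complex.I * (k * p.1)) = Complex.I * ((-k : ℝ) * p.1) := by push_cast; ring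
    rw [norm_mul, this, norm_exp_I_mul, one_mul]
    exact hD _
  rw [integral_kernel_mul hw hwD, integral_prod_test (integrable_initialProfile_mul hw hwD)
    (integral_initialProfile_mul_cexp k)]
  congr 2
  rw [intervalIntegral.integral_of_le zero_le_one, intervalIntegral.integral_of_le zero_le_one]
  apply setIntegral_congr_fun measurableSet_Ioc
  intro r hr
  exact integral_prod_test (integrable_layerProfile_mul hr hw hwD)
    (integral_layerProfile_mul_cexp hr k)

lemma integral_sq_mul_exp_Ioi : ∫ Y in Ioi (0 : ℝ), Y ^ 2 * Real.exp (-Y ^ 2 / 4) = 2 * √Real.pi := by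
  have h := integral_rpow_mul_exp_neg_mul_rpow (p := 2) (q := 2) (b := 1 / 4) (by norm_num)
    (by norm_num) (by norm_num)
  have e : ∀ Y : ℝ, Y ^ (2 : ℝ) * Real.exp (-(1 / 4) * Y ^ (2 : ℝ)) = Y ^ 2 * Real.exp (-Y ^ 2 / 4) := by
    intro Y
    rw [Real.rpow_two]; congr 2; ring
  simp only [e] at h
  rw [h, show ((2 : ℝ) + 1) / 2 = 1 / 2 + 1 by norm_num, Real.Gamma_add_one (by norm_num),
    Real.Gamma_one_half_eq]
  have : (1 / 4 : ℝ) ^ (-(2 + 1) / 2 : ℝ) = 8 := by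
    rw [show (1 / 4 : ℝ) = (2 : ℝ) ^ (-2 : ℝ) by
      rw [Real.rpow_neg (by norm_num), Real.rpow_two]; norm_num, ← Real.rpow_mul (by norm_num),
      show (-2 : ℝ) * (-(2 + 1) / 2) = (3 : ℕ) by norm_num, Real.rpow_natCast]
    norm_num
  rw [this]; ring

/-- At zero frequency the layers do not contribute: their densities vanish at `k = 0`. -/
lemma momentum_kernel : ∫ p in halfPlane, p.2 * kernel p = 1 := by
  have hm : MeasurableSet halfPlane := measurableSet_lt measurable_const measurable_snd
  set g : ℝ → ℂ := (Ioi (0 : ℝ)).indicator fun Y => (Y : ℂ) with hg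
  have h := integral_kernel_mul_prod 0 (g := g) (D := 1)
    (AEStronglyMeasurable.indicator (Continuous.aestronglyMeasurable (by fun_prop))
      measurableSet_Ioi)
    (fun Y => by
      refine (norm_indicator_le_norm_self _ _).trans ?_
      rw [Complex.norm_real, Real.norm_eq_abs]; linarith)
  have hz : ∀ r, density r 0 = 0 := by simp [density]
  simp only [hz, mul_zero, Complex.ofReal_zero, zero_mul, integral_zero,
    intervalIntegral.integral_zero, add_zero, neg_zero, Complex.exp_zero, one_mul, sub_zero,
    zero_div, ne_eq, OfNat.ofNat_ne_zero, not_false_eq_true, zero_pow] at h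
  have e1 : ∫ p : ℝ × ℝ, (kernel p : ℂ) * g p.2 = ((∫ p in halfPlane, p.2 * kernel p : ℝ) : ℂ) := by
    rw [← integral_indicator hm]
    refine Eq.trans ?_ integral_complex_ofReal
    congr 1; ext p
    by_cases hp : 0 < p.2
    · rw [indicator_of_mem (show p ∈ halfPlane from hp), hg, indicator_of_mem (show p.2 ∈ Ioi 0 from hp)]
      push_cast; ring
    · rw [indicator_of_notMem (show p ∉ halfPlane from hp), hg,
        indicator_of_notMem (show p.2 ∉ Ioi 0 from hp)]
      simp
  have e2 : ∫ Y : ℝ, ((1 / (2 * √Real.pi) : ℝ) : ℂ) * Y * Complex.exp (-(Y : ℂ) ^ 2 / 4) * g Y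
      = ((1 / (2 * √Real.pi) * ∫ Y in Ioi (0 : ℝ), Y ^ 2 * Real.exp (-Y ^ 2 / 4) : ℝ) : ℂ) := by
    rw [← integral_const_mul, ← integral_indicator measurableSet_Ioi]
    refine Eq.trans ?_ integral_complex_ofReal
    congr 1; ext Y
    by_cases hY : Y ∈ Ioi (0 : ℝ)
    · rw [indicator_of_mem hY, hg, indicator_of_mem hY]
      push_cast; ring
    · rw [indicator_of_notMem hY, hg, indicator_of_notMem hY]
      simp
  rw [e1, e2, integral_sq_mul_exp_Ioi] at h
  have h' := Complex.ofReal_injective h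
  rw [h']
  have : √Real.pi ≠ 0 := by positivity
  field_simp

lemma centralExtension_kernel : centralExtension kernel = kernel := by
  ext p
  unfold centralExtension
  split_ifs with h1 h2
  · rfl
  · rw [kernel_neg, neg_neg]
  · rw [show p = (p.1, 0) from Prod.ext rfl (le_antisymm (not_lt.1 h1) (not_lt.1 h2)), kernel_boundary]

/-- The Fourier transform of the kernel, before the change of variables. -/
lemma fourierPlane_kernel (k η : ℝ) :
    fourierPlane kernel k η
      = -2 * Complex.I * (((k + η) * Real.exp (-(η ^ 2 + η * k + k ^ 2 / 3)) : ℝ) : ℂ)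
        + ∫ r in (0 : ℝ)..1, Complex.I *
          ((Real.exp (-r * (η + k * r / 2) ^ 2) * density r k : ℝ) : ℂ) := by
  have h := integral_kernel_mul_prod k (g := fun Y => Complex.exp (-(Complex.I * (η * Y)))) (D := 1)
    (Continuous.aestronglyMeasurable (by fun_prop)) (fun Y => by
      have : -(Complex.I * (η * Y)) = Complex.I * ((-η : ℝ) * Y) := by push_cast; ring
      rw [this, norm_exp_I_mul]
      linarith [abs_nonneg Y])
  have e0 : fourierPlane kernel k η = ∫ p : ℝ × ℝ, (kernel p : ℂ) *
      (Complex.exp (-(Complex.I * (k * p.1))) * Complex.exp (-(Complex.I * (η * p.2)))) := by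
    unfold fourierPlane
    congr 1; ext p
    rw [← Complex.exp_add, sub_eq_add_neg]
  rw [e0, h]
  have hpi : √Real.pi ≠ 0 := by positivity
  congr 1
  · obtain ⟨h1, h2, h3⟩ := integral_mul_cexp_neg_sq (b := 1 / 4) (by norm_num) (-(k / 2 + η))
    have e : ∀ Y : ℝ, ((1 / (2 * √Real.pi) : ℝ) : ℂ) * (Y - Complex.I * k) *
          Complex.exp (-(Y : ℂ) ^ 2 / 4 - Complex.I * k * Y / 2 - (k : ℂ) ^ 2 / 12)
          * Complex.exp (-(Complex.I * (η * Y)))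
        = ((1 / (2 * √Real.pi) : ℝ) : ℂ) * Complex.exp (-(k : ℂ) ^ 2 / 12) *
          ((Y : ℂ) * Complex.exp (-(1 / 4 : ℝ) * Y ^ 2 + Complex.I * (-(k / 2 + η) : ℝ) * Y)
          - Complex.I * k * Complex.exp (-(1 / 4 : ℝ) * Y ^ 2 + Complex.I * (-(k / 2 + η) : ℝ) * Y)) := by
      intro Y
      have : Complex.exp (-(Y : ℂ) ^ 2 / 4 - Complex.I * k * Y / 2 - (k : ℂ) ^ 2 / 12)
          * Complex.exp (-(Complex.I * (η * Y))) = Complex.exp (-(k : ℂ) ^ 2 / 12) *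
          Complex.exp (-(1 / 4 : ℝ) * Y ^ 2 + Complex.I * (-(k / 2 + η) : ℝ) * Y) := by
        rw [← Complex.exp_add, ← Complex.exp_add]
        congr 1; push_cast; ring
      rw [mul_assoc, this]; ring
    simp_rw [e]
    rw [integral_const_mul, integral_sub h2 (h1.const_mul _), integral_const_mul, h3,
      integral_cexp_neg_sq (by norm_num)]
    have e2 : √(Real.pi / (1 / 4)) = 2 * √Real.pi := by
      rw [show Real.pi / (1 / 4) = 2 ^ 2 * Real.pi by ring, Real.sqrt_mul (by norm_num),
        Real.sqrt_sq (by norm_num)]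
    have e3 : ((Real.exp (-(η ^ 2 + η * k + k ^ 2 / 3)) : ℝ) : ℂ) = Complex.exp (-(k : ℂ) ^ 2 / 12)
        * Complex.exp ((Complex.I * (-(k / 2 + η) : ℝ)) ^ 2 / (4 * (1 / 4 : ℝ))) := by
      rw [← Complex.exp_add, mul_pow, Complex.I_sq, Complex.ofReal_exp]
      congr 1; push_cast; ring
    rw [Complex.ofReal_mul, e3, e2]
    have hpi' : ((√Real.pi : ℝ) : ℂ) ≠ 0 := by exact_mod_cast hpi
    push_cast
    field_simp
    ring
  · rw [← intervalIntegral.integral_const_mul, intervalIntegral.integral_of_le zero_le_one,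
      intervalIntegral.integral_of_le zero_le_one]
    apply setIntegral_congr_fun measurableSet_Ioc
    intro r hr
    have hr0 : 0 < r := hr.1
    simp only
    have e : ∀ Y : ℝ, ((r ^ (-(1 / 2) : ℝ) * density r k : ℝ) : ℂ) * (2 * Real.pi * Complex.I) *
          Complex.exp (-((1 / (4 * r) : ℝ) : ℂ) * Y ^ 2 + Complex.I * (-(k * r / 2) : ℝ) * Y)
          * Complex.exp (-(Complex.I * (η * Y)))
        = ((r ^ (-(1 / 2) : ℝ) * density r k : ℝ) : ℂ) * (2 * Real.pi * Complex.I) *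
          Complex.exp (-((1 / (4 * r) : ℝ) : ℂ) * Y ^ 2
            + Complex.I * (-(η + k * r / 2) : ℝ) * Y) := by
      intro Y
      rw [mul_assoc, ← Complex.exp_add]
      congr 2; push_cast; ring
    simp_rw [e]
    rw [integral_const_mul, integral_cexp_neg_sq (by positivity)]
    have e2 : r ^ (-(1 / 2) : ℝ) * √(Real.pi / (1 / (4 * r))) = 2 * √Real.pi := by
      rw [show Real.pi / (1 / (4 * r)) = 2 ^ 2 * Real.pi * r by field_simp; norm_num,
        Real.sqrt_mul (by positivity), Real.sqrt_mul (by norm_num), Real.sqrt_sq (by norm_num),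
        Real.rpow_neg hr0.le, ← Real.sqrt_eq_rpow]
      have : √r ≠ 0 := by positivity
      field_simp
    have e3 : ((Real.exp (-r * (η + k * r / 2) ^ 2) : ℝ) : ℂ)
        = Complex.exp ((Complex.I * (-(η + k * r / 2) : ℝ)) ^ 2 / (4 * (1 / (4 * r) : ℝ))) := by
      rw [mul_pow, Complex.I_sq, Complex.ofReal_exp]
      congr 1
      have : (r : ℂ) ≠ 0 := by exact_mod_cast hr0.ne'
      push_cast; field_simp
    rw [Complex.ofReal_mul (Real.exp _), e3]
    have e4 : ((1 / (4 * Real.pi * √Real.pi) : ℝ) : ℂ) * ((r ^ (-(1 / 2) : ℝ) : ℝ)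
        * (√(Real.pi / (1 / (4 * r))) : ℝ)) * (2 * Real.pi) = 1 := by
      rw [← Complex.ofReal_mul, e2]
      norm_cast
      field_simp
      norm_num
    rw [Complex.ofReal_mul]
    linear_combination (Complex.I * density r k * Complex.exp ((Complex.I *
      (-(η + k * r / 2) : ℝ)) ^ 2 / (4 * (1 / (4 * r) : ℝ)))) * e4

/-! ### The characteristic formula -/

lemma solvesVolterra_volterraSeries : SolvesVolterra fun t => Complex.I * volterraSeries (t ^ 3) := by
  intro τ hτ
  rw [← volterraSeries_convolution hτ, ← intervalIntegral.integral_ofReal,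
    ← intervalIntegral.integral_const_mul]
  congr 1; ext s
  push_cast; ring

/-- The substitution `l = |k| (1 - r)^(3/2)` in `fourierPlane_kernel`. -/
lemma fourierPlane_kernel_eq_characteristicFormula (k η : ℝ) :
    fourierPlane kernel k η
      = characteristicFormula (boundaryDatum fun t => Complex.I * volterraSeries (t ^ 3)) k η := by
  rw [fourierPlane_kernel, characteristicFormula,
    show -(η ^ 2 + η * k + k ^ 2 / 3) = -(k + η) ^ 2 + k * (k + η) - 1 / 3 * k ^ 2 by ring]
  congr 1
  rcases eq_or_ne k 0 with rfl | hk
  · simp [density]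
  have hk0 : 0 < |k| := abs_pos.2 hk
  set f : ℝ → ℝ := fun r => |k| * (1 - r) ^ (3 / 2 : ℝ) with hf
  have hinj : InjOn f (Ioo 0 1) := by
    intro a ha b hb hab
    have h := mul_left_cancel₀ hk0.ne' hab
    have := (Real.rpow_left_inj (by linarith [ha.2]) (by linarith [hb.2]) (by norm_num)).1 h
    linarith
  have hd : ∀ r ∈ Ioo (0 : ℝ) 1, HasDerivWithinAt f (|k| * (-1 * (3 / 2) * (1 - r) ^ (1 / 2 : ℝ)))
      (Ioo 0 1) r := by
    intro r hr
    have h := ((((hasDerivAt_id r).const_sub 1).rpow_const (p := 3 / 2)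
      (Or.inl (by simp only [id]; linarith [hr.2]))).const_mul |k|).hasDerivWithinAt (s := Ioo 0 1)
    simp only [id] at h
    refine h.congr_deriv ?_
    norm_num
  have himg : f '' Ioo 0 1 = Ioo 0 |k| := by
    ext l
    constructor
    · rintro ⟨r, hr, rfl⟩
      have h1 : 0 < 1 - r := by linarith [hr.2]
      refine ⟨by positivity, ?_⟩
      have : (1 - r) ^ (3 / 2 : ℝ) < 1 := Real.rpow_lt_one h1.le (by linarith [hr.1]) (by norm_num)
      simp only [hf]; nlinarith
    · rintro ⟨h0, h1⟩
      have hq0 : 0 < l / |k| := by positivity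
      have hq1 : l / |k| < 1 := (div_lt_one hk0).2 h1
      refine ⟨1 - (l / |k|) ^ (2 / 3 : ℝ), ⟨?_, ?_⟩, ?_⟩
      · linarith [Real.rpow_lt_one hq0.le hq1 (z := 2 / 3) (by norm_num)]
      · linarith [Real.rpow_pos_of_pos hq0 (2 / 3)]
      · simp only [hf, sub_sub_cancel]
        rw [← Real.rpow_mul hq0.le, show (2 / 3 : ℝ) * (3 / 2) = 1 by norm_num, Real.rpow_one]
        field_simp
  rw [intervalIntegral.integral_of_le hk0.le, intervalIntegral.integral_of_le zero_le_one,
    integral_Ioc_eq_integral_Ioo, integral_Ioc_eq_integral_Ioo, ← himg,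
    integral_image_eq_integral_abs_deriv_smul measurableSet_Ioo hd hinj, ← integral_const_mul]
  apply setIntegral_congr_fun measurableSet_Ioo
  intro r hr
  have hs : 0 < 1 - r := by linarith [hr.2]
  simp only
  set s := 1 - r with hs'
  have hr' : r = 1 - s := by rw [hs']; ring
  have q1 : f r / |k| = s ^ (3 / 2 : ℝ) := by
    simp only [hf]; rw [← hs']; field_simp
  have q2 : |k| / f r = s ^ (-(3 / 2) : ℝ) := by
    rw [Real.rpow_neg hs.le, ← q1, inv_div]
  have p1 : (s ^ (3 / 2 : ℝ)) ^ (2 / 3 : ℝ) = s := by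
    rw [← Real.rpow_mul hs.le, show (3 / 2 : ℝ) * (2 / 3) = 1 by norm_num, Real.rpow_one]
  have p2 : (s ^ (3 / 2 : ℝ)) ^ (4 / 3 : ℝ) = s ^ 2 := by
    rw [← Real.rpow_mul hs.le, show (3 / 2 : ℝ) * (4 / 3) = (2 : ℕ) by norm_num, Real.rpow_natCast]
  have p3 : (s ^ (-(3 / 2) : ℝ)) ^ (1 / 3 : ℝ) = s ^ (-(1 / 2) : ℝ) := by
    rw [← Real.rpow_mul hs.le]; norm_num
  have p4 : (s ^ (3 / 2 : ℝ)) ^ 2 = s ^ 3 := by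
    rw [← Real.rpow_natCast, ← Real.rpow_mul hs.le,
      show (3 / 2 : ℝ) * (2 : ℕ) = (3 : ℕ) by norm_num, Real.rpow_natCast]
  have hfr : 0 < f r := by simp only [hf]; positivity
  have p5 : (f r) ^ 2 = k ^ 2 * s ^ 3 := by
    simp only [hf]; rw [mul_pow, sq_abs, ← hs', p4]
  have hsgn : |(SignType.sign k : ℝ) * f r| = f r := by
    rcases hk.lt_or_gt with h | h
    · simp [sign_neg h, abs_of_pos hfr]
    · simp [sign_pos h, abs_of_pos hfr]
  have hsgn' : |k| * (SignType.sign k : ℝ) = k := by rw [mul_comm]; exact sign_mul_abs k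
  have p6 : ((f r) ^ (2 / 3 : ℝ)) ^ 3 = k ^ 2 * s ^ 3 := by
    rw [← Real.rpow_natCast, ← Real.rpow_mul hfr.le,
      show (2 / 3 : ℝ) * (3 : ℕ) = (2 : ℕ) by norm_num, Real.rpow_natCast, p5]
  have p7 : s ^ (1 / 2 : ℝ) * s ^ (-(1 / 2) : ℝ) = 1 := by
    rw [← Real.rpow_add hs]; norm_num
  have habs : |(|k| * (-1 * (3 / 2) * s ^ (1 / 2 : ℝ)))| = |k| * (3 / 2) * s ^ (1 / 2 : ℝ) := by
    rw [abs_mul, abs_abs, abs_mul, abs_of_pos (Real.rpow_pos_of_pos hs _)]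
    norm_num [mul_assoc]
  rw [q1, q2, p1, p2, p3, habs, boundaryDatum, hsgn, p6, p5]
  have hexp : Real.exp (-(k + η) ^ 2 * (1 - s) + k * (k + η) * (1 - s ^ 2)
      - 1 / 3 * (k ^ 2 - k ^ 2 * s ^ 3))
      = Real.exp (-r * (η + k * r / 2) ^ 2) * Real.exp (-(r ^ 3 * k ^ 2) / 12) := by
    rw [← Real.exp_add]; congr 1; rw [hr']; ring
  have hfr' : (f r : ℂ) ≠ 0 := by exact_mod_cast hfr.ne'
  rw [hexp, density, ← hs', mul_comm (s ^ 3), Complex.real_smul]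
  have c7 : ((s ^ (1 / 2 : ℝ) : ℝ) : ℂ) * ((s ^ (-(1 / 2) : ℝ) : ℝ) : ℂ) = 1 := by
    exact_mod_cast p7
  have csgn : ((|k| : ℝ) : ℂ) * ((SignType.sign k : ℝ) : ℂ) = k := by exact_mod_cast hsgn'
  simp only [Complex.ofReal_mul, Complex.ofReal_div, Complex.ofReal_ofNat]
  field_simp
  linear_combination -(Complex.ofReal (volterraSeries (k ^ 2 * s ^ 3))
    * Complex.ofReal (s ^ (1 / 2 : ℝ)) * Complex.ofReal (s ^ (-(1 / 2) : ℝ))) * csgn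
    - Complex.ofReal (volterraSeries (k ^ 2 * s ^ 3)) * k * c7

/-! ### The operator and its formal adjoint -/

lemma partialX_eq {v : ℝ × ℝ → ℝ} {p : ℝ × ℝ} {d : ℝ} (hv : DifferentiableAt ℝ v p)
    (h : HasDerivAt (fun t => v (t, p.2)) d p.1) : partialX v p = d := by
  have h1 : HasDerivAt (fun t : ℝ => (t, p.2)) ((1 : ℝ), (0 : ℝ)) p.1 :=
    (hasDerivAt_id p.1).prodMk (hasDerivAt_const _ _)
  exact (hv.hasFDerivAt.comp_hasDerivAt (f := fun t : ℝ => (t, p.2)) p.1 h1).unique h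

lemma partialY_eq {v : ℝ × ℝ → ℝ} {p : ℝ × ℝ} {d : ℝ} (hv : DifferentiableAt ℝ v p)
    (h : HasDerivAt (fun t => v (p.1, t)) d p.2) : partialY v p = d := by
  have h1 : HasDerivAt (fun t : ℝ => (p.1, t)) ((0 : ℝ), (1 : ℝ)) p.2 :=
    (hasDerivAt_const _ _).prodMk (hasDerivAt_id p.2)
  exact (hv.hasFDerivAt.comp_hasDerivAt (f := fun t : ℝ => (p.1, t)) p.2 h1).unique h

lemma contDiff_partialX {v : ℝ × ℝ → ℝ} (hv : ContDiff ℝ ∞ v) : ContDiff ℝ ∞ (partialX v) :=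
  (hv.fderiv_right (m := ∞) (by simp)).clm_apply contDiff_const

lemma contDiff_partialY {v : ℝ × ℝ → ℝ} (hv : ContDiff ℝ ∞ v) : ContDiff ℝ ∞ (partialY v) :=
  (hv.fderiv_right (m := ∞) (by simp)).clm_apply contDiff_const

lemma tsupport_partialX_subset (v : ℝ × ℝ → ℝ) : tsupport (partialX v) ⊆ tsupport v :=
  tsupport_fderiv_apply_subset ℝ (1, 0)

lemma tsupport_partialY_subset (v : ℝ × ℝ → ℝ) : tsupport (partialY v) ⊆ tsupport v :=
  tsupport_fderiv_apply_subset ℝ (0, 1)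

/-- The operator `𝓛`, applied to a classical function. -/
noncomputable def operatorL (v : ℝ × ℝ → ℝ) (p : ℝ × ℝ) : ℝ :=
  partialY (partialY v) p + (3 / 2) * p.1 * partialX v p + (1 / 2) * p.2 * partialY v p
    + (5 / 2) * v p - p.2 * partialX v p

lemma integrable_mul_of_compact {v φ : ℝ × ℝ → ℝ} (hv : Continuous v) (hφ : Continuous φ)
    (hc : HasCompactSupport φ) : Integrable fun p => v p * φ p :=
  (hv.mul hφ).integrable_of_hasCompactSupport hc.mul_left

lemma integral_mul_fderiv {v φ : ℝ × ℝ → ℝ} (hv : ContDiff ℝ ∞ v) (hφ : ContDiff ℝ ∞ φ)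
    (hc : HasCompactSupport φ) (e : ℝ × ℝ) :
    ∫ p, v p * fderiv ℝ φ p e = -∫ p, fderiv ℝ v p e * φ p := by
  have hv' : Continuous fun p => fderiv ℝ v p e :=
    ((hv.fderiv_right (m := ∞) (by simp)).clm_apply contDiff_const).continuous
  have hφ' : Continuous fun p => fderiv ℝ φ p e :=
    ((hφ.fderiv_right (m := ∞) (by simp)).clm_apply contDiff_const).continuous
  exact integral_mul_fderiv_eq_neg_fderiv_mul_of_integrable
    (integrable_mul_of_compact hv' hφ.continuous hc)
    (integrable_mul_of_compact hv.continuous hφ' (hc.fderiv_apply ℝ e))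
    (integrable_mul_of_compact hv.continuous hφ.continuous hc)
    (fun _ _ => hv.differentiable (by simp) _) (fun _ _ => hφ.differentiable (by simp) _)

lemma continuous_adjointL {φ : ℝ × ℝ → ℝ} (hφ : ContDiff ℝ ∞ φ) : Continuous (adjointL φ) := by
  have h1 := (contDiff_partialY (contDiff_partialY hφ)).continuous
  have h2 := (contDiff_partialX (v := fun q => q.1 * φ q) (by fun_prop)).continuous
  have h3 := (contDiff_partialY (v := fun q => q.2 * φ q) (by fun_prop)).continuous
  have h4 := (contDiff_partialX (v := fun q => q.2 * φ q) (by fun_prop)).continuous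
  have h5 := hφ.continuous
  unfold adjointL
  fun_prop

lemma adjointL_eq_zero {φ : ℝ × ℝ → ℝ} {p : ℝ × ℝ} (hp : p ∉ tsupport φ) : adjointL φ p = 0 := by
  have h0 : φ p = 0 := image_eq_zero_of_notMem_tsupport hp
  have h1 : partialY (partialY φ) p = 0 := image_eq_zero_of_notMem_tsupport
    fun h => hp (tsupport_partialY_subset _ (tsupport_partialY_subset _ h))
  have h2 : partialX (fun q => q.1 * φ q) p = 0 := image_eq_zero_of_notMem_tsupport
    fun h => hp (tsupport_mul_subset_right (tsupport_partialX_subset _ h))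
  have h3 : partialY (fun q => q.2 * φ q) p = 0 := image_eq_zero_of_notMem_tsupport
    fun h => hp (tsupport_mul_subset_right (tsupport_partialY_subset _ h))
  have h4 : partialX (fun q => q.2 * φ q) p = 0 := image_eq_zero_of_notMem_tsupport
    fun h => hp (tsupport_mul_subset_right (tsupport_partialX_subset _ h))
  rw [adjointL, h0, h1, h2, h3, h4]; ring

lemma hasCompactSupport_adjointL {φ : ℝ × ℝ → ℝ} (hc : HasCompactSupport φ) :
    HasCompactSupport (adjointL φ) :=
  hc.mono' fun p hp => by
    by_contra h; exact hp (adjointL_eq_zero h)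

lemma integral_linear_combination {a b c d e : ℝ × ℝ → ℝ} (ha : Integrable a) (hb : Integrable b)
    (hc : Integrable c) (hd : Integrable d) (he : Integrable e) (x y z t : ℝ) :
    ∫ p, (a p + x * b p + y * c p + z * d p + t * e p)
      = (∫ p, a p) + x * (∫ p, b p) + y * (∫ p, c p) + z * (∫ p, d p) + t * ∫ p, e p := by
  have hb' := hb.const_mul x
  have hc' := hc.const_mul y
  have hd' := hd.const_mul z
  have he' := he.const_mul t
  have h2 : Integrable fun p => a p + x * b p := ha.add hb'
  have h3 : Integrable fun p => a p + x * b p + y * c p := h2.add hc'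
  have h4 : Integrable fun p => a p + x * b p + y * c p + z * d p := h3.add hd'
  rw [integral_add h4 he', integral_add h3 hd', integral_add h2 hc', integral_add ha hb']
  simp only [integral_const_mul]

lemma integral_mul_adjointL {v φ : ℝ × ℝ → ℝ} (hv : ContDiff ℝ ∞ v) (hφ : ContDiff ℝ ∞ φ)
    (hc : HasCompactSupport φ) : ∫ p, v p * adjointL φ p = ∫ p, operatorL v p * φ p := by
  have a1 : ContDiff ℝ ∞ fun q : ℝ × ℝ => q.1 * φ q := by fun_prop
  have a2 : ContDiff ℝ ∞ fun q : ℝ × ℝ => q.2 * φ q := by fun_prop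
  have c1 : HasCompactSupport fun q : ℝ × ℝ => q.1 * φ q := hc.mul_left
  have c2 : HasCompactSupport fun q : ℝ × ℝ => q.2 * φ q := hc.mul_left
  have cY : HasCompactSupport (partialY φ) := hc.fderiv_apply ℝ _
  have i0 : ∫ p, v p * partialY (partialY φ) p = ∫ p, partialY (partialY v) p * φ p := by
    have e1 : ∫ p, v p * partialY (partialY φ) p = -∫ p, partialY v p * partialY φ p :=
      integral_mul_fderiv hv (contDiff_partialY hφ) cY _
    have e2 : ∫ p, partialY v p * partialY φ p = -∫ p, partialY (partialY v) p * φ p :=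
      integral_mul_fderiv (contDiff_partialY hv) hφ hc _
    rw [e1, e2, neg_neg]
  have i1 : ∫ p, v p * partialX (fun q => q.1 * φ q) p = -∫ p, partialX v p * (p.1 * φ p) :=
    integral_mul_fderiv hv a1 c1 _
  have i2 : ∫ p, v p * partialY (fun q => q.2 * φ q) p = -∫ p, partialY v p * (p.2 * φ p) :=
    integral_mul_fderiv hv a2 c2 _
  have i3 : ∫ p, v p * partialX (fun q => q.2 * φ q) p = -∫ p, partialX v p * (p.2 * φ p) :=
    integral_mul_fderiv hv a2 c2 _
  have vX := (contDiff_partialX hv).continuous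
  have vY := (contDiff_partialY hv).continuous
  have vYY := (contDiff_partialY (contDiff_partialY hv)).continuous
  have I0 := integrable_mul_of_compact hv.continuous
    (contDiff_partialY (contDiff_partialY hφ)).continuous (cY.fderiv_apply ℝ (0, 1))
  have I1 := integrable_mul_of_compact hv.continuous (contDiff_partialX a1).continuous
    (c1.fderiv_apply ℝ (1, 0))
  have I2 := integrable_mul_of_compact hv.continuous (contDiff_partialY a2).continuous
    (c2.fderiv_apply ℝ (0, 1))
  have I3 := integrable_mul_of_compact hv.continuous (contDiff_partialX a2).continuous
    (c2.fderiv_apply ℝ (1, 0))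
  have I4 := integrable_mul_of_compact hv.continuous hφ.continuous hc
  have J0 := integrable_mul_of_compact vYY hφ.continuous hc
  have J1 := integrable_mul_of_compact vX a1.continuous c1
  have J2 := integrable_mul_of_compact vY a2.continuous c2
  have J3 := integrable_mul_of_compact vX a2.continuous c2
  have eA : ∀ p, v p * adjointL φ p = v p * partialY (partialY φ) p
      + -(3 / 2) * (v p * partialX (fun q => q.1 * φ q) p)
      + -(1 / 2) * (v p * partialY (fun q => q.2 * φ q) p) + (5 / 2) * (v p * φ p)
      + 1 * (v p * partialX (fun q => q.2 * φ q) p) := by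
    intro p; rw [adjointL]; ring
  have eL : ∀ p, operatorL v p * φ p = partialY (partialY v) p * φ p
      + (3 / 2) * (partialX v p * (p.1 * φ p)) + (1 / 2) * (partialY v p * (p.2 * φ p))
      + (5 / 2) * (v p * φ p) + -1 * (partialX v p * (p.2 * φ p)) := by
    intro p; rw [operatorL]; ring
  simp_rw [eA, eL]
  rw [integral_linear_combination I0 I1 I2 I4 I3, integral_linear_combination J0 J1 J2 I4 J3,
    i0, i1, i2, i3]
  ring

/-! ### The kernel solves the equation -/

lemma operatorL_initialProfile (p : ℝ × ℝ) : operatorL initialProfile p = 0 := by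
  set e : ℝ × ℝ → ℝ := fun p => Real.exp (-p.2 ^ 2 / 4 - 3 * (p.1 - p.2 / 2) ^ 2) with he
  have hv : ContDiff ℝ ∞ initialProfile := by unfold initialProfile; fun_prop
  have eX : ∀ p : ℝ × ℝ, HasDerivAt (fun t => e (t, p.2)) (e p * (-6 * (p.1 - p.2 / 2))) p.1 := by
    intro p
    have h := (((((hasDerivAt_id p.1).sub_const (p.2 / 2)).pow 2).const_mul 3).const_sub
      (-p.2 ^ 2 / 4)).exp
    refine h.congr_deriv ?_
    simp [he]; ring
  have eY : ∀ p : ℝ × ℝ, HasDerivAt (fun t => e (p.1, t))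
      (e p * (-p.2 / 2 + 3 * (p.1 - p.2 / 2))) p.2 := by
    intro p
    have h := (((((hasDerivAt_id p.2).pow 2).neg).div_const 4).sub
      (((((hasDerivAt_id p.2).div_const 2).const_sub p.1).pow 2).const_mul 3)).exp
    refine h.congr_deriv ?_
    simp [he]; ring
  have hX : ∀ p : ℝ × ℝ, partialX initialProfile p = √3 / (2 * Real.pi) *
      (e p * (6 - 6 * (p.1 - p.2 / 2) * (6 * p.1 - 2 * p.2))) := by
    intro p
    apply partialX_eq (hv.differentiable (by simp) _)
    refine (((((hasDerivAt_id p.1).const_mul 6).sub_const (2 * p.2)).mul (eX p)).const_mul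
      (√3 / (2 * Real.pi))).congr_deriv ?_
    simp; ring
  have hY : partialY initialProfile = fun p => √3 / (2 * Real.pi) *
      (e p * (-2 + (-p.2 / 2 + 3 * (p.1 - p.2 / 2)) * (6 * p.1 - 2 * p.2))) := by
    ext p
    apply partialY_eq (hv.differentiable (by simp) _)
    refine ((((((hasDerivAt_id p.2).const_mul 2).const_sub (6 * p.1))).mul (eY p)).const_mul
      (√3 / (2 * Real.pi))).congr_deriv ?_
    simp; ring
  have hYY : partialY (partialY initialProfile) p = √3 / (2 * Real.pi) *
      (e p * ((-p.2 / 2 + 3 * (p.1 - p.2 / 2)) *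
        (-2 + (-p.2 / 2 + 3 * (p.1 - p.2 / 2)) * (6 * p.1 - 2 * p.2))
        + (-2 * (6 * p.1 - 2 * p.2) + (-p.2 / 2 + 3 * (p.1 - p.2 / 2)) * (-2)))) := by
    have hd := (contDiff_partialY hv).differentiable (by simp) p
    apply partialY_eq hd
    rw [hY]
    have h1 : HasDerivAt (fun t : ℝ => -t / 2 + 3 * (p.1 - t / 2)) (-2) p.2 := by
      refine ((((hasDerivAt_id p.2).neg).div_const 2).add
        ((((hasDerivAt_id p.2).div_const 2).const_sub p.1).const_mul 3)).congr_deriv ?_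
      norm_num
    have h2 : HasDerivAt (fun t : ℝ => 6 * p.1 - 2 * t) (-2) p.2 := by
      refine (((hasDerivAt_id p.2).const_mul 2).const_sub (6 * p.1)).congr_deriv ?_
      norm_num
    refine (((eY p).mul ((h1.mul h2).const_add (-2))).const_mul
      (√3 / (2 * Real.pi))).congr_deriv ?_
    simp; ring
  rw [operatorL, hX, hYY, hY, show initialProfile p = √3 / (2 * Real.pi) * ((6 * p.1 - 2 * p.2) * e p)
    from rfl]
  ring

/-! ### Single frequencies of the layers -/

/-- The derivative of `density r` in the frequency. -/
noncomputable def densityDeriv (r k : ℝ) : ℝ :=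
  Real.exp (-(r ^ 3 * k ^ 2) / 12) * volterraSeries ((1 - r) ^ 3 * k ^ 2)
    + k * (Real.exp (-(r ^ 3 * k ^ 2) / 12) * (-(r ^ 3 * k) / 6) *
        volterraSeries ((1 - r) ^ 3 * k ^ 2)
      + Real.exp (-(r ^ 3 * k ^ 2) / 12) *
        (deriv volterraSeries ((1 - r) ^ 3 * k ^ 2) * (2 * (1 - r) ^ 3 * k)))

/-- The derivative of `(1 - r) * density r k` in `r`, expressed through the frequency derivative. -/
noncomputable def densityFlux (r k : ℝ) : ℝ :=
  -density r k - (1 - r) * r ^ 2 * k ^ 2 / 4 * density r k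
    - (3 / 2) * (k * densityDeriv r k - density r k + r ^ 3 * k ^ 2 / 6 * density r k)

lemma hasDerivAt_volterraSeries (x : ℝ) :
    HasDerivAt volterraSeries (deriv volterraSeries x) x :=
  (contDiff_volterraSeries.differentiable (by simp) x).hasDerivAt

lemma hasDerivAt_density (r k : ℝ) : HasDerivAt (density r) (densityDeriv r k) k := by
  have h1 : HasDerivAt (fun k : ℝ => Real.exp (-(r ^ 3 * k ^ 2) / 12))
      (Real.exp (-(r ^ 3 * k ^ 2) / 12) * (-(r ^ 3 * k) / 6)) k := by
    refine (((((hasDerivAt_id k).pow 2).const_mul (r ^ 3)).neg.div_const 12).exp).congr_deriv ?_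
    simp; ring
  have h2 : HasDerivAt (fun k : ℝ => volterraSeries ((1 - r) ^ 3 * k ^ 2))
      (deriv volterraSeries ((1 - r) ^ 3 * k ^ 2) * (2 * (1 - r) ^ 3 * k)) k := by
    refine ((hasDerivAt_volterraSeries _).comp k
      (((hasDerivAt_id k).pow 2).const_mul ((1 - r) ^ 3))).congr_deriv ?_
    simp; left; ring
  refine ((hasDerivAt_id k).mul (h1.mul h2)).congr_deriv ?_
  simp only [densityDeriv, id, Pi.mul_apply]; ring

lemma hasDerivAt_density_flux (r k : ℝ) :
    HasDerivAt (fun r => (1 - r) * density r k) (densityFlux r k) r := by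
  have h1 : HasDerivAt (fun r : ℝ => Real.exp (-(r ^ 3 * k ^ 2) / 12))
      (Real.exp (-(r ^ 3 * k ^ 2) / 12) * (-(r ^ 2 * k ^ 2) / 4)) r := by
    refine (((((hasDerivAt_id r).pow 3).mul_const (k ^ 2)).neg.div_const 12).exp).congr_deriv ?_
    simp; ring
  have h2 : HasDerivAt (fun r : ℝ => volterraSeries ((1 - r) ^ 3 * k ^ 2))
      (deriv volterraSeries ((1 - r) ^ 3 * k ^ 2) * (-3 * (1 - r) ^ 2 * k ^ 2)) r := by
    refine ((hasDerivAt_volterraSeries _).comp r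
      ((((hasDerivAt_id r).const_sub 1).pow 3).mul_const (k ^ 2))).congr_deriv ?_
    simp
  refine (((hasDerivAt_id r).const_sub 1).mul ((h1.mul h2).const_mul k)).congr_deriv ?_
  simp only [densityFlux, densityDeriv, density, id, Pi.mul_apply]; ring

lemma continuous_densityDeriv : Continuous (Function.uncurry densityDeriv) := by
  have h1 := continuous_volterraSeries
  have h2 : Continuous (deriv volterraSeries) := contDiff_volterraSeries.continuous_deriv (by simp)
  unfold densityDeriv Function.uncurry; fun_prop

lemma continuous_densityFlux : Continuous (Function.uncurry densityFlux) := by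
  have h1 : Continuous fun q : ℝ × ℝ => density q.1 q.2 := continuous_density
  have h2 : Continuous fun q : ℝ × ℝ => densityDeriv q.1 q.2 := continuous_densityDeriv
  unfold densityFlux Function.uncurry; fun_prop

/-- Uniform integrable bounds in the frequency for the densities and their fluxes. -/
lemma exists_density_bounds : ∃ C, 0 ≤ C ∧ ∀ r ∈ Icc (0 : ℝ) 1, ∀ k : ℝ,
    |density r k| ≤ C * (1 + k ^ 2)⁻¹ ∧ |k * density r k| ≤ C * (1 + k ^ 2)⁻¹ ∧
    |density r k + k * densityDeriv r k| ≤ C * (1 + k ^ 2)⁻¹ ∧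
    |densityFlux r k| ≤ C * (1 + k ^ 2)⁻¹ := by
  obtain ⟨A, hA⟩ := exists_density_le 0 4
  obtain ⟨B, hB⟩ := exists_density_le 1 4
  have hA0 : 0 ≤ A := le_trans (by positivity) (hA 0 ⟨le_rfl, zero_le_one⟩ 0)
  have hB0 : 0 ≤ B := le_trans (by positivity) (hB 0 ⟨le_rfl, zero_le_one⟩ 0)
  refine ⟨10 * (A + B), by positivity, fun r hr k => ?_⟩
  have a := hA r hr k
  have b := hB r hr k
  rw [iteratedDeriv_zero] at a
  rw [iteratedDeriv_one, (hasDerivAt_density r k).deriv] at b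
  have hk := abs_nonneg k
  set D := density r k with hD
  set D' := densityDeriv r k with hD'
  have key : ∀ f : ℝ, |f| ≤ (1 + |k|) ^ 2 * (10 * (|D| + |D'|)) →
      |f| ≤ 10 * (A + B) * (1 + k ^ 2)⁻¹ := by
    intro f hf
    rw [← div_eq_mul_inv, le_div_iff₀ (by positivity)]
    have e : 1 + k ^ 2 ≤ (1 + |k|) ^ 2 := by rw [← sq_abs k]; nlinarith
    calc |f| * (1 + k ^ 2) ≤ (1 + |k|) ^ 2 * (10 * (|D| + |D'|)) * (1 + |k|) ^ 2 := by gcongr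
      _ = 10 * ((1 + |k|) ^ 4 * |D| + (1 + |k|) ^ 4 * |D'|) := by ring
      _ ≤ _ := by gcongr
  have hDn := abs_nonneg D
  have hDn' := abs_nonneg D'
  have q1 : 1 ≤ (1 + |k|) ^ 2 := by nlinarith
  have q2 : |k| ≤ (1 + |k|) ^ 2 := by nlinarith
  have q3 : k ^ 2 ≤ (1 + |k|) ^ 2 := by rw [← sq_abs k]; nlinarith
  set w := (1 + |k|) ^ 2 with hw
  have m1 : |D| ≤ w * |D| := le_mul_of_one_le_left hDn q1
  have m2 : |k * D| ≤ w * |D| := by rw [abs_mul]; gcongr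
  have m3 : |k * D'| ≤ w * |D'| := by rw [abs_mul]; gcongr
  have m4 : k ^ 2 * |D| ≤ w * |D| := by gcongr
  have m0 : 0 ≤ w * |D'| := by positivity
  refine ⟨key _ (by linarith), key _ (by linarith), key _ ?_, key _ ?_⟩
  · exact (abs_add_le _ _).trans (by linarith)
  · have hr2 : |(1 - r) * r ^ 2 * k ^ 2 / 4 * D| ≤ w * |D| := by
      have h0 : 0 ≤ (1 - r) * r ^ 2 := mul_nonneg (by linarith [hr.2]) (sq_nonneg r)
      have h1 : (1 - r) * r ^ 2 ≤ 1 := by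
        have : r ^ 2 ≤ 1 := pow_le_one₀ hr.1 hr.2
        nlinarith [hr.1, hr.2]
      rw [abs_mul, abs_of_nonneg (by positivity)]
      calc _ = (1 - r) * r ^ 2 * (k ^ 2 * |D|) / 4 := by ring
        _ ≤ 1 * (w * |D|) / 4 := by gcongr
        _ ≤ _ := by nlinarith [mul_nonneg (zero_le_one.trans q1) hDn]
    have hr3 : |r ^ 3 * k ^ 2 / 6 * D| ≤ w * |D| := by
      have h0 : 0 ≤ r ^ 3 := pow_nonneg hr.1 3
      have h1 : r ^ 3 ≤ 1 := pow_le_one₀ hr.1 hr.2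
      rw [abs_mul, abs_of_nonneg (by positivity)]
      calc _ = r ^ 3 * (k ^ 2 * |D|) / 6 := by ring
        _ ≤ 1 * (w * |D|) / 6 := by gcongr
        _ ≤ _ := by nlinarith [mul_nonneg (zero_le_one.trans q1) hDn]
    rw [densityFlux, ← hD, ← hD']
    have := abs_le.1 m1
    rw [abs_le] at m3 hr2 hr3 ⊢
    have t := abs_le.1 (le_refl |D|)
    constructor <;> linarith [m3.1, m3.2, hr2.1, hr2.2, hr3.1, hr3.2, t.1, t.2]

/-- The one-dimensional heat factor of a layer emitted at the fraction `1 - r` of the time. -/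
noncomputable def heatFactor (r Y : ℝ) : ℝ := r ^ (-(1 / 2) : ℝ) * Real.exp (-Y ^ 2 / (4 * r))

lemma hasDerivAt_heatFactor {r : ℝ} (hr : 0 < r) (Y : ℝ) :
    HasDerivAt (fun r => heatFactor r Y)
      (heatFactor r Y * (Y ^ 2 / (4 * r ^ 2) - 1 / (2 * r))) r := by
  have h1 := (Real.hasDerivAt_rpow_const (p := (-(1 / 2) : ℝ)) (Or.inl hr.ne'))
  have h2 : HasDerivAt (fun r : ℝ => Real.exp (-Y ^ 2 / (4 * r)))
      (Real.exp (-Y ^ 2 / (4 * r)) * (Y ^ 2 / (4 * r ^ 2))) r := by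
    refine (((hasDerivAt_const r (-Y ^ 2)).div ((hasDerivAt_id r).const_mul 4)
      (by simp [hr.ne'])).exp).congr_deriv ?_
    simp only [id]
    congr 1; field_simp; ring
  refine (h1.mul h2).congr_deriv ?_
  rw [heatFactor, show (-(1 / 2) : ℝ) - 1 = -(1 / 2) + -1 by ring, Real.rpow_add hr,
    Real.rpow_neg_one]
  field_simp
  ring

lemma heatFactor_nonneg {r : ℝ} (hr : 0 ≤ r) (Y : ℝ) : 0 ≤ heatFactor r Y :=
  mul_nonneg (Real.rpow_nonneg hr _) (Real.exp_pos _).le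

lemma heatFactor_zero (Y : ℝ) : heatFactor 0 Y = 0 := by
  rw [heatFactor, Real.zero_rpow (by norm_num), zero_mul]

/-- Away from the boundary `Y = 0` the heat factor vanishes to second order as `r → 0`. -/
lemma heatFactor_le {r δ Y : ℝ} (hr : r ∈ Ioc (0 : ℝ) 1) (hδ : 0 < δ) (hY : δ ≤ Y) :
    heatFactor r Y ≤ 384 / δ ^ 6 * r ^ 2 := by
  have hr0 := hr.1
  have hY0 : 0 < Y := hδ.trans_le hY
  have hz : 0 < Y ^ 2 / (4 * r) := by positivity
  have h1 := Real.pow_div_factorial_le_exp _ hz.le 3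
  have h2 : Real.exp (-Y ^ 2 / (4 * r)) ≤ 384 * r ^ 3 / Y ^ 6 := by
    rw [neg_div, Real.exp_neg]
    refine (inv_anti₀ (by positivity) h1).trans (le_of_eq ?_)
    norm_num [Nat.factorial]; field_simp; norm_num
  have h3 : r ^ (-(1 / 2) : ℝ) * r ≤ 1 := by
    have : r ^ (-(1 / 2) : ℝ) * r = r ^ (1 / 2 : ℝ) := by
      conv_lhs => rw [← Real.rpow_one r, ← Real.rpow_mul hr0.le, ← Real.rpow_add hr0]
      norm_num
    rw [this]; exact Real.rpow_le_one hr0.le hr.2 (by norm_num)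
  have hrp : 0 ≤ r ^ (-(1 / 2) : ℝ) := Real.rpow_nonneg hr0.le _
  calc heatFactor r Y ≤ r ^ (-(1 / 2) : ℝ) * (384 * r ^ 3 / Y ^ 6) := by
        rw [heatFactor]; gcongr
    _ = (r ^ (-(1 / 2) : ℝ) * r) * (384 / Y ^ 6 * r ^ 2) := by ring
    _ ≤ 1 * (384 / δ ^ 6 * r ^ 2) := by gcongr
    _ = _ := one_mul _

lemma heatFactor_mul_le {r δ Y : ℝ} (hr : r ∈ Ioc (0 : ℝ) 1) (hδ : 0 < δ) (hY : δ ≤ Y) :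
    |heatFactor r Y * (Y ^ 2 / (4 * r ^ 2) - 1 / (2 * r))| ≤ 384 / δ ^ 6 * (Y ^ 2 + 1) := by
  have hr0 := hr.1
  have h := heatFactor_le hr hδ hY
  have hd : |Y ^ 2 / (4 * r ^ 2) - 1 / (2 * r)| ≤ (Y ^ 2 + 1) / r ^ 2 := by
    have e1 : 1 / (2 * r) ≤ 1 / r ^ 2 := by
      apply one_div_le_one_div_of_le (by positivity); nlinarith [hr.2]
    have e2 : Y ^ 2 / (4 * r ^ 2) ≤ Y ^ 2 / r ^ 2 := by
      gcongr; nlinarith [sq_nonneg r]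
    have e3 : 0 ≤ Y ^ 2 / (4 * r ^ 2) := by positivity
    have e4 : 0 ≤ 1 / (2 * r) := by positivity
    rw [add_div, abs_le]; constructor <;> linarith
  rw [abs_mul, abs_of_nonneg (heatFactor_nonneg hr0.le Y)]
  calc _ ≤ 384 / δ ^ 6 * r ^ 2 * ((Y ^ 2 + 1) / r ^ 2) := by gcongr
    _ = _ := by field_simp

lemma heatFactor_le_rpow {r : ℝ} (hr : 0 < r) (Y : ℝ) : heatFactor r Y ≤ r ^ (-(1 / 2) : ℝ) := by
  rw [heatFactor]
  apply mul_le_of_le_one_right (Real.rpow_nonneg hr.le _)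
  apply Real.exp_le_one_iff.2
  rw [neg_div]
  have : 0 ≤ Y ^ 2 / (4 * r) := by positivity
  linarith

/-- A single frequency of a layer. -/
noncomputable def layerWave (r k : ℝ) (p : ℝ × ℝ) : ℝ :=
  heatFactor r p.2 * (Real.sin (k * (p.1 - r * p.2 / 2)) * density r k)

/-- The derivative of `k * layerWave r k p` in `k`. -/
noncomputable def waveFluxK (r k : ℝ) (p : ℝ × ℝ) : ℝ :=
  heatFactor r p.2 * ((density r k + k * densityDeriv r k) * Real.sin (k * (p.1 - r * p.2 / 2))
    + (p.1 - r * p.2 / 2) * (k * density r k) * Real.cos (k * (p.1 - r * p.2 / 2)))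

/-- The derivative of `(1 - r) * layerWave r k p` in `r`. -/
noncomputable def waveFluxR (r k : ℝ) (p : ℝ × ℝ) : ℝ :=
  heatFactor r p.2 * (densityFlux r k * Real.sin (k * (p.1 - r * p.2 / 2))
      - (1 - r) * (k * density r k) * (p.2 / 2) * Real.cos (k * (p.1 - r * p.2 / 2)))
    + heatFactor r p.2 * (p.2 ^ 2 / (4 * r ^ 2) - 1 / (2 * r)) * ((1 - r) * density r k *
        Real.sin (k * (p.1 - r * p.2 / 2)))

lemma hasDerivAt_layerWave_k (r k : ℝ) (p : ℝ × ℝ) :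
    HasDerivAt (fun k => k * layerWave r k p) (waveFluxK r k p) k := by
  set x := p.1 - r * p.2 / 2 with hx
  have h1 : HasDerivAt (fun k : ℝ => Real.sin (k * x)) (Real.cos (k * x) * x) k := by
    simpa using ((hasDerivAt_id k).mul_const x).sin
  have h := (hasDerivAt_id k).mul ((h1.mul (hasDerivAt_density r k)).const_mul (heatFactor r p.2))
  refine h.congr_deriv ?_
  simp only [waveFluxK, ← hx, id, Pi.mul_apply]; ring

lemma hasDerivAt_layerWave_r {r : ℝ} (hr : 0 < r) (k : ℝ) (p : ℝ × ℝ) :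
    HasDerivAt (fun r => (1 - r) * layerWave r k p) (waveFluxR r k p) r := by
  have h1 : HasDerivAt (fun r : ℝ => Real.sin (k * (p.1 - r * p.2 / 2)))
      (Real.cos (k * (p.1 - r * p.2 / 2)) * (-(k * p.2 / 2))) r := by
    refine ((((((hasDerivAt_id r).mul_const p.2).div_const 2).const_sub p.1).const_mul k).sin).congr_deriv ?_
    simp; left; ring
  have h := (hasDerivAt_heatFactor hr p.2).mul (h1.mul (hasDerivAt_density_flux r k))
  have e : (fun r => (1 - r) * layerWave r k p) = fun r => heatFactor r p.2 *
      (Real.sin (k * (p.1 - r * p.2 / 2)) * ((1 - r) * density r k)) := by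
    ext r; rw [layerWave]; ring
  rw [e]
  refine h.congr_deriv ?_
  simp only [waveFluxR, Pi.mul_apply]; ring

lemma contDiff_layerWave (r k : ℝ) : ContDiff ℝ ∞ (layerWave r k) := by
  unfold layerWave heatFactor; fun_prop

/-- On a single frequency of a layer the operator acts as a divergence in `(k, r)`. -/
lemma operatorL_layerWave {r : ℝ} (hr : 0 < r) (k : ℝ) (p : ℝ × ℝ) :
    operatorL (layerWave r k) p = (3 / 2) * waveFluxK r k p + waveFluxR r k p := by
  have hv := contDiff_layerWave r k
  have eY : ∀ p : ℝ × ℝ, HasDerivAt (fun t => heatFactor r t)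
      (heatFactor r p.2 * (-p.2 / (2 * r))) p.2 := by
    intro p
    refine (((((hasDerivAt_id p.2).pow 2).neg).div_const (4 * r)).exp.const_mul
      (r ^ (-(1 / 2) : ℝ))).congr_deriv ?_
    simp [heatFactor]; field_simp; ring
  have sX : ∀ p : ℝ × ℝ, HasDerivAt (fun t => Real.sin (k * (t - r * p.2 / 2)))
      (Real.cos (k * (p.1 - r * p.2 / 2)) * k) p.1 := by
    intro p
    simpa using (((hasDerivAt_id p.1).sub_const (r * p.2 / 2)).const_mul k).sin
  have sY : ∀ p : ℝ × ℝ, HasDerivAt (fun t => Real.sin (k * (p.1 - r * t / 2)))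
      (Real.cos (k * (p.1 - r * p.2 / 2)) * (-(k * r / 2))) p.2 := by
    intro p
    refine ((((((hasDerivAt_id p.2).const_mul r).div_const 2).const_sub p.1).const_mul k).sin).congr_deriv ?_
    simp; left; ring
  have cY : ∀ p : ℝ × ℝ, HasDerivAt (fun t => Real.cos (k * (p.1 - r * t / 2)))
      (Real.sin (k * (p.1 - r * p.2 / 2)) * (k * r / 2)) p.2 := by
    intro p
    refine ((((((hasDerivAt_id p.2).const_mul r).div_const 2).const_sub p.1).const_mul k).cos).congr_deriv ?_
    simp; left; ring
  have hX : ∀ p : ℝ × ℝ, partialX (layerWave r k) p = heatFactor r p.2 *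
      (k * Real.cos (k * (p.1 - r * p.2 / 2)) * density r k) := by
    intro p
    apply partialX_eq (hv.differentiable (by simp) _)
    refine (((sX p).mul_const (density r k)).const_mul (heatFactor r p.2)).congr_deriv ?_
    ring
  have hY : partialY (layerWave r k) = fun p => heatFactor r p.2 * density r k *
      (-p.2 / (2 * r) * Real.sin (k * (p.1 - r * p.2 / 2))
        - k * r / 2 * Real.cos (k * (p.1 - r * p.2 / 2))) := by
    ext p
    apply partialY_eq (hv.differentiable (by simp) _)
    refine ((eY p).mul ((sY p).mul_const (density r k))).congr_deriv ?_
    simp; ring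
  have hYY : partialY (partialY (layerWave r k)) p = heatFactor r p.2 * density r k *
      ((p.2 ^ 2 / (4 * r ^ 2) - 1 / (2 * r) - k ^ 2 * r ^ 2 / 4)
        * Real.sin (k * (p.1 - r * p.2 / 2))
        + p.2 * k / 2 * Real.cos (k * (p.1 - r * p.2 / 2))) := by
    have hd := (contDiff_partialY hv).differentiable (by simp) p
    apply partialY_eq hd
    rw [hY]
    have h1 : HasDerivAt (fun t : ℝ => -t / (2 * r)) (-1 / (2 * r)) p.2 :=
      ((hasDerivAt_id p.2).neg).div_const (2 * r)
    refine (((eY p).mul_const (density r k)).mul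
      ((h1.mul (sY p)).sub ((cY p).const_mul (k * r / 2)))).congr_deriv ?_
    simp only [Pi.mul_apply, Pi.sub_apply]
    field_simp
    ring
  rw [operatorL, hX, hYY, hY, layerWave, waveFluxK, waveFluxR, densityFlux]
  field_simp
  ring

lemma integrable_of_le_mul_inv {F : ℝ × (ℝ × ℝ) → ℝ} (hF : AEStronglyMeasurable F)
    {φ : ℝ × ℝ → ℝ} (hφ : Integrable φ) {C : ℝ}
    (h : ∀ k p, |F (k, p)| ≤ C * (1 + k ^ 2)⁻¹ * |φ p|) : Integrable F := by
  have := Integrable.mul_prod (μ := volume) (ν := volume)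
    (integrable_inv_one_add_sq.const_mul C) hφ.abs
  exact this.mono' hF (Eventually.of_forall fun q => h q.1 q.2)

/-- A compact subset of the open half-plane keeps a positive distance from the boundary. -/
lemma exists_bounds_of_compact {K : Set (ℝ × ℝ)} (hK : IsCompact K) (hs : K ⊆ halfPlane) :
    ∃ δ M : ℝ, 0 < δ ∧ 0 ≤ M ∧ ∀ p ∈ K, δ ≤ p.2 ∧ |p.1| ≤ M ∧ |p.2| ≤ M := by
  obtain ⟨M, hM⟩ := hK.isBounded.exists_norm_le
  have hδ : ∃ δ : ℝ, 0 < δ ∧ ∀ p ∈ K, δ ≤ p.2 := by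
    rcases K.eq_empty_or_nonempty with rfl | hne
    · exact ⟨1, one_pos, by simp⟩
    · obtain ⟨q, hq, hmin⟩ := hK.exists_isMinOn hne continuous_snd.continuousOn
      exact ⟨q.2, hs hq, fun p hp => hmin hp⟩
  obtain ⟨δ, h0, h1⟩ := hδ
  refine ⟨δ, max M 0, h0, le_max_right _ _, fun p hp => ⟨h1 p hp, ?_, ?_⟩⟩
  · exact ((norm_fst_le p).trans (hM p hp)).trans (le_max_left _ _)
  · exact ((norm_snd_le p).trans (hM p hp)).trans (le_max_left _ _)

lemma abs_sub_half_le {r X Y M : ℝ} (hr : r ∈ Ioc (0 : ℝ) 1) (hX : |X| ≤ M) (hY : |Y| ≤ M) :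
    |X - r * Y / 2| ≤ 2 * M := by
  have e : |r * Y / 2| ≤ |Y| := by
    rw [abs_div, abs_mul, abs_of_pos hr.1, abs_two]
    nlinarith [mul_le_mul_of_nonneg_right hr.2 (abs_nonneg Y), abs_nonneg Y]
  have := abs_sub (X) (r * Y / 2)
  linarith

lemma abs_mul_sin_le (a θ : ℝ) : |a * Real.sin θ| ≤ |a| := by
  rw [abs_mul]; exact mul_le_of_le_one_right (abs_nonneg _) (Real.abs_sin_le_one _)

lemma abs_mul_cos_le (a θ : ℝ) : |a * Real.cos θ| ≤ |a| := by
  rw [abs_mul]; exact mul_le_of_le_one_right (abs_nonneg _) (Real.abs_cos_le_one _)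

lemma continuous_heatFactor {r : ℝ} : Continuous (heatFactor r) := by
  unfold heatFactor; fun_prop

lemma continuous_layerWave_right (r : ℝ) :
    Continuous fun q : ℝ × (ℝ × ℝ) => layerWave r q.1 q.2 := by
  have h1 := continuous_heatFactor (r := r)
  have h2 := continuous_density_right r
  unfold layerWave; fun_prop

lemma continuous_waveFluxK_right (r : ℝ) :
    Continuous fun q : ℝ × (ℝ × ℝ) => waveFluxK r q.1 q.2 := by
  have h1 := continuous_heatFactor (r := r)
  have h2 := continuous_density_right r
  have h3 : Continuous (densityDeriv r) :=
    continuous_densityDeriv.comp (by fun_prop : Continuous fun k => (r, k))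
  unfold waveFluxK; fun_prop

lemma continuous_waveFluxR_right (r : ℝ) :
    Continuous fun q : ℝ × (ℝ × ℝ) => waveFluxR r q.1 q.2 := by
  have h1 := continuous_heatFactor (r := r)
  have h2 := continuous_density_right r
  have h3 : Continuous (densityFlux r) :=
    continuous_densityFlux.comp (by fun_prop : Continuous fun k => (r, k))
  unfold waveFluxR; fun_prop

lemma measurable_waveFluxR :
    Measurable fun q : ℝ × (ℝ × (ℝ × ℝ)) => waveFluxR q.1 q.2.1 q.2.2 := by
  have h1 : Measurable fun q : ℝ × (ℝ × (ℝ × ℝ)) => density q.1 q.2.1 :=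
    continuous_density.measurable.comp (by fun_prop : Measurable fun q : ℝ × (ℝ × (ℝ × ℝ)) => (q.1, q.2.1))
  have h2 : Measurable fun q : ℝ × (ℝ × (ℝ × ℝ)) => densityFlux q.1 q.2.1 :=
    continuous_densityFlux.measurable.comp (by fun_prop : Measurable fun q : ℝ × (ℝ × (ℝ × ℝ)) => (q.1, q.2.1))
  unfold waveFluxR heatFactor
  fun_prop

lemma exists_layerWave_le : ∃ C, 0 ≤ C ∧ ∀ r ∈ Ioc (0 : ℝ) 1, ∀ k p,
    |layerWave r k p| ≤ r ^ (-(1 / 2) : ℝ) * C * (1 + k ^ 2)⁻¹ := by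
  obtain ⟨C, hC0, hC⟩ := exists_density_bounds
  refine ⟨C, hC0, fun r hr k p => ?_⟩
  obtain ⟨b1, -, -, -⟩ := hC r (Ioc_subset_Icc_self hr) k
  rw [layerWave, abs_mul, abs_of_nonneg (heatFactor_nonneg hr.1.le _), mul_comm (Real.sin _),
    mul_assoc]
  exact mul_le_mul (heatFactor_le_rpow hr.1 _) ((abs_mul_sin_le _ _).trans b1) (abs_nonneg _)
    (Real.rpow_nonneg hr.1.le _)

lemma exists_waveFluxK_le (M : ℝ) : ∃ C, 0 ≤ C ∧ ∀ r ∈ Ioc (0 : ℝ) 1, ∀ k, ∀ p : ℝ × ℝ,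
    |p.1| ≤ M → |p.2| ≤ M → |waveFluxK r k p| ≤ r ^ (-(1 / 2) : ℝ) * C * (1 + k ^ 2)⁻¹ := by
  obtain ⟨C, hC0, hC⟩ := exists_density_bounds
  refine ⟨C + 2 * |M| * C, by positivity, fun r hr k p hX hY => ?_⟩
  obtain ⟨-, b2, b3, -⟩ := hC r (Ioc_subset_Icc_self hr) k
  rw [waveFluxK, abs_mul, abs_of_nonneg (heatFactor_nonneg hr.1.le _),
    mul_assoc (r ^ (-(1 / 2) : ℝ))]
  refine mul_le_mul (heatFactor_le_rpow hr.1 _) ?_ (abs_nonneg _) (Real.rpow_nonneg hr.1.le _)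
  refine (abs_add_le _ _).trans ?_
  rw [add_mul C]
  refine add_le_add ((abs_mul_sin_le _ _).trans b3) ((abs_mul_cos_le _ _).trans ?_)
  rw [abs_mul, mul_assoc (2 * |M|)]
  refine mul_le_mul ?_ b2 (abs_nonneg _) (by positivity)
  exact abs_sub_half_le hr (hX.trans (le_abs_self _)) (hY.trans (le_abs_self _))

lemma exists_waveFluxR_le {δ : ℝ} (hδ : 0 < δ) (M : ℝ) : ∃ C, 0 ≤ C ∧
    ∀ r ∈ Ioc (0 : ℝ) 1, ∀ k, ∀ p : ℝ × ℝ, δ ≤ p.2 → |p.2| ≤ M →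
      |waveFluxR r k p| ≤ C * (1 + k ^ 2)⁻¹ := by
  obtain ⟨C, hC0, hC⟩ := exists_density_bounds
  refine ⟨384 / δ ^ 6 * (C + |M| * C) + 384 / δ ^ 6 * (M ^ 2 + 1) * C, by positivity,
    fun r hr k p hY hY' => ?_⟩
  obtain ⟨b1, b2, -, b4⟩ := hC r (Ioc_subset_Icc_self hr) k
  have hr1 : |1 - r| ≤ 1 := by rw [abs_le]; constructor <;> linarith [hr.1, hr.2]
  have hM : |p.2| ≤ |M| := hY'.trans (le_abs_self _)
  have hE : 0 < (1 + k ^ 2)⁻¹ := by positivity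
  have hh : heatFactor r p.2 ≤ 384 / δ ^ 6 := by
    refine (heatFactor_le hr hδ hY).trans ?_
    apply mul_le_of_le_one_right (by positivity)
    exact pow_le_one₀ hr.1.le hr.2
  rw [waveFluxR]
  refine (abs_add_le _ _).trans ?_
  rw [add_mul]
  apply add_le_add
  · rw [abs_mul, abs_of_nonneg (heatFactor_nonneg hr.1.le _), mul_assoc (384 / δ ^ 6)]
    refine mul_le_mul hh ?_ (abs_nonneg _) (by positivity)
    refine (abs_sub _ _).trans ?_
    rw [add_mul]
    refine add_le_add ((abs_mul_sin_le _ _).trans b4) ((abs_mul_cos_le _ _).trans ?_)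
    rw [abs_mul, abs_mul, abs_div, abs_two]
    calc |1 - r| * |k * density r k| * (|p.2| / 2)
        ≤ 1 * (C * (1 + k ^ 2)⁻¹) * |M| := by
          gcongr; linarith [abs_nonneg p.2]
      _ = _ := by ring
  · rw [abs_mul, mul_assoc (384 / δ ^ 6 * (M ^ 2 + 1))]
    refine mul_le_mul ?_ ?_ (abs_nonneg _) (by positivity)
    · refine (heatFactor_mul_le hr hδ hY).trans ?_
      have : p.2 ^ 2 ≤ M ^ 2 := sq_le_sq.2 hM
      gcongr
    · refine (abs_mul_sin_le _ _).trans ?_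
      rw [abs_mul]
      calc _ ≤ 1 * (C * (1 + k ^ 2)⁻¹) := by gcongr
        _ = _ := one_mul _

/-- The frequency flux has zero integral. -/
lemma integral_waveFluxK {r : ℝ} (hr : r ∈ Ioc (0 : ℝ) 1) (p : ℝ × ℝ) :
    ∫ k, waveFluxK r k p = 0 := by
  obtain ⟨C, hC0, hC⟩ := exists_waveFluxK_le (max |p.1| |p.2|)
  obtain ⟨C', hC0', hC'⟩ := exists_density_bounds
  have hp : Continuous fun k : ℝ => (k, p) := by fun_prop
  apply integral_eq_zero_of_hasDerivAt_of_integrable (hasDerivAt_layerWave_k r · p)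
  · refine integrable_of_le_inv (C := r ^ (-(1 / 2) : ℝ) * C)
      ((continuous_waveFluxK_right r).comp hp) fun k => ?_
    rw [div_eq_mul_inv]
    exact hC r hr k p (le_max_left _ _) (le_max_right _ _)
  · refine integrable_of_le_inv (C := r ^ (-(1 / 2) : ℝ) * C')
      (continuous_id.mul ((continuous_layerWave_right r).comp hp)) fun k => ?_
    obtain ⟨-, b2, -, -⟩ := hC' r (Ioc_subset_Icc_self hr) k
    rw [layerWave, show k * (heatFactor r p.2 * (Real.sin (k * (p.1 - r * p.2 / 2)) * density r k))
      = heatFactor r p.2 * (k * density r k * Real.sin (k * (p.1 - r * p.2 / 2))) by ring, abs_mul,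
      abs_of_nonneg (heatFactor_nonneg hr.1.le _), mul_div_assoc (r ^ (-(1 / 2) : ℝ)),
      div_eq_mul_inv C']
    exact mul_le_mul (heatFactor_le_rpow hr.1 _) ((abs_mul_sin_le _ _).trans b2) (abs_nonneg _)
      (Real.rpow_nonneg hr.1.le _)

/-- The flux in `r` has zero integral at an interior point. -/
lemma integral_waveFluxR (k : ℝ) {p : ℝ × ℝ} (hp : 0 < p.2) :
    ∫ r in Ioc (0 : ℝ) 1, waveFluxR r k p = 0 := by
  obtain ⟨C, hC0, hC⟩ := exists_waveFluxR_le hp |p.2|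
  obtain ⟨D, hD0, hD⟩ := exists_density_bounds
  rw [← intervalIntegral.integral_of_le zero_le_one]
  have hint : IntervalIntegrable (fun r => waveFluxR r k p) volume 0 1 := by
    rw [intervalIntegrable_iff_integrableOn_Ioc_of_le zero_le_one]
    refine Measure.integrableOn_of_bounded (M := C * (1 + k ^ 2)⁻¹) (by simp)
      (measurable_waveFluxR.comp (by fun_prop : Measurable fun r : ℝ => (r, (k, p)))).aestronglyMeasurable
      ?_
    rw [ae_restrict_iff' measurableSet_Ioc]
    exact Eventually.of_forall fun r hr => hC r hr k p le_rfl le_rfl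
  rw [intervalIntegral.integral_eq_sub_of_hasDerivAt_of_le zero_le_one
    (f := fun r => (1 - r) * layerWave r k p) _ (fun r hr => hasDerivAt_layerWave_r hr.1 k p) hint]
  · simp [layerWave, heatFactor_zero]
  · intro r hr
    -- at `r = 0` continuity is the rapid decay of the heat factor away from the boundary
    rcases hr.1.eq_or_lt with rfl | hr0
    · rw [ContinuousWithinAt]
      have h0 : (1 - (0 : ℝ)) * layerWave 0 k p = 0 := by simp [layerWave, heatFactor_zero]
      rw [h0]
      apply squeeze_zero_norm' (a := fun r : ℝ => 384 / p.2 ^ 6 * r ^ 2 * (D * (1 + k ^ 2)⁻¹))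
      · filter_upwards [self_mem_nhdsWithin] with r hr
        rcases hr.1.eq_or_lt with rfl | hr0
        · rw [h0]; simp
        · have hr' : r ∈ Ioc (0 : ℝ) 1 := ⟨hr0, hr.2⟩
          obtain ⟨b1, -, -, -⟩ := hD r hr k
          have hr1 : |1 - r| ≤ 1 := by rw [abs_le]; constructor <;> linarith [hr.1, hr.2]
          rw [Real.norm_eq_abs, layerWave, abs_mul, abs_mul, mul_comm (Real.sin _),
            abs_of_nonneg (heatFactor_nonneg hr.1 _), ← one_mul (384 / p.2 ^ 6 * r ^ 2 * _)]
          exact mul_le_mul hr1 (mul_le_mul (heatFactor_le hr' hp le_rfl)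
            ((abs_mul_sin_le _ _).trans b1) (abs_nonneg _) (by positivity))
            (mul_nonneg (heatFactor_nonneg hr.1 _) (abs_nonneg _)) zero_le_one
      · have : Continuous fun r : ℝ => 384 / p.2 ^ 6 * r ^ 2 * (D * (1 + k ^ 2)⁻¹) := by fun_prop
        have h := (this.tendsto 0).mono_left (nhdsWithin_le_nhds (s := Icc (0 : ℝ) 1))
        simpa using h
    · exact (hasDerivAt_layerWave_r hr0 k p).continuousAt.continuousWithinAt

lemma layerProfile_eq_integral (r : ℝ) (p : ℝ × ℝ) :
    layerProfile r p = -∫ k, layerWave r k p := by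
  simp only [layerWave]
  rw [integral_const_mul, layerProfile, layer, heatFactor]; ring

/-- Testing a layer against the adjoint operator leaves the flux in `r` only. -/
lemma integral_layerProfile_adjointL {φ : ℝ × ℝ → ℝ} (hφ : ContDiff ℝ ∞ φ)
    (hc : HasCompactSupport φ) (hs : tsupport φ ⊆ halfPlane) {r : ℝ} (hr : r ∈ Ioc (0 : ℝ) 1) :
    ∫ p, layerProfile r p * adjointL φ p = -∫ q : ℝ × (ℝ × ℝ), waveFluxR r q.1 q.2 * φ q.2 := by
  obtain ⟨δ, M, hδ, hM, hK⟩ := exists_bounds_of_compact hc.isCompact hs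
  have hφi : Integrable φ := hφ.continuous.integrable_of_hasCompactSupport hc
  have hψ := continuous_adjointL hφ
  have hψi : Integrable (adjointL φ) := hψ.integrable_of_hasCompactSupport (hasCompactSupport_adjointL hc)
  have hφc := hφ.continuous
  obtain ⟨C1, hC1, h1⟩ := exists_layerWave_le
  obtain ⟨C2, hC2, h2⟩ := exists_waveFluxK_le M
  obtain ⟨C3, hC3, h3⟩ := exists_waveFluxR_le hδ M
  have I1 : Integrable fun q : ℝ × (ℝ × ℝ) => layerWave r q.1 q.2 * adjointL φ q.2 := by
    apply integrable_of_le_mul_inv (C := r ^ (-(1 / 2) : ℝ) * C1)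
      ((continuous_layerWave_right r).mul (by fun_prop)).aestronglyMeasurable hψi
    intro k p
    rw [Pi.mul_apply, abs_mul]; gcongr; exact h1 r hr k p
  have I2 : Integrable fun q : ℝ × (ℝ × ℝ) => waveFluxK r q.1 q.2 * φ q.2 := by
    apply integrable_of_le_mul_inv (C := r ^ (-(1 / 2) : ℝ) * C2)
      ((continuous_waveFluxK_right r).mul (by fun_prop)).aestronglyMeasurable hφi
    intro k p
    by_cases hp : p ∈ tsupport φ
    · rw [Pi.mul_apply, abs_mul]; gcongr; exact h2 r hr k p (hK p hp).2.1 (hK p hp).2.2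
    · simp [image_eq_zero_of_notMem_tsupport hp]
  have I3 : Integrable fun q : ℝ × (ℝ × ℝ) => waveFluxR r q.1 q.2 * φ q.2 := by
    apply integrable_of_le_mul_inv (C := C3)
      ((continuous_waveFluxR_right r).mul (by fun_prop)).aestronglyMeasurable hφi
    intro k p
    by_cases hp : p ∈ tsupport φ
    · rw [Pi.mul_apply, abs_mul]; gcongr; exact h3 r hr k p (hK p hp).1 (hK p hp).2.2
    · simp [image_eq_zero_of_notMem_tsupport hp]
  have e1 : ∫ p, layerProfile r p * adjointL φ p
      = -∫ q : ℝ × (ℝ × ℝ), layerWave r q.1 q.2 * adjointL φ q.2 := by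
    rw [show ∫ q : ℝ × (ℝ × ℝ), layerWave r q.1 q.2 * adjointL φ q.2
      = ∫ p, ∫ k, layerWave r k p * adjointL φ p from integral_prod_symm _ I1, ← integral_neg]
    congr 1; ext p
    rw [layerProfile_eq_integral, neg_mul, ← integral_mul_const]
  have e2 : ∫ q : ℝ × (ℝ × ℝ), layerWave r q.1 q.2 * adjointL φ q.2
      = ∫ q : ℝ × (ℝ × ℝ), ((3 / 2) * (waveFluxK r q.1 q.2 * φ q.2) + waveFluxR r q.1 q.2 * φ q.2) := by
    have I4 : Integrable fun q : ℝ × (ℝ × ℝ) =>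
        (3 / 2) * (waveFluxK r q.1 q.2 * φ q.2) + waveFluxR r q.1 q.2 * φ q.2 :=
      (I2.const_mul _).add I3
    rw [Measure.volume_eq_prod, integral_prod _ I1, integral_prod _ I4]
    congr 1; ext k
    refine (integral_mul_adjointL (contDiff_layerWave r k) hφ hc).trans ?_
    congr 1; ext p
    rw [operatorL_layerWave hr.1]; ring
  have e3 : ∫ q : ℝ × (ℝ × ℝ), waveFluxK r q.1 q.2 * φ q.2 = 0 := by
    rw [Measure.volume_eq_prod, integral_prod_symm _ I2]
    simp only [integral_mul_const, integral_waveFluxK hr, zero_mul, integral_zero]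
  rw [e1, e2, integral_add (I2.const_mul _) I3, integral_const_mul, e3]
  ring

/-- The initial contribution is a classical solution; the layers contribute the integral of the flux
in `r`, which vanishes on the support of the test function. -/
lemma solvesL_kernel : SolvesL kernel := by
  intro φ hφ hc hs
  obtain ⟨δ, M, hδ, hM, hK⟩ := exists_bounds_of_compact hc.isCompact hs
  have hm : MeasurableSet halfPlane := measurableSet_lt measurable_const measurable_snd
  have hφi : Integrable φ := hφ.continuous.integrable_of_hasCompactSupport hc
  have hφc := hφ.continuous
  have hψ := continuous_adjointL hφ
  obtain ⟨B, hB⟩ := hψ.bounded_above_of_compact_support (hasCompactSupport_adjointL hc)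
  have hB0 : 0 ≤ B := (norm_nonneg _).trans (hB 0)
  rw [setIntegral_eq_integral_of_forall_compl_eq_zero fun p hp => by
    rw [adjointL_eq_zero fun h => hp (hs h), mul_zero]]
  have h := integral_kernel_mul (w := fun p => (adjointL φ p : ℂ)) (D := B)
    (Complex.continuous_ofReal.comp hψ).aestronglyMeasurable fun p => by
      rw [Complex.norm_real]
      exact (hB p).trans (le_mul_of_one_le_right hB0 (by linarith [abs_nonneg p.2]))
  simp only [← Complex.ofReal_mul] at h
  simp only [integral_complex_ofReal, intervalIntegral.integral_ofReal] at h
  rw [← Complex.ofReal_mul, ← Complex.ofReal_add] at h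
  rw [Complex.ofReal_injective h, integral_mul_adjointL
    (by unfold initialProfile; fun_prop) hφ hc]
  simp only [operatorL_initialProfile, zero_mul, integral_zero, zero_add]
  apply mul_eq_zero_of_right
  rw [intervalIntegral.integral_of_le zero_le_one, setIntegral_congr_fun measurableSet_Ioc
    (g := fun r => -∫ q : ℝ × (ℝ × ℝ), waveFluxR r q.1 q.2 * φ q.2)
    fun r hr => integral_layerProfile_adjointL hφ hc hs hr]
  obtain ⟨C3, hC3, h3⟩ := exists_waveFluxR_le hδ M
  have hint : Integrable (Function.uncurry fun (r : ℝ) (q : ℝ × (ℝ × ℝ)) =>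
      waveFluxR r q.1 q.2 * φ q.2) ((volume.restrict (Ioc 0 1)).prod volume) := by
    have hb : Integrable fun q : ℝ × (ℝ × ℝ) => C3 * (1 + q.1 ^ 2)⁻¹ * |φ q.2| :=
      Integrable.mul_prod (integrable_inv_one_add_sq.const_mul C3) hφi.abs
    have := Integrable.mul_prod (μ := volume.restrict (Ioc (0 : ℝ) 1)) (ν := volume)
      (integrable_const (1 : ℝ)) hb
    refine this.mono' (measurable_waveFluxR.mul (hφc.measurable.comp
      (measurable_snd.comp measurable_snd))).aestronglyMeasurable ?_
    have : ∀ᵐ q : ℝ × (ℝ × (ℝ × ℝ)) ∂((volume.restrict (Ioc 0 1)).prod volume),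
        q.1 ∈ Ioc (0 : ℝ) 1 :=
      Measure.quasiMeasurePreserving_fst.ae (ae_restrict_mem measurableSet_Ioc)
    filter_upwards [this] with q hq
    simp only [Function.uncurry, norm_mul, Real.norm_eq_abs, one_mul]
    by_cases hp : q.2.2 ∈ tsupport φ
    · gcongr; exact h3 _ hq _ _ (hK _ hp).1 (hK _ hp).2.2
    · simp [image_eq_zero_of_notMem_tsupport hp]
  rw [integral_neg, integral_integral_swap hint]
  have : ∀ q : ℝ × (ℝ × ℝ), ∫ r in Ioc (0 : ℝ) 1, waveFluxR r q.1 q.2 * φ q.2 = 0 := by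
    intro q
    rw [integral_mul_const]
    by_cases hp : q.2 ∈ tsupport φ
    · rw [integral_waveFluxR _ (hs hp), zero_mul]
    · rw [image_eq_zero_of_notMem_tsupport hp, mul_zero]
  simp [this]

theorem isNormalizedKernel_kernel (m : ℕ) : IsNormalizedKernel m kernel where
  memL2 := memL2Weighted_kernel m
  solves := solvesL_kernel
  zeroTrace := hasZeroTrace_kernel
  momentum := momentum_kernel

/-! ### Differences of normalized solutions -/

lemma measurableSet_halfPlane : MeasurableSet halfPlane :=
  measurableSet_lt measurable_const measurable_snd

/-- A solution of the homogeneous problem with zero momentum and finitely many moments. -/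
structure IsNullSolution (d : ℝ × ℝ → ℝ) : Prop where
  aestronglyMeasurable : AEStronglyMeasurable d (volume.restrict halfPlane)
  moment : IntegrableOn (fun p => |d p| * (1 + p.1 ^ 2 + p.2 ^ 2) ^ 2) halfPlane
  sq : IntegrableOn (fun p => d p ^ 2 * (1 + p.1 ^ 2)) halfPlane
  solves : SolvesL d
  zeroTrace : HasZeroTrace d
  momentum : ∫ p in halfPlane, p.2 * d p = 0

lemma MemL2Weighted.moment {m : ℕ} (hm : 5 < m) {u : ℝ × ℝ → ℝ} (hu : MemL2Weighted m u) :
    IntegrableOn (fun p => |u p| * (1 + p.1 ^ 2 + p.2 ^ 2) ^ 2) halfPlane := by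
  have h : IntegrableOn (fun p : ℝ × ℝ => |u p| ^ 2 * (1 + p.1 ^ 2 + p.2 ^ 2) ^ m
      + (1 + p.1 ^ 2)⁻¹ * (1 + p.2 ^ 2)⁻¹) halfPlane := hu.2.add integrable_inv_prod.integrableOn
  refine h.mono' ?_ (Eventually.of_forall fun p => ?_)
  · exact hu.1.norm.mul (Continuous.aestronglyMeasurable (by fun_prop))
  · set w := 1 + p.1 ^ 2 + p.2 ^ 2 with hw
    have hw1 : 1 ≤ w := by rw [hw]; nlinarith [sq_nonneg p.1, sq_nonneg p.2]
    have hw0 : 0 < w := by linarith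
    rw [Real.norm_of_nonneg (by positivity)]
    have e1 : (w⁻¹) ^ 2 ≤ (1 + p.1 ^ 2)⁻¹ * (1 + p.2 ^ 2)⁻¹ := by
      rw [inv_pow, ← mul_inv]
      apply inv_anti₀ (by positivity)
      rw [pow_two w, hw]
      exact mul_le_mul (by linarith [sq_nonneg p.2]) (by linarith [sq_nonneg p.1])
        (by positivity) (by positivity)
    have e2 : w ^ 6 ≤ w ^ m := pow_le_pow_right₀ hw1 hm
    have e3 : |u p| * w ^ 2 = (|u p| * w ^ 3) * w⁻¹ := by field_simp
    rw [e3]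
    have e4 : ∀ a b : ℝ, a * b ≤ a ^ 2 + b ^ 2 := fun a b => by
      nlinarith [sq_nonneg (a - b), sq_nonneg a, sq_nonneg b]
    calc _ ≤ (|u p| * w ^ 3) ^ 2 + (w⁻¹) ^ 2 := e4 _ _
      _ = |u p| ^ 2 * w ^ 6 + (w⁻¹) ^ 2 := by ring
      _ ≤ _ := by gcongr

/-- Integrability against continuous weights of at most quartic growth. -/
lemma integrable_mul_of_moment {u : ℝ × ℝ → ℝ}
    (hu : AEStronglyMeasurable u (volume.restrict halfPlane))
    (hm : IntegrableOn (fun p => |u p| * (1 + p.1 ^ 2 + p.2 ^ 2) ^ 2) halfPlane)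
    {w : ℝ × ℝ → ℝ} (hw : AEStronglyMeasurable w (volume.restrict halfPlane)) {C : ℝ}
    (hC : ∀ p, |w p| ≤ C * (1 + p.1 ^ 2 + p.2 ^ 2) ^ 2) :
    IntegrableOn (fun p => u p * w p) halfPlane := by
  refine (hm.const_mul C).mono' (hu.mul hw) (Eventually.of_forall fun p => ?_)
  rw [norm_mul, Real.norm_eq_abs, Real.norm_eq_abs]
  calc _ ≤ |u p| * (C * (1 + p.1 ^ 2 + p.2 ^ 2) ^ 2) := by gcongr; exact hC p
    _ = _ := by ring

lemma abs_le_mul_weight {x C : ℝ} (h : |x| ≤ C) (p : ℝ × ℝ) :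
    |x| ≤ C * (1 + p.1 ^ 2 + p.2 ^ 2) ^ 2 := by
  refine h.trans (le_mul_of_one_le_right ((abs_nonneg _).trans h) ?_)
  exact one_le_pow₀ (by nlinarith [sq_nonneg p.1, sq_nonneg p.2])

lemma isNullSolution_sub {m : ℕ} (hm : 5 < m) {u v : ℝ × ℝ → ℝ} (hu : IsNormalizedKernel m u)
    (hv : IsNormalizedKernel m v) : IsNullSolution fun p => u p - v p := by
  have mu := hu.memL2.moment hm
  have mv := hv.memL2.moment hm
  have hw : ∀ p : ℝ × ℝ, 1 ≤ 1 + p.1 ^ 2 + p.2 ^ 2 := fun p => by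
    nlinarith [sq_nonneg p.1, sq_nonneg p.2]
  refine ⟨hu.memL2.1.sub hv.memL2.1, ?_, ?_, ?_, ?_, ?_⟩
  · refine (mu.add mv).mono' ?_ (Eventually.of_forall fun p => ?_)
    · exact (hu.memL2.1.sub hv.memL2.1).norm.mul (Continuous.aestronglyMeasurable (by fun_prop))
    · rw [Real.norm_of_nonneg (by positivity), Pi.add_apply, ← add_mul]
      gcongr
      exact abs_sub _ _
  · have h2 := (hu.memL2.2.const_mul 2).add (hv.memL2.2.const_mul 2)
    refine h2.mono' ?_ (Eventually.of_forall fun p => ?_)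
    · exact ((hu.memL2.1.sub hv.memL2.1).pow 2).mul (Continuous.aestronglyMeasurable (by fun_prop))
    · rw [Real.norm_of_nonneg (by positivity)]
      have e1 : 1 + p.1 ^ 2 ≤ (1 + p.1 ^ 2 + p.2 ^ 2) ^ m := by
        refine le_trans ?_ (le_self_pow₀ (hw p) (by omega))
        nlinarith [sq_nonneg p.2]
      have e2 : (u p - v p) ^ 2 ≤ 2 * |u p| ^ 2 + 2 * |v p| ^ 2 := by
        rw [sq_abs, sq_abs]; nlinarith [sq_nonneg (u p + v p)]
      calc _ ≤ (2 * |u p| ^ 2 + 2 * |v p| ^ 2) * (1 + p.1 ^ 2 + p.2 ^ 2) ^ m := by gcongr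
        _ = _ := by simp only [Pi.add_apply]; ring
  · intro φ hφ hc hs
    have hψ := continuous_adjointL hφ
    obtain ⟨B, hB⟩ := hψ.bounded_above_of_compact_support (hasCompactSupport_adjointL hc)
    have i1 := integrable_mul_of_moment hu.memL2.1 mu hψ.aestronglyMeasurable
      fun p => abs_le_mul_weight (hB p) p
    have i2 := integrable_mul_of_moment hv.memL2.1 mv hψ.aestronglyMeasurable
      fun p => abs_le_mul_weight (hB p) p
    simp only [sub_mul]
    rw [integral_sub i1 i2, hu.solves φ hφ hc hs, hv.solves φ hφ hc hs, sub_zero]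
  · intro φ hφ hc
    obtain ⟨B, hB⟩ := hφ.continuous.bounded_above_of_compact_support hc
    have hφ' := hφ.continuous
    have hφm : Continuous fun p : ℝ × ℝ => φ p.1 := by fun_prop
    have i1 := integrable_mul_of_moment hu.memL2.1 mu hφm.aestronglyMeasurable
      fun p => abs_le_mul_weight (hB p.1) p
    have i2 := integrable_mul_of_moment hv.memL2.1 mv hφm.aestronglyMeasurable
      fun p => abs_le_mul_weight (hB p.1) p
    have hsub : ∀ ε : ℝ, (univ : Set ℝ) ×ˢ Ioo 0 ε ⊆ halfPlane := fun ε p hp => hp.2.1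
    have h := (hu.zeroTrace φ hφ hc).sub (hv.zeroTrace φ hφ hc)
    rw [sub_zero] at h
    refine h.congr fun ε => ?_
    rw [← mul_sub, ← integral_sub (i1.mono_set (hsub ε)) (i2.mono_set (hsub ε))]
    simp only [sub_mul]
  · have hY : ∀ p : ℝ × ℝ, |p.2| ≤ 1 * (1 + p.1 ^ 2 + p.2 ^ 2) ^ 2 := by
      intro p
      have : |p.2| ≤ 1 + p.1 ^ 2 + p.2 ^ 2 := by
        rw [← sq_abs p.2]; nlinarith [sq_nonneg (|p.2| - 1), sq_nonneg p.1, sq_nonneg (|p.2|)]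
      rw [one_mul]
      exact this.trans (le_self_pow₀ (hw p) (by norm_num))
    have i1 := integrable_mul_of_moment hu.memL2.1 mu
      (w := fun p => p.2) (Continuous.aestronglyMeasurable (by fun_prop)) hY
    have i2 := integrable_mul_of_moment hv.memL2.1 mv
      (w := fun p => p.2) (Continuous.aestronglyMeasurable (by fun_prop)) hY
    have e1 := hu.momentum
    have e2 := hv.momentum
    simp only [mul_comm _ (u _), mul_comm _ (v _)] at e1 e2
    have : ∀ p : ℝ × ℝ, p.2 * (u p - v p) = u p * p.2 - v p * p.2 := fun p => by ring
    simp only [this]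
    rw [integral_sub i1 i2, e1, e2, sub_self]

/-! ### Admissible test functions -/

/-- The adjoint operator applied to the product `f(X) g(Y)`. -/
noncomputable def adjointProd (f g : ℝ → ℝ) (p : ℝ × ℝ) : ℝ :=
  f p.1 * deriv (deriv g) p.2 - (3 / 2) * p.1 * deriv f p.1 * g p.2
    - (1 / 2) * p.2 * f p.1 * deriv g p.2 + (1 / 2) * f p.1 * g p.2 + p.2 * deriv f p.1 * g p.2

lemma hasDerivAt_of_contDiff {f : ℝ → ℝ} (hf : ContDiff ℝ ∞ f) (x : ℝ) :
    HasDerivAt f (deriv f x) x := (hf.differentiable (by simp) x).hasDerivAt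

lemma contDiff_deriv {f : ℝ → ℝ} (hf : ContDiff ℝ ∞ f) : ContDiff ℝ ∞ (deriv f) := by
  simpa using contDiff_iteratedDeriv hf 1

lemma adjointL_prod {f g : ℝ → ℝ} (hf : ContDiff ℝ ∞ f) (hg : ContDiff ℝ ∞ g) (p : ℝ × ℝ) :
    adjointL (fun q => f q.1 * g q.2) p = adjointProd f g p := by
  have hg' := contDiff_deriv hg
  have dY : partialY (fun q : ℝ × ℝ => f q.1 * g q.2) = fun q => f q.1 * deriv g q.2 := by
    ext q
    apply partialY_eq (ContDiff.differentiable (n := ∞) (by fun_prop) (by simp) q)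
    exact (hasDerivAt_of_contDiff hg q.2).const_mul (f q.1)
  have dYY : partialY (partialY (fun q : ℝ × ℝ => f q.1 * g q.2)) p
      = f p.1 * deriv (deriv g) p.2 := by
    rw [dY]
    apply partialY_eq (ContDiff.differentiable (n := ∞) (by fun_prop) (by simp) p)
    exact (hasDerivAt_of_contDiff hg' p.2).const_mul (f p.1)
  have d1 : partialX (fun q : ℝ × ℝ => q.1 * (f q.1 * g q.2)) p
      = f p.1 * g p.2 + p.1 * (deriv f p.1 * g p.2) := by
    apply partialX_eq (ContDiff.differentiable (n := ∞) (by fun_prop) (by simp) p)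
    refine ((hasDerivAt_id p.1).mul ((hasDerivAt_of_contDiff hf _).mul_const (g p.2))).congr_deriv ?_
    simp
  have d2 : partialY (fun q : ℝ × ℝ => q.2 * (f q.1 * g q.2)) p
      = f p.1 * g p.2 + p.2 * (f p.1 * deriv g p.2) := by
    apply partialY_eq (ContDiff.differentiable (n := ∞) (by fun_prop) (by simp) p)
    refine ((hasDerivAt_id p.2).mul ((hasDerivAt_of_contDiff hg _).const_mul (f p.1))).congr_deriv ?_
    simp
  have d3 : partialX (fun q : ℝ × ℝ => q.2 * (f q.1 * g q.2)) p
      = p.2 * (deriv f p.1 * g p.2) := by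
    apply partialX_eq (ContDiff.differentiable (n := ∞) (by fun_prop) (by simp) p)
    exact ((hasDerivAt_of_contDiff hf _).mul_const (g p.2)).const_mul p.2
  rw [adjointL, dYY, d1, d2, d3, adjointProd]
  ring

/-- A product test function whose second factor vanishes near `Y ≤ 0` is admissible. -/
lemma IsNullSolution.integral_adjointProd_of_interior {d : ℝ × ℝ → ℝ} (hd : IsNullSolution d)
    {f g : ℝ → ℝ} (hf : ContDiff ℝ ∞ f) (hfc : HasCompactSupport f) (hg : ContDiff ℝ ∞ g)
    (hgc : HasCompactSupport g) {δ : ℝ} (hδ : 0 < δ) (h0 : ∀ y < δ, g y = 0) :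
    ∫ p in halfPlane, d p * adjointProd f g p = 0 := by
  have h := hd.solves (fun q => f q.1 * g q.2) (by fun_prop) ?_ ?_
  · simpa only [adjointL_prod hf hg] using h
  · refine HasCompactSupport.intro (hfc.isCompact.prod hgc.isCompact) fun q hq => ?_
    by_contra hne
    exact hq ⟨subset_tsupport _ (left_ne_zero_of_mul hne), subset_tsupport _ (right_ne_zero_of_mul hne)⟩
  · have hcl : IsClosed {q : ℝ × ℝ | δ ≤ q.2} := isClosed_le continuous_const continuous_snd
    refine (closure_minimal (fun q hq => ?_) hcl).trans fun q hq => lt_of_lt_of_le hδ hq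
    by_contra hne
    exact hq (by simp only; rw [h0 q.2 (not_le.1 hne), mul_zero])

/-- Averages of a function of zero trace against any rescaled profile tend to zero. -/
lemma IsNullSolution.tendsto_trace {d : ℝ × ℝ → ℝ} (hd : IsNullSolution d)
    {f : ℝ → ℝ} (hf : ContDiff ℝ ∞ f) (hfc : HasCompactSupport f) {l : ℝ → ℝ}
    (hl : ContDiff ℝ ∞ l) (hl3 : ∀ y, 3 ≤ y → l y = 0) {L : ℝ} (hL : ∀ y, |deriv l y| ≤ L) :
    Tendsto (fun ε : ℝ => ε⁻¹ * ∫ p in halfPlane, d p * (f p.1 * l (p.2 * ε⁻¹))) (𝓝[>] 0) (𝓝 0) := by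
  have hL0 : 0 ≤ L := (abs_nonneg _).trans (hL 0)
  have hfc' := hf.continuous
  obtain ⟨B, hB⟩ := hfc'.bounded_above_of_compact_support hfc
  have hfm : Continuous fun p : ℝ × ℝ => f p.1 := by fun_prop
  have hdf := integrable_mul_of_moment hd.aestronglyMeasurable hd.moment
    hfm.aestronglyMeasurable fun p => abs_le_mul_weight (hB p.1) p
  set T : ℝ → ℝ := fun s => ∫ p in (univ : Set ℝ) ×ˢ Ioo 0 s, d p * f p.1 with hT
  have key : ∀ ε : ℝ, 0 < ε → ∫ p in halfPlane, d p * (f p.1 * l (p.2 * ε⁻¹))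
      = -∫ t in Ioc (0 : ℝ) 3, deriv l t * T (t * ε) := by
    intro ε hε
    have hl' := (contDiff_deriv hl).continuous
    set S : Set ((ℝ × ℝ) × ℝ) := {q | q.1.2 < q.2 * ε} with hS
    have hSm : MeasurableSet S := measurableSet_lt (by fun_prop) (by fun_prop)
    have hint : Integrable (Function.uncurry fun (p : ℝ × ℝ) (t : ℝ) =>
        S.indicator (fun q : (ℝ × ℝ) × ℝ => (d q.1 * f q.1.1) * deriv l q.2) (p, t))
        ((volume.restrict halfPlane).prod (volume.restrict (Ioc 0 3))) := by
      refine Integrable.indicator ?_ hSm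
      refine Integrable.mul_prod hdf ?_
      exact (hl'.integrableOn_Icc (a := 0) (b := 3)).mono_set Ioc_subset_Icc_self
    have e1 : ∀ p ∈ halfPlane, d p * (f p.1 * l (p.2 * ε⁻¹)) = -∫ t in Ioc (0 : ℝ) 3,
        S.indicator (fun q : (ℝ × ℝ) × ℝ => (d q.1 * f q.1.1) * deriv l q.2) (p, t) := by
      intro p hp
      have hp : 0 < p.2 := hp
      have hy : 0 < p.2 * ε⁻¹ := by positivity
      have e2 : ∀ t, S.indicator (fun q : (ℝ × ℝ) × ℝ => (d q.1 * f q.1.1) * deriv l q.2) (p, t)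
          = (Ioi (p.2 * ε⁻¹)).indicator (fun t => (d p * f p.1) * deriv l t) t := by
        intro t
        have : (p, t) ∈ S ↔ t ∈ Ioi (p.2 * ε⁻¹) := by
          rw [hS, mem_ofPred_eq, mem_Ioi, ← div_eq_mul_inv, div_lt_iff₀ hε]
        by_cases h : (p, t) ∈ S
        · rw [indicator_of_mem h, indicator_of_mem (this.1 h)]
        · rw [indicator_of_notMem h, indicator_of_notMem (fun h' => h (this.2 h'))]
      simp only [e2]
      rw [setIntegral_indicator measurableSet_Ioi, integral_const_mul, Ioc_inter_Ioi,
        max_eq_right hy.le]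
      rcases le_total 3 (p.2 * ε⁻¹) with h | h
      · rw [hl3 _ h, Ioc_eq_empty_of_le h]; simp
      · rw [← intervalIntegral.integral_of_le h, intervalIntegral.integral_eq_sub_of_hasDerivAt
          (fun x _ => hasDerivAt_of_contDiff hl x) (hl'.intervalIntegrable _ _), hl3 3 le_rfl]
        ring
    rw [setIntegral_congr_fun measurableSet_halfPlane e1, integral_neg,
      integral_integral_swap hint]
    congr 1
    apply setIntegral_congr_fun measurableSet_Ioc
    intro t ht
    have e3 : ∀ p : ℝ × ℝ, S.indicator (fun q : (ℝ × ℝ) × ℝ => (d q.1 * f q.1.1) * deriv l q.2) (p, t)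
        = deriv l t * {p : ℝ × ℝ | p.2 < t * ε}.indicator (fun p => d p * f p.1) p := by
      intro p
      by_cases h : p.2 < t * ε
      · rw [indicator_of_mem (show (p, t) ∈ S from h), indicator_of_mem (show p ∈ {p : ℝ × ℝ | p.2 < t * ε} from h)]
        ring
      · rw [indicator_of_notMem (show (p, t) ∉ S from h),
          indicator_of_notMem (show p ∉ {p : ℝ × ℝ | p.2 < t * ε} from h), mul_zero]
    simp only [e3]
    rw [integral_const_mul, setIntegral_indicator (measurableSet_lt (by fun_prop) (by fun_prop)), hT]
    congr 3
    ext p; simp [halfPlane]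
  have h0 := hd.zeroTrace f hf hfc
  rw [Metric.tendsto_nhds] at h0 ⊢
  intro η hη
  have hη' : 0 < η / (9 * L + 1) := by positivity
  obtain ⟨δ, hδ, hδ'⟩ := mem_nhdsGT_iff_exists_Ioo_subset.1 (h0 _ hη')
  have hδ : 0 < δ := hδ
  filter_upwards [Ioo_mem_nhdsGT (show (0 : ℝ) < δ / 3 by positivity)] with ε hε
  have hε0 := hε.1
  rw [key ε hε0, dist_zero_right, mul_neg, norm_neg, norm_mul, Real.norm_of_nonneg (by positivity)]
  have hb : ∀ t ∈ Ioc (0 : ℝ) 3, ‖deriv l t * T (t * ε)‖ ≤ L * (3 * ε * (η / (9 * L + 1))) := by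
    intro t ht
    have hmem : t * ε ∈ Ioo 0 δ := by
      refine ⟨mul_pos ht.1 hε0, ?_⟩
      have := hε.2
      nlinarith [ht.2, mul_le_mul_of_nonneg_right ht.2 hε0.le]
    have h1 := hδ' hmem
    rw [mem_ofPred_eq, dist_zero_right, norm_mul, norm_inv, Real.norm_of_nonneg hmem.1.le,
      inv_mul_lt_iff₀ hmem.1] at h1
    rw [norm_mul]
    refine mul_le_mul (hL t) (h1.le.trans ?_) (norm_nonneg _) hL0
    gcongr
    exact ht.2
  have h2 := norm_setIntegral_le_of_norm_le_const (μ := volume) (by simp) hb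
  rw [measureReal_def, Real.volume_Ioc, ENNReal.toReal_ofReal (by norm_num)] at h2
  calc _ ≤ ε⁻¹ * (L * (3 * ε * (η / (9 * L + 1))) * (3 - 0)) := by gcongr
    _ = 9 * L * η / (9 * L + 1) := by field_simp; ring
    _ < η := by
        rw [div_lt_iff₀ (by positivity)]; nlinarith

/-! ### Truncations -/

lemma deriv_mul_comp {g κ : ℝ → ℝ} (hg : ContDiff ℝ ∞ g) (hκ : ContDiff ℝ ∞ κ) (c y : ℝ) :
    HasDerivAt (fun y => g y * κ (y * c)) (deriv g y * κ (y * c) + c * (g y * deriv κ (y * c))) y := by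
  have h := (hasDerivAt_of_contDiff hκ (y * c)).comp y ((hasDerivAt_id y).mul_const c)
  refine ((hasDerivAt_of_contDiff hg y).mul h).congr_deriv ?_
  simp; ring

lemma deriv_deriv_mul_comp {g κ : ℝ → ℝ} (hg : ContDiff ℝ ∞ g) (hκ : ContDiff ℝ ∞ κ) (c y : ℝ) :
    deriv (deriv fun y => g y * κ (y * c)) y = deriv (deriv g) y * κ (y * c)
      + 2 * c * (deriv g y * deriv κ (y * c)) + c ^ 2 * (g y * deriv (deriv κ) (y * c)) := by
  have e : deriv (fun y => g y * κ (y * c))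
      = fun y => deriv g y * κ (y * c) + c * (g y * deriv κ (y * c)) :=
    funext fun y => (deriv_mul_comp hg hκ c y).deriv
  rw [e]
  refine HasDerivAt.deriv (((deriv_mul_comp (contDiff_deriv hg) hκ c y).add
    ((deriv_mul_comp hg (contDiff_deriv hκ) c y).const_mul c)).congr_deriv ?_)
  ring

/-- A smooth cutoff: `0` for `y ≤ 1`, `1` for `2 ≤ y`. -/
noncomputable def cutoff (y : ℝ) : ℝ := Real.smoothTransition (y - 1)

lemma contDiff_cutoff : ContDiff ℝ ∞ cutoff := by
  have : ContDiff ℝ ∞ Real.smoothTransition := Real.smoothTransition.contDiff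
  unfold cutoff; fun_prop

lemma cutoff_of_le {y : ℝ} (h : y ≤ 1) : cutoff y = 0 :=
  Real.smoothTransition.zero_of_nonpos (by linarith)

lemma cutoff_of_ge {y : ℝ} (h : 2 ≤ y) : cutoff y = 1 :=
  Real.smoothTransition.one_of_one_le (by linarith)

lemma abs_cutoff_le (y : ℝ) : |cutoff y| ≤ 1 := by
  rw [cutoff, abs_of_nonneg (Real.smoothTransition.nonneg _)]
  exact Real.smoothTransition.le_one _

lemma deriv_cutoff_of_gt {y : ℝ} (h : 2 < y) : deriv cutoff y = 0 := by
  have : cutoff =ᶠ[𝓝 y] fun _ => 1 := by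
    filter_upwards [Ioi_mem_nhds h] with z hz using cutoff_of_ge (le_of_lt hz)
  rw [this.deriv_eq, deriv_const]

lemma deriv_cutoff_of_lt {y : ℝ} (h : y < 1) : deriv cutoff y = 0 := by
  have : cutoff =ᶠ[𝓝 y] fun _ => 0 := by
    filter_upwards [Iio_mem_nhds h] with z hz using cutoff_of_le (le_of_lt hz)
  rw [this.deriv_eq, deriv_const]

lemma deriv_deriv_cutoff_of_gt {y : ℝ} (h : 2 < y) : deriv (deriv cutoff) y = 0 := by
  have : deriv cutoff =ᶠ[𝓝 y] fun _ => 0 := by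
    filter_upwards [Ioi_mem_nhds h] with z hz using deriv_cutoff_of_gt hz
  rw [this.deriv_eq, deriv_const]

lemma deriv_deriv_cutoff_of_lt {y : ℝ} (h : y < 1) : deriv (deriv cutoff) y = 0 := by
  have : deriv cutoff =ᶠ[𝓝 y] fun _ => 0 := by
    filter_upwards [Iio_mem_nhds h] with z hz using deriv_cutoff_of_lt hz
  rw [this.deriv_eq, deriv_const]

lemma exists_bound_of_eq_zero {f : ℝ → ℝ} (hf : Continuous f) (h1 : ∀ y < 1, f y = 0)
    (h2 : ∀ y, 2 < y → f y = 0) : ∃ C, ∀ y, |f y| ≤ C :=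
  hf.bounded_above_of_compact_support (HasCompactSupport.intro (isCompact_Icc (a := 1) (b := 2))
    fun y hy => by
      by_cases h : y < 1
      · exact h1 y h
      · exact h2 y (not_le.1 fun h' => hy ⟨not_lt.1 h, h'⟩))

lemma abs_sub_taylor_le {g : ℝ → ℝ} (hg : ContDiff ℝ ∞ g) (h0 : g 0 = 0) {C : ℝ}
    (hC : ∀ y, |deriv (deriv g) y| ≤ C) {y : ℝ} (hy : 0 ≤ y) :
    |deriv g y - deriv g 0| ≤ C * y ∧ |g y - deriv g 0 * y| ≤ C * y * y := by
  have h1 : ∀ z, 0 ≤ z → |deriv g z - deriv g 0| ≤ C * z := by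
    intro z hz
    have := Convex.norm_image_sub_le_of_norm_deriv_le (f := deriv g) (s := univ) (C := C) (x := 0)
      (y := z) (fun x _ => (contDiff_deriv hg).differentiable (by simp) x) (fun x _ => hC x)
      convex_univ (mem_univ _) (mem_univ _)
    simpa [abs_of_nonneg hz] using this
  refine ⟨h1 y hy, ?_⟩
  have hC0 : 0 ≤ C := (abs_nonneg _).trans (hC 0)
  have := Convex.norm_image_sub_le_of_norm_hasDerivWithin_le (f := fun z => g z - deriv g 0 * z)
    (f' := fun z => deriv g z - deriv g 0) (s := Icc 0 y) (C := C * y) (x := 0) (y := y)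
    (fun x _ => by
      have := ((hasDerivAt_of_contDiff hg x).sub ((hasDerivAt_id x).const_mul (deriv g 0)))
      exact (this.congr_deriv (by simp)).hasDerivWithinAt)
    (fun x hx => (h1 x hx.1).trans (mul_le_mul_of_nonneg_left hx.2 hC0))
    (convex_Icc _ _) (left_mem_Icc.2 hy) (right_mem_Icc.2 hy)
  simpa [h0, abs_of_nonneg hy] using this

lemma continuous_adjointProd {f g : ℝ → ℝ} (hf : ContDiff ℝ ∞ f) (hg : ContDiff ℝ ∞ g) :
    Continuous (adjointProd f g) := by
  have h1 := hf.continuous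
  have h2 := (contDiff_deriv hf).continuous
  have h3 := hg.continuous
  have h4 := (contDiff_deriv hg).continuous
  have h5 := (contDiff_deriv (contDiff_deriv hg)).continuous
  unfold adjointProd; fun_prop

lemma abs_adjointProd_le {f g : ℝ → ℝ} {A B : ℝ} (hf : ∀ x, |f x| ≤ A) (hf' : ∀ x, |deriv f x| ≤ A)
    (hg : ∀ x, |g x| ≤ B) (hg' : ∀ x, |deriv g x| ≤ B) (hg'' : ∀ x, |deriv (deriv g) x| ≤ B)
    (p : ℝ × ℝ) : |adjointProd f g p| ≤ 6 * (A * B) * (1 + p.1 ^ 2 + p.2 ^ 2) ^ 2 := by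
  have hA : 0 ≤ A := (abs_nonneg _).trans (hf 0)
  have hB : 0 ≤ B := (abs_nonneg _).trans (hg 0)
  have hm : ∀ a b : ℝ, |a| ≤ A → |b| ≤ B → |a * b| ≤ A * B := fun a b ha hb => by
    rw [abs_mul]; exact mul_le_mul ha hb (abs_nonneg _) hA
  set w := 1 + p.1 ^ 2 + p.2 ^ 2 with hw
  have hw1 : 1 ≤ w := by rw [hw]; nlinarith [sq_nonneg p.1, sq_nonneg p.2]
  have hX : |p.1| ≤ w := by
    rw [hw, ← sq_abs p.1]; nlinarith [sq_nonneg (|p.1| - 1), sq_nonneg p.2, sq_nonneg (|p.1|)]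
  have hY : |p.2| ≤ w := by
    rw [hw, ← sq_abs p.2]; nlinarith [sq_nonneg (|p.2| - 1), sq_nonneg p.1, sq_nonneg (|p.2|)]
  have hw2 : w ≤ w ^ 2 := by nlinarith
  have hAB : 0 ≤ A * B := by positivity
  have t1 := hm _ _ (hf p.1) (hg'' p.2)
  have t2 := hm _ _ (hf' p.1) (hg p.2)
  have t3 := hm _ _ (hf p.1) (hg' p.2)
  have t4 := hm _ _ (hf p.1) (hg p.2)
  have s2 : |p.1 * (deriv f p.1 * g p.2)| ≤ w * (A * B) := by
    rw [abs_mul]; exact mul_le_mul hX t2 (abs_nonneg _) (by linarith)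
  have s3 : |p.2 * (f p.1 * deriv g p.2)| ≤ w * (A * B) := by
    rw [abs_mul]; exact mul_le_mul hY t3 (abs_nonneg _) (by linarith)
  have s5 : |p.2 * (deriv f p.1 * g p.2)| ≤ w * (A * B) := by
    rw [abs_mul]; exact mul_le_mul hY t2 (abs_nonneg _) (by linarith)
  have e : adjointProd f g p = f p.1 * deriv (deriv g) p.2
      - (3 / 2) * (p.1 * (deriv f p.1 * g p.2)) - (1 / 2) * (p.2 * (f p.1 * deriv g p.2))
      + (1 / 2) * (f p.1 * g p.2) + p.2 * (deriv f p.1 * g p.2) := by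
    rw [adjointProd]; ring
  have q1 : A * B ≤ A * B * w := le_mul_of_one_le_right hAB hw1
  have q2 : A * B * w ≤ A * B * w ^ 2 := mul_le_mul_of_nonneg_left hw2 hAB
  rw [e]
  rw [abs_le] at t1 t4 s2 s3 s5 ⊢
  constructor <;> nlinarith [t1.1, t1.2, t4.1, t4.2, s2.1, s2.2, s3.1, s3.2, s5.1, s5.2]

lemma exists_bound_of_hasCompactSupport {g : ℝ → ℝ} (hg : ContDiff ℝ ∞ g)
    (hgc : HasCompactSupport g) : ∃ B, (∀ x, |g x| ≤ B) ∧ (∀ x, |deriv g x| ≤ B) ∧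
      ∀ x, |deriv (deriv g) x| ≤ B := by
  obtain ⟨a, ha⟩ := hg.continuous.bounded_above_of_compact_support hgc
  obtain ⟨b, hb⟩ := (contDiff_deriv hg).continuous.bounded_above_of_compact_support hgc.deriv
  obtain ⟨c, hc⟩ := (contDiff_deriv (contDiff_deriv hg)).continuous.bounded_above_of_compact_support
    hgc.deriv.deriv
  refine ⟨max a (max b c), fun x => (ha x).trans (le_max_left _ _),
    fun x => (hb x).trans ((le_max_left _ _).trans (le_max_right _ _)),
    fun x => (hc x).trans ((le_max_right _ _).trans (le_max_right _ _))⟩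

/-- The vanishing trace admits test functions that only vanish on the boundary `Y = 0`. -/
lemma IsNullSolution.integral_adjointProd_of_compact {d : ℝ × ℝ → ℝ} (hd : IsNullSolution d)
    {f g : ℝ → ℝ} (hf : ContDiff ℝ ∞ f) (hfc : HasCompactSupport f) (hg : ContDiff ℝ ∞ g)
    (hgc : HasCompactSupport g) (h0 : g 0 = 0) :
    ∫ p in halfPlane, d p * adjointProd f g p = 0 := by
  have hκ := contDiff_cutoff
  have hκ1 := contDiff_deriv hκ
  have hκ2 := contDiff_deriv hκ1
  have hκ3 := contDiff_deriv hκ2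
  obtain ⟨A, hA, hA', -⟩ := exists_bound_of_hasCompactSupport hf hfc
  obtain ⟨B, hB, hB', hB''⟩ := exists_bound_of_hasCompactSupport hg hgc
  obtain ⟨L1, hL1⟩ := exists_bound_of_eq_zero hκ1.continuous (fun y => deriv_cutoff_of_lt)
    (fun y => deriv_cutoff_of_gt)
  obtain ⟨L2, hL2⟩ := exists_bound_of_eq_zero hκ2.continuous (fun y => deriv_deriv_cutoff_of_lt)
    (fun y => deriv_deriv_cutoff_of_gt)
  have hA0 : 0 ≤ A := (abs_nonneg _).trans (hA 0)
  have hB0 : 0 ≤ B := (abs_nonneg _).trans (hB 0)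
  have hL10 : 0 ≤ L1 := (abs_nonneg _).trans (hL1 0)
  have hL20 : 0 ≤ L2 := (abs_nonneg _).trans (hL2 0)
  set a := deriv g 0 with ha
  -- the profile `l` is the second derivative of `y * cutoff y`
  set l : ℝ → ℝ := fun y => 2 * deriv cutoff y + y * deriv (deriv cutoff) y with hl
  have hlc : ContDiff ℝ ∞ l := by fun_prop
  have hl3 : ∀ y, 2 < y → l y = 0 := fun y hy => by
    simp only [hl]; rw [deriv_cutoff_of_gt hy, deriv_deriv_cutoff_of_gt hy]; ring
  have hl1 : ∀ y, y < 1 → l y = 0 := fun y hy => by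
    simp only [hl]; rw [deriv_cutoff_of_lt hy, deriv_deriv_cutoff_of_lt hy]; ring
  obtain ⟨L, hL⟩ := exists_bound_of_eq_zero (contDiff_deriv hlc).continuous
    (fun y hy => by
      have : l =ᶠ[𝓝 y] fun _ => 0 := by filter_upwards [Iio_mem_nhds hy] with z hz using hl1 z hz
      rw [this.deriv_eq, deriv_const])
    (fun y hy => by
      have : l =ᶠ[𝓝 y] fun _ => 0 := by filter_upwards [Ioi_mem_nhds hy] with z hz using hl3 z hz
      rw [this.deriv_eq, deriv_const])
  have htr := hd.tendsto_trace hf hfc hlc (fun y hy => hl3 y (by linarith)) hL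
  -- the part of the truncated test function that stays bounded as `ε → 0`
  set R : ℝ → ℝ × ℝ → ℝ := fun ε p => cutoff (p.2 * ε⁻¹) * adjointProd f g p
    + f p.1 * (2 * ((deriv g p.2 - a) * ε⁻¹ * deriv cutoff (p.2 * ε⁻¹))
      + (g p.2 - a * p.2) * ε⁻¹ ^ 2 * deriv (deriv cutoff) (p.2 * ε⁻¹))
    - (1 / 2) * (f p.1 * g p.2 * (p.2 * ε⁻¹ * deriv cutoff (p.2 * ε⁻¹))) with hR
  have hRc : ∀ ε, Continuous (R ε) := by
    intro ε
    have c1 := continuous_adjointProd hf hg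
    have c2 := hf.continuous
    have c3 := hg.continuous
    have c4 := (contDiff_deriv hg).continuous
    have c5 := hκ.continuous
    have c6 := hκ1.continuous
    have c7 := hκ2.continuous
    simp only [hR]; fun_prop
  set M := A * (2 * (B * 2 * L1) + B * 2 * 2 * L2) + 1 / 2 * (A * B * (2 * L1)) with hM
  have hRle : ∀ ε, 0 < ε → ∀ p ∈ halfPlane, |R ε p| ≤ |adjointProd f g p| + M := by
    intro ε hε p hp
    have hp : 0 < p.2 := hp
    have hy : 0 < p.2 * ε⁻¹ := by positivity
    have m1 : |cutoff (p.2 * ε⁻¹) * adjointProd f g p| ≤ |adjointProd f g p| := by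
      rw [abs_mul]; exact mul_le_of_le_one_left (abs_nonneg _) (abs_cutoff_le _)
    rcases lt_or_ge 2 (p.2 * ε⁻¹) with h | h
    · have : R ε p = cutoff (p.2 * ε⁻¹) * adjointProd f g p := by
        simp only [hR]; rw [deriv_cutoff_of_gt h, deriv_deriv_cutoff_of_gt h]; ring
      rw [this]
      have : 0 ≤ M := by positivity
      linarith
    · obtain ⟨g1, g2⟩ := abs_sub_taylor_le hg h0 hB'' hp.le
      have n1 : |(deriv g p.2 - a) * ε⁻¹ * deriv cutoff (p.2 * ε⁻¹)| ≤ B * 2 * L1 := by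
        rw [abs_mul, abs_mul, abs_of_pos (inv_pos.2 hε)]
        have : |deriv g p.2 - a| * ε⁻¹ ≤ B * 2 := by
          calc _ ≤ B * p.2 * ε⁻¹ := by gcongr
            _ = B * (p.2 * ε⁻¹) := by ring
            _ ≤ _ := by gcongr
        exact mul_le_mul this (hL1 _) (abs_nonneg _) (by positivity)
      have n2 : |(g p.2 - a * p.2) * ε⁻¹ ^ 2 * deriv (deriv cutoff) (p.2 * ε⁻¹)| ≤ B * 2 * 2 * L2 := by
        rw [abs_mul, abs_mul, abs_of_pos (pow_pos (inv_pos.2 hε) 2)]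
        have : |g p.2 - a * p.2| * ε⁻¹ ^ 2 ≤ B * 2 * 2 := by
          calc _ ≤ B * p.2 * p.2 * ε⁻¹ ^ 2 := by gcongr
            _ = B * (p.2 * ε⁻¹) * (p.2 * ε⁻¹) := by ring
            _ ≤ _ := by gcongr
        exact mul_le_mul this (hL2 _) (abs_nonneg _) (by positivity)
      have n3 : |p.2 * ε⁻¹ * deriv cutoff (p.2 * ε⁻¹)| ≤ 2 * L1 := by
        rw [abs_mul, abs_of_pos hy]
        exact mul_le_mul h (hL1 _) (abs_nonneg _) (by norm_num)
      simp only [hR]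
      refine (abs_sub _ _).trans ?_
      have o1 := (abs_add_le (cutoff (p.2 * ε⁻¹) * adjointProd f g p)
        (f p.1 * (2 * ((deriv g p.2 - a) * ε⁻¹ * deriv cutoff (p.2 * ε⁻¹))
        + (g p.2 - a * p.2) * ε⁻¹ ^ 2 * deriv (deriv cutoff) (p.2 * ε⁻¹))))
      have o2 : |f p.1 * (2 * ((deriv g p.2 - a) * ε⁻¹ * deriv cutoff (p.2 * ε⁻¹))
        + (g p.2 - a * p.2) * ε⁻¹ ^ 2 * deriv (deriv cutoff) (p.2 * ε⁻¹))|
          ≤ A * (2 * (B * 2 * L1) + B * 2 * 2 * L2) := by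
        rw [abs_mul]
        refine mul_le_mul (hA _) ((abs_add_le _ _).trans (add_le_add ?_ n2)) (abs_nonneg _) hA0
        rw [abs_mul, abs_two]; gcongr
      have o3 : |(1 / 2) * (f p.1 * g p.2 * (p.2 * ε⁻¹ * deriv cutoff (p.2 * ε⁻¹)))|
          ≤ 1 / 2 * (A * B * (2 * L1)) := by
        rw [abs_mul, abs_of_pos (by norm_num : (0 : ℝ) < 1 / 2), abs_mul, abs_mul]
        gcongr
        exacts [hA _, hB _]
      linarith
  have hRlim : ∀ p ∈ halfPlane, Tendsto (fun ε => R ε p) (𝓝[>] 0) (𝓝 (adjointProd f g p)) := by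
    intro p hp
    have hp : 0 < p.2 := hp
    refine tendsto_const_nhds.congr' ?_
    filter_upwards [Ioo_mem_nhdsGT (show (0 : ℝ) < p.2 / 2 by positivity)] with ε hε
    have h : 2 < p.2 * ε⁻¹ := by
      rw [← div_eq_mul_inv, lt_div_iff₀ hε.1]; linarith [hε.2]
    simp only [hR]
    rw [deriv_cutoff_of_gt h, deriv_deriv_cutoff_of_gt h, cutoff_of_ge h.le]; ring
  have hNb := abs_adjointProd_le hA hA' hB hB' hB''
  have hdR : Tendsto (fun ε => ∫ p in halfPlane, d p * R ε p) (𝓝[>] 0)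
      (𝓝 (∫ p in halfPlane, d p * adjointProd f g p)) := by
    apply tendsto_integral_filter_of_dominated_convergence
      (fun p => |d p| * (1 + p.1 ^ 2 + p.2 ^ 2) ^ 2 * (6 * (A * B) + M))
    · exact Eventually.of_forall fun ε => hd.aestronglyMeasurable.mul (hRc ε).aestronglyMeasurable
    · filter_upwards [self_mem_nhdsWithin] with ε hε
      rw [ae_restrict_iff' measurableSet_halfPlane]
      refine Eventually.of_forall fun p hp => ?_
      rw [norm_mul, Real.norm_eq_abs, Real.norm_eq_abs, mul_assoc]
      gcongr
      refine (hRle ε hε p hp).trans ?_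
      have hM0 : 0 ≤ M := by positivity
      have h1 : M ≤ M * (1 + p.1 ^ 2 + p.2 ^ 2) ^ 2 := le_mul_of_one_le_right hM0
        (one_le_pow₀ (by nlinarith [sq_nonneg p.1, sq_nonneg p.2]))
      linarith [hNb p]
    · exact hd.moment.mul_const _
    · rw [ae_restrict_iff' measurableSet_halfPlane]
      exact Eventually.of_forall fun p hp => (hRlim p hp).const_mul (d p)
  have heq : ∀ ε, 0 < ε → ∫ p in halfPlane, d p * R ε p
      = -(a * (ε⁻¹ * ∫ p in halfPlane, d p * (f p.1 * l (p.2 * ε⁻¹)))) := by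
    intro ε hε
    set gε : ℝ → ℝ := fun y => g y * cutoff (y * ε⁻¹) with hgε
    have h1 := hd.integral_adjointProd_of_interior hf hfc (g := gε) (by fun_prop)
      (hgc.mul_right) hε (fun y hy => by
        simp only [hgε]
        rw [cutoff_of_le, mul_zero]
        rw [← div_eq_mul_inv, div_le_one hε]; exact hy.le)
    have hlm : Continuous fun p : ℝ × ℝ => f p.1 * l (p.2 * ε⁻¹) := by
      have := hf.continuous
      have := hlc.continuous
      fun_prop
    obtain ⟨L', hL'⟩ := exists_bound_of_eq_zero hlc.continuous hl1 hl3
    have i1 := integrable_mul_of_moment hd.aestronglyMeasurable hd.moment hlm.aestronglyMeasurable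
      (C := A * L') fun p => abs_le_mul_weight (by
        rw [abs_mul]; exact mul_le_mul (hA _) (hL' _) (abs_nonneg _) hA0) p
    have i2 : IntegrableOn (fun p => d p * R ε p) halfPlane := by
      refine (hd.moment.mul_const (6 * (A * B) + M)).mono'
        (hd.aestronglyMeasurable.mul (hRc ε).aestronglyMeasurable) ?_
      rw [ae_restrict_iff' measurableSet_halfPlane]
      refine Eventually.of_forall fun p hp => ?_
      rw [norm_mul, Real.norm_eq_abs, Real.norm_eq_abs, mul_assoc]
      gcongr
      refine (hRle ε hε p hp).trans ?_
      have hM0 : 0 ≤ M := by positivity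
      have h1 : M ≤ M * (1 + p.1 ^ 2 + p.2 ^ 2) ^ 2 := le_mul_of_one_le_right hM0
        (one_le_pow₀ (by nlinarith [sq_nonneg p.1, sq_nonneg p.2]))
      linarith [hNb p]
    have e : ∀ p : ℝ × ℝ, d p * adjointProd f gε p
        = d p * R ε p + a * ε⁻¹ * (d p * (f p.1 * l (p.2 * ε⁻¹))) := by
      intro p
      rw [adjointProd, hgε, deriv_deriv_mul_comp hg hκ, (deriv_mul_comp hg hκ _ _).deriv]
      simp only [hR, hl, adjointProd]
      ring
    simp only [e] at h1
    rw [integral_add i2 (i1.const_mul _), integral_const_mul] at h1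
    linarith
  have h2 := (htr.const_mul a).neg
  rw [mul_zero, neg_zero] at h2
  refine tendsto_nhds_unique hdR (h2.congr' ?_)
  filter_upwards [self_mem_nhdsWithin] with ε hε
  rw [heq ε hε]

/-- Truncations of a bounded smooth function, with uniform bounds. -/
lemma exists_truncation {f : ℝ → ℝ} (hf : ContDiff ℝ ∞ f) {B : ℝ} (h : ∀ x, |f x| ≤ B)
    (h' : ∀ x, |deriv f x| ≤ B) (h'' : ∀ x, |deriv (deriv f) x| ≤ B) :
    ∃ (F : ℕ → ℝ → ℝ) (C : ℝ), (∀ n, ContDiff ℝ ∞ (F n) ∧ HasCompactSupport (F n) ∧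
      (∀ x, |F n x| ≤ C) ∧ (∀ x, |deriv (F n) x| ≤ C) ∧ (∀ x, |deriv (deriv (F n)) x| ≤ C) ∧
      F n 0 = f 0) ∧ ∀ x, ∀ᶠ n in atTop, F n =ᶠ[𝓝 x] f := by
  set χ : ContDiffBump (0 : ℝ) := ⟨1, 2, one_pos, one_lt_two⟩ with hχ
  have hc : ContDiff ℝ ∞ χ := χ.contDiff
  obtain ⟨K, k0, k1, k2⟩ := exists_bound_of_hasCompactSupport hc χ.hasCompactSupport
  have hB0 : 0 ≤ B := (abs_nonneg _).trans (h 0)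
  have hK0 : 0 ≤ K := (abs_nonneg _).trans (k0 0)
  have hi : ∀ n : ℕ, 0 < ((n : ℝ) + 1)⁻¹ := fun n => by positivity
  have hi1 : ∀ n : ℕ, ((n : ℝ) + 1)⁻¹ ≤ 1 := fun n => inv_le_one_of_one_le₀ (by
    have : (0 : ℝ) ≤ n := n.cast_nonneg
    linarith)
  have hone : ∀ x : ℝ, |x| ≤ 1 → χ x = 1 := fun x hx =>
    χ.one_of_mem_closedBall (by simpa [hχ] using hx)
  have hm : ∀ a b : ℝ, |a| ≤ B → |b| ≤ K → |a * b| ≤ B * K := fun a b ha hb => by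
    rw [abs_mul]; exact mul_le_mul ha hb (abs_nonneg _) hB0
  refine ⟨fun n x => f x * χ (x * ((n : ℝ) + 1)⁻¹), 4 * (B * K), fun n => ⟨by fun_prop, ?_, ?_, ?_, ?_, ?_⟩, ?_⟩
  · apply HasCompactSupport.mul_left
    exact χ.hasCompactSupport.comp_homeomorph (Homeomorph.mulRight₀ _ (hi n).ne')
  · intro x
    have := hm _ _ (h x) (k0 (x * ((n : ℝ) + 1)⁻¹))
    nlinarith [mul_nonneg hB0 hK0]
  · intro x
    rw [(deriv_mul_comp hf hc _ x).deriv]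
    have t1 := hm _ _ (h' x) (k0 (x * ((n : ℝ) + 1)⁻¹))
    have t2 := hm _ _ (h x) (k1 (x * ((n : ℝ) + 1)⁻¹))
    refine (abs_add_le _ _).trans ?_
    rw [abs_mul (_)⁻¹, abs_of_pos (hi n)]
    have : ((n : ℝ) + 1)⁻¹ * |f x * deriv χ (x * ((n : ℝ) + 1)⁻¹)| ≤ 1 * (B * K) := by
      gcongr; exact hi1 n
    nlinarith [mul_nonneg hB0 hK0]
  · intro x
    rw [deriv_deriv_mul_comp hf hc]
    have t1 := hm _ _ (h'' x) (k0 (x * ((n : ℝ) + 1)⁻¹))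
    have t2 := hm _ _ (h' x) (k1 (x * ((n : ℝ) + 1)⁻¹))
    have t3 := hm _ _ (h x) (k2 (x * ((n : ℝ) + 1)⁻¹))
    refine (abs_add_three _ _ _).trans ?_
    rw [abs_mul (2 * ((n : ℝ) + 1)⁻¹), abs_mul (((n : ℝ) + 1)⁻¹ ^ 2),
      abs_of_pos (by positivity : (0 : ℝ) < 2 * ((n : ℝ) + 1)⁻¹),
      abs_of_pos (by positivity : (0 : ℝ) < ((n : ℝ) + 1)⁻¹ ^ 2)]
    have u2 : 2 * ((n : ℝ) + 1)⁻¹ * |deriv f x * deriv χ (x * ((n : ℝ) + 1)⁻¹)| ≤ 2 * 1 * (B * K) := by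
      gcongr; exact hi1 n
    have u3 : ((n : ℝ) + 1)⁻¹ ^ 2 * |f x * deriv (deriv χ) (x * ((n : ℝ) + 1)⁻¹)| ≤ 1 ^ 2 * (B * K) := by
      gcongr; exact hi1 n
    linarith
  · simp only [zero_mul]; rw [hone 0 (by simp), mul_one]
  · intro x
    obtain ⟨N, hN⟩ := exists_nat_gt (|x| + 1)
    filter_upwards [eventually_ge_atTop N] with n hn
    have hn' : (N : ℝ) ≤ n := by exact_mod_cast hn
    filter_upwards [Metric.ball_mem_nhds x one_pos] with y hy
    rw [hone, mul_one]
    rw [abs_mul, abs_of_pos (hi n), ← div_eq_mul_inv, div_le_one (by positivity)]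
    rw [Metric.mem_ball, Real.dist_eq] at hy
    have := abs_sub_abs_le_abs_sub y x
    linarith

/-- Bounded smooth functions `f(X) g(Y)` with `g(0) = 0` are admissible test functions. -/
lemma IsNullSolution.integral_adjointProd {d : ℝ × ℝ → ℝ} (hd : IsNullSolution d)
    {f g : ℝ → ℝ} (hf : ContDiff ℝ ∞ f) (hg : ContDiff ℝ ∞ g) (h0 : g 0 = 0) {A B : ℝ}
    (hA : ∀ x, |f x| ≤ A) (hA' : ∀ x, |deriv f x| ≤ A) (hA'' : ∀ x, |deriv (deriv f) x| ≤ A)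
    (hB : ∀ x, |g x| ≤ B) (hB' : ∀ x, |deriv g x| ≤ B) (hB'' : ∀ x, |deriv (deriv g) x| ≤ B) :
    ∫ p in halfPlane, d p * adjointProd f g p = 0 := by
  obtain ⟨F, C, hF, hFl⟩ := exists_truncation hf hA hA' hA''
  obtain ⟨G, D, hG, hGl⟩ := exists_truncation hg hB hB' hB''
  have hlim : Tendsto (fun n => ∫ p in halfPlane, d p * adjointProd (F n) (G n) p) atTop
      (𝓝 (∫ p in halfPlane, d p * adjointProd f g p)) := by
    apply tendsto_integral_of_dominated_convergence
      (fun p => |d p| * (1 + p.1 ^ 2 + p.2 ^ 2) ^ 2 * (6 * (C * D)))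
    · exact fun n => hd.aestronglyMeasurable.mul
        (continuous_adjointProd (hF n).1 (hG n).1).aestronglyMeasurable
    · exact hd.moment.mul_const _
    · intro n
      obtain ⟨-, -, a1, a2, a3, -⟩ := hF n
      obtain ⟨-, -, b1, b2, b3, -⟩ := hG n
      refine Eventually.of_forall fun p => ?_
      rw [norm_mul, Real.norm_eq_abs, Real.norm_eq_abs, mul_assoc, mul_comm (_ ^ 2)]
      gcongr
      exact abs_adjointProd_le a1 a2 b1 b2 b3 p
    · refine Eventually.of_forall fun p => tendsto_const_nhds.congr' ?_
      filter_upwards [hFl p.1, hGl p.2] with n h1 h2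
      rw [adjointProd, adjointProd, h1.eq_of_nhds, h1.deriv_eq, h2.eq_of_nhds, h2.deriv_eq,
        h2.deriv.deriv_eq]
  refine tendsto_nhds_unique hlim (tendsto_const_nhds.congr fun n => ?_)
  rw [hd.integral_adjointProd_of_compact (hF n).1 (hF n).2.1 (hG n).1 (hG n).2.1
    ((hG n).2.2.2.2.2.trans h0)]

/-! ### Fourier–sine transforms of a null solution -/

/-- The polynomial weight that dominates all the test functions. -/
noncomputable def weight (p : ℝ × ℝ) : ℝ := (1 + p.1 ^ 2 + p.2 ^ 2) ^ 2

lemma one_le_weight (p : ℝ × ℝ) : 1 ≤ weight p :=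
  one_le_pow₀ (by nlinarith [sq_nonneg p.1, sq_nonneg p.2])

lemma abs_fst_le_weight (p : ℝ × ℝ) : |p.1| ≤ weight p := by
  have : |p.1| ≤ 1 + p.1 ^ 2 + p.2 ^ 2 := by
    rw [← sq_abs p.1]; nlinarith [sq_nonneg (|p.1| - 1), sq_nonneg p.2, sq_nonneg (|p.1|)]
  exact this.trans (le_self_pow₀ (by nlinarith [sq_nonneg p.1, sq_nonneg p.2]) (by norm_num))

lemma abs_snd_le_weight (p : ℝ × ℝ) : |p.2| ≤ weight p := by
  have : |p.2| ≤ 1 + p.1 ^ 2 + p.2 ^ 2 := by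
    rw [← sq_abs p.2]; nlinarith [sq_nonneg (|p.2| - 1), sq_nonneg p.1, sq_nonneg (|p.2|)]
  exact this.trans (le_self_pow₀ (by nlinarith [sq_nonneg p.1, sq_nonneg p.2]) (by norm_num))

/-- The total weighted mass. -/
noncomputable def weightedMass (d : ℝ × ℝ → ℝ) : ℝ := ∫ p in halfPlane, |d p| * weight p

lemma weightedMass_nonneg (d : ℝ × ℝ → ℝ) : 0 ≤ weightedMass d :=
  integral_nonneg fun p => mul_nonneg (abs_nonneg _) (zero_le_one.trans (one_le_weight p))

namespace IsNullSolution

variable {d : ℝ × ℝ → ℝ}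

lemma integrable_mul (hd : IsNullSolution d) {w : ℝ × ℝ → ℝ} (hw : Continuous w)
    (hb : ∀ p, |w p| ≤ weight p) : IntegrableOn (fun p => d p * w p) halfPlane :=
  integrable_mul_of_moment hd.aestronglyMeasurable hd.moment hw.aestronglyMeasurable (C := 1)
    fun p => by rw [one_mul]; exact hb p

lemma abs_integral_le (hd : IsNullSolution d) {w : ℝ × ℝ → ℝ} {C : ℝ}
    (hb : ∀ p, |w p| ≤ C * weight p) :
    |∫ p in halfPlane, d p * w p| ≤ C * weightedMass d := by
  rw [← Real.norm_eq_abs, weightedMass, ← integral_const_mul]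
  refine norm_integral_le_of_norm_le (Integrable.const_mul hd.moment _)
    (Eventually.of_forall fun p => ?_)
  rw [norm_mul, Real.norm_eq_abs, Real.norm_eq_abs]
  calc _ ≤ |d p| * (C * weight p) := by gcongr; exact hb p
    _ = _ := by rw [weight]; ring

lemma continuous_integral (hd : IsNullSolution d) {W : ℝ → ℝ × ℝ → ℝ}
    (hW : ∀ t, Continuous (W t)) (hW' : ∀ p, Continuous fun t => W t p)
    (hb : ∀ t p, |W t p| ≤ weight p) : Continuous fun t => ∫ p in halfPlane, d p * W t p := by
  apply continuous_of_dominated (bound := fun p => |d p| * weight p)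
  · exact fun t => hd.aestronglyMeasurable.mul (hW t).aestronglyMeasurable
  · intro t
    refine Eventually.of_forall fun p => ?_
    rw [norm_mul, Real.norm_eq_abs, Real.norm_eq_abs]
    gcongr; exact hb t p
  · exact hd.moment
  · exact Eventually.of_forall fun p => continuous_const.mul (hW' p)

lemma hasDerivAt_integral (hd : IsNullSolution d) {W W' : ℝ → ℝ × ℝ → ℝ}
    (hW : ∀ t, Continuous (W t)) (hW' : ∀ t, Continuous (W' t))
    (hdW : ∀ t p, HasDerivAt (fun t => W t p) (W' t p) t)
    (hb : ∀ t p, |W t p| ≤ weight p) (hb' : ∀ t p, |W' t p| ≤ weight p) (t : ℝ) :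
    HasDerivAt (fun t => ∫ p in halfPlane, d p * W t p) (∫ p in halfPlane, d p * W' t p) t := by
  refine (hasDerivAt_integral_of_dominated_loc_of_deriv_le
    (bound := fun p => |d p| * weight p) (F' := fun t p => d p * W' t p)
    univ_mem ?_ ?_ ?_ ?_ ?_ ?_).2
  · exact Eventually.of_forall fun t => hd.aestronglyMeasurable.mul (hW t).aestronglyMeasurable
  · exact hd.integrable_mul (hW t) (hb t)
  · exact hd.aestronglyMeasurable.mul (hW' t).aestronglyMeasurable
  · refine Eventually.of_forall fun p s _ => ?_
    rw [norm_mul, Real.norm_eq_abs, Real.norm_eq_abs]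
    gcongr; exact hb' s p
  · exact hd.moment
  · exact Eventually.of_forall fun p s _ => (hdW s p).const_mul (d p)

end IsNullSolution

lemma abs_mul_mul_le {x y z w : ℝ} (hx : |x| ≤ w) (hy : |y| ≤ 1) (hz : |z| ≤ 1) :
    |x * (y * z)| ≤ w := by
  rw [abs_mul, abs_mul]
  calc |x| * (|y| * |z|) ≤ w * (1 * 1) := by gcongr; exact (abs_nonneg _).trans hx
    _ = w := by ring

lemma abs_mul_le_weight {y z : ℝ} (hy : |y| ≤ 1) (hz : |z| ≤ 1) (p : ℝ × ℝ) :
    |y * z| ≤ weight p := by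
  have := abs_mul_mul_le (x := 1) (w := 1) (by simp) hy hz
  rw [one_mul] at this
  exact this.trans (one_le_weight p)

/-- `∫ d f(kX) sin(ξY)`, where `f` is `cos` or `sin`. -/
noncomputable def sineTransform (d : ℝ × ℝ → ℝ) (f : ℝ → ℝ) (k ξ : ℝ) : ℝ :=
  ∫ p in halfPlane, d p * (f (k * p.1) * Real.sin (ξ * p.2))

/-- `∫ d X f(kX) sin(ξY)`. -/
noncomputable def sineTransformX (d : ℝ × ℝ → ℝ) (f : ℝ → ℝ) (k ξ : ℝ) : ℝ :=
  ∫ p in halfPlane, d p * (p.1 * (f (k * p.1) * Real.sin (ξ * p.2)))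

/-- `∫ d Y f(kX) sin(ξY)`. -/
noncomputable def sineTransformY (d : ℝ × ℝ → ℝ) (f : ℝ → ℝ) (k ξ : ℝ) : ℝ :=
  ∫ p in halfPlane, d p * (p.2 * (f (k * p.1) * Real.sin (ξ * p.2)))

/-- `∫ d Y f(kX) cos(ξY)`. -/
noncomputable def cosineTransformY (d : ℝ × ℝ → ℝ) (f : ℝ → ℝ) (k ξ : ℝ) : ℝ :=
  ∫ p in halfPlane, d p * (p.2 * (f (k * p.1) * Real.cos (ξ * p.2)))

namespace IsNullSolution

variable {d : ℝ × ℝ → ℝ} {f f' : ℝ → ℝ}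

lemma abs_sineTransform_le (hd : IsNullSolution d) (hf : ∀ x, |f x| ≤ 1) (k ξ : ℝ) :
    |sineTransform d f k ξ| ≤ weightedMass d := by
  rw [← one_mul (weightedMass d)]
  refine hd.abs_integral_le fun p => ?_
  rw [one_mul]; exact abs_mul_le_weight (hf _) (Real.abs_sin_le_one _) p

lemma abs_sineTransformX_le (hd : IsNullSolution d) (hf : ∀ x, |f x| ≤ 1) (k ξ : ℝ) :
    |sineTransformX d f k ξ| ≤ weightedMass d := by
  rw [← one_mul (weightedMass d)]
  refine hd.abs_integral_le fun p => ?_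
  rw [one_mul]; exact abs_mul_mul_le (abs_fst_le_weight p) (hf _) (Real.abs_sin_le_one _)

lemma abs_sineTransformY_le (hd : IsNullSolution d) (hf : ∀ x, |f x| ≤ 1) (k ξ : ℝ) :
    |sineTransformY d f k ξ| ≤ weightedMass d := by
  rw [← one_mul (weightedMass d)]
  refine hd.abs_integral_le fun p => ?_
  rw [one_mul]; exact abs_mul_mul_le (abs_snd_le_weight p) (hf _) (Real.abs_sin_le_one _)

lemma abs_cosineTransformY_le (hd : IsNullSolution d) (hf : ∀ x, |f x| ≤ 1) (k ξ : ℝ) :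
    |cosineTransformY d f k ξ| ≤ weightedMass d := by
  rw [← one_mul (weightedMass d)]
  refine hd.abs_integral_le fun p => ?_
  rw [one_mul]; exact abs_mul_mul_le (abs_snd_le_weight p) (hf _) (Real.abs_cos_le_one _)

lemma continuous_sineTransform (hd : IsNullSolution d) (hfc : Continuous f) (hf : ∀ x, |f x| ≤ 1)
    (k : ℝ) : Continuous (sineTransform d f k) :=
  hd.continuous_integral (fun t => by fun_prop) (fun p => by fun_prop)
    fun t p => abs_mul_le_weight (hf _) (Real.abs_sin_le_one _) p

lemma continuous_sineTransformX (hd : IsNullSolution d) (hfc : Continuous f) (hf : ∀ x, |f x| ≤ 1)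
    (k : ℝ) : Continuous (sineTransformX d f k) :=
  hd.continuous_integral (fun t => by fun_prop) (fun p => by fun_prop)
    fun t p => abs_mul_mul_le (abs_fst_le_weight p) (hf _) (Real.abs_sin_le_one _)

lemma continuous_sineTransformY (hd : IsNullSolution d) (hfc : Continuous f) (hf : ∀ x, |f x| ≤ 1)
    (k : ℝ) : Continuous (sineTransformY d f k) :=
  hd.continuous_integral (fun t => by fun_prop) (fun p => by fun_prop)
    fun t p => abs_mul_mul_le (abs_snd_le_weight p) (hf _) (Real.abs_sin_le_one _)

lemma continuous_cosineTransformY (hd : IsNullSolution d) (hfc : Continuous f) (hf : ∀ x, |f x| ≤ 1)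
    (k : ℝ) : Continuous (cosineTransformY d f k) :=
  hd.continuous_integral (fun t => by fun_prop) (fun p => by fun_prop)
    fun t p => abs_mul_mul_le (abs_snd_le_weight p) (hf _) (Real.abs_cos_le_one _)

lemma hasDerivAt_sineTransform_ξ (hd : IsNullSolution d) (hfc : Continuous f)
    (hf : ∀ x, |f x| ≤ 1) (k ξ : ℝ) :
    HasDerivAt (sineTransform d f k) (cosineTransformY d f k ξ) ξ := by
  refine hd.hasDerivAt_integral (W := fun ξ p => f (k * p.1) * Real.sin (ξ * p.2))
    (W' := fun ξ p => p.2 * (f (k * p.1) * Real.cos (ξ * p.2)))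
    (fun t => by fun_prop) (fun t => by fun_prop) (fun t p => ?_)
    (fun t p => abs_mul_le_weight (hf _) (Real.abs_sin_le_one _) p)
    (fun t p => abs_mul_mul_le (abs_snd_le_weight p) (hf _) (Real.abs_cos_le_one _)) ξ
  refine (((hasDerivAt_id t).mul_const p.2).sin.const_mul (f (k * p.1))).congr_deriv ?_
  simp; ring

lemma hasDerivAt_sineTransform_k (hd : IsNullSolution d) (hfc : Continuous f)
    (hfc' : Continuous f') (hff : ∀ x, HasDerivAt f (f' x) x)
    (hf : ∀ x, |f x| ≤ 1) (hf' : ∀ x, |f' x| ≤ 1) (k ξ : ℝ) :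
    HasDerivAt (fun k => sineTransform d f k ξ) (sineTransformX d f' k ξ) k := by
  refine hd.hasDerivAt_integral (W := fun k p => f (k * p.1) * Real.sin (ξ * p.2))
    (W' := fun k p => p.1 * (f' (k * p.1) * Real.sin (ξ * p.2)))
    (fun t => by fun_prop) (fun t => by fun_prop) (fun t p => ?_)
    (fun t p => abs_mul_le_weight (hf _) (Real.abs_sin_le_one _) p)
    (fun t p => abs_mul_mul_le (abs_fst_le_weight p) (hf' _) (Real.abs_sin_le_one _)) k
  refine (((hff (t * p.1)).comp t ((hasDerivAt_id t).mul_const p.1)).mul_const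
    (Real.sin (ξ * p.2))).congr_deriv ?_
  simp; ring

/-- The equation on the Fourier–sine side, for `f = cos` and `f = sin`. -/
lemma sineTransform_equation (hd : IsNullSolution d) (hfs : ContDiff ℝ ∞ f)
    (hff : deriv f = f') (hf : ∀ x, |f x| ≤ 1) (hf' : ∀ x, |f' x| ≤ 1)
    (hf'' : ∀ x, |deriv f' x| ≤ 1) (k ξ : ℝ) :
    (3 / 2) * k * sineTransformX d f' k ξ = (1 / 2 - ξ ^ 2) * sineTransform d f k ξ
      - (1 / 2) * ξ * cosineTransformY d f k ξ + k * sineTransformY d f' k ξ := by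
  have hfs' : ContDiff ℝ ∞ f' := hff ▸ contDiff_deriv hfs
  have hfd : ∀ x, HasDerivAt f (f' x) x := fun x => hff ▸ hasDerivAt_of_contDiff hfs x
  set F : ℝ → ℝ := fun x => f (k * x) with hF
  set G : ℝ → ℝ := fun y => Real.sin (ξ * y) with hG
  have dF : deriv F = fun x => k * f' (k * x) := by
    ext x
    refine HasDerivAt.deriv (((hfd (k * x)).comp x ((hasDerivAt_id x).const_mul k)).congr_deriv ?_)
    simp; ring
  have ddF : deriv (deriv F) = fun x => k * (k * deriv f' (k * x)) := by
    rw [dF]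
    ext x
    refine HasDerivAt.deriv ((((hasDerivAt_of_contDiff hfs' (k * x)).comp x
      ((hasDerivAt_id x).const_mul k)).const_mul k).congr_deriv ?_)
    simp; ring_nf; simp
  have dG : deriv G = fun y => ξ * Real.cos (ξ * y) := by
    ext y
    refine HasDerivAt.deriv ((((hasDerivAt_id y).const_mul ξ).sin).congr_deriv ?_)
    simp; ring
  have ddG : deriv (deriv G) = fun y => -(ξ ^ 2 * Real.sin (ξ * y)) := by
    rw [dG]
    ext y
    refine HasDerivAt.deriv ((((hasDerivAt_id y).const_mul ξ).cos.const_mul ξ).congr_deriv ?_)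
    simp; ring
  have hle : ∀ c a : ℝ, |a| ≤ 1 → |c * a| ≤ |c| := fun c a ha => by
    rw [abs_mul]; exact mul_le_of_le_one_right (abs_nonneg _) ha
  have h := hd.integral_adjointProd (f := F) (g := G) (A := 1 + |k| + |k| * |k|)
    (B := 1 + |ξ| + |ξ ^ 2|) (by fun_prop) (by fun_prop) (by simp [hG])
    (fun x => (hf _).trans (by nlinarith [abs_nonneg k]))
    (fun x => by
      rw [dF]; exact (hle _ _ (hf' _)).trans (by nlinarith [abs_nonneg k]))
    (fun x => by
      rw [ddF, abs_mul]
      have := hle k _ (hf'' (k * x))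
      nlinarith [abs_nonneg k, mul_le_mul_of_nonneg_left this (abs_nonneg k)])
    (fun y => (Real.abs_sin_le_one _).trans (by linarith [abs_nonneg ξ, abs_nonneg (ξ ^ 2)]))
    (fun y => by
      rw [dG]
      exact (hle _ _ (Real.abs_cos_le_one _)).trans (by linarith [abs_nonneg (ξ ^ 2)]))
    (fun y => by
      rw [ddG, abs_neg]
      exact (hle _ _ (Real.abs_sin_le_one _)).trans (by linarith [abs_nonneg ξ]))
  have c1 := hfs.continuous
  have c2 := hfs'.continuous
  have i1 := hd.integrable_mul (w := fun p => f (k * p.1) * Real.sin (ξ * p.2)) (by fun_prop)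
    fun p => abs_mul_le_weight (hf _) (Real.abs_sin_le_one _) p
  have i2 := hd.integrable_mul (w := fun p => p.1 * (f' (k * p.1) * Real.sin (ξ * p.2)))
    (by fun_prop) fun p => abs_mul_mul_le (abs_fst_le_weight p) (hf' _) (Real.abs_sin_le_one _)
  have i3 := hd.integrable_mul (w := fun p => p.2 * (f (k * p.1) * Real.cos (ξ * p.2)))
    (by fun_prop) fun p => abs_mul_mul_le (abs_snd_le_weight p) (hf _) (Real.abs_cos_le_one _)
  have i4 := hd.integrable_mul (w := fun p => p.2 * (f' (k * p.1) * Real.sin (ξ * p.2)))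
    (by fun_prop) fun p => abs_mul_mul_le (abs_snd_le_weight p) (hf' _) (Real.abs_sin_le_one _)
  have e : ∀ p, d p * adjointProd F G p
      = (1 / 2 - ξ ^ 2) * (d p * (f (k * p.1) * Real.sin (ξ * p.2)))
        + -(3 / 2) * k * (d p * (p.1 * (f' (k * p.1) * Real.sin (ξ * p.2))))
        + -(1 / 2) * ξ * (d p * (p.2 * (f (k * p.1) * Real.cos (ξ * p.2))))
        + k * (d p * (p.2 * (f' (k * p.1) * Real.sin (ξ * p.2)))) := by
    intro p
    rw [adjointProd, dF, ddG, dG]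
    simp only [hF, hG]
    ring
  simp only [e] at h
  have j1 := i1.const_mul (1 / 2 - ξ ^ 2)
  have j2 := i2.const_mul (-(3 / 2) * k)
  have j3 := i3.const_mul (-(1 / 2) * ξ)
  have j4 := i4.const_mul k
  have j12 := j1.add j2
  have j123 := j12.add j3
  simp only [Pi.add_def] at j12 j123
  rw [integral_add j123 j4, integral_add j12 j3, integral_add j1 j2, integral_const_mul,
    integral_const_mul, integral_const_mul, integral_const_mul] at h
  rw [sineTransform, sineTransformX, cosineTransformY, sineTransformY]
  linarith

end IsNullSolution

/-! ### Behaviour at zero frequency -/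

namespace IsNullSolution

variable {d : ℝ × ℝ → ℝ}

/-- The transform at zero frequency solves `ξ P' = (1 - 2 ξ²) P`, and `P'(0)` is the momentum. -/
lemma sineTransform_cos_zero (hd : IsNullSolution d) (ξ : ℝ) :
    sineTransform d Real.cos 0 ξ = 0 := by
  set P : ℝ → ℝ := sineTransform d Real.cos 0 with hP
  have hdP : ∀ ξ, HasDerivAt P (cosineTransformY d Real.cos 0 ξ) ξ := fun ξ =>
    hd.hasDerivAt_sineTransform_ξ Real.continuous_cos Real.abs_cos_le_one 0 ξ
  have hP0 : P 0 = 0 := by simp [hP, sineTransform]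
  have hC0 : cosineTransformY d Real.cos 0 0 = 0 := by
    refine Eq.trans ?_ hd.momentum
    refine integral_congr_ae (Eventually.of_forall fun p => ?_)
    simp [mul_comm]
  have heq : ∀ ξ, ξ * cosineTransformY d Real.cos 0 ξ = (1 - 2 * ξ ^ 2) * P ξ := by
    intro ξ
    have h := hd.sineTransform_equation Real.contDiff_cos (f' := fun x => -Real.sin x)
      (by ext x; exact Real.deriv_cos) Real.abs_cos_le_one
      (fun x => by rw [abs_neg]; exact Real.abs_sin_le_one x)
      (fun x => by
        have : deriv (fun x => -Real.sin x) x = -Real.cos x := by simp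
        rw [this, abs_neg]; exact Real.abs_cos_le_one x) 0 ξ
    simp only [mul_zero, zero_mul, add_zero] at h
    rw [← hP] at h
    linarith
  set g : ℝ → ℝ := fun ξ => P ξ * Real.exp (ξ ^ 2) / ξ with hg
  have hdg : ∀ ξ ∈ Ioi (0 : ℝ), HasDerivAt g 0 ξ := by
    intro ξ hξ
    have hξ : 0 < ξ := hξ
    have he : HasDerivAt (fun ξ : ℝ => Real.exp (ξ ^ 2)) (Real.exp (ξ ^ 2) * (2 * ξ)) ξ := by
      simpa using (hasDerivAt_pow 2 ξ).exp
    refine (((hdP ξ).mul he).div (hasDerivAt_id ξ) hξ.ne').congr_deriv ?_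
    simp only [id, Pi.mul_apply]
    rw [div_eq_zero_iff]; left
    linear_combination Real.exp (ξ ^ 2) * heq ξ
  have hconst : ∀ x ∈ Ioi (0 : ℝ), ∀ y ∈ Ioi (0 : ℝ), g x = g y := fun x hx y hy =>
    isOpen_Ioi.is_const_of_deriv_eq_zero isPreconnected_Ioi
      (fun z hz => (hdg z hz).differentiableAt.differentiableWithinAt)
      (fun z hz => (hdg z hz).deriv) hx hy
  have hlim : Tendsto g (𝓝[>] 0) (𝓝 0) := by
    have h1 := hdP 0
    rw [hasDerivAt_iff_tendsto_slope_zero, hC0] at h1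
    have h1 := h1.mono_left (nhdsGT_le_nhdsNE 0)
    have h2 : Tendsto (fun ξ : ℝ => Real.exp (ξ ^ 2)) (𝓝[>] 0) (𝓝 1) := by
      have : Continuous fun ξ : ℝ => Real.exp (ξ ^ 2) := by fun_prop
      simpa using (this.tendsto 0).mono_left nhdsWithin_le_nhds
    have h3 := h1.mul h2
    rw [zero_mul] at h3
    refine h3.congr fun ξ => ?_
    simp only [hg, zero_add, hP0, sub_zero, smul_eq_mul]
    rw [div_eq_mul_inv]; ring
  have hpos : ∀ x, 0 < x → P x = 0 := by
    intro x hx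
    have h0 : g x = 0 := by
      refine tendsto_nhds_unique (tendsto_const_nhds.congr' ?_) hlim
      filter_upwards [self_mem_nhdsWithin] with y hy using hconst x hx y hy
    simp only [hg] at h0
    rw [div_eq_zero_iff, mul_eq_zero] at h0
    rcases h0 with (h | h) | h
    · exact h
    · exact absurd h (Real.exp_pos _).ne'
    · exact absurd h hx.ne'
  rcases lt_trichotomy ξ 0 with h | h | h
  · have hodd : P ξ = -P (-ξ) := by
      simp [hP, sineTransform, integral_neg]
    rw [hodd, hpos _ (by linarith), neg_zero]
  · rw [h, hP0]
  · exact hpos ξ h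

lemma abs_sineTransform_le_mul (hd : IsNullSolution d) {f f' : ℝ → ℝ}
    (hfc : Continuous f) (hfc' : Continuous f') (hff : ∀ x, HasDerivAt f (f' x) x)
    (hf : ∀ x, |f x| ≤ 1) (hf' : ∀ x, |f' x| ≤ 1) {ξ : ℝ} (h0 : sineTransform d f 0 ξ = 0) (k : ℝ) :
    |sineTransform d f k ξ| ≤ weightedMass d * |k| := by
  have := Convex.norm_image_sub_le_of_norm_hasDerivWithin_le
    (f := fun k => sineTransform d f k ξ) (f' := fun k => sineTransformX d f' k ξ)
    (s := univ) (C := weightedMass d) (x := 0) (y := k)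
    (fun x _ => (hd.hasDerivAt_sineTransform_k hfc hfc' hff hf hf' x ξ).hasDerivWithinAt)
    (fun x _ => hd.abs_sineTransformX_le hf' x ξ) convex_univ (mem_univ _) (mem_univ _)
  simpa [h0] using this

/-! ### The Gaussian-weighted energy -/

/-- The squared modulus of the Fourier–sine transform. -/
noncomputable def _root_.HalfPlaneKernel.sineDensity (d : ℝ × ℝ → ℝ) (k ξ : ℝ) : ℝ :=
  sineTransform d Real.cos k ξ ^ 2 + sineTransform d Real.sin k ξ ^ 2

/-- The energy `∫ |s(k, ξ)|² exp(-ε ξ²) dξ` of the Fourier–sine transform. -/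
noncomputable def _root_.HalfPlaneKernel.sineEnergy (d : ℝ × ℝ → ℝ) (ε k : ℝ) : ℝ :=
  ∫ ξ : ℝ, sineDensity d k ξ * Real.exp (-ε * ξ ^ 2)

/-- The production term of the energy, due to the transport `Y ∂_X`. -/
noncomputable def _root_.HalfPlaneKernel.sineProduction (d : ℝ × ℝ → ℝ) (ε k : ℝ) : ℝ :=
  ∫ ξ : ℝ, (sineTransform d Real.sin k ξ * sineTransformY d Real.cos k ξ
    - sineTransform d Real.cos k ξ * sineTransformY d Real.sin k ξ) * Real.exp (-ε * ξ ^ 2)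

lemma continuous_sineDensity (hd : IsNullSolution d) (k : ℝ) : Continuous (sineDensity d k) :=
  ((hd.continuous_sineTransform Real.continuous_cos Real.abs_cos_le_one k).pow 2).add
    ((hd.continuous_sineTransform Real.continuous_sin Real.abs_sin_le_one k).pow 2)

lemma _root_.HalfPlaneKernel.sineDensity_nonneg (d : ℝ × ℝ → ℝ) (k ξ : ℝ) :
    0 ≤ sineDensity d k ξ := by
  unfold sineDensity; positivity

lemma sineDensity_le (hd : IsNullSolution d) (k ξ : ℝ) :
    sineDensity d k ξ ≤ 2 * weightedMass d ^ 2 := by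
  have h1 := sq_le_sq' (abs_le.1 (hd.abs_sineTransform_le Real.abs_cos_le_one k ξ)).1
    (abs_le.1 (hd.abs_sineTransform_le Real.abs_cos_le_one k ξ)).2
  have h2 := sq_le_sq' (abs_le.1 (hd.abs_sineTransform_le Real.abs_sin_le_one k ξ)).1
    (abs_le.1 (hd.abs_sineTransform_le Real.abs_sin_le_one k ξ)).2
  rw [sineDensity]; linarith

lemma _root_.HalfPlaneKernel.integrable_mul_gaussian {f : ℝ → ℝ} (hf : Continuous f) {C ε : ℝ}
    (hε : 0 < ε) (hC : ∀ ξ, |f ξ| ≤ C) : Integrable fun ξ => f ξ * Real.exp (-ε * ξ ^ 2) :=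
  (integrable_exp_neg_mul_sq hε).bdd_mul hf.aestronglyMeasurable (Eventually.of_forall hC)

lemma integrable_sineDensity (hd : IsNullSolution d) {ε : ℝ} (hε : 0 < ε) (k : ℝ) :
    Integrable fun ξ => sineDensity d k ξ * Real.exp (-ε * ξ ^ 2) :=
  integrable_mul_gaussian (hd.continuous_sineDensity k) hε (C := 2 * weightedMass d ^ 2) fun ξ => by
    rw [abs_of_nonneg (sineDensity_nonneg d k ξ)]; exact hd.sineDensity_le k ξ

/-- The transform vanishes linearly at zero frequency, hence the energy quadratically. -/
lemma sineEnergy_le (hd : IsNullSolution d) {ε : ℝ} (hε : 0 < ε) (k : ℝ) :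
    sineEnergy d ε k ≤ 2 * weightedMass d ^ 2 * k ^ 2 * √(Real.pi / ε) := by
  have hneg : Continuous fun x => -Real.sin x := by fun_prop
  have hb : ∀ ξ, sineDensity d k ξ ≤ 2 * weightedMass d ^ 2 * k ^ 2 := by
    intro ξ
    have h1 := hd.abs_sineTransform_le_mul Real.continuous_cos hneg Real.hasDerivAt_cos
      Real.abs_cos_le_one (fun x => by rw [abs_neg]; exact Real.abs_sin_le_one x)
      (hd.sineTransform_cos_zero ξ) k
    have h2 := hd.abs_sineTransform_le_mul (ξ := ξ) Real.continuous_sin Real.continuous_cos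
      Real.hasDerivAt_sin Real.abs_sin_le_one Real.abs_cos_le_one (by simp [sineTransform]) k
    have h3 := sq_le_sq' (abs_le.1 h1).1 (abs_le.1 h1).2
    have h4 := sq_le_sq' (abs_le.1 h2).1 (abs_le.1 h2).2
    rw [mul_pow, sq_abs] at h3 h4
    rw [sineDensity]; linarith
  rw [← integral_gaussian, sineEnergy, ← integral_const_mul]
  apply integral_mono (hd.integrable_sineDensity hε k) ((integrable_exp_neg_mul_sq hε).const_mul _)
  intro ξ
  exact mul_le_mul_of_nonneg_right (hb ξ) (Real.exp_pos _).le

lemma sineEnergy_anti (hd : IsNullSolution d) {ε : ℝ} (hε : 0 < ε) (hε1 : ε ≤ 1) (k : ℝ) :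
    sineEnergy d 1 k ≤ sineEnergy d ε k := by
  apply integral_mono (hd.integrable_sineDensity one_pos k) (hd.integrable_sineDensity hε k)
  intro ξ
  apply mul_le_mul_of_nonneg_left _ (sineDensity_nonneg d k ξ)
  apply Real.exp_le_exp.2
  nlinarith [sq_nonneg ξ]

/-- The energy inequality: the `ξ`-transport integrates by parts to a total derivative, and the
dissipation `-ξ² |s|²` as well as the derivative of the Gaussian have a good sign. -/
lemma hasDerivAt_sineEnergy (hd : IsNullSolution d) {ε : ℝ} (hε : 0 < ε) (k : ℝ) :
    ∃ E', HasDerivAt (sineEnergy d ε) E' k ∧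
      k * E' ≤ sineEnergy d ε k + (4 / 3) * k * sineProduction d ε k := by
  have hneg : Continuous fun x => -Real.sin x := by fun_prop
  have hneg1 : ∀ x, |-Real.sin x| ≤ 1 := fun x => by rw [abs_neg]; exact Real.abs_sin_le_one x
  have hM := weightedMass_nonneg d
  set M := weightedMass d with hMdef
  have hm : ∀ a b : ℝ, |a| ≤ M → |b| ≤ M → |a * b| ≤ M * M := fun a b ha hb => by
    rw [abs_mul]; exact mul_le_mul ha hb (abs_nonneg _) hM
  set P := sineTransform d Real.cos with hP
  set Q := sineTransform d Real.sin with hQ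
  set Pk := sineTransformX d fun x => -Real.sin x with hPk
  set Qk := sineTransformX d Real.cos with hQk
  set Pξ := cosineTransformY d Real.cos with hPξ
  set Qξ := cosineTransformY d Real.sin with hQξ
  set U := sineTransformY d Real.cos with hU
  set V := sineTransformY d Real.sin with hV
  have cP := hd.continuous_sineTransform Real.continuous_cos Real.abs_cos_le_one
  have cQ := hd.continuous_sineTransform Real.continuous_sin Real.abs_sin_le_one
  have cPk := hd.continuous_sineTransformX hneg hneg1
  have cQk := hd.continuous_sineTransformX Real.continuous_cos Real.abs_cos_le_one
  have cPξ := hd.continuous_cosineTransformY Real.continuous_cos Real.abs_cos_le_one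
  have cQξ := hd.continuous_cosineTransformY Real.continuous_sin Real.abs_sin_le_one
  have cU := hd.continuous_sineTransformY Real.continuous_cos Real.abs_cos_le_one
  have cV := hd.continuous_sineTransformY Real.continuous_sin Real.abs_sin_le_one
  have bP := hd.abs_sineTransform_le Real.abs_cos_le_one
  have bQ := hd.abs_sineTransform_le Real.abs_sin_le_one
  have bPk := hd.abs_sineTransformX_le hneg1
  have bQk := hd.abs_sineTransformX_le Real.abs_cos_le_one
  have bPξ := hd.abs_cosineTransformY_le Real.abs_cos_le_one
  have bQξ := hd.abs_cosineTransformY_le Real.abs_sin_le_one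
  have bU := hd.abs_sineTransformY_le Real.abs_cos_le_one
  have bV := hd.abs_sineTransformY_le Real.abs_sin_le_one
  rw [← hP, ← hMdef] at bP
  rw [← hQ, ← hMdef] at bQ
  rw [← hPk, ← hMdef] at bPk
  rw [← hQk, ← hMdef] at bQk
  rw [← hPξ, ← hMdef] at bPξ
  rw [← hQξ, ← hMdef] at bQξ
  rw [← hU, ← hMdef] at bU
  rw [← hV, ← hMdef] at bV
  rw [← hP] at cP
  rw [← hQ] at cQ
  rw [← hPk] at cPk
  rw [← hQk] at cQk
  rw [← hPξ] at cPξ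
  rw [← hQξ] at cQξ
  rw [← hU] at cU
  rw [← hV] at cV
  have hb' : ∀ k ξ, |2 * (P k ξ * Pk k ξ + Q k ξ * Qk k ξ)| ≤ 4 * (M * M) := by
    intro k ξ
    have t1 := abs_le.1 (hm _ _ (bP k ξ) (bPk k ξ))
    have t2 := abs_le.1 (hm _ _ (bQ k ξ) (bQk k ξ))
    rw [abs_le]; constructor <;> linarith
  have hderiv : HasDerivAt (sineEnergy d ε)
      (∫ ξ, 2 * (P k ξ * Pk k ξ + Q k ξ * Qk k ξ) * Real.exp (-ε * ξ ^ 2)) k := by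
    refine (hasDerivAt_integral_of_dominated_loc_of_deriv_le
      (bound := fun ξ => 4 * (M * M) * Real.exp (-ε * ξ ^ 2))
      (F' := fun k ξ => 2 * (P k ξ * Pk k ξ + Q k ξ * Qk k ξ) * Real.exp (-ε * ξ ^ 2))
      univ_mem ?_ ?_ ?_ ?_ ?_ ?_).2
    · exact Eventually.of_forall fun k => (hd.integrable_sineDensity hε k).aestronglyMeasurable
    · exact hd.integrable_sineDensity hε k
    · have h1 := cP k
      have h2 := cQ k
      have h3 := cPk k
      have h4 := cQk k
      exact Continuous.aestronglyMeasurable (by fun_prop)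
    · refine Eventually.of_forall fun ξ k _ => ?_
      rw [norm_mul, Real.norm_eq_abs, Real.norm_of_nonneg (Real.exp_pos _).le]
      gcongr; exact hb' k ξ
    · exact (integrable_exp_neg_mul_sq hε).const_mul _
    · refine Eventually.of_forall fun ξ k _ => ?_
      have d1 := hd.hasDerivAt_sineTransform_k Real.continuous_cos hneg Real.hasDerivAt_cos
        Real.abs_cos_le_one hneg1 k ξ
      have d2 := hd.hasDerivAt_sineTransform_k Real.continuous_sin Real.continuous_cos
        Real.hasDerivAt_sin Real.abs_sin_le_one Real.abs_cos_le_one k ξ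
      refine (((d1.pow 2).add (d2.pow 2)).mul_const (Real.exp (-ε * ξ ^ 2))).congr_deriv ?_
      simp only [hP, hQ, hPk, hQk]
      push_cast
      ring
  refine ⟨_, hderiv, ?_⟩
  -- the total derivative of `ξ |s|² exp(-ε ξ²)`
  set D : ℝ → ℝ := fun ξ => sineDensity d k ξ * Real.exp (-ε * ξ ^ 2)
    + 2 * ((P k ξ * Pξ k ξ + Q k ξ * Qξ k ξ) * (ξ * Real.exp (-ε * ξ ^ 2)))
    - 2 * ε * (sineDensity d k ξ * (ξ ^ 2 * Real.exp (-ε * ξ ^ 2))) with hD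
  have hS := hd.integrable_sineDensity hε k
  have cS := hd.continuous_sineDensity k
  have bS : ∀ ξ, ‖sineDensity d k ξ‖ ≤ 2 * M ^ 2 := fun ξ => by
    rw [Real.norm_of_nonneg (sineDensity_nonneg d k ξ)]; exact hd.sineDensity_le k ξ
  have g1 : Integrable fun ξ : ℝ => ξ * Real.exp (-ε * ξ ^ 2) := integrable_mul_exp_neg_mul_sq hε
  have g2 : Integrable fun ξ : ℝ => ξ ^ 2 * Real.exp (-ε * ξ ^ 2) := by
    have := integrable_rpow_mul_exp_neg_mul_sq hε (s := 2) (by norm_num)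
    simpa using this
  have hD2 : Integrable fun ξ => (P k ξ * Pξ k ξ + Q k ξ * Qξ k ξ) * (ξ * Real.exp (-ε * ξ ^ 2)) := by
    refine g1.bdd_mul (c := 2 * (M * M)) ?_ (Eventually.of_forall fun ξ => ?_)
    · exact (((cP k).mul (cPξ k)).add ((cQ k).mul (cQξ k))).aestronglyMeasurable
    · have t1 := abs_le.1 (hm _ _ (bP k ξ) (bPξ k ξ))
      have t2 := abs_le.1 (hm _ _ (bQ k ξ) (bQξ k ξ))
      rw [Real.norm_eq_abs, abs_le]; constructor <;> linarith
  have hD3 : Integrable fun ξ => sineDensity d k ξ * (ξ ^ 2 * Real.exp (-ε * ξ ^ 2)) :=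
    g2.bdd_mul cS.aestronglyMeasurable (Eventually.of_forall bS)
  have hD1 : Integrable fun ξ => sineDensity d k ξ * (ξ * Real.exp (-ε * ξ ^ 2)) :=
    g1.bdd_mul cS.aestronglyMeasurable (Eventually.of_forall bS)
  have hDi : Integrable D := (hS.add (hD2.const_mul 2)).sub (hD3.const_mul (2 * ε))
  have hD0 : ∫ ξ, D ξ = 0 := by
    apply integral_eq_zero_of_hasDerivAt_of_integrable
      (f := fun ξ => sineDensity d k ξ * (ξ * Real.exp (-ε * ξ ^ 2))) _ hDi hD1
    intro ξ
    have d1 := hd.hasDerivAt_sineTransform_ξ Real.continuous_cos Real.abs_cos_le_one k ξ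
    have d2 := hd.hasDerivAt_sineTransform_ξ Real.continuous_sin Real.abs_sin_le_one k ξ
    have d3 : HasDerivAt (fun ξ : ℝ => Real.exp (-ε * ξ ^ 2))
        (Real.exp (-ε * ξ ^ 2) * (-ε * (2 * ξ))) ξ := by
      simpa using ((hasDerivAt_pow 2 ξ).const_mul (-ε)).exp
    refine ((((d1.pow 2).add (d2.pow 2))).mul ((hasDerivAt_id ξ).mul d3)).congr_deriv ?_
    simp only [hD, sineDensity, hP, hQ, hPξ, hQξ, Pi.add_apply, Pi.pow_apply, Pi.mul_apply, id]
    push_cast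
    ring
  have hJ : Integrable fun ξ => (Q k ξ * U k ξ - P k ξ * V k ξ) * Real.exp (-ε * ξ ^ 2) :=
    integrable_mul_gaussian (((cQ k).mul (cU k)).sub ((cP k).mul (cV k))) hε (C := 2 * (M * M))
      fun ξ => by
        have t1 := abs_le.1 (hm _ _ (bQ k ξ) (bU k ξ))
        have t2 := abs_le.1 (hm _ _ (bP k ξ) (bV k ξ))
        change |Q k ξ * U k ξ - P k ξ * V k ξ| ≤ _
        rw [abs_le]; constructor <;> linarith
  have hE : Integrable fun ξ => 2 * (P k ξ * Pk k ξ + Q k ξ * Qk k ξ) * Real.exp (-ε * ξ ^ 2) :=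
    integrable_mul_gaussian ((((cP k).mul (cPk k)).add ((cQ k).mul (cQk k))).const_mul 2) hε
      (C := 4 * (M * M)) fun ξ => hb' k ξ
  have hVneg : ∀ ξ, sineTransformY d (fun x => -Real.sin x) k ξ = -V k ξ := by
    intro ξ
    simp only [hV, sineTransformY, neg_mul, mul_neg, integral_neg]
  have hpoint : ∀ ξ, k * (2 * (P k ξ * Pk k ξ + Q k ξ * Qk k ξ) * Real.exp (-ε * ξ ^ 2))
      ≤ sineDensity d k ξ * Real.exp (-ε * ξ ^ 2)
        + (4 / 3) * k * ((Q k ξ * U k ξ - P k ξ * V k ξ) * Real.exp (-ε * ξ ^ 2))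
        - (1 / 3) * D ξ := by
    intro ξ
    have q1 := hd.sineTransform_equation Real.contDiff_cos (f' := fun x => -Real.sin x)
      (by ext x; exact Real.deriv_cos) Real.abs_cos_le_one hneg1
      (fun x => by
        have : deriv (fun x => -Real.sin x) x = -Real.cos x := by simp
        rw [this, abs_neg]; exact Real.abs_cos_le_one x) k ξ
    have q2 := hd.sineTransform_equation Real.contDiff_sin (f' := Real.cos)
      Real.deriv_sin Real.abs_sin_le_one Real.abs_cos_le_one
      (fun x => by rw [Real.deriv_cos]; exact hneg1 x) k ξ
    rw [hVneg, ← hP, ← hPk, ← hPξ] at q1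
    rw [← hQ, ← hQk, ← hQξ, ← hU] at q2
    have e : sineDensity d k ξ * Real.exp (-ε * ξ ^ 2)
        + (4 / 3) * k * ((Q k ξ * U k ξ - P k ξ * V k ξ) * Real.exp (-ε * ξ ^ 2))
        - (1 / 3) * D ξ - k * (2 * (P k ξ * Pk k ξ + Q k ξ * Qk k ξ) * Real.exp (-ε * ξ ^ 2))
        = (4 / 3 + 2 / 3 * ε) * (ξ ^ 2 * (sineDensity d k ξ * Real.exp (-ε * ξ ^ 2))) := by
      simp only [hD, sineDensity, ← hP, ← hQ]
      linear_combination (-(4 / 3) * P k ξ * Real.exp (-ε * ξ ^ 2)) * q1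
        + (-(4 / 3) * Q k ξ * Real.exp (-ε * ξ ^ 2)) * q2
    have h0 : 0 ≤ (4 / 3 + 2 / 3 * ε) * (ξ ^ 2 * (sineDensity d k ξ * Real.exp (-ε * ξ ^ 2))) := by
      have := sineDensity_nonneg d k ξ
      positivity
    linarith
  have hmono := integral_mono (hE.const_mul k)
    ((hS.add (hJ.const_mul ((4 / 3) * k))).sub (hDi.const_mul (1 / 3))) hpoint
  rw [integral_const_mul] at hmono
  refine hmono.trans (le_of_eq ?_)
  have h12 := hS.add (hJ.const_mul ((4 / 3) * k))
  simp only [Pi.add_def] at h12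
  simp only [Pi.sub_apply, Pi.add_apply]
  rw [integral_sub h12 (hDi.const_mul (1 / 3)), integral_add hS (hJ.const_mul _),
    integral_const_mul, integral_const_mul, hD0, sineEnergy, sineProduction]
  ring

end IsNullSolution

/-! ### The production term -/

lemma integral_cos_mul_gaussian {ε : ℝ} (hε : 0 < ε) (a : ℝ) :
    ∫ ξ : ℝ, Real.cos (ξ * a) * Real.exp (-ε * ξ ^ 2)
      = √(Real.pi / ε) * Real.exp (-a ^ 2 / (4 * ε)) := by
  have h := fourierIntegral_gaussian (b := (ε : ℂ)) (by simpa using hε) (a : ℂ)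
  have h2 := congrArg Complex.re h
  have hpt : ∀ x : ℝ, Complex.exp (Complex.I * a * x) * Complex.exp (-(ε : ℂ) * x ^ 2)
      = Complex.exp (((x * a : ℝ) : ℂ) * Complex.I) * ((Real.exp (-ε * x ^ 2) : ℝ) : ℂ) := by
    intro x
    push_cast
    congr 2; ring
  simp only [hpt] at h2
  have hint : Integrable fun x : ℝ => Complex.exp (((x * a : ℝ) : ℂ) * Complex.I)
      * ((Real.exp (-ε * x ^ 2) : ℝ) : ℂ) := by
    refine (integrable_exp_neg_mul_sq hε).ofReal.bdd_mul (c := 1)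
      (Continuous.aestronglyMeasurable (by fun_prop)) (Eventually.of_forall fun x => ?_)
    rw [Complex.norm_exp_ofReal_mul_I]
  rw [show (∫ x : ℝ, Complex.exp (((x * a : ℝ) : ℂ) * Complex.I)
      * ((Real.exp (-ε * x ^ 2) : ℝ) : ℂ)).re = ∫ x : ℝ, (Complex.exp (((x * a : ℝ) : ℂ) * Complex.I)
      * ((Real.exp (-ε * x ^ 2) : ℝ) : ℂ)).re from (integral_re hint).symm] at h2
  simp only [Complex.re_mul_ofReal, Complex.exp_ofReal_mul_I_re] at h2
  rw [h2]
  have e1 : ((Real.pi : ℂ) / ε) ^ (1 / 2 : ℂ) = ((√(Real.pi / ε) : ℝ) : ℂ) := by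
    rw [Real.sqrt_eq_rpow, Complex.ofReal_cpow (by positivity)]
    push_cast; rfl
  have e2 : Complex.exp (-(a : ℂ) ^ 2 / (4 * ε)) = ((Real.exp (-a ^ 2 / (4 * ε)) : ℝ) : ℂ) := by
    push_cast; rfl
  rw [e1, e2, ← Complex.ofReal_mul, Complex.ofReal_re]

lemma integral_sin_sin_gaussian {ε : ℝ} (hε : 0 < ε) (y z : ℝ) :
    ∫ ξ : ℝ, Real.sin (ξ * y) * Real.sin (ξ * z) * Real.exp (-ε * ξ ^ 2)
      = √(Real.pi / ε) / 2 * (Real.exp (-(y - z) ^ 2 / (4 * ε))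
        - Real.exp (-(y + z) ^ 2 / (4 * ε))) := by
  have hi : ∀ a : ℝ, Integrable fun ξ : ℝ => Real.cos (ξ * a) * Real.exp (-ε * ξ ^ 2) := fun a =>
    integrable_mul_gaussian (by fun_prop) hε fun ξ => Real.abs_cos_le_one _
  have e : ∀ ξ : ℝ, Real.sin (ξ * y) * Real.sin (ξ * z) * Real.exp (-ε * ξ ^ 2)
      = (1 / 2) * (Real.cos (ξ * (y - z)) * Real.exp (-ε * ξ ^ 2)
        - Real.cos (ξ * (y + z)) * Real.exp (-ε * ξ ^ 2)) := by
    intro ξ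
    rw [mul_sub ξ, mul_add ξ, Real.cos_sub, Real.cos_add]; ring
  simp only [e]
  rw [integral_const_mul, integral_sub (hi _) (hi _), integral_cos_mul_gaussian hε,
    integral_cos_mul_gaussian hε]
  ring

lemma mul_exp_neg_sq_le (s : ℝ) : s * Real.exp (-s ^ 2 / 8) ≤ 2 := by
  have h1 := Real.add_one_le_exp (s ^ 2 / 8)
  have h2 : Real.exp (-s ^ 2 / 8) * Real.exp (s ^ 2 / 8) = 1 := by
    rw [← Real.exp_add]; simp; ring
  have h3 := Real.exp_pos (-s ^ 2 / 8)
  have h4 : s ≤ 2 * Real.exp (s ^ 2 / 8) := by nlinarith [sq_nonneg (s - 2)]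
  calc s * Real.exp (-s ^ 2 / 8) ≤ 2 * Real.exp (s ^ 2 / 8) * Real.exp (-s ^ 2 / 8) := by gcongr
    _ = 2 := by linear_combination 2 * h2

/-- The factor `Y - Y'` compensates the concentration of the kernel on the diagonal. -/
lemma abs_sub_mul_integral_sin_sin_le {δ : ℝ} (hδ : 0 < δ) {y z : ℝ} (hy : 0 < y) (hz : 0 < z) :
    |(z - y) * ∫ ξ : ℝ, Real.sin (ξ * y) * Real.sin (ξ * z) * Real.exp (-δ ^ 4 * ξ ^ 2)|
      ≤ 2 * Real.exp (-(y - z) ^ 2 / (8 * δ ^ 4)) := by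
  rw [integral_sin_sin_gaussian (by positivity)]
  set A := Real.exp (-(y - z) ^ 2 / (4 * δ ^ 4)) with hA
  set B := Real.exp (-(y + z) ^ 2 / (4 * δ ^ 4)) with hB
  set G := Real.exp (-(y - z) ^ 2 / (8 * δ ^ 4)) with hG
  have hBA : B ≤ A := by
    apply Real.exp_le_exp.2
    gcongr ?_ / _
    nlinarith [mul_pos hy hz]
  have hAG : A = G * G := by
    rw [hA, hG, ← Real.exp_add]; congr 1; field_simp; ring
  have hB0 : 0 < B := Real.exp_pos _
  have hG0 : 0 < G := Real.exp_pos _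
  have hsq : √(Real.pi / δ ^ 4) = √Real.pi / δ ^ 2 := by
    rw [Real.sqrt_div Real.pi_pos.le, show δ ^ 4 = (δ ^ 2) ^ 2 by ring,
      Real.sqrt_sq (by positivity)]
  have hpi : √Real.pi ≤ 2 := by
    rw [Real.sqrt_le_left (by norm_num)]; linarith [Real.pi_le_four]
  have hs := mul_exp_neg_sq_le (|z - y| / δ ^ 2)
  have hs' : Real.exp (-(|z - y| / δ ^ 2) ^ 2 / 8) = G := by
    rw [hG, div_pow, sq_abs]; congr 1; field_simp; ring
  rw [hs'] at hs
  rw [abs_mul, abs_of_nonneg (a := _ * (A - B)) (mul_nonneg (by positivity) (by linarith)), hsq]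
  calc |z - y| * (√Real.pi / δ ^ 2 / 2 * (A - B))
      ≤ |z - y| * (2 / δ ^ 2 / 2 * (A - 0)) := by gcongr
    _ = (|z - y| / δ ^ 2 * G) * G := by rw [hAG]; ring
    _ ≤ 2 * G := by gcongr

lemma integrable_prod_gaussian {δ : ℝ} (hδ : 0 < δ) (y : ℝ) :
    Integrable (fun q : ℝ × ℝ => (1 + q.1 ^ 2)⁻¹ * Real.exp (-(y - q.2) ^ 2 / (4 * δ ^ 4))) := by
  have h2 : Integrable fun t : ℝ => Real.exp (-(y - t) ^ 2 / (4 * δ ^ 4)) := by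
    have := (integrable_exp_neg_mul_sq (b := 1 / (4 * δ ^ 4)) (by positivity)).comp_sub_left y
    refine this.congr (Eventually.of_forall fun t => ?_)
    simp only
    congr 1; ring
  rw [Measure.volume_eq_prod]
  exact integrable_inv_one_add_sq.mul_prod h2

lemma integral_prod_gaussian {δ : ℝ} (hδ : 0 < δ) (y : ℝ) :
    ∫ q : ℝ × ℝ, (1 + q.1 ^ 2)⁻¹ * Real.exp (-(y - q.2) ^ 2 / (4 * δ ^ 4))
      = 2 * Real.pi * √Real.pi * δ ^ 2 := by
  have h2 : ∫ t : ℝ, Real.exp (-(y - t) ^ 2 / (4 * δ ^ 4)) = 2 * √Real.pi * δ ^ 2 := by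
    have h := integral_gaussian (1 / (4 * δ ^ 4))
    rw [← integral_sub_left_eq_self _ volume y] at h
    have e : ∀ t : ℝ, Real.exp (-(y - t) ^ 2 / (4 * δ ^ 4))
        = Real.exp (-(1 / (4 * δ ^ 4)) * (y - t) ^ 2) := fun t => by congr 1; ring
    simp only [e]
    rw [h, show Real.pi / (1 / (4 * δ ^ 4)) = Real.pi * (2 * δ ^ 2) ^ 2 by field_simp; ring,
      Real.sqrt_mul Real.pi_pos.le, Real.sqrt_sq (by positivity)]
    ring
  rw [Measure.volume_eq_prod, integral_prod_mul (fun x : ℝ => (1 + x ^ 2)⁻¹)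
    (fun t : ℝ => Real.exp (-(y - t) ^ 2 / (4 * δ ^ 4))), h2, integral_univ_inv_one_add_sq]
  ring

namespace IsNullSolution

variable {d : ℝ × ℝ → ℝ}

lemma integrable (hd : IsNullSolution d) : Integrable d (volume.restrict halfPlane) := by
  have h := hd.integrable_mul (w := fun _ => 1) (by fun_prop) fun p => by
    simpa using one_le_weight p
  simp only [mul_one] at h
  exact h

lemma integrable_mul_snd (hd : IsNullSolution d) :
    Integrable (fun p => d p * p.2) (volume.restrict halfPlane) :=
  hd.integrable_mul (by fun_prop) abs_snd_le_weight

lemma integrable_mul_exp (hd : IsNullSolution d) (δ y : ℝ) : Integrable (fun q : ℝ × ℝ =>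
    |d q| * Real.exp (-(y - q.2) ^ 2 / (8 * δ ^ 4))) (volume.restrict halfPlane) := by
  refine hd.integrable.abs.mul_bdd (c := 1)
    (Continuous.aestronglyMeasurable (by fun_prop)) (Eventually.of_forall fun q => ?_)
  rw [Real.norm_of_nonneg (Real.exp_pos _).le, Real.exp_le_one_iff, neg_div]
  exact neg_nonpos.2 (by positivity)

/-- A strip of width `δ²` carries mass `O(δ)`: the weight `1 + X²` in the `L²` bound makes up for the
unbounded length of the strip. -/
lemma integral_mul_exp_le (hd : IsNullSolution d) {δ : ℝ} (hδ : 0 < δ) (y : ℝ) :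
    ∫ q in halfPlane, |d q| * Real.exp (-(y - q.2) ^ 2 / (8 * δ ^ 4))
      ≤ (1 / 2 * (∫ q in halfPlane, d q ^ 2 * (1 + q.1 ^ 2)) + Real.pi * √Real.pi) * δ := by
  have h1 := (integrable_prod_gaussian hδ y).integrableOn (s := halfPlane)
  have h2 : ∫ q in halfPlane, (1 + q.1 ^ 2)⁻¹ * Real.exp (-(y - q.2) ^ 2 / (4 * δ ^ 4))
      ≤ 2 * Real.pi * √Real.pi * δ ^ 2 := by
    rw [← integral_prod_gaussian hδ y]
    exact setIntegral_le_integral (integrable_prod_gaussian hδ y)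
      (Eventually.of_forall fun q => by positivity)
  have hm : ∫ q in halfPlane, |d q| * Real.exp (-(y - q.2) ^ 2 / (8 * δ ^ 4))
      ≤ ∫ q in halfPlane, (δ / 2 * (d q ^ 2 * (1 + q.1 ^ 2)) + 1 / (2 * δ)
        * ((1 + q.1 ^ 2)⁻¹ * Real.exp (-(y - q.2) ^ 2 / (4 * δ ^ 4)))) := by
    apply integral_mono (hd.integrable_mul_exp δ y)
      ((Integrable.const_mul hd.sq _).add (h1.const_mul _))
    intro q
    simp only [Pi.add_apply]
    set G := Real.exp (-(y - q.2) ^ 2 / (8 * δ ^ 4)) with hG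
    have hG2 : Real.exp (-(y - q.2) ^ 2 / (4 * δ ^ 4)) = G * G := by
      rw [hG, ← Real.exp_add]; congr 1; field_simp; ring
    rw [hG2, ← sq_abs (d q)]
    set w := 1 + q.1 ^ 2 with hw
    have hw0 : 0 < w := by positivity
    have : δ / 2 * (|d q| ^ 2 * w) + 1 / (2 * δ) * (w⁻¹ * (G * G)) - |d q| * G
        = 1 / (2 * δ * w) * (δ * w * |d q| - G) ^ 2 := by
      field_simp; ring
    have h0 : 0 ≤ 1 / (2 * δ * w) * (δ * w * |d q| - G) ^ 2 := by positivity
    linarith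
  refine hm.trans ?_
  rw [integral_add (Integrable.const_mul hd.sq _) (h1.const_mul _), integral_const_mul,
    integral_const_mul]
  calc _ ≤ δ / 2 * (∫ q in halfPlane, d q ^ 2 * (1 + q.1 ^ 2))
        + 1 / (2 * δ) * (2 * Real.pi * √Real.pi * δ ^ 2) := by gcongr
    _ = _ := by field_simp

/-- The production term as a double integral; symmetrization brings out the factor `Y' - Y`. -/
lemma two_mul_sineProduction (hd : IsNullSolution d) {ε : ℝ} (hε : 0 < ε) (k : ℝ) :
    2 * sineProduction d ε k =
      ∫ z, d z.1 * d z.2 * Real.sin (k * (z.1.1 - z.2.1)) * ((z.2.2 - z.1.2) *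
        ∫ ξ : ℝ, Real.sin (ξ * z.1.2) * Real.sin (ξ * z.2.2) * Real.exp (-ε * ξ ^ 2))
        ∂((volume.restrict halfPlane).prod (volume.restrict halfPlane)) := by
  set μ : Measure (ℝ × ℝ) := volume.restrict halfPlane with hμ
  set Γ : ℝ → ℝ → ℝ := fun y z =>
    ∫ ξ : ℝ, Real.sin (ξ * y) * Real.sin (ξ * z) * Real.exp (-ε * ξ ^ 2) with hΓ
  set I : ℝ → (ℝ × ℝ) × (ℝ × ℝ) → ℝ := fun ξ z => Real.exp (-ε * ξ ^ 2) *
    ((Real.sin (k * (z.1.1 - z.2.1)) * (Real.sin (ξ * z.1.2) * Real.sin (ξ * z.2.2))) *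
      (d z.1 * (d z.2 * z.2.2))) with hI
  have hdd : Integrable (fun z : (ℝ × ℝ) × (ℝ × ℝ) => d z.1 * (d z.2 * z.2.2)) (μ.prod μ) :=
    hd.integrable.mul_prod hd.integrable_mul_snd
  have hle : ∀ a b c : ℝ, |Real.sin a * (Real.sin b * Real.sin c)| ≤ 1 := fun a b c =>
    abs_mul_mul_le (Real.abs_sin_le_one _) (Real.abs_sin_le_one _) (Real.abs_sin_le_one _)
  have hint : Integrable (Function.uncurry I) (volume.prod (μ.prod μ)) := by
    have h0 := (integrable_exp_neg_mul_sq hε).mul_prod hdd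
    refine (h0.bdd_mul (c := 1) (f := fun w : ℝ × ((ℝ × ℝ) × (ℝ × ℝ)) =>
      Real.sin (k * (w.2.1.1 - w.2.2.1)) * (Real.sin (w.1 * w.2.1.2) * Real.sin (w.1 * w.2.2.2)))
      (Continuous.aestronglyMeasurable (by fun_prop))
      (Eventually.of_forall fun w => hle _ _ _)).congr (Eventually.of_forall fun w => ?_)
    simp only [Function.uncurry, hI]
    ring
  have hslice : ∀ ξ : ℝ, Integrable (fun z : (ℝ × ℝ) × (ℝ × ℝ) =>
      (Real.sin (k * (z.1.1 - z.2.1)) * (Real.sin (ξ * z.1.2) * Real.sin (ξ * z.2.2))) *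
      (d z.1 * (d z.2 * z.2.2))) (μ.prod μ) := fun ξ =>
    hdd.bdd_mul (c := 1) (Continuous.aestronglyMeasurable (by fun_prop))
      (Eventually.of_forall fun w => hle _ _ _)
  have hmul : ∀ f g : ℝ → ℝ, ∀ ξ : ℝ, sineTransform d f k ξ * sineTransformY d g k ξ
      = ∫ z, (d z.1 * (f (k * z.1.1) * Real.sin (ξ * z.1.2)))
        * (d z.2 * (z.2.2 * (g (k * z.2.1) * Real.sin (ξ * z.2.2)))) ∂(μ.prod μ) := fun f g ξ =>
    (integral_prod_mul (μ := μ) (ν := μ)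
      (fun p : ℝ × ℝ => d p * (f (k * p.1) * Real.sin (ξ * p.2)))
      (fun p : ℝ × ℝ => d p * (p.2 * (g (k * p.1) * Real.sin (ξ * p.2))))).symm
  have hi1 : ∀ {f : ℝ → ℝ}, Continuous f → (∀ x, |f x| ≤ 1) → ∀ ξ : ℝ,
      Integrable (fun p : ℝ × ℝ => d p * (f (k * p.1) * Real.sin (ξ * p.2))) μ := fun hf hb ξ =>
    hd.integrable_mul (by fun_prop) fun p => abs_mul_le_weight (hb _) (Real.abs_sin_le_one _) p
  have hi2 : ∀ {f : ℝ → ℝ}, Continuous f → (∀ x, |f x| ≤ 1) → ∀ ξ : ℝ,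
      Integrable (fun p : ℝ × ℝ => d p * (p.2 * (f (k * p.1) * Real.sin (ξ * p.2)))) μ :=
    fun hf hb ξ => hd.integrable_mul (by fun_prop) fun p =>
      abs_mul_mul_le (abs_snd_le_weight p) (hb _) (Real.abs_sin_le_one _)
  have hJ : sineProduction d ε k = ∫ z, d z.1 * d z.2 * Real.sin (k * (z.1.1 - z.2.1))
      * (z.2.2 * Γ z.1.2 z.2.2) ∂(μ.prod μ) := by
    have e1 : sineProduction d ε k = ∫ ξ, ∫ z, I ξ z ∂(μ.prod μ) := by
      rw [sineProduction]
      refine integral_congr_ae (Eventually.of_forall fun ξ => ?_)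
      simp only [hI]
      rw [integral_const_mul, hmul, hmul, ← integral_sub, mul_comm]
      · congr 1
        refine integral_congr_ae (Eventually.of_forall fun z => ?_)
        simp only
        rw [mul_sub, Real.sin_sub]
        ring
      · exact (hi1 Real.continuous_sin Real.abs_sin_le_one ξ).mul_prod
          (hi2 Real.continuous_cos Real.abs_cos_le_one ξ)
      · exact (hi1 Real.continuous_cos Real.abs_cos_le_one ξ).mul_prod
          (hi2 Real.continuous_sin Real.abs_sin_le_one ξ)
    rw [e1, integral_integral_swap hint]
    refine integral_congr_ae (Eventually.of_forall fun z => ?_)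
    simp only [hI, hΓ]
    rw [← integral_const_mul, ← integral_const_mul]
    refine integral_congr_ae (Eventually.of_forall fun ξ => ?_)
    simp only
    ring
  have hJint : Integrable (fun z : (ℝ × ℝ) × (ℝ × ℝ) => d z.1 * d z.2 *
      Real.sin (k * (z.1.1 - z.2.1)) * (z.2.2 * Γ z.1.2 z.2.2)) (μ.prod μ) := by
    refine hint.integral_prod_right.congr (Eventually.of_forall fun z => ?_)
    simp only [Function.uncurry, hI, hΓ]
    rw [← integral_const_mul, ← integral_const_mul]
    refine integral_congr_ae (Eventually.of_forall fun ξ => ?_)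
    simp only
    ring
  have hΓs : ∀ y z, Γ y z = Γ z y := fun y z => by
    simp only [hΓ]; congr 1; ext ξ; ring
  have hJ' : sineProduction d ε k = ∫ z, -(d z.1 * d z.2 * Real.sin (k * (z.1.1 - z.2.1))
      * (z.1.2 * Γ z.1.2 z.2.2)) ∂(μ.prod μ) := by
    rw [hJ, ← integral_prod_swap]
    refine integral_congr_ae (Eventually.of_forall fun z => ?_)
    simp only [Prod.fst_swap, Prod.snd_swap]
    rw [hΓs z.2.2 z.1.2, show k * (z.2.1 - z.1.1) = -(k * (z.1.1 - z.2.1)) by ring, Real.sin_neg]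
    ring
  have hJint' : Integrable (fun z : (ℝ × ℝ) × (ℝ × ℝ) => -(d z.1 * d z.2 *
      Real.sin (k * (z.1.1 - z.2.1)) * (z.1.2 * Γ z.1.2 z.2.2))) (μ.prod μ) := by
    refine hJint.swap.congr (Eventually.of_forall fun z => ?_)
    simp only [Function.comp, Prod.fst_swap, Prod.snd_swap]
    rw [hΓs z.2.2 z.1.2, show k * (z.2.1 - z.1.1) = -(k * (z.1.1 - z.2.1)) by ring, Real.sin_neg]
    ring
  rw [two_mul]
  nth_rewrite 1 [hJ]
  rw [hJ', ← integral_add hJint hJint']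
  refine integral_congr_ae (Eventually.of_forall fun z => ?_)
  simp only
  ring

/-- The production tends to zero with the Gaussian parameter `δ⁴`, uniformly in `k`. -/
lemma exists_abs_sineProduction_le (hd : IsNullSolution d) :
    ∃ C : ℝ, 0 ≤ C ∧ ∀ δ : ℝ, 0 < δ → ∀ k : ℝ, |sineProduction d (δ ^ 4) k| ≤ C * δ := by
  set N := 1 / 2 * (∫ q in halfPlane, d q ^ 2 * (1 + q.1 ^ 2)) + Real.pi * √Real.pi with hN
  have hN0 : 0 ≤ N := by
    have : 0 ≤ ∫ q in halfPlane, d q ^ 2 * (1 + q.1 ^ 2) :=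
      integral_nonneg fun q => by positivity
    positivity
  have hI0 : 0 ≤ ∫ p in halfPlane, |d p| := integral_nonneg fun p => abs_nonneg _
  refine ⟨(∫ p in halfPlane, |d p|) * N, by positivity, fun δ hδ k => ?_⟩
  set μ : Measure (ℝ × ℝ) := volume.restrict halfPlane with hμ
  have hH : ∀ᵐ z ∂(μ.prod μ), 0 < z.1.2 ∧ 0 < z.2.2 := by
    rw [hμ, Measure.prod_restrict]
    exact ae_restrict_mem (measurableSet_halfPlane.prod measurableSet_halfPlane)
  have hbi : Integrable (fun z : (ℝ × ℝ) × (ℝ × ℝ) => |d z.1| * (|d z.2| *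
      Real.exp (-(z.1.2 - z.2.2) ^ 2 / (8 * δ ^ 4)))) (μ.prod μ) := by
    refine ((hd.integrable.abs.mul_prod hd.integrable.abs).mul_bdd (c := 1)
      (g := fun z : (ℝ × ℝ) × (ℝ × ℝ) => Real.exp (-(z.1.2 - z.2.2) ^ 2 / (8 * δ ^ 4)))
      (Continuous.aestronglyMeasurable (by fun_prop)) (Eventually.of_forall fun q => ?_)).congr
      (Eventually.of_forall fun z => by simp only; ring)
    rw [Real.norm_of_nonneg (Real.exp_pos _).le, Real.exp_le_one_iff, neg_div]
    exact neg_nonpos.2 (by positivity)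
  have h1 : |2 * sineProduction d (δ ^ 4) k| ≤ ∫ z, 2 * (|d z.1| * (|d z.2| *
      Real.exp (-(z.1.2 - z.2.2) ^ 2 / (8 * δ ^ 4)))) ∂(μ.prod μ) := by
    rw [hd.two_mul_sineProduction (by positivity), ← Real.norm_eq_abs]
    refine norm_integral_le_of_norm_le (hbi.const_mul 2) ?_
    filter_upwards [hH] with z hz
    have h2 := abs_sub_mul_integral_sin_sin_le hδ hz.1 hz.2
    rw [Real.norm_eq_abs, abs_mul, abs_mul, abs_mul]
    calc _ ≤ |d z.1| * |d z.2| * 1 * (2 * Real.exp (-(z.1.2 - z.2.2) ^ 2 / (8 * δ ^ 4))) := by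
          gcongr; exact Real.abs_sin_le_one _
      _ = _ := by ring
  have h2 : ∫ z, |d z.1| * (|d z.2| * Real.exp (-(z.1.2 - z.2.2) ^ 2 / (8 * δ ^ 4))) ∂(μ.prod μ)
      ≤ (∫ p in halfPlane, |d p|) * (N * δ) := by
    rw [integral_prod _ hbi, ← integral_mul_const]
    apply integral_mono hbi.integral_prod_left (hd.integrable.abs.mul_const _)
    intro p
    simp only
    rw [integral_const_mul]
    exact mul_le_mul_of_nonneg_left (hd.integral_mul_exp_le hδ p.2) (abs_nonneg _)
  rw [integral_const_mul, abs_mul, abs_two] at h1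
  linarith

end IsNullSolution

/-! ### Vanishing of the energy -/

namespace IsNullSolution

variable {d : ℝ × ℝ → ℝ}

/-- Integration of the energy inequality from `k₁` to `k`. -/
lemma sineEnergy_div_le (hd : IsNullSolution d) {ε B : ℝ} (hε : 0 < ε)
    (hB : ∀ k, |sineProduction d ε k| ≤ B) {k₁ k : ℝ} (hk₁ : 0 < k₁) (hk : k₁ ≤ k) :
    sineEnergy d ε k / k - 4 / 3 * B * Real.log k
      ≤ sineEnergy d ε k₁ / k₁ - 4 / 3 * B * Real.log k₁ := by
  have hder : ∀ k ∈ Ioi (0 : ℝ), ∃ F', HasDerivAt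
      (fun k => sineEnergy d ε k / k - 4 / 3 * B * Real.log k) F' k ∧ F' ≤ 0 := by
    intro k hk
    have hk : 0 < k := hk
    obtain ⟨E', hE, hle⟩ := hd.hasDerivAt_sineEnergy hε k
    refine ⟨_, (hE.div (hasDerivAt_id k) hk.ne').sub ((Real.hasDerivAt_log hk.ne').const_mul _), ?_⟩
    have h1 := (abs_le.1 (hB k)).2
    have h2 : (4 / 3) * k * sineProduction d ε k ≤ 4 / 3 * k * B := by gcongr
    rw [sub_nonpos, div_le_iff₀ (by simpa using pow_pos hk 2)]
    simp only [id]
    have : 4 / 3 * B * k⁻¹ * k ^ 2 = 4 / 3 * k * B := by field_simp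
    rw [this]
    linarith
  have hanti : AntitoneOn (fun k => sineEnergy d ε k / k - 4 / 3 * B * Real.log k) (Ioi 0) := by
    apply antitoneOn_of_deriv_nonpos (convex_Ioi 0)
    · intro k hk
      obtain ⟨F', h, -⟩ := hder k hk
      exact h.continuousAt.continuousWithinAt
    · intro k hk
      rw [interior_Ioi] at hk
      obtain ⟨F', h, -⟩ := hder k hk
      exact h.differentiableAt.differentiableWithinAt
    · intro k hk
      rw [interior_Ioi] at hk
      obtain ⟨F', h, h'⟩ := hder k hk
      rw [h.deriv]; exact h'
  exact hanti hk₁ (hk₁.trans_le hk) hk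

/-- The balance `ε = k₁ = δ⁴` makes both the initial energy and the accumulated production
small. -/
lemma sineEnergy_one_nonpos (hd : IsNullSolution d) {k : ℝ} (hk : 0 < k) :
    sineEnergy d 1 k ≤ 0 := by
  -- the initial energy at `k₁ = δ⁴` is `O(δ²)`, the production is `O(δ log (1 / δ))`
  obtain ⟨C, hC0, hC⟩ := hd.exists_abs_sineProduction_le
  have hmain : ∀ δ : ℝ, 0 < δ → δ ≤ 1 → δ ^ 4 ≤ k → sineEnergy d 1 k / k ≤
      2 * weightedMass d ^ 2 * √Real.pi * δ ^ 2
        + 4 / 3 * C * (δ * Real.log k - 4 * (Real.log δ * δ)) := by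
    intro δ hδ hδ1 hδk
    have hε : 0 < δ ^ 4 := by positivity
    have h1 := hd.sineEnergy_div_le hε (hC δ hδ) hε hδk
    have h2 := hd.sineEnergy_le hε (δ ^ 4)
    have h3 := hd.sineEnergy_anti hε (pow_le_one₀ hδ.le hδ1) k
    have hsq : √(Real.pi / δ ^ 4) = √Real.pi / δ ^ 2 := by
      rw [Real.sqrt_div Real.pi_pos.le, show δ ^ 4 = (δ ^ 2) ^ 2 by ring,
        Real.sqrt_sq (by positivity)]
    rw [hsq] at h2
    have h4 : sineEnergy d (δ ^ 4) (δ ^ 4) / δ ^ 4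
        ≤ 2 * weightedMass d ^ 2 * √Real.pi * δ ^ 2 := by
      rw [div_le_iff₀ hε]
      refine h2.trans (le_of_eq ?_)
      field_simp
    have h5 : sineEnergy d 1 k / k ≤ sineEnergy d (δ ^ 4) k / k := by gcongr
    rw [Real.log_pow] at h1
    push_cast at h1
    linarith
  have hlim : Tendsto (fun δ : ℝ => 2 * weightedMass d ^ 2 * √Real.pi * δ ^ 2
        + 4 / 3 * C * (δ * Real.log k - 4 * (Real.log δ * δ))) (𝓝[>] 0) (𝓝 0) := by
    have t1 : Tendsto (fun δ : ℝ => 2 * weightedMass d ^ 2 * √Real.pi * δ ^ 2) (𝓝[>] 0) (𝓝 0) := by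
      have : Continuous fun δ : ℝ => 2 * weightedMass d ^ 2 * √Real.pi * δ ^ 2 := by fun_prop
      simpa using (this.tendsto 0).mono_left nhdsWithin_le_nhds
    have t2 : Tendsto (fun δ : ℝ => δ * Real.log k) (𝓝[>] 0) (𝓝 0) := by
      have : Continuous fun δ : ℝ => δ * Real.log k := by fun_prop
      simpa using (this.tendsto 0).mono_left nhdsWithin_le_nhds
    have t3 : Tendsto (fun δ : ℝ => Real.log δ * δ) (𝓝[>] 0) (𝓝 0) := by
      have h := (Real.continuous_mul_log.tendsto 0).mono_left (nhdsWithin_le_nhds (s := Ioi 0))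
      simpa [mul_comm] using h
    simpa using t1.add ((t2.sub (t3.const_mul 4)).const_mul (4 / 3 * C))
  have hle : sineEnergy d 1 k / k ≤ 0 := by
    refine ge_of_tendsto hlim ?_
    have e1 : ∀ᶠ δ : ℝ in 𝓝[>] 0, δ < 1 := nhdsWithin_le_nhds (Iio_mem_nhds one_pos)
    have e2 : ∀ᶠ δ : ℝ in 𝓝[>] 0, δ ^ 4 < k := by
      have : Continuous fun δ : ℝ => δ ^ 4 := by fun_prop
      have := (this.tendsto 0).mono_left (nhdsWithin_le_nhds (s := Ioi 0))
      exact this.eventually_lt_const (by simpa using hk)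
    filter_upwards [e1, e2, self_mem_nhdsWithin] with δ h1 h2 h3
    exact hmain δ h3 h1.le h2.le
  rwa [div_le_iff₀ hk, zero_mul] at hle

lemma sineDensity_eq_zero (hd : IsNullSolution d) {k : ℝ} (hk : 0 < k) (ξ : ℝ) :
    sineDensity d k ξ = 0 := by
  have hnn : 0 ≤ fun ξ => sineDensity d k ξ * Real.exp (-1 * ξ ^ 2) := fun ξ =>
    mul_nonneg (sineDensity_nonneg d k ξ) (Real.exp_pos _).le
  have h0 : ∫ ξ, sineDensity d k ξ * Real.exp (-1 * ξ ^ 2) = 0 :=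
    le_antisymm (hd.sineEnergy_one_nonpos hk) (integral_nonneg hnn)
  rw [integral_eq_zero_iff_of_nonneg hnn (hd.integrable_sineDensity one_pos k)] at h0
  have hc : Continuous fun ξ => sineDensity d k ξ * Real.exp (-1 * ξ ^ 2) :=
    (hd.continuous_sineDensity k).mul (by fun_prop)
  have h1 := congrFun (Measure.eq_of_ae_eq h0 hc continuous_const) ξ
  simpa [Real.exp_ne_zero] using h1

lemma sineTransform_cos_eq_zero (hd : IsNullSolution d) (k ξ : ℝ) :
    sineTransform d Real.cos k ξ = 0 := by
  have hpos : ∀ k, 0 < k → sineTransform d Real.cos k ξ = 0 := fun k hk => by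
    have h := hd.sineDensity_eq_zero hk ξ
    rw [sineDensity] at h
    exact pow_eq_zero_iff two_ne_zero |>.1
      (le_antisymm (by linarith [sq_nonneg (sineTransform d Real.sin k ξ)]) (sq_nonneg _))
  rcases lt_trichotomy k 0 with h | h | h
  · rw [← hpos (-k) (by linarith)]
    simp [sineTransform]
  · rw [h, hd.sineTransform_cos_zero]
  · exact hpos k h

lemma sineTransform_sin_eq_zero (hd : IsNullSolution d) (k ξ : ℝ) :
    sineTransform d Real.sin k ξ = 0 := by
  have hpos : ∀ k, 0 < k → sineTransform d Real.sin k ξ = 0 := fun k hk => by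
    have h := hd.sineDensity_eq_zero hk ξ
    rw [sineDensity] at h
    exact pow_eq_zero_iff two_ne_zero |>.1
      (le_antisymm (by linarith [sq_nonneg (sineTransform d Real.cos k ξ)]) (sq_nonneg _))
  rcases lt_trichotomy k 0 with h | h | h
  · rw [← neg_eq_zero, ← hpos (-k) (by linarith)]
    simp [sineTransform, integral_neg]
  · simp [h, sineTransform]
  · exact hpos k h

end IsNullSolution

/-! ### Injectivity of the Fourier–sine transform -/

/-- An integrable function whose Fourier transform vanishes is zero: its positive and negative
parts define finite measures with the same characteristic function. -/
lemma ae_eq_zero_of_integral_cos_sin_eq_zero {D : ℝ × ℝ → ℝ} (hD : Integrable D)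
    (hc : ∀ a b : ℝ, ∫ p, D p * Real.cos (a * p.1 + b * p.2) = 0)
    (hs : ∀ a b : ℝ, ∫ p, D p * Real.sin (a * p.1 + b * p.2) = 0) : D =ᵐ[volume] 0 := by
  have hm := hD.aestronglyMeasurable.aemeasurable
  have hfin : IsFiniteMeasure (volume.withDensity fun p => ENNReal.ofReal (D p)) :=
    isFiniteMeasure_withDensity_ofReal hD.2
  have hfin' : IsFiniteMeasure (volume.withDensity fun p => ENNReal.ofReal (-D p)) :=
    isFiniteMeasure_withDensity_ofReal hD.neg.2
  have hbd : ∀ {f : ℝ × ℝ → ℝ} {c : ℝ × ℝ → ℝ}, Integrable f → Continuous c → (∀ p, |c p| ≤ 1) →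
      Integrable fun p => f p * c p := fun hf hc hb =>
    hf.mul_bdd (c := 1) hc.aestronglyMeasurable (Eventually.of_forall hb)
  have hpm : ∀ {c : ℝ × ℝ → ℝ}, Continuous c → (∀ p, |c p| ≤ 1) → ∫ p, D p * c p = 0 →
      ∫ p, max (D p) 0 * c p = ∫ p, max (-D p) 0 * c p := by
    intro c hcc hb h0
    rw [← sub_eq_zero, ← integral_sub (hbd hD.pos_part hcc hb) (hbd hD.neg_part hcc hb)]
    refine Eq.trans (integral_congr_ae (Eventually.of_forall fun p => ?_)) h0
    simp only
    rw [← sub_mul, max_zero_sub_max_neg_zero_eq_self]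
  have hchar : ∀ {f : ℝ × ℝ → ℝ}, Integrable f → ∀ L : StrongDual ℝ (ℝ × ℝ),
      charFunDual (volume.withDensity fun p => ENNReal.ofReal (f p)) L
        = ((∫ p, max (f p) 0 * Real.cos (L (1, 0) * p.1 + L (0, 1) * p.2) : ℝ) : ℂ)
        + ((∫ p, max (f p) 0 * Real.sin (L (1, 0) * p.1 + L (0, 1) * p.2) : ℝ) : ℂ)
          * Complex.I := by
    intro f hf L
    have i1 := hbd hf.pos_part (c := fun p => Real.cos (L (1, 0) * p.1 + L (0, 1) * p.2))
      (by fun_prop) fun p => Real.abs_cos_le_one _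
    have i2 := hbd hf.pos_part (c := fun p => Real.sin (L (1, 0) * p.1 + L (0, 1) * p.2))
      (by fun_prop) fun p => Real.abs_sin_le_one _
    have hL : ∀ p : ℝ × ℝ, L p = L (1, 0) * p.1 + L (0, 1) * p.2 := by
      intro p
      have : p = p.1 • ((1, 0) : ℝ × ℝ) + p.2 • ((0, 1) : ℝ × ℝ) := by ext <;> simp
      conv_lhs => rw [this, map_add, map_smul, map_smul]
      simp [mul_comm]
    rw [charFunDual_apply, integral_withDensity_eq_integral_toReal_smul₀
      hf.aestronglyMeasurable.aemeasurable.ennreal_ofReal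
      (Eventually.of_forall fun p => ENNReal.ofReal_lt_top), ← integral_complex_ofReal,
      ← integral_complex_ofReal, ← integral_mul_const, ← integral_add i1.ofReal
      (i2.ofReal.mul_const _)]
    refine integral_congr_ae (Eventually.of_forall fun p => ?_)
    simp only
    rw [hL p, Complex.exp_ofReal_mul_I, ENNReal.toReal_ofReal', Complex.real_smul]
    push_cast
    ring
  have heq : (volume.withDensity fun p => ENNReal.ofReal (D p))
      = volume.withDensity fun p => ENNReal.ofReal (-D p) := by
    apply Measure.ext_of_charFunDual
    ext L
    rw [hchar hD L, hchar (f := fun p => -D p) hD.neg L, hpm (c := fun p => Real.cos (L (1, 0) * p.1 + L (0, 1) * p.2)) (by fun_prop)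
      (fun p => Real.abs_cos_le_one _) (hc _ _),
      hpm (c := fun p => Real.sin (L (1, 0) * p.1 + L (0, 1) * p.2)) (by fun_prop)
      (fun p => Real.abs_sin_le_one _) (hs _ _)]
  filter_upwards [(withDensity_eq_iff_of_sigmaFinite hm.ennreal_ofReal
    hm.neg.ennreal_ofReal).1 heq] with p hp
  have h1 := congrArg ENNReal.toReal hp
  rw [ENNReal.toReal_ofReal', ENNReal.toReal_ofReal'] at h1
  have := max_zero_sub_max_neg_zero_eq_self (D p)
  simp only [Pi.zero_apply, Pi.neg_apply] at h1 ⊢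
  linarith

lemma measurePreserving_reflection :
    MeasurePreserving (fun p : ℝ × ℝ => (p.1, -p.2)) := by
  rw [Measure.volume_eq_prod]
  exact (MeasurePreserving.id volume).prod (Measure.measurePreserving_neg volume)

/-- A null solution vanishes: its odd extension in `Y` has zero Fourier transform. -/
lemma IsNullSolution.ae_eq_zero {d : ℝ × ℝ → ℝ} (hd : IsNullSolution d) :
    d =ᵐ[volume.restrict halfPlane] 0 := by
  set E : ℝ × ℝ → ℝ := halfPlane.indicator d with hE
  set R : ℝ × ℝ → ℝ × ℝ := fun p => (p.1, -p.2) with hR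
  have hRm : MeasurableEmbedding R :=
    ((MeasurableEquiv.refl ℝ).prodCongr (MeasurableEquiv.neg ℝ)).measurableEmbedding
  have hEi : Integrable E := (integrable_indicator_iff measurableSet_halfPlane).2 hd.integrable
  have hEd : ∀ g : ℝ × ℝ → ℝ, ∫ p, E p * g p = ∫ p in halfPlane, d p * g p := fun g => by
    rw [← integral_indicator measurableSet_halfPlane]
    congr 1; ext p
    simp only [hE, indicator_mul_left]
  have hEg : ∀ {g : ℝ × ℝ → ℝ}, Continuous g → (∀ p, |g p| ≤ 1) →
      Integrable fun p => E p * g p := fun hg hb =>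
    hEi.mul_bdd (c := 1) hg.aestronglyMeasurable (Eventually.of_forall hb)
  have hodd : ∀ {g : ℝ × ℝ → ℝ}, Continuous g → (∀ p, |g p| ≤ 1) →
      ∫ p, (E p - E (R p)) * g p = ∫ p in halfPlane, d p * (g p - g (R p)) := by
    intro g hg hb
    have hgR : Continuous fun p => g (R p) := by fun_prop
    have i2 : Integrable fun p => E (R p) * g (R (R p)) :=
      (measurePreserving_reflection.integrable_comp_emb hRm).2 (hEg hgR fun p => hb _)
    have e2 : ∫ p, E (R p) * g (R (R p)) = ∫ p, E p * g (R p) :=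
      measurePreserving_reflection.integral_comp hRm fun p => E p * g (R p)
    have e : ∀ p, (E p - E (R p)) * g p = E p * g p - E (R p) * g (R (R p)) := fun p => by
      simp only [hR, neg_neg]; ring
    simp only [e]
    rw [integral_sub (hEg hg hb) i2, e2, ← integral_sub (hEg hg hb) (hEg hgR fun p => hb _), ← hEd]
    congr 1; ext p; ring
  have h0 := ae_eq_zero_of_integral_cos_sin_eq_zero (D := fun p => E p - E (R p))
    (hEi.sub ((measurePreserving_reflection.integrable_comp_emb hRm).2 hEi))
    (fun a b => by
      rw [hodd (by fun_prop) fun p => Real.abs_cos_le_one _, ← mul_zero (-2 : ℝ),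
        ← hd.sineTransform_sin_eq_zero a b, sineTransform, ← integral_const_mul]
      congr 1; ext p
      simp only [hR]
      rw [mul_neg, Real.cos_add, Real.cos_add, Real.cos_neg, Real.sin_neg]
      ring)
    (fun a b => by
      rw [hodd (by fun_prop) fun p => Real.abs_sin_le_one _, ← mul_zero (2 : ℝ),
        ← hd.sineTransform_cos_eq_zero a b, sineTransform, ← integral_const_mul]
      congr 1; ext p
      simp only [hR]
      rw [mul_neg, Real.sin_add, Real.sin_add, Real.cos_neg, Real.sin_neg]
      ring)
  filter_upwards [ae_restrict_of_ae h0, ae_restrict_mem measurableSet_halfPlane] with p hp hpH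
  have hpH' : 0 < p.2 := hpH
  have h1 : E p = d p := indicator_of_mem hpH d
  have h2 : E (R p) = 0 := indicator_of_notMem
    (fun h => by have : 0 < -p.2 := h; linarith) d
  simpa [h1, h2] using hp

/-- Uniqueness of the normalized kernel. -/
lemma IsNormalizedKernel.ae_eq {m : ℕ} (hm : 5 < m) {u v : ℝ × ℝ → ℝ}
    (hu : IsNormalizedKernel m u) (hv : IsNormalizedKernel m v) :
    u =ᵐ[volume.restrict halfPlane] v := by
  filter_upwards [(isNullSolution_sub hm hu hv).ae_eq_zero] with p hp
  exact sub_eq_zero.1 hp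

end HalfPlaneKernel

theorem proposition3p1 :
    ∃ Ω : ℝ × ℝ → ℝ,
      (ContinuousOn Ω {p : ℝ × ℝ | 0 ≤ p.2} ∧ ∀ X : ℝ, Ω (X, 0) = 0) ∧
      (∀ m : ℕ, 5 < m → HalfPlaneKernel.IsNormalizedKernel m Ω) ∧
      (∀ m : ℕ, 5 < m → ∀ u : ℝ × ℝ → ℝ, HalfPlaneKernel.IsNormalizedKernel m u →
        u =ᵐ[volume.restrict HalfPlaneKernel.halfPlane] Ω) ∧
      ∃ h : ℝ → ℂ, ContinuousOn h (Ici 0) ∧ HalfPlaneKernel.SolvesVolterra h ∧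
        ∀ k η : ℝ,
          HalfPlaneKernel.fourierPlane (HalfPlaneKernel.centralExtension Ω) k η =
            HalfPlaneKernel.characteristicFormula (HalfPlaneKernel.boundaryDatum h) k η := by
  open HalfPlaneKernel in
  refine ⟨kernel, ⟨continuous_kernel.continuousOn, kernel_boundary⟩,
    fun m _ => isNormalizedKernel_kernel m, fun m hm u hu => ?_,
    fun t => Complex.I * volterraSeries (t ^ 3), ?_, solvesVolterra_volterraSeries, fun k η => ?_⟩
  · exact hu.ae_eq hm (isNormalizedKernel_kernel m)
  · have := continuous_volterraSeries
    exact Continuous.continuousOn (by fun_prop)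
  · rw [centralExtension_kernel]
    exact fourierPlane_kernel_eq_characteristicFormula k η
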